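/- **Conventions.** $z,\bar z$ (likewise $z_i,\bar z_i$) are independent formal variables, and $r,s$ denote real exponents. *AH pairs.* Let $H$ be a finite-dimensional real vector space with a non-degenerate symmetric bilinear form $(-,-)$, and let $A=\bigoplus_{\alpha\in H}A^\alpha$ be an $H$-graded unital associative $\mathbb C$-algebra ($1\in A^0$, $A^\alpha A^\beta\subset A^{\alpha+\beta}$). $(A,H)$ is an *even AH pair* if $A^\alpha A^\beta\neq 0$ implies $(\alpha,\beta)\in\mathbb Z$; $vw=(-1)^{(\alpha,\beta)}wv$ for $v\in A^\alpha$, $w\in A^\beta$ (when $(\alpha,\beta)\notin\mathbb Z$ both products vanish); and $(\alpha,\alpha)\in 2\mathbb Z$ whenever $A^\alpha\ne 0$. $P(H)$ is the set of $p\in\mathrm{End}\,H$ with $p^2=p$ and $\ker p\perp\ker(1-p)$. For $p\in P(H)$ put $\bar p=1-p$, $H_l=\ker\bar p$, $H_r=\ker p$, $(h,h')_p=(ph,ph')-(\bar ph,\bar ph')$. *The module.* Let $\hat H^p=\bigoplus_{n\in\mathbb Z}(H\otimes_{\mathbb R}\mathbb C)t^n\oplus\mathbb Cc$ be the Lie algebra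 with $c$ central and $[ht^n,h't^m]=n(h,h')_p\delta_{n+m,0}c$. Its subalgebra $\bigoplus_{n\ge0}(H\otimes\mathbb C)t^n\oplus\mathbb Cc$ acts on $A$ by $c\mapsto 1$, $ht^n\mapsto0$ for $n\ge1$, and $ht^0a=(h,\alpha)_pa$ for $a\in A^\alpha$. $F=F_{A,H,p}$ is the induced $\hat H^p$-module, $h(n)$ is the action of $ht^n$, $A$ is identified with its image $1\otimes A$, and $\mathbf 1=1\otimes 1$. Grade $F$ by letting $F_{h,\bar h}$ be the span of the vectors $$h_l^1(-i_1)\cdots h_l^k(-i_k)\,h_r^1(-j_1)\cdots h_r^{m}(-j_{m})\,a$$ with $h_l^\bullet\in H_l$, $h_r^\bullet\in H_r$, $i_\bullet,j_\bullet\ge1$, $a\in A^\alpha$, $h=\tfrac12(p\alpha,p\alpha)_p+\sum i_\bullet$, $\bar h=\tfrac12(\bar p\alpha,\bar p\alpha)_p+\sum j_\bullet$. *Vertex operators.* For $h\in H$ let $h^+(\underline z)=\sum_{n\ge0}\big((ph)(n)z^{-n-1}+(\bar ph)(n)\bar z^{-n-1}\big)$, $h^-(\underline z)=\sum_{n\ge0}\big((ph)(-n-1)z^{n}+(\bar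 ph)(-n-1)\bar z^{n}\big)$ and $$E^{\pm}(h,\underline z)=\exp\Big(-\sum_{\pm n\ge1}\Big(\tfrac{(ph)(n)}{n}z^{-n}+\tfrac{(\bar ph)(n)}{n}\bar z^{-n}\Big)\Big).$$ For $a\in A^\alpha$ let $l_az^{p\alpha}\bar z^{\bar p\alpha}$ be the map sending $h^1(-n_1)\cdots h^k(-n_k)b$ ($b\in A^\beta$, $n_i\ge1$, $h^i\in H$) to $z^{(p\alpha,p\beta)_p}\bar z^{(\bar p\alpha,\bar p\beta)_p}h^1(-n_1)\cdots h^k(-n_k)ab$. *Full vertex algebras.* A full vertex algebra is a $\mathbb C$-vector space $F=\bigoplus_{h,\bar h\in\mathbb R}F_{h,\bar h}$ with $\mathbf 1\in F_{0,0}$ and a linear map $a\mapsto Y(a,\underline z)=\sum_{r,s\in\mathbb R}a(r,s)z^{-r-1}\bar z^{-s-1}$, $a(r,s)\in\mathrm{End}\,F$, such that $a(r,s)=0$ unless $r-s\in\mathbb Z$; for all $a,b\in F$ only countably many $a(r,s)b$ are non-zero; and 1. for all $a,b$ there is $N\in\mathbb R$ with $a(r,s)b=0$ if $r\ge N$ or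 $s\ge N$; 2. $F_{h,\bar h}=0$ unless $h-\bar h\in\mathbb Z$; 3. $Y(a,\underline z)\mathbf 1\in F[[z,\bar z]]$ and $a(-1,-1)\mathbf 1=a$; 4. $Y(\mathbf 1,\underline z)=\mathrm{id}_F$; 5. for all $a,b,c\in F$ and $u\in F^\vee=\bigoplus F_{h,\bar h}^*$ there is $\mu\in\mathrm{GCor}_2$ with $u(Y(a,\underline z_1)Y(b,\underline z_2)c)=\mu|_{|z_1|>|z_2|}$, $u(Y(Y(a,\underline z_0)b,\underline z_2)c)=\mu|_{|z_2|>|z_1-z_2|}$ (where $z_0=z_1-z_2$), $u(Y(b,\underline z_2)Y(a,\underline z_1)c)=\mu|_{|z_2|>|z_1|}$; 6. $F_{h,\bar h}(r,s)F_{h',\bar h'}\subset F_{h+h'-r-1,\bar h+\bar h'-s-1}$. Here $\mathrm{GCor}_2$ is the span of the functions $z_1^{\alpha_1}z_2^{\alpha_2}(z_1-z_2)^{\alpha_{12}}\bar z_1^{\beta_1}\bar z_2^{\beta_2}(\bar z_1-\bar z_2)^{\beta_{12}}f(z_2/z_1)$ on $\{z_1\ne z_2,\ z_1\neq 0,\ z_2\ne0\}\subset\mathbb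 C^2$, with real exponents such that $\alpha_1-\beta_1,\alpha_2-\beta_2,\alpha_{12}-\beta_{12}\in\mathbb Z$ and $f$ real analytic on $\mathbb{CP}^1\setminus\{0,1,\infty\}$ such that, for every holomorphic chart $q$ at $0$, $1$ or $\infty$ vanishing there, $f$ is near that point the sum of an absolutely convergent series $\sum a_{r,s}q^r\bar q^s$ with countably many non-zero terms, exponents bounded below and $r-s\in\mathbb Z$. The three expansions of such a function are the formal series obtained by expanding $(z_1-z_2)^{\alpha_{12}}(\bar z_1-\bar z_2)^{\beta_{12}}$ binomially in $z_2/z_1,\bar z_2/\bar z_1$ and $f$ in the chart $q=z_2/z_1$ at $0$ (for $|z_1|>|z_2|$); the same factor in $z_1/z_2,\bar z_1/\bar z_2$ and $f$ in the chart $q=z_1/z_2$ at $\infty$ (for $|z_2|>|z_1|$); and $z_1^{\alpha_1}\bar z_1^{\beta_1}=(z_2+z_0)^{\alpha_1}(\bar z_2+\bar z_0)^{\beta_1}$ in $z_0/z_2,\bar z_0/\bar z_2$ and $f$ in the chart $q=1-z_1/z_2=-z_0/z_2$ at $1$ (for $|z_2|>|z_1-z_2|$). **Proposition.** Let $(A,H)$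 be an even AH pair and $p\in P(H)$. There is exactly one linear map $Y$ from $F=F_{A,H,p}$ to families $(a(r,s))_{r,s\in\mathbb R}$ in $\mathrm{End}\,F$ such that $$Y(a,\underline z)=E^-(\alpha,\underline z)E^+(\alpha,\underline z)\,l_az^{p\alpha}\bar z^{\bar p\alpha}\qquad(a\in A^\alpha),$$ and, for all $v\in F$, $h_l\in H_l$, $h_r\in H_r$ and $n\ge0$, $$Y(h_l(-n-1)v,\underline z)=\tfrac1{n!}\big(\tfrac{d^n}{dz^n}h_l^-(z)\big)Y(v,\underline z)+Y(v,\underline z)\tfrac1{n!}\big(\tfrac{d^n}{dz^n}h_l^+(z)\big),$$ $$Y(h_r(-n-1)v,\underline z)=\tfrac1{n!}\big(\tfrac{d^n}{d\bar z^n}h_r^-(\bar z)\big)Y(v,\underline z)+Y(v,\underline z)\tfrac1{n!}\big(\tfrac{d^n}{d\bar z^n}h_r^+(\bar z)\big).$$ With this $Y$ and the grading above, $(F_{A,H,p},Y,\mathbf 1)$ is a full vertex algebra. If moreover $A^\alpha\neq0$ for only countably many $\alpha$, then for every $v\in F$ only countably many of the operators $v(r,s)\in\mathrm{End}\,F$ are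 non-zero. -/

import Mathlib

open scoped TensorProduct

namespace AHVertex

noncomputable section

/-! ## Formal series with real exponents and conformal singularities -/

/-- `z^r z̄^s`.  It is used only for `r - s ∈ ℤ`, where it is single valued on `z ≠ 0`. -/
def cpow2 (z : ℂ) (r s : ℝ) : ℂ := z ^ (r : ℂ) * (starRingEnd ℂ) (z ^ (s : ℂ))

/-- The sign `(-1)^x` for an integer-valued real number `x`. -/
def signPow (x : ℝ) : ℂ := (-1 : ℂ) ^ ⌊x⌋

/-- `a` is the coefficient family of an element `∑ a r s p^r p̄^s` of `ℂ((p, p̄, |p|^ℝ))`. -/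
structure IsSeries (a : ℝ → ℝ → ℂ) : Prop where
  integral : ∀ r s, a r s ≠ 0 → ∃ n : ℤ, r - s = n
  countable : {q : ℝ × ℝ | a q.1 q.2 ≠ 0}.Countable
  bounded : ∃ N : ℝ, ∀ r s, a r s ≠ 0 → N ≤ r ∧ N ≤ s

/-- The series `∑ a r s p^r p̄^s` in `ℂ((p, p̄, |p|^ℝ))` converges absolutely to `g` in a punctured
disk.  (The exponents being bounded below, the convergence is then uniform on compact subsets.) -/
def IsExpansionAtZero (g : ℂ → ℂ) (a : ℝ → ℝ → ℂ) : Prop :=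
  IsSeries a ∧ ∃ R : ℝ, 0 < R ∧ ∀ p : ℂ, p ≠ 0 → ‖p‖ < R →
    HasSum (fun q : ℝ × ℝ => a q.1 q.2 * cpow2 p q.1 q.2) (g p)

/-- `f` has a conformal singularity at the point `x` of `ℂ`: it has an expansion in every chart of
the Riemann sphere at `x`.  Here `φ` is the inverse of the chart, near `0`. -/
def HasConformalSingularityAt (f : ℂ → ℂ) (x : ℂ) : Prop :=
  ∀ φ : ℂ → ℂ, AnalyticAt ℂ φ 0 → φ 0 = x → deriv φ 0 ≠ 0 →
    ∃ a : ℝ → ℝ → ℂ, IsExpansionAtZero (fun p => f (φ p)) a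

/-- The space `F_{0,1,∞}` of real analytic functions on `ℂP¹ \ {0,1,∞} = ℂ \ {0,1}` with possible
conformal singularities at `0`, `1`, `∞`. (Only the values on `ℂ \ {0,1}` matter.) -/
structure MemF01inf (f : ℂ → ℂ) : Prop where
  analytic : AnalyticOnNhd ℝ f ({0, 1} : Set ℂ)ᶜ
  sing_zero : HasConformalSingularityAt f 0
  sing_one : HasConformalSingularityAt f 1
  sing_inf : HasConformalSingularityAt (fun w => f w⁻¹) 0

/-! ## Generalized two point correlation functions -/

/-- `Y₂ = {(z₁, z₂) ∈ ℂ² | z₁ ≠ z₂, z₁ ≠ 0, z₂ ≠ 0}`. -/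
def Y2 : Type := {z : ℂ × ℂ // z.1 ≠ z.2 ∧ z.1 ≠ 0 ∧ z.2 ≠ 0}

/-- The data of a function
`z₁^α₁ z₂^α₂ (z₁-z₂)^α₁₂ z̄₁^β₁ z̄₂^β₂ (z̄₁-z̄₂)^β₁₂ f(z₂/z₁)` with `f ∈ F_{0,1,∞}`, together with
the expansions `j(p, f)`, `j(p⁻¹, f)`, `j(1 - p⁻¹, f)` of `f` in the charts `p`, `p⁻¹`, `1 - p⁻¹`
at `0`, `∞`, `1`. -/
structure GTerm where
  (α₁ α₂ α₁₂ β₁ β₂ β₁₂ : ℝ)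
  int₁ : ∃ n : ℤ, α₁ - β₁ = n
  int₂ : ∃ n : ℤ, α₂ - β₂ = n
  int₁₂ : ∃ n : ℤ, α₁₂ - β₁₂ = n
  f : ℂ → ℂ
  mem_f : MemF01inf f
  (j₀ jinf j₁ : ℝ → ℝ → ℂ)
  exp_zero : IsExpansionAtZero f j₀
  exp_inf : IsExpansionAtZero (fun q => f q⁻¹) jinf
  exp_one : IsExpansionAtZero (fun q => f (1 - q)⁻¹) j₁

/-- The function on `Y₂` given by a term. -/
def GTerm.toFun (t : GTerm) : Y2 → ℂ := fun z =>
  cpow2 z.1.1 t.α₁ t.β₁ * cpow2 z.1.2 t.α₂ t.β₂ * cpow2 (z.1.1 - z.1.2) t.α₁₂ t.β₁₂ *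
    t.f (z.1.2 / z.1.1)

/-- `S x y x' y'` is the coefficient of `w^x w̄^y w'^x' w̄'^y'` of a formal series in two pairs of
formal variables `(w, w̄)` and `(w', w̄')`. -/
abbrev Series4 : Type := ℝ → ℝ → ℝ → ℝ → ℂ

/-- The expansion of a term in `|z₁| > |z₂|`, a series in `z₁`, `z₂`:
`z₁^(α₁+α₁₂) z̄₁^(β₁+β₁₂) z₂^α₂ z̄₂^β₂ ∑ (α₁₂ choose i) (β₁₂ choose j) (-z₂/z₁)^i (-z̄₂/z̄₁)^j`
times `j(p, f)` at `p = z₂/z₁`. -/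
def GTerm.exp₁₂ (t : GTerm) : Series4 := fun x₁ y₁ x₂ y₂ =>
  open Classical in
  if x₁ + x₂ = t.α₁ + t.α₂ + t.α₁₂ ∧ y₁ + y₂ = t.β₁ + t.β₂ + t.β₁₂ then
    ∑ᶠ k : ℕ × ℕ, (Ring.choose t.α₁₂ k.1 : ℂ) * (Ring.choose t.β₁₂ k.2 : ℂ) *
      (-1) ^ (k.1 + k.2) * t.j₀ (x₂ - t.α₂ - k.1) (y₂ - t.β₂ - k.2)
  else 0

/-- The expansion of a term in `|z₂| > |z₁|`, a series in `z₁`, `z₂`: `(-1)^(α₁₂-β₁₂)` times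
`z₁^α₁ z̄₁^β₁ z₂^(α₂+α₁₂) z̄₂^(β₂+β₁₂) ∑ (α₁₂ choose i) (β₁₂ choose j) (-z₁/z₂)^i (-z̄₁/z̄₂)^j`
times `j(p⁻¹, f)` at `p = z₁/z₂`. -/
def GTerm.exp₂₁ (t : GTerm) : Series4 := fun x₁ y₁ x₂ y₂ =>
  open Classical in
  if x₁ + x₂ = t.α₁ + t.α₂ + t.α₁₂ ∧ y₁ + y₂ = t.β₁ + t.β₂ + t.β₁₂ then
    signPow (t.α₁₂ - t.β₁₂) *
    ∑ᶠ k : ℕ × ℕ, (Ring.choose t.α₁₂ k.1 : ℂ) * (Ring.choose t.β₁₂ k.2 : ℂ) *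
      (-1) ^ (k.1 + k.2) * t.jinf (x₁ - t.α₁ - k.1) (y₁ - t.β₁ - k.2)
  else 0

/-- The expansion of a term in `|z₂| > |z₁ - z₂|`, a series in `z₀ = z₁ - z₂` and `z₂`:
`z₂^(α₁+α₂) z̄₂^(β₁+β₂) z₀^α₁₂ z̄₀^β₁₂ ∑ (α₁ choose i) (β₁ choose j) (z₀/z₂)^i (z̄₀/z̄₂)^j`
times `j(1 - p⁻¹, f)` at `p = -z₀/z₂`. -/
def GTerm.exp₂₀ (t : GTerm) : Series4 := fun x₀ y₀ x₂ y₂ =>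
  open Classical in
  if x₀ + x₂ = t.α₁ + t.α₂ + t.α₁₂ ∧ y₀ + y₂ = t.β₁ + t.β₂ + t.β₁₂ then
    ∑ᶠ k : ℕ × ℕ, (Ring.choose t.α₁ k.1 : ℂ) * (Ring.choose t.β₁ k.2 : ℂ) *
      (signPow ((x₀ - t.α₁₂ - k.1) - (y₀ - t.β₁₂ - k.2)) *
        t.j₁ (x₀ - t.α₁₂ - k.1) (y₀ - t.β₁₂ - k.2))
  else 0

/-- The space `GCor₂` of functions on `Y₂`. -/
def GCor2 : Submodule ℂ (Y2 → ℂ) := Submodule.span ℂ (Set.range GTerm.toFun)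

/-- `(μ, S) ∈ expansion₁₂` iff `S = μ|_{|z₁|>|z₂|}`: the graph of the linear map on `GCor₂` whose
value on a term is given by `GTerm.exp₁₂`. -/
def expansion₁₂ : Submodule ℂ ((Y2 → ℂ) × Series4) :=
  Submodule.span ℂ (Set.range fun t : GTerm => (t.toFun, t.exp₁₂))

/-- The graph of `μ ↦ μ|_{|z₂|>|z₁|}`. -/
def expansion₂₁ : Submodule ℂ ((Y2 → ℂ) × Series4) :=
  Submodule.span ℂ (Set.range fun t : GTerm => (t.toFun, t.exp₂₁))

/-- The graph of `μ ↦ μ|_{|z₂|>|z₁-z₂|}`. -/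
def expansion₂₀ : Submodule ℂ ((Y2 → ℂ) × Series4) :=
  Submodule.span ℂ (Set.range fun t : GTerm => (t.toFun, t.exp₂₀))

/-! ## Full vertex algebras -/

section FullVertexAlgebra

variable {F : Type*} [AddCommGroup F] [Module ℂ F]

/-- The restricted dual `F^∨ = ⊕ F_{h,h̄}^*` of a graded space. -/
def IsRestrictedDual (gr : ℝ × ℝ → Submodule ℂ F) (u : F →ₗ[ℂ] ℂ) : Prop :=
  {q : ℝ × ℝ | ∃ v ∈ gr q, u v ≠ 0}.Finite

/-- `(F, Y, 1)` with `F = ⊕ F_{h,h̄}` is a full vertex algebra.  Here `Y a r s` is the mode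
`a(r,s)`, that is, `Y(a, z) = ∑ a(r,s) z^(-r-1) z̄^(-s-1)`. -/
structure IsFullVertexAlgebra (gr : ℝ × ℝ → Submodule ℂ F)
    (Y : F →ₗ[ℂ] (ℝ → ℝ → Module.End ℂ F)) (vac : F) : Prop where
  /-- `F` is the direct sum of the `F_{h,h̄}`. -/
  decomp : open Classical in DirectSum.IsInternal gr
  vac_mem : vac ∈ gr (0, 0)
  /-- Only exponents with `r - s ∈ ℤ` occur. -/
  mode_integral : ∀ a r s, (¬ ∃ n : ℤ, r - s = n) → Y a r s = 0
  /-- `Y(a, z) b` has countably many nonzero terms. -/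
  mode_countable : ∀ a b, {q : ℝ × ℝ | Y a q.1 q.2 b ≠ 0}.Countable
  fv1 : ∀ a b, ∃ N : ℝ, ∀ r s, (N ≤ r ∨ N ≤ s) → Y a r s b = 0
  fv2 : ∀ h h' : ℝ, (¬ ∃ n : ℤ, h - h' = n) → gr (h, h') = ⊥
  fv3_holomorphic : ∀ a r s, Y a r s vac ≠ 0 → ∃ m n : ℕ, r = -(m : ℝ) - 1 ∧ s = -(n : ℝ) - 1
  fv3_creation : ∀ a, Y a (-1) (-1) vac = a
  fv4_id : Y vac (-1) (-1) = LinearMap.id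
  fv4_zero : ∀ r s, ¬ (r = -1 ∧ s = -1) → Y vac r s = 0
  fv5 : ∀ a b c : F, ∀ u : F →ₗ[ℂ] ℂ, IsRestrictedDual gr u → ∃ μ ∈ GCor2,
    (μ, fun x₁ y₁ x₂ y₂ => u (Y a (-x₁ - 1) (-y₁ - 1) (Y b (-x₂ - 1) (-y₂ - 1) c)))
        ∈ expansion₁₂ ∧
    (μ, fun x₀ y₀ x₂ y₂ => u (Y (Y a (-x₀ - 1) (-y₀ - 1) b) (-x₂ - 1) (-y₂ - 1) c))
        ∈ expansion₂₀ ∧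
    (μ, fun x₁ y₁ x₂ y₂ => u (Y b (-x₂ - 1) (-y₂ - 1) (Y a (-x₁ - 1) (-y₁ - 1) c)))
        ∈ expansion₂₁
  fv6 : ∀ r s h₁ h₁' h₂ h₂' : ℝ, ∀ a ∈ gr (h₁, h₁'), ∀ b ∈ gr (h₂, h₂'),
    Y a r s b ∈ gr (h₁ + h₂ - r - 1, h₁' + h₂' - s - 1)

end FullVertexAlgebra

/-! ## AH pairs and the set `P(H)` -/

section AHPair

variable {H : Type*} [AddCommGroup H] [Module ℝ H]

/-- The conditions AH2, AH3 on an `H`-graded algebra `A = ⊕ A^α` (AH1 is part of the notion of a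
graded algebra), where `B` is the bilinear form of `H`. -/
structure IsAHPair {A : Type*} [Ring A] [Algebra ℂ A] (B : LinearMap.BilinForm ℝ H)
    (𝒜 : H → Submodule ℂ A) : Prop where
  integral : ∀ α β, ∀ a ∈ 𝒜 α, ∀ b ∈ 𝒜 β, a * b ≠ 0 → ∃ n : ℤ, B α β = n
  comm : ∀ α β, ∀ a ∈ 𝒜 α, ∀ b ∈ 𝒜 β, ∀ n : ℤ, B α β = n → a * b = ((-1 : ℂ) ^ n) • (b * a)

/-- Even AH pairs. -/
structure IsEvenAHPair {A : Type*} [Ring A] [Algebra ℂ A] (B : LinearMap.BilinForm ℝ H)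
    (𝒜 : H → Submodule ℂ A) : Prop extends IsAHPair B 𝒜 where
  even : ∀ α, 𝒜 α ≠ ⊥ → ∃ n : ℤ, B α α = 2 * n

/-- The set `P(H)` of projections whose kernel and range `ker (1 - p)` are orthogonal. -/
def projections (B : LinearMap.BilinForm ℝ H) : Set (Module.End ℝ H) :=
  {p | p * p = p ∧ ∀ x ∈ LinearMap.ker p, ∀ y ∈ LinearMap.ker (1 - p), B x y = 0}

/-- The form `(h, h')_p = (p h, p h') - (p̄ h, p̄ h')` with `p̄ = 1 - p`. -/
def twistedForm (B : LinearMap.BilinForm ℝ H) (p : Module.End ℝ H) : LinearMap.BilinForm ℝ H :=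
  B.compl₁₂ p p - B.compl₁₂ (1 - p) (1 - p)

theorem twistedForm_isSymm {B : LinearMap.BilinForm ℝ H} (hB : B.IsSymm) (p : Module.End ℝ H) :
    (twistedForm B p).IsSymm :=
  ⟨fun x y => by simp [twistedForm, hB.eq (p x) (p y), hB.eq (x - p x) (y - p y),
    -map_sub]⟩

/-- The complex bilinear extension of `(-,-)_p` to `H ⊗ ℂ`. -/
def complexForm (B : LinearMap.BilinForm ℝ H) (p : Module.End ℝ H) :
    LinearMap.BilinForm ℂ (ℂ ⊗[ℝ] H) := (twistedForm B p).baseChange ℂ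

theorem complexForm_isSymm {B : LinearMap.BilinForm ℝ H} (hB : B.IsSymm) (p : Module.End ℝ H) :
    (complexForm B p).IsSymm :=
  LinearMap.BilinForm.isSymm_iff.mpr (LinearMap.BilinForm.IsSymm.baseChange ℂ
    (LinearMap.BilinForm.isSymm_iff.mp (twistedForm_isSymm hB p)))

end AHPair

/-! ## The affine Heisenberg Lie algebra -/

section Heisenberg

variable {V : Type*} [AddCommGroup V] [Module ℂ V]

/-- The affine Heisenberg Lie algebra `⊕_{n ∈ ℤ} V t^n ⊕ ℂ c` of a complex vector space with a
symmetric bilinear form. -/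
def HeisenbergAlg (Φ : LinearMap.BilinForm ℂ V) (_hΦ : Φ.IsSymm) : Type _ := (ℤ →₀ V) × ℂ

variable (Φ : LinearMap.BilinForm ℂ V) (hΦ : Φ.IsSymm)

instance : AddCommGroup (HeisenbergAlg Φ hΦ) := inferInstanceAs (AddCommGroup ((ℤ →₀ V) × ℂ))
instance : Module ℂ (HeisenbergAlg Φ hΦ) := inferInstanceAs (Module ℂ ((ℤ →₀ V) × ℂ))

/-- The coefficient of `c` in the bracket; `[h t^n, k t^m] = n (h, k) δ_{n+m,0} c`. -/
def heisCocycle (x y : ℤ →₀ V) : ℂ := x.sum fun n v => (n : ℂ) * Φ v (y (-n))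

theorem heisCocycle_add_left (x y z : ℤ →₀ V) :
    heisCocycle Φ (x + y) z = heisCocycle Φ x z + heisCocycle Φ y z := by
  unfold heisCocycle
  rw [Finsupp.sum_add_index'] <;> intros <;> simp [mul_add]

theorem heisCocycle_add_right (x y z : ℤ →₀ V) :
    heisCocycle Φ x (y + z) = heisCocycle Φ x y + heisCocycle Φ x z := by
  simp [heisCocycle, mul_add, Finsupp.sum_add]

theorem heisCocycle_smul_right (r : ℂ) (x y : ℤ →₀ V) :
    heisCocycle Φ x (r • y) = r * heisCocycle Φ x y := by
  simp [heisCocycle, Finsupp.sum, Finset.mul_sum, mul_left_comm]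

theorem heisCocycle_self (hΦ : Φ.IsSymm) (x : ℤ →₀ V) : heisCocycle Φ x x = 0 := by
  classical
  let s : Finset ℤ := x.support ∪ x.support.image Neg.neg
  have h1 : heisCocycle Φ x x = ∑ n ∈ s, (n : ℂ) * Φ (x n) (x (-n)) :=
    Finsupp.sum_of_support_subset _ Finset.subset_union_left _ (by simp)
  have h2 : ∑ n ∈ s, (n : ℂ) * Φ (x n) (x (-n))
      = ∑ n ∈ s, -((n : ℂ) * Φ (x n) (x (-n))) := by
    refine Finset.sum_nbij' (fun n => -n) (fun n => -n) ?_ ?_ (by simp) (by simp) ?_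
    · intro n hn
      simp only [s, Finset.mem_union, Finset.mem_image] at hn ⊢
      rcases hn with h | ⟨m, h, rfl⟩
      · exact Or.inr ⟨n, h, rfl⟩
      · exact Or.inl (by simpa using h)
    · intro n hn
      simp only [s, Finset.mem_union, Finset.mem_image] at hn ⊢
      rcases hn with h | ⟨m, h, rfl⟩
      · exact Or.inr ⟨n, h, rfl⟩
      · exact Or.inl (by simpa using h)
    · intro n _
      simp [hΦ.eq (x (-n)) (x n)]
  rw [Finset.sum_neg_distrib] at h2
  rw [h1]
  linear_combination h2 / 2

instance : LieRing (HeisenbergAlg Φ hΦ) where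
  bracket x y := ((0 : ℤ →₀ V), heisCocycle Φ x.1 y.1)
  add_lie x y z := Prod.ext (add_zero _).symm (heisCocycle_add_left Φ x.1 y.1 z.1)
  lie_add x y z := Prod.ext (add_zero _).symm (heisCocycle_add_right Φ x.1 y.1 z.1)
  lie_self x := Prod.ext rfl (heisCocycle_self Φ hΦ x.1)
  leibniz_lie x y z := Prod.ext (add_zero _).symm (by
    change heisCocycle Φ x.1 0 = heisCocycle Φ 0 z.1 + heisCocycle Φ y.1 0
    simp [heisCocycle])

instance : LieAlgebra ℂ (HeisenbergAlg Φ hΦ) where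
  lie_smul r x y := Prod.ext (smul_zero r).symm (heisCocycle_smul_right Φ r x.1 y.1)

/-- The element `h t^n` of the affine Heisenberg algebra. -/
def HeisenbergAlg.mode (n : ℤ) (v : V) : HeisenbergAlg Φ hΦ := (Finsupp.single n v, (0 : ℂ))

/-- The central element `c`. -/
def HeisenbergAlg.central : HeisenbergAlg Φ hΦ := ((0 : ℤ →₀ V), (1 : ℂ))

end Heisenberg

/-! ## The induced module `F_{A,H,p}` -/

section Induced

variable {H : Type*} [AddCommGroup H] [Module ℝ H] {A : Type*} [Ring A] [Algebra ℂ A]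
variable (B : LinearMap.BilinForm ℝ H) (hB : B.IsSymm) (p : Module.End ℝ H)
variable (𝒜 : H → Submodule ℂ A)

/-- The affine Heisenberg algebra of `H ⊗ ℂ` with the form `(-,-)_p`. -/
abbrev Hhat : Type _ :=
  HeisenbergAlg (complexForm B p) (complexForm_isSymm hB p)

/-- Its universal enveloping algebra. -/
abbrev UHhat : Type _ := UniversalEnvelopingAlgebra ℂ (Hhat B hB p)

/-- The element `v t^n` of the enveloping algebra. -/
def UHhat.mode (n : ℤ) (v : ℂ ⊗[ℝ] H) : UHhat B hB p :=
  UniversalEnvelopingAlgebra.ι ℂ (HeisenbergAlg.mode _ _ n v)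

/-- The element `c` of the enveloping algebra. -/
def UHhat.central : UHhat B hB p :=
  UniversalEnvelopingAlgebra.ι ℂ (HeisenbergAlg.central _ _)

/-- The relations `u x ⊗ a = u ⊗ x a` for `x` in the subalgebra `⊕_{n ≥ 0} H t^n ⊕ ℂ c`, which acts
on `A` by `c a = a`, `(h t^n) a = 0` for `n ≥ 1`, and `(h t^0) a = (h, α)_p a` for `a ∈ A^α`. -/
def inducedRelations : Submodule (UHhat B hB p) (UHhat B hB p ⊗[ℂ] A) :=
  Submodule.span (UHhat B hB p)
    ({t | ∃ a : A, t = UHhat.central B hB p ⊗ₜ[ℂ] a - 1 ⊗ₜ[ℂ] a} ∪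
     {t | ∃ n : ℤ, 1 ≤ n ∧ ∃ (v : ℂ ⊗[ℝ] H) (a : A), t = UHhat.mode B hB p n v ⊗ₜ[ℂ] a} ∪
     {t | ∃ (h α : H), ∃ a ∈ 𝒜 α, t = UHhat.mode B hB p 0 (1 ⊗ₜ[ℝ] h) ⊗ₜ[ℂ] a -
        1 ⊗ₜ[ℂ] ((twistedForm B p h α : ℂ) • a)})

/-- The module `F_{A,H,p}` induced from `A`: the quotient of `U(Ĥ) ⊗ A` by the relations above,
that is, `U(Ĥ) ⊗_{U(Ĥ_{≥0})} A`. -/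
def Induced : Type _ := (UHhat B hB p ⊗[ℂ] A) ⧸ inducedRelations B hB p 𝒜

instance : AddCommGroup (Induced B hB p 𝒜) :=
  inferInstanceAs (AddCommGroup ((UHhat B hB p ⊗[ℂ] A) ⧸ inducedRelations B hB p 𝒜))
instance : Module (UHhat B hB p) (Induced B hB p 𝒜) :=
  inferInstanceAs (Module (UHhat B hB p) ((UHhat B hB p ⊗[ℂ] A) ⧸ inducedRelations B hB p 𝒜))
instance : Module ℂ (Induced B hB p 𝒜) :=
  inferInstanceAs (Module ℂ ((UHhat B hB p ⊗[ℂ] A) ⧸ inducedRelations B hB p 𝒜))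
instance : IsScalarTower ℂ (UHhat B hB p) (Induced B hB p 𝒜) :=
  inferInstanceAs (IsScalarTower ℂ (UHhat B hB p)
    ((UHhat B hB p ⊗[ℂ] A) ⧸ inducedRelations B hB p 𝒜))

/-- The image `1 ⊗ a` of `a ∈ A` in `F_{A,H,p}`. -/
def incl (a : A) : Induced B hB p 𝒜 :=
  Submodule.Quotient.mk (p := inducedRelations B hB p 𝒜) (1 ⊗ₜ[ℂ] a)

/-- The operator `h(n)` on `F_{A,H,p}`. -/
def heis (n : ℤ) (h : H) : Module.End ℂ (Induced B hB p 𝒜) :=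
  Algebra.lsmul ℂ ℂ (Induced B hB p 𝒜) (UHhat.mode B hB p n (1 ⊗ₜ[ℝ] h))

/-- `create [(n₁, h₁), …, (n_k, h_k)] v = h₁(-n₁-1) ⋯ h_k(-n_k-1) v`. -/
def create (L : List (ℕ × H)) (v : Induced B hB p 𝒜) : Induced B hB p 𝒜 :=
  L.foldr (fun q w => heis B hB p 𝒜 (-(q.1 : ℤ) - 1) q.2 w) v

/-- The total degree `∑ (n_i + 1)` of a list of creation operators. -/
def degree (L : List (ℕ × H)) : ℕ := (L.map fun q => q.1 + 1).sum

/-- `F_{h,h̄}` is spanned by the vectors `h_l¹(-i₁) ⋯ h_l^k(-i_k) h_r¹(-j₁) ⋯ h_r^l(-j_l) a` with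
`h_l ∈ H_l = ker (1 - p)`, `h_r ∈ H_r = ker p`, `a ∈ A^α`, `h = (pα, pα)_p / 2 + i₁ + ⋯ + i_k` and
`h̄ = (p̄α, p̄α)_p / 2 + j₁ + ⋯ + j_l`. -/
def grading (q : ℝ × ℝ) : Submodule ℂ (Induced B hB p 𝒜) :=
  Submodule.span ℂ {v | ∃ (α : H), ∃ a ∈ 𝒜 α, ∃ L R : List (ℕ × H),
    (∀ x ∈ L, x.2 ∈ LinearMap.ker (1 - p)) ∧ (∀ x ∈ R, x.2 ∈ LinearMap.ker p) ∧
    q.1 = twistedForm B p (p α) (p α) / 2 + degree L ∧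
    q.2 = twistedForm B p ((1 - p) α) ((1 - p) α) / 2 + degree R ∧
    v = create B hB p 𝒜 L (create B hB p 𝒜 R (incl B hB p 𝒜 a))}

end Induced

/-! ## Operator valued series and vertex operators -/

section Series

variable {F : Type*} [AddCommGroup F] [Module ℂ F]

/-- `S x y` is the coefficient of `z^x z̄^y` of a formal series with coefficients in `End F`. -/
abbrev OpSeries (F : Type*) [AddCommGroup F] [Module ℂ F] : Type _ := ℝ → ℝ → Module.End ℂ F

/-- `Y(v, z)` as a series, from its modes. -/
def fieldSeries (Y : F →ₗ[ℂ] (ℝ → ℝ → Module.End ℂ F)) (v : F) : OpSeries F :=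
  fun x y => Y v (-x - 1) (-y - 1)

/-- The coefficient of `z^x z̄^y` in the product `S T` of two series applied to the vector `w`. -/
def opMul (S T : OpSeries F) (x y : ℝ) (w : F) : F :=
  ∑ᶠ q : ℝ × ℝ, S q.1 q.2 (T (x - q.1) (y - q.2) w)

/-- `d/dz`. -/
def ddz (S : OpSeries F) : OpSeries F := fun x y => ((x + 1 : ℝ) : ℂ) • S (x + 1) y

/-- `d/dz̄`. -/
def ddzbar (S : OpSeries F) : OpSeries F := fun x y => ((y + 1 : ℝ) : ℂ) • S x (y + 1)

/-- The exponential `∑ X^k / k!` of a power series in two variables without constant term. -/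
def expSeries (X : MvPowerSeries (Fin 2) (Module.End ℂ F)) :
    MvPowerSeries (Fin 2) (Module.End ℂ F) := fun d =>
  ∑ k ∈ Finset.range (d.degree + 1), ((k.factorial : ℂ)⁻¹) • MvPowerSeries.coeff d (X ^ k)

end Series

section VertexOperators

variable {H : Type*} [AddCommGroup H] [Module ℝ H] {A : Type*} [Ring A] [Algebra ℂ A]
variable (B : LinearMap.BilinForm ℝ H) (hB : B.IsSymm) (p : Module.End ℝ H)
variable (𝒜 : H → Submodule ℂ A)

open Classical in
/-- `h^+(z) = ∑_{n ≥ 0} ((p h)(n) z^(-n-1) + (p̄ h)(n) z̄^(-n-1))`. -/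
def hPlus (h : H) : OpSeries (Induced B hB p 𝒜) := fun x y =>
  ∑ᶠ n : ℕ, ((if x = -(n : ℝ) - 1 ∧ y = 0 then heis B hB p 𝒜 n (p h) else 0) +
    (if x = 0 ∧ y = -(n : ℝ) - 1 then heis B hB p 𝒜 n ((1 - p) h) else 0))

open Classical in
/-- `h^-(z) = ∑_{n ≥ 0} ((p h)(-n-1) z^n + (p̄ h)(-n-1) z̄^n)`. -/
def hMinus (h : H) : OpSeries (Induced B hB p 𝒜) := fun x y =>
  ∑ᶠ n : ℕ, ((if x = (n : ℝ) ∧ y = 0 then heis B hB p 𝒜 (-(n : ℤ) - 1) (p h) else 0) +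
    (if x = 0 ∧ y = (n : ℝ) then heis B hB p 𝒜 (-(n : ℤ) - 1) ((1 - p) h) else 0))

/-- For `ε = 1` the series `-∑_{n ≥ 1} ((p h)(n)/n z^(-n) + (p̄ h)(n)/n z̄^(-n))`, as a power series
in `z⁻¹`, `z̄⁻¹`; for `ε = -1` the series
`-∑_{n ≤ -1} ((p h)(n)/n z^(-n) + (p̄ h)(n)/n z̄^(-n))`, as a power series in `z`, `z̄`. -/
def expArg (ε : ℤ) (h : H) : MvPowerSeries (Fin 2) (Module.End ℂ (Induced B hB p 𝒜)) := fun d =>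
  -((if 1 ≤ d 0 ∧ d 1 = 0 then
        (((ε * d 0 : ℤ) : ℂ)⁻¹) • heis B hB p 𝒜 (ε * d 0) (p h) else 0) +
    (if d 0 = 0 ∧ 1 ≤ d 1 then
        (((ε * d 1 : ℤ) : ℂ)⁻¹) • heis B hB p 𝒜 (ε * d 1) ((1 - p) h) else 0))

open Classical in
/-- `E^+(h, z)`, a series in `z⁻¹`, `z̄⁻¹`. -/
def EPlus (h : H) : OpSeries (Induced B hB p 𝒜) := fun x y =>
  ∑ᶠ d : Fin 2 →₀ ℕ, if x = -(d 0 : ℝ) ∧ y = -(d 1 : ℝ) then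
    MvPowerSeries.coeff d (expSeries (expArg B hB p 𝒜 1 h)) else 0

open Classical in
/-- `E^-(h, z)`, a series in `z`, `z̄`. -/
def EMinus (h : H) : OpSeries (Induced B hB p 𝒜) := fun x y =>
  ∑ᶠ d : Fin 2 →₀ ℕ, if x = (d 0 : ℝ) ∧ y = (d 1 : ℝ) then
    MvPowerSeries.coeff d (expSeries (expArg B hB p 𝒜 (-1) h)) else 0

/-- `Y` is the map defined inductively by `Y(a, z) = E^-(α, z) E^+(α, z) l_a z^(pα) z̄^(p̄α)` for
`a ∈ A^α` and by normal ordering.  Here `l_a z^(pα) z̄^(p̄α)` sends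
`h₁(-n₁-1) ⋯ h_k(-n_k-1) b`, for `b ∈ A^β`, to
`z^((pα, pβ)_p) z̄^((p̄α, p̄β)_p) h₁(-n₁-1) ⋯ h_k(-n_k-1) a b`. -/
structure IsVertexOperator (Y : Induced B hB p 𝒜 →ₗ[ℂ]
    (ℝ → ℝ → Module.End ℂ (Induced B hB p 𝒜))) : Prop where
  base : ∀ α, ∀ a ∈ 𝒜 α, ∀ β, ∀ b ∈ 𝒜 β, ∀ (L : List (ℕ × H)) (x y : ℝ),
    fieldSeries Y (incl B hB p 𝒜 a) x y (create B hB p 𝒜 L (incl B hB p 𝒜 b)) =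
      opMul (EMinus B hB p 𝒜 α) (EPlus B hB p 𝒜 α)
        (x - twistedForm B p (p α) (p β)) (y - twistedForm B p ((1 - p) α) ((1 - p) β))
        (create B hB p 𝒜 L (incl B hB p 𝒜 (a * b)))
  left : ∀ h ∈ LinearMap.ker (1 - p), ∀ (n : ℕ) (v : Induced B hB p 𝒜) (x y : ℝ)
    (w : Induced B hB p 𝒜),
    fieldSeries Y (heis B hB p 𝒜 (-(n : ℤ) - 1) h v) x y w =
      opMul ((n.factorial : ℂ)⁻¹ • ddz^[n] (hMinus B hB p 𝒜 h)) (fieldSeries Y v) x y w +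
      opMul (fieldSeries Y v) ((n.factorial : ℂ)⁻¹ • ddz^[n] (hPlus B hB p 𝒜 h)) x y w
  right : ∀ h ∈ LinearMap.ker p, ∀ (n : ℕ) (v : Induced B hB p 𝒜) (x y : ℝ)
    (w : Induced B hB p 𝒜),
    fieldSeries Y (heis B hB p 𝒜 (-(n : ℤ) - 1) h v) x y w =
      opMul ((n.factorial : ℂ)⁻¹ • ddzbar^[n] (hMinus B hB p 𝒜 h)) (fieldSeries Y v) x y w +
      opMul (fieldSeries Y v) ((n.factorial : ℂ)⁻¹ • ddzbar^[n] (hPlus B hB p 𝒜 h)) x y w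

end VertexOperators

end

end AHVertex

open scoped TensorProduct
namespace AHVertex
noncomputable section

/-! ## The induced module -/

section InducedBasics

variable {H : Type*} [AddCommGroup H] [Module ℝ H] {A : Type*} [Ring A] [Algebra ℂ A]
variable (B : LinearMap.BilinForm ℝ H) (hB : B.IsSymm) (p : Module.End ℝ H)
variable (𝒜 : H → Submodule ℂ A)

attribute [local instance 100] LieRing.ofAssociativeRing

/-! The induced module F is free over the commuting creation operators h(-n-1), n ≥ 0, with A as its
space of generators. The part of this that matters is `exists_creation_lift`: a linear map out of F
may be prescribed arbitrarily on A, together with commuting operators on the target to which the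
h(-n-1) are sent. It is obtained by mapping F to an explicit Fock space, polynomials tensor A, where
the Heisenberg relations are checked by hand. Its counterpart `create_induction` (creation operators
applied to A span F) is behind every induction below and behind the uniqueness of Y.

Existence of Y. Take as target the space of operator series that are truncated on every vector.
Normal ordering with a derivative of a current puts creation operators on the left and annihilation
operators on the right. Two such operations therefore commute as soon as creation operators commute
among themselves and annihilation operators do, with no locality needed (`normHom_comm`). So Y
exists, once the vertex operators of elements of A are known to be truncated. The exponentials in
these are handled through the recursion n e_n = ∑ d_m e_{n-1-m} (`recSeq`), which reduces their
commutation rules to induction.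

Gradings. A charge decomposition into sectors confines the exponents of Y between charges α and β to
a coset of ℤ² on which x - y differs from (α, β) by an integer; this yields the integrality and
countability statements. The bigrading is the eigenspace decomposition of a single operator with
eigenvalue h + i h̄, for which the modes of Y are homogeneous.

Correlation functions. The three series are simultaneously the expansions of one finite linear
combination of monomials in z₁, z₂, z₁ - z₂ and their conjugates, so the function f can always be
the constant 1. `Good` is the span of the triples of expansions of such monomials, and it is stable
under integral powers of z₁, z₂, z₁ - z₂. The commutator [h(m), Y(v, z)] = ∑ (m choose j) Y(h(j)v,
z) z^(m-j) gives Ward identities that strip creation operators from the first vector, then from the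
second (the first being in A), then from the third (the first two being in A). The factors z₁^r,
z₂^r, (z₁ - z₂)^r in them are the same in all three regions; only their expansions differ
(`good_create_left`, `good_create_middle`, `good_create_right`). Antiholomorphic currents are
treated by exchanging z and z̄. For three elements of A the correlation function is computed from
the exponentials (`good_incl`); the sign from exchanging z₁ and z₂ is exactly the sign in ab =
(-1)^(α,β) ba. All sums are finite because weights in a charge sector are bounded below and a
restricted functional sees only finitely many of them. -/

theorem HeisenbergAlg.mode_lie {V : Type*} [AddCommGroup V] [Module ℂ V]
    (Φ : LinearMap.BilinForm ℂ V) (hΦ : Φ.IsSymm) (n m : ℤ) (v w : V) :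
    ⁅HeisenbergAlg.mode Φ hΦ n v, HeisenbergAlg.mode Φ hΦ m w⁆ =
      (if n + m = 0 then (n : ℂ) * Φ v w else 0) • HeisenbergAlg.central Φ hΦ := by
  refine Prod.ext (smul_zero _).symm ?_
  change heisCocycle Φ (Finsupp.single n v) (Finsupp.single m w) =
    (if n + m = 0 then (n : ℂ) * Φ v w else 0) * 1
  rw [heisCocycle, Finsupp.sum_single_index (by simp), Finsupp.single_apply]
  by_cases h : n + m = 0
  · rw [if_pos (by omega), if_pos h, mul_one]
  · rw [if_neg (by omega), if_neg h]; simp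

theorem UHhat.mode_mul_sub (n m : ℤ) (v w : ℂ ⊗[ℝ] H) :
    UHhat.mode B hB p n v * UHhat.mode B hB p m w -
      UHhat.mode B hB p m w * UHhat.mode B hB p n v =
      (if n + m = 0 then (n : ℂ) * complexForm B p v w else 0) • UHhat.central B hB p := by
  have h := congrArg (UniversalEnvelopingAlgebra.ι ℂ)
    (HeisenbergAlg.mode_lie (complexForm B p) (complexForm_isSymm hB p) n m v w)
  rw [LieHom.map_lie, map_smul, LieRing.of_associative_ring_bracket] at h
  exact h

theorem HeisenbergAlg.central_lie {V : Type*} [AddCommGroup V] [Module ℂ V]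
    (Φ : LinearMap.BilinForm ℂ V) (hΦ : Φ.IsSymm) (x : HeisenbergAlg Φ hΦ) :
    ⁅HeisenbergAlg.central Φ hΦ, x⁆ = 0 := by
  refine Prod.ext rfl ?_
  change heisCocycle Φ 0 x.1 = 0
  simp [heisCocycle]

/-- The enveloping algebra is a quotient of the tensor algebra, so tensor algebra induction
descends. -/
theorem uea_induction {L : Type*} [LieRing L] [LieAlgebra ℂ L]
    {C : UniversalEnvelopingAlgebra ℂ L → Prop}
    (algebraMap : ∀ r : ℂ, C (algebraMap ℂ _ r))
    (ι : ∀ x, C (UniversalEnvelopingAlgebra.ι ℂ x))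
    (mul : ∀ a b, C a → C b → C (a * b)) (add : ∀ a b, C a → C b → C (a + b)) (u) : C u := by
  obtain ⟨t, rfl⟩ : ∃ t, UniversalEnvelopingAlgebra.mkAlgHom ℂ L t = u :=
    Quotient.exists_rep u
  induction t using TensorAlgebra.induction with
  | algebraMap r => rw [AlgHom.commutes]; exact algebraMap r
  | ι x => exact ι x
  | mul a b ha hb => rw [map_mul]; exact mul _ _ ha hb
  | add a b ha hb => rw [map_add]; exact add _ _ ha hb

theorem UHhat.central_mul (u : UHhat B hB p) :
    UHhat.central B hB p * u = u * UHhat.central B hB p := by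
  induction u using uea_induction with
  | algebraMap r => exact (Algebra.commutes _ _).symm
  | ι x =>
    have h := congrArg (UniversalEnvelopingAlgebra.ι ℂ)
      (HeisenbergAlg.central_lie (complexForm B p) (complexForm_isSymm hB p) x)
    rw [LieHom.map_lie, LieRing.of_associative_ring_bracket, map_zero, sub_eq_zero] at h
    exact h
  | mul a b ha hb => rw [← mul_assoc, ha, mul_assoc, hb, mul_assoc]
  | add a b ha hb => rw [mul_add, add_mul, ha, hb]

theorem Induced.induction {C : Induced B hB p 𝒜 → Prop}
    (smul_incl : ∀ (u : UHhat B hB p) a, C (u • incl B hB p 𝒜 a))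
    (add : ∀ a b, C a → C b → C (a + b)) (v) : C v := by
  obtain ⟨t, rfl⟩ := Submodule.Quotient.mk_surjective (inducedRelations B hB p 𝒜) v
  induction t using TensorProduct.induction_on with
  | zero => have := smul_incl 0 0; rwa [zero_smul] at this
  | tmul u a =>
    rw [← mul_one u, ← smul_eq_mul, ← TensorProduct.smul_tmul']
    exact smul_incl u a
  | add a b ha hb => exact add _ _ ha hb

/-- The defining relations only control c on the generators 1 ⊗ a; centrality moves c past any
element of the enveloping algebra to reach them. -/
theorem central_smul (v : Induced B hB p 𝒜) : UHhat.central B hB p • v = v := by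
  induction v using Induced.induction with
  | smul_incl u a =>
    rw [← mul_smul, UHhat.central_mul, mul_smul]
    congr 1
    refine (Submodule.Quotient.eq (inducedRelations B hB p 𝒜)).2 ?_
    beta_reduce
    rw [TensorProduct.smul_tmul', smul_eq_mul, mul_one]
    exact Submodule.subset_span (Or.inl (Or.inl ⟨a, rfl⟩))
  | add a b ha hb => rw [smul_add, ha, hb]

theorem complexForm_tmul (h k : H) :
    complexForm B p (1 ⊗ₜ h) (1 ⊗ₜ k) = (twistedForm B p h k : ℂ) := by
  simp [complexForm]

theorem heis_comm_apply (n m : ℤ) (h k : H) (v : Induced B hB p 𝒜) :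
    heis B hB p 𝒜 n h (heis B hB p 𝒜 m k v) = heis B hB p 𝒜 m k (heis B hB p 𝒜 n h v) +
      (if n + m = 0 then (n : ℂ) * twistedForm B p h k else 0) • v := by
  have h1 := congrArg (· • v) (UHhat.mode_mul_sub B hB p n m (1 ⊗ₜ h) (1 ⊗ₜ k))
  simp only [sub_smul, mul_smul, smul_assoc, central_smul, complexForm_tmul] at h1
  rw [← h1]
  simp [heis]

theorem heis_incl_pos {n : ℤ} (hn : 1 ≤ n) (h : H) (a : A) :
    heis B hB p 𝒜 n h (incl B hB p 𝒜 a) = 0 := by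
  refine (Submodule.Quotient.mk_eq_zero (inducedRelations B hB p 𝒜)).2 ?_
  beta_reduce
  rw [TensorProduct.smul_tmul', smul_eq_mul, mul_one]
  exact Submodule.subset_span (Or.inl (Or.inr ⟨n, hn, _, a, rfl⟩))

theorem heis_zero_incl (h α : H) {a : A} (ha : a ∈ 𝒜 α) :
    heis B hB p 𝒜 0 h (incl B hB p 𝒜 a) = (twistedForm B p h α : ℂ) • incl B hB p 𝒜 a := by
  refine (Submodule.Quotient.eq (inducedRelations B hB p 𝒜)).2 ?_
  beta_reduce
  rw [TensorProduct.smul_tmul', smul_eq_mul, mul_one, ← TensorProduct.tmul_smul]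
  exact Submodule.subset_span (Or.inr ⟨h, α, a, ha, rfl⟩)

theorem HeisenbergAlg.mode_add {V : Type*} [AddCommGroup V] [Module ℂ V]
    (Φ : LinearMap.BilinForm ℂ V) (hΦ : Φ.IsSymm) (n : ℤ) (v w : V) :
    mode Φ hΦ n (v + w) = mode Φ hΦ n v + mode Φ hΦ n w :=
  Prod.ext (Finsupp.single_add n v w) (add_zero _).symm

theorem HeisenbergAlg.mode_smul {V : Type*} [AddCommGroup V] [Module ℂ V]
    (Φ : LinearMap.BilinForm ℂ V) (hΦ : Φ.IsSymm) (n : ℤ) (r : ℂ) (v : V) :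
    mode Φ hΦ n (r • v) = r • mode Φ hΦ n v :=
  Prod.ext (Finsupp.smul_single r n v).symm (mul_zero _).symm

theorem heis_add (n : ℤ) (h k : H) :
    heis B hB p 𝒜 n (h + k) = heis B hB p 𝒜 n h + heis B hB p 𝒜 n k := by
  rw [heis, UHhat.mode, TensorProduct.tmul_add, HeisenbergAlg.mode_add, map_add, map_add]
  rfl

theorem heis_smul (n : ℤ) (r : ℝ) (h : H) :
    heis B hB p 𝒜 n (r • h) = (r : ℂ) • heis B hB p 𝒜 n h := by
  have : (1 : ℂ) ⊗ₜ[ℝ] (r • h) = (r : ℂ) • (1 : ℂ) ⊗ₜ[ℝ] h := by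
    rw [TensorProduct.tmul_smul, TensorProduct.smul_tmul', TensorProduct.smul_tmul']
    simp
  rw [heis, UHhat.mode, this, HeisenbergAlg.mode_smul, map_smul, map_smul]
  rfl

/-- The operators `h(n)` as a linear map in `h`. -/
def heisHom (n : ℤ) : H →ₗ[ℝ] Module.End ℂ (Induced B hB p 𝒜) where
  toFun h := heis B hB p 𝒜 n h
  map_add' := heis_add B hB p 𝒜 n
  map_smul' r h := by rw [heis_smul]; rfl

/-- The inclusion of `A` as a linear map. -/
def inclHom : A →ₗ[ℂ] Induced B hB p 𝒜 where
  toFun := incl B hB p 𝒜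
  map_add' a b := by rw [incl, TensorProduct.tmul_add]; rfl
  map_smul' r a := by rw [incl, TensorProduct.tmul_smul]; rfl

end InducedBasics

end
end AHVertex

open scoped TensorProduct
namespace AHVertex
noncomputable section

/-! ## The universal property of the induced module over the creation operators -/

/-- A commuting family of operators extends to a homomorphism from a polynomial ring. -/
theorem exists_aeval_of_commute {σ X : Type*} [AddCommGroup X] [Module ℂ X]
    (g : σ → Module.End ℂ X) (hg : ∀ i j, g i * g j = g j * g i) :
    ∃ ρ : MvPolynomial σ ℂ →ₐ[ℂ] Module.End ℂ X, ∀ i, ρ (MvPolynomial.X i) = g i := by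
  have hc : IsMulCommutative (Algebra.adjoin ℂ (Set.range g)) := by
    apply Algebra.isMulCommutative_adjoin
    rintro _ ⟨i, rfl⟩ _ ⟨j, rfl⟩
    exact hg i j
  let _ : CommRing (Algebra.adjoin ℂ (Set.range g)) :=
    { (inferInstance : Ring (Algebra.adjoin ℂ (Set.range g))) with mul_comm := hc.is_comm.comm }
  exact ⟨(Algebra.adjoin ℂ (Set.range g)).val.comp
    (MvPolynomial.aeval fun i => ⟨g i, Algebra.subset_adjoin ⟨i, rfl⟩⟩), fun i => by simp⟩

section Fock

variable {H : Type*} [AddCommGroup H] [Module ℝ H] {A : Type*} [Ring A] [Algebra ℂ A]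
variable (B : LinearMap.BilinForm ℝ H) (hB : B.IsSymm) (p : Module.End ℝ H)
variable (𝒜 : H → Submodule ℂ A)

attribute [local instance 100] LieRing.ofAssociativeRing

/-- A linear map out of a graded algebra given on homogeneous components. -/
def gradedLift [DecidableEq H] [GradedAlgebra 𝒜] {X : Type*} [AddCommGroup X] [Module ℂ X]
    (f : ∀ α, 𝒜 α →ₗ[ℂ] X) : A →ₗ[ℂ] X :=
  DirectSum.toModule ℂ H X f ∘ₗ (DirectSum.decomposeLinearEquiv 𝒜).toLinearMap

theorem gradedLift_apply [DecidableEq H] [GradedAlgebra 𝒜] {X : Type*} [AddCommGroup X]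
    [Module ℂ X] (f : ∀ α, 𝒜 α →ₗ[ℂ] X) {α : H} {a : A} (ha : a ∈ 𝒜 α) :
    gradedLift 𝒜 f a = f α ⟨a, ha⟩ := by
  have h : DirectSum.decomposeLinearEquiv 𝒜 a = DirectSum.lof ℂ H (fun α => 𝒜 α) α ⟨a, ha⟩ :=
    DirectSum.decompose_of_mem 𝒜 ha
  rw [gradedLift, LinearMap.comp_apply, LinearEquiv.coe_coe, h, DirectSum.toModule_lof]

theorem graded_hom_ext [DecidableEq H] [GradedAlgebra 𝒜] {X : Type*} [AddCommGroup X]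
    [Module ℂ X] {f g : A →ₗ[ℂ] X} (h : ∀ α, ∀ a ∈ 𝒜 α, f a = g a) : f = g := by
  ext a
  induction a using DirectSum.Decomposition.inductionOn 𝒜 with
  | zero => simp
  | homogeneous a => exact h _ a a.2
  | add a b ha hb => rw [map_add, map_add, ha, hb]

variable {ι : Type*} (b : Module.Basis ι ℝ H)

/-- The multiplication operators of the Fock module. -/
def fockX (n : ℕ) : ℂ ⊗[ℝ] H →ₗ[ℂ] MvPolynomial (ℕ × ι) ℂ :=
  (b.baseChange ℂ).constr ℂ fun i => MvPolynomial.X (n, i)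

open Classical in
/-- The derivations of the Fock module. -/
def fockD (n : ℕ) (v : ℂ ⊗[ℝ] H) :
    Derivation ℂ (MvPolynomial (ℕ × ι) ℂ) (MvPolynomial (ℕ × ι) ℂ) :=
  MvPolynomial.mkDerivation ℂ fun q => MvPolynomial.C
    (if q.1 = n then ((n : ℂ) + 1) * complexForm B p v (b.baseChange ℂ q.2) else 0)

/-- Both sides are linear in w, so the identity need only be checked on the basis indexing the
variables. With the Leibniz rule it becomes the canonical commutation relation. -/
theorem fockD_X (n k : ℕ) (v w : ℂ ⊗[ℝ] H) :
    fockD B p b n v (fockX b k w) = MvPolynomial.C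
      (if k = n then ((n : ℂ) + 1) * complexForm B p v w else 0) := by
  by_cases h : k = n
  · subst h
    simp only [if_true]
    have : (fockD B p b k v).toLinearMap ∘ₗ fockX b k =
        (Algebra.linearMap ℂ (MvPolynomial (ℕ × ι) ℂ)) ∘ₗ
          (((k : ℂ) + 1) • complexForm B p v) := by
      refine (b.baseChange ℂ).ext fun i => ?_
      simp [fockX, fockD, Module.Basis.constr_basis, MvPolynomial.mkDerivation_X,
        MvPolynomial.algebraMap_eq, -Module.Basis.baseChange_apply]
    exact LinearMap.congr_fun this w
  · simp only [if_neg h, map_zero]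
    have : (fockD B p b n v).toLinearMap ∘ₗ fockX b k = 0 := by
      refine (b.baseChange ℂ).ext fun i => ?_
      simp [fockX, fockD, Module.Basis.constr_basis, MvPolynomial.mkDerivation_X, h,
        -Module.Basis.baseChange_apply]
    exact LinearMap.congr_fun this w

theorem fockD_add (n : ℕ) (v w : ℂ ⊗[ℝ] H) :
    fockD B p b n (v + w) = fockD B p b n v + fockD B p b n w := by
  refine MvPolynomial.derivation_ext fun q => ?_
  simp only [fockD, Derivation.add_apply, MvPolynomial.mkDerivation_X, ← map_add]
  split_ifs <;> simp [mul_add]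

theorem fockD_smul (n : ℕ) (r : ℂ) (v : ℂ ⊗[ℝ] H) :
    fockD B p b n (r • v) = r • fockD B p b n v := by
  refine MvPolynomial.derivation_ext fun q => ?_
  simp only [fockD, Derivation.smul_apply, MvPolynomial.mkDerivation_X, MvPolynomial.smul_eq_C_mul,
    ← map_mul]
  split_ifs <;> simp [mul_left_comm]

/-- Derivations with constant coefficients: the commutator is a derivation that kills every
variable. -/
theorem fockD_comm (n k : ℕ) (v w : ℂ ⊗[ℝ] H) (f : MvPolynomial (ℕ × ι) ℂ) :
    fockD B p b n v (fockD B p b k w f) = fockD B p b k w (fockD B p b n v f) := by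
  have : ⁅fockD B p b n v, fockD B p b k w⁆ = 0 := by
    refine MvPolynomial.derivation_ext fun q => ?_
    simp [Derivation.commutator_apply, fockD, MvPolynomial.mkDerivation_X]
  have h := Derivation.congr_fun this f
  rwa [Derivation.commutator_apply, Derivation.zero_apply, sub_eq_zero] at h

variable [DecidableEq H] [GradedAlgebra 𝒜]

/-- The zero mode on `A`. -/
def zeroMode : ℂ ⊗[ℝ] H →ₗ[ℂ] Module.End ℂ A where
  toFun v := gradedLift 𝒜 fun α => complexForm B p v (1 ⊗ₜ α) • (𝒜 α).subtype
  map_add' v w := graded_hom_ext 𝒜 fun α a ha => by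
    simp [gradedLift_apply 𝒜 _ ha, add_smul]
  map_smul' r v := graded_hom_ext 𝒜 fun α a ha => by
    simp [gradedLift_apply 𝒜 _ ha, mul_smul]

theorem zeroMode_apply (v : ℂ ⊗[ℝ] H) {α : H} {a : A} (ha : a ∈ 𝒜 α) :
    zeroMode B p 𝒜 v a = complexForm B p v (1 ⊗ₜ α) • a := by
  simp [zeroMode, gradedLift_apply 𝒜 _ ha]

theorem zeroMode_comm (v w : ℂ ⊗[ℝ] H) (a : A) :
    zeroMode B p 𝒜 v (zeroMode B p 𝒜 w a) = zeroMode B p 𝒜 w (zeroMode B p 𝒜 v a) := by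
  refine LinearMap.congr_fun (f := zeroMode B p 𝒜 v ∘ₗ zeroMode B p 𝒜 w)
    (g := zeroMode B p 𝒜 w ∘ₗ zeroMode B p 𝒜 v) (graded_hom_ext 𝒜 fun α a ha => ?_) a
  simp [zeroMode_apply B p 𝒜 _ ha, smul_smul, mul_comm]

/-- The modes of the Heisenberg algebra on the Fock module. -/
def fockMode : ℤ → (ℂ ⊗[ℝ] H →ₗ[ℂ] Module.End ℂ (MvPolynomial (ℕ × ι) ℂ ⊗[ℂ] A))
  | Int.ofNat 0 => LinearMap.lTensorHom _ ∘ₗ zeroMode B p 𝒜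
  | Int.ofNat (n + 1) => LinearMap.rTensorHom _ ∘ₗ
      { toFun := fun v => (fockD B p b n v).toLinearMap
        map_add' := fun v w => by rw [fockD_add]; rfl
        map_smul' := fun r v => by rw [fockD_smul]; rfl }
  | Int.negSucc n => LinearMap.rTensorHom _ ∘ₗ LinearMap.mul ℂ (MvPolynomial (ℕ × ι) ℂ) ∘ₗ fockX b n

/-- Of the nine sign combinations only a positive mode against a negative one contributes, by the
Leibniz rule. `ofNat (n + 1)` pairs with `negSucc n`, which explains the factor n + 1 in `fockD`.
The symmetry of the form is needed when the two modes occur in the opposite order. -/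
theorem fockMode_comm (hB : B.IsSymm) (n m : ℤ) (v w : ℂ ⊗[ℝ] H) (x : MvPolynomial (ℕ × ι) ℂ ⊗[ℂ] A) :
    fockMode B p 𝒜 b n v (fockMode B p 𝒜 b m w x) -
      fockMode B p 𝒜 b m w (fockMode B p 𝒜 b n v x) =
      (if n + m = 0 then (n : ℂ) * complexForm B p v w else 0) • x := by
  induction x using TensorProduct.induction_on with
  | zero => simp
  | add x y hx hy =>
    rw [smul_add, ← hx, ← hy]; simp only [map_add]; abel
  | tmul s a =>
    rcases n with (_ | n) | n <;> rcases m with (_ | m) | m <;>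
      simp only [fockMode, LinearMap.comp_apply, LinearMap.coe_lTensorHom,
        LinearMap.coe_rTensorHom, LinearMap.lTensor_tmul, LinearMap.rTensor_tmul,
        LinearMap.mul_apply', LinearMap.coe_mk, AddHom.coe_mk, Derivation.coeFn_coe]
    · simp [zeroMode_comm B p 𝒜 v w]
    · simp
    · simp
    · rw [if_neg (by simp; omega), sub_self, zero_smul]
    · rw [fockD_comm, sub_self, if_neg (by simp; omega), zero_smul]
    · rw [Derivation.leibniz, fockD_X]
      by_cases h : m = n
      · subst h
        rw [if_pos rfl, if_pos (by simp [Int.negSucc_eq]), TensorProduct.smul_tmul', ← TensorProduct.sub_tmul,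
          smul_eq_mul, smul_eq_mul, mul_comm s, ← MvPolynomial.smul_eq_C_mul]
        simp
      · rw [if_neg h, if_neg (by simp; omega)]
        simp
    · simp
    · rw [Derivation.leibniz, fockD_X]
      by_cases h : m = n
      · subst h
        rw [if_pos rfl, if_pos (by simp [Int.negSucc_eq]), TensorProduct.smul_tmul', ← TensorProduct.sub_tmul,
          smul_eq_mul, smul_eq_mul, mul_comm s, ← MvPolynomial.smul_eq_C_mul]
        rw [(complexForm_isSymm hB p).eq v w, sub_add_cancel_left, ← neg_smul]
        congr 2
        simp; ring
      · rw [if_neg (Ne.symm h), if_neg (by simp; omega)]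
        simp
    · rw [if_neg (by omega), zero_smul, mul_left_comm, sub_self]

/-- The action of finite sums of modes on the Fock module. -/
def fockLin : (ℤ →₀ ℂ ⊗[ℝ] H) →ₗ[ℂ] Module.End ℂ (MvPolynomial (ℕ × ι) ℂ ⊗[ℂ] A) :=
  Finsupp.lsum ℂ (fockMode B p 𝒜 b)

theorem fockLin_single (n : ℤ) (v : ℂ ⊗[ℝ] H) :
    fockLin B p 𝒜 b (Finsupp.single n v) = fockMode B p 𝒜 b n v :=
  Finsupp.lsum_single ..

theorem fockLin_comm (hB : B.IsSymm) (x y : ℤ →₀ ℂ ⊗[ℝ] H) :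
    fockLin B p 𝒜 b x * fockLin B p 𝒜 b y - fockLin B p 𝒜 b y * fockLin B p 𝒜 b x =
      heisCocycle (complexForm B p) x y • 1 := by
  induction x using Finsupp.induction_linear with
  | zero => simp [heisCocycle]; exact LinearMap.ext fun _ => sub_self (0 : MvPolynomial (ℕ × ι) ℂ ⊗[ℂ] A)
  | add x x' hx hx' =>
    rw [heisCocycle_add_left, add_smul, ← hx, ← hx', map_add, add_mul, mul_add]; abel
  | single n v =>
    induction y using Finsupp.induction_linear with
    | zero => simp [heisCocycle]; exact LinearMap.ext fun _ => sub_self (0 : MvPolynomial (ℕ × ι) ℂ ⊗[ℂ] A)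
    | add x x' hx hx' =>
      rw [heisCocycle_add_right, add_smul, ← hx, ← hx', map_add, add_mul, mul_add]; abel
    | single m w =>
      rw [fockLin_single, fockLin_single]
      refine LinearMap.ext fun z => ?_
      refine Eq.trans (fockMode_comm B p 𝒜 b hB n m v w z) ?_
      rw [LinearMap.smul_apply, Module.End.one_apply, heisCocycle,
        Finsupp.sum_single_index (by simp), Finsupp.single_apply]
      by_cases h : n + m = 0
      · rw [if_pos (by omega : m = -n), if_pos h]
      · rw [if_neg (by omega : ¬ m = -n), if_neg h]; simp

/-- The Heisenberg algebra acts on the Fock module. -/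
def fockRep : Hhat B hB p →ₗ⁅ℂ⁆ Module.End ℂ (MvPolynomial (ℕ × ι) ℂ ⊗[ℂ] A) where
  toFun x := fockLin B p 𝒜 b x.1 + x.2 • 1
  map_add' x y := by
    change fockLin B p 𝒜 b (x.1 + y.1) + (x.2 + y.2) • 1 = _
    rw [map_add, add_smul]; abel
  map_smul' r x := by
    change fockLin B p 𝒜 b (r • x.1) + (r * x.2) • 1 = _
    rw [map_smul, mul_smul, RingHom.id_apply, smul_add]
  map_lie' := by
    rintro ⟨x, c⟩ ⟨y, d⟩
    change fockLin B p 𝒜 b 0 + heisCocycle (complexForm B p) x y • 1 =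
      (fockLin B p 𝒜 b x + c • 1) * (fockLin B p 𝒜 b y + d • 1) -
        (fockLin B p 𝒜 b y + d • 1) * (fockLin B p 𝒜 b x + c • 1)
    rw [← fockLin_comm B p 𝒜 b hB, map_zero, zero_add]
    simp only [add_mul, mul_add, smul_mul_assoc, mul_smul_comm, one_mul, mul_one, smul_add]
    rw [smul_comm c d]
    abel

/-- The action of the enveloping algebra on the Fock module. -/
def fockAct : UHhat B hB p →ₐ[ℂ] Module.End ℂ (MvPolynomial (ℕ × ι) ℂ ⊗[ℂ] A) :=
  UniversalEnvelopingAlgebra.lift ℂ (fockRep B hB p 𝒜 b)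

theorem fockAct_mode (n : ℤ) (v : ℂ ⊗[ℝ] H) :
    fockAct B hB p 𝒜 b (UHhat.mode B hB p n v) = fockMode B p 𝒜 b n v := by
  rw [fockAct, UHhat.mode, UniversalEnvelopingAlgebra.lift_ι_apply]
  change fockLin B p 𝒜 b (Finsupp.single n v) + (0 : ℂ) • 1 = _
  rw [fockLin_single, zero_smul, add_zero]

theorem fockAct_central : fockAct B hB p 𝒜 b (UHhat.central B hB p) = 1 := by
  rw [fockAct, UHhat.central, UniversalEnvelopingAlgebra.lift_ι_apply]
  change fockLin B p 𝒜 b 0 + (1 : ℂ) • 1 = _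
  rw [map_zero, one_smul, zero_add]

/-- The map `u ⊗ a ↦ u (1 ⊗ a)` to the Fock module. -/
def fockPre : UHhat B hB p ⊗[ℂ] A →ₗ[ℂ] MvPolynomial (ℕ × ι) ℂ ⊗[ℂ] A :=
  TensorProduct.lift ((LinearMap.lcomp ℂ _ (TensorProduct.mk ℂ (MvPolynomial (ℕ × ι) ℂ) A 1)).comp
    (fockAct B hB p 𝒜 b).toLinearMap)

theorem fockPre_tmul (u : UHhat B hB p) (a : A) :
    fockPre B hB p 𝒜 b (u ⊗ₜ a) = fockAct B hB p 𝒜 b u (1 ⊗ₜ a) := rfl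

theorem fockPre_smul (u : UHhat B hB p) (t : UHhat B hB p ⊗[ℂ] A) :
    fockPre B hB p 𝒜 b (u • t) = fockAct B hB p 𝒜 b u (fockPre B hB p 𝒜 b t) := by
  induction t using TensorProduct.induction_on with
  | zero => simp
  | add x y hx hy => rw [smul_add, map_add, map_add, hx, hy, map_add]
  | tmul w a =>
    rw [TensorProduct.smul_tmul', smul_eq_mul, fockPre_tmul, fockPre_tmul, map_mul]; rfl

/-- The vectors 1 ⊗ a of the Fock module satisfy the relations defining the induced module, hence
the map descends to the quotient. -/
theorem fockPre_eq_zero (t : UHhat B hB p ⊗[ℂ] A) (ht : t ∈ inducedRelations B hB p 𝒜) :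
    fockPre B hB p 𝒜 b t = 0 := by
  induction ht using Submodule.span_induction with
  | zero => simp
  | add x y _ _ hx hy => rw [map_add, hx, hy, add_zero]
  | smul u x _ hx => rw [fockPre_smul, hx, map_zero]
  | mem x hx =>
    rcases hx with (⟨a, rfl⟩ | ⟨n, hn, v, a, rfl⟩) | ⟨h, α, a, ha, rfl⟩
    · rw [map_sub, fockPre_tmul, fockPre_tmul, fockAct_central, map_one, sub_self]
    · rw [fockPre_tmul, fockAct_mode]
      obtain ⟨k, rfl⟩ : ∃ k : ℕ, n = Int.ofNat (k + 1) :=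
        ⟨(n - 1).toNat, by rw [Int.ofNat_eq_natCast]; omega⟩
      simp [fockMode]
    · rw [map_sub, fockPre_tmul, fockPre_tmul, fockAct_mode, map_one]
      simp only [fockMode, LinearMap.comp_apply,
        LinearMap.coe_lTensorHom, LinearMap.lTensor_tmul, zeroMode_apply B p 𝒜 _ ha,
        complexForm_tmul, Module.End.one_apply, sub_self]

/-- The map from the induced module to the Fock module. -/
def toFock : Induced B hB p 𝒜 →ₗ[ℂ] MvPolynomial (ℕ × ι) ℂ ⊗[ℂ] A :=
  (Submodule.liftQ ((inducedRelations B hB p 𝒜).restrictScalars ℂ) (fockPre B hB p 𝒜 b)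
    (fun t ht => fockPre_eq_zero B hB p 𝒜 b t ht)).comp
    (Submodule.Quotient.restrictScalarsEquiv ℂ (inducedRelations B hB p 𝒜)).symm.toLinearMap

theorem toFock_mk (t : UHhat B hB p ⊗[ℂ] A) :
    toFock B hB p 𝒜 b (Submodule.Quotient.mk (p := inducedRelations B hB p 𝒜) t) =
      fockPre B hB p 𝒜 b t := rfl

theorem toFock_heis (n : ℤ) (h : H) (v : Induced B hB p 𝒜) :
    toFock B hB p 𝒜 b (heis B hB p 𝒜 n h v) =
      fockMode B p 𝒜 b n (1 ⊗ₜ h) (toFock B hB p 𝒜 b v) := by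
  obtain ⟨t, rfl⟩ := Submodule.Quotient.mk_surjective (inducedRelations B hB p 𝒜) v
  refine Eq.trans (fockPre_smul B hB p 𝒜 b (UHhat.mode B hB p n (1 ⊗ₜ h)) t) ?_
  rw [fockAct_mode]; rfl

/-- The induced module is free over the commuting creation operators. -/
theorem exists_creation_lift {X : Type*} [AddCommGroup X] [Module ℂ X]
    (N : ℕ → H →+ Module.End ℂ X) (hs : ∀ n (r : ℝ) h, N n (r • h) = (r : ℂ) • N n h)
    (hN : ∀ n m h k x, N n h (N m k x) = N m k (N n h x))
    (Y : A →ₗ[ℂ] X) :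
    ∃ T : Induced B hB p 𝒜 →ₗ[ℂ] X, (∀ a, T (incl B hB p 𝒜 a) = Y a) ∧
      ∀ (n : ℕ) h v, T (heis B hB p 𝒜 (-(n : ℤ) - 1) h v) = N n h (T v) := by
  let b := Module.Basis.ofVectorSpace ℝ H
  obtain ⟨ρ, hρ⟩ := exists_aeval_of_commute (fun q : ℕ × Module.Basis.ofVectorSpaceIndex ℝ H =>
    N q.1 (b q.2)) fun i j => LinearMap.ext fun x => hN _ _ _ _ _
  -- The polynomial action is fixed on basis vectors only; linearity in h, from `hs`, extends it to
  -- all of H.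
  have hX (n : ℕ) (h : H) : ρ (fockX b n (1 ⊗ₜ h)) = N n h := by
    let f : H →ₗ[ℝ] Module.End ℂ X :=
      { toFun := fun h => N n h, map_add' := map_add (N n),
        map_smul' := fun r h => by rw [hs]; rfl }
    let g : H →ₗ[ℝ] Module.End ℂ X :=
      (ρ.toLinearMap ∘ₗ fockX b n).restrictScalars ℝ ∘ₗ (TensorProduct.mk ℝ ℂ H 1)
    have : g = f := by
      refine b.ext fun i => ?_
      change ρ (fockX b n (1 ⊗ₜ b i)) = N n (b i)
      rw [← Module.Basis.baseChange_apply, fockX, Module.Basis.constr_basis, hρ]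
    exact LinearMap.congr_fun this h
  -- The map is `toFock` followed by P ⊗ a ↦ ρ(P)(Y a). Only the existence of `toFock` is used, not
  -- its bijectivity.
  refine ⟨TensorProduct.lift ((LinearMap.lcomp ℂ _ Y).comp ρ.toLinearMap) ∘ₗ
    toFock B hB p 𝒜 b, fun a => ?_, fun n h v => ?_⟩
  · rw [LinearMap.comp_apply, incl, toFock_mk, fockPre_tmul, map_one]
    simp
  · rw [LinearMap.comp_apply, LinearMap.comp_apply, toFock_heis,
      show -(n : ℤ) - 1 = Int.negSucc n by rw [Int.negSucc_eq]; ring]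
    generalize toFock B hB p 𝒜 b v = x
    induction x using TensorProduct.induction_on with
    | zero => simp
    | add x y hx hy => rw [map_add, map_add, hx, hy, map_add, map_add]
    | tmul s a =>
      simp only [fockMode, LinearMap.comp_apply, LinearMap.coe_rTensorHom, LinearMap.rTensor_tmul,
        LinearMap.mul_apply', TensorProduct.lift.tmul, AlgHom.toLinearMap_apply, map_mul, hX]
      rfl

/-- The inclusion of the finite sums of modes in the Heisenberg algebra. -/
def HeisenbergAlg.ofFinsupp {V : Type*} [AddCommGroup V] [Module ℂ V]
    (Φ : LinearMap.BilinForm ℂ V) (hΦ : Φ.IsSymm) : (ℤ →₀ V) →ₗ[ℂ] HeisenbergAlg Φ hΦ where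
  toFun x := (x, (0 : ℂ))
  map_add' _ _ := Prod.ext rfl (add_zero (0 : ℂ)).symm
  map_smul' r _ := Prod.ext rfl (mul_zero r).symm

theorem HeisenbergAlg.mk_eq {V : Type*} [AddCommGroup V] [Module ℂ V]
    (Φ : LinearMap.BilinForm ℂ V) (hΦ : Φ.IsSymm) (x : ℤ →₀ V) (c : ℂ) :
    ((x, c) : HeisenbergAlg Φ hΦ) = ofFinsupp Φ hΦ x + c • central Φ hΦ :=
  Prod.ext (show x = x + c • 0 by simp) (show c = 0 + c * 1 by simp)

/-- The induced module is spanned by the products of creation operators applied to `A`. -/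
theorem create_induction {C : Induced B hB p 𝒜 → Prop}
    (incl : ∀ α, ∀ a ∈ 𝒜 α, C (incl B hB p 𝒜 a))
    (heis : ∀ (n : ℕ) h v, C v → C (heis B hB p 𝒜 (-(n : ℤ) - 1) h v))
    (zero : C 0) (add : ∀ v w, C v → C w → C (v + w)) (smul : ∀ (r : ℂ) v, C v → C (r • v)) (v) :
    C v := by
  -- The span of the vectors lying in every predicate that contains A and is stable under creation
  -- operators. It remains to see that it is stable under the whole enveloping algebra.
  let S : Submodule ℂ (Induced B hB p 𝒜) := Submodule.span ℂ {v | ∀ D : Induced B hB p 𝒜 → Prop,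
    (∀ α, ∀ a ∈ 𝒜 α, D (AHVertex.incl B hB p 𝒜 a)) →
    (∀ (n : ℕ) h v, D v → D (AHVertex.heis B hB p 𝒜 (-(n : ℤ) - 1) h v)) → D v}
  have hmode (n : ℤ) (h : H) (v) (hv : v ∈ S) : AHVertex.heis B hB p 𝒜 n h v ∈ S := by
    induction hv using Submodule.span_induction with
    | zero => rw [map_zero]; exact S.zero_mem
    | add x y _ _ hx hy => rw [map_add]; exact S.add_mem hx hy
    | smul r x _ hx => rw [map_smul]; exact S.smul_mem r hx
    | mem x hx =>
      rcases lt_or_ge n 0 with hn | hn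
      · obtain ⟨k, rfl⟩ : ∃ k : ℕ, n = -(k : ℤ) - 1 := ⟨(-n - 1).toNat, by omega⟩
        exact Submodule.subset_span fun D h1 h2 => h2 _ _ _ (hx D h1 h2)
      -- For a nonnegative mode the predicate must also carry membership in S: commuting past a
      -- creation operator leaves a scalar multiple of the vector itself.
      · refine (hx (fun v => v ∈ S ∧ AHVertex.heis B hB p 𝒜 n h v ∈ S) (fun α a ha => ?_)
          fun m k v hv => ?_).2
        · have : AHVertex.incl B hB p 𝒜 a ∈ S := Submodule.subset_span fun D h1 h2 => h1 α a ha
          refine ⟨this, ?_⟩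
          rcases hn.lt_or_eq with hn | rfl
          · rw [heis_incl_pos B hB p 𝒜 hn]; exact S.zero_mem
          · rw [heis_zero_incl B hB p 𝒜 h α ha]; exact S.smul_mem _ this
        · have hcr (w) (hw : w ∈ S) : AHVertex.heis B hB p 𝒜 (-(m : ℤ) - 1) k w ∈ S := by
            induction hw using Submodule.span_induction with
            | zero => rw [map_zero]; exact S.zero_mem
            | add x y _ _ hx hy => rw [map_add]; exact S.add_mem hx hy
            | smul r x _ hx => rw [map_smul]; exact S.smul_mem r hx
            | mem x hx => exact Submodule.subset_span fun D h1 h2 => h2 _ _ _ (hx D h1 h2)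
          refine ⟨hcr v hv.1, ?_⟩
          rw [heis_comm_apply]
          exact S.add_mem (hcr _ hv.2) (S.smul_mem _ hv.1)
  have hU (u : UHhat B hB p) : ∀ v ∈ S, u • v ∈ S := by
    induction u using uea_induction with
    | algebraMap r => intro v hv; rw [algebraMap_smul]; exact S.smul_mem r hv
    | mul a b ha hb => intro v hv; rw [mul_smul]; exact ha _ (hb _ hv)
    | add a b ha hb => intro v hv; rw [add_smul]; exact S.add_mem (ha _ hv) (hb _ hv)
    | ι x =>
      intro v hv
      obtain ⟨x, c⟩ := x
      rw [HeisenbergAlg.mk_eq, map_add, map_smul, add_smul, smul_assoc]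
      refine S.add_mem ?_ (S.smul_mem c ((central_smul B hB p 𝒜 v).symm ▸ hv))
      induction x using Finsupp.induction_linear with
      | zero =>
        rw [show (UniversalEnvelopingAlgebra.ι ℂ) (HeisenbergAlg.ofFinsupp (complexForm B p)
          (complexForm_isSymm hB p) 0) = 0 by rw [map_zero, map_zero], zero_smul]
        exact S.zero_mem
      | add x y hx hy => rw [map_add, map_add, add_smul]; exact S.add_mem hx hy
      | single n w =>
        change UHhat.mode B hB p n w • v ∈ S
        induction w using TensorProduct.induction_on with
        | zero =>
          rw [UHhat.mode, ← zero_smul ℂ (0 : ℂ ⊗[ℝ] H), HeisenbergAlg.mode_smul, zero_smul, map_zero,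
            zero_smul]
          exact S.zero_mem
        | add x y hx hy =>
          rw [UHhat.mode, HeisenbergAlg.mode_add, map_add, add_smul]; exact S.add_mem hx hy
        | tmul r k =>
          rw [← mul_one r, ← smul_eq_mul, ← TensorProduct.smul_tmul', UHhat.mode,
            HeisenbergAlg.mode_smul, map_smul, smul_assoc]
          exact S.smul_mem r (hmode n k v hv)
  have hS : v ∈ S := by
    induction v using Induced.induction with
    | add a b ha hb => exact S.add_mem ha hb
    | smul_incl u a =>
      refine hU u _ ?_
      induction a using DirectSum.Decomposition.inductionOn 𝒜 with
      | zero => rw [show AHVertex.incl B hB p 𝒜 0 = 0 from map_zero (inclHom B hB p 𝒜)]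
                exact S.zero_mem
      | homogeneous a => exact Submodule.subset_span fun D h1 h2 => h1 _ a a.2
      | add a b ha hb =>
        rw [show AHVertex.incl B hB p 𝒜 (a + b) = _ from map_add (inclHom B hB p 𝒜) a b]
        exact S.add_mem ha hb
  induction hS using Submodule.span_induction with
  | zero => exact zero
  | add x y _ _ hx hy => exact add x y hx hy
  | smul r x _ hx => exact smul r x hx
  | mem x hx => exact hx C incl heis

end Fock

end
end AHVertex

open scoped TensorProduct
namespace AHVertex
noncomputable section

/-! ## Eventually constant sums -/

section EvSum

variable {E E' : Type*} [AddCommGroup E] [AddCommGroup E']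

/-- `s` is the sum of the sequence `g`, whose partial sums are eventually constant. -/
def EvSum (g : ℕ → E) (s : E) : Prop := ∀ᶠ N in Filter.atTop, ∑ i ∈ Finset.range N, g i = s

theorem EvSum.unique {g : ℕ → E} {s t : E} (h : EvSum g s) (h' : EvSum g t) : s = t := by
  obtain ⟨N, h1, h2⟩ := (h.and h').exists
  exact h1.symm.trans h2

theorem EvSum.congr {g g' : ℕ → E} {s s' : E} (h : EvSum g s) (hg : ∀ n, g n = g' n)
    (hs : s = s') : EvSum g' s' := by
  rwa [← funext hg, ← hs]

theorem EvSum.zero : EvSum (fun _ => (0 : E)) 0 := by simp [EvSum]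

theorem EvSum.add {g g' : ℕ → E} {s s' : E} (h : EvSum g s) (h' : EvSum g' s') :
    EvSum (fun n => g n + g' n) (s + s') := by
  filter_upwards [h, h'] with N h h'
  rw [Finset.sum_add_distrib, h, h']

theorem EvSum.map {g : ℕ → E} {s : E} (h : EvSum g s) (f : E →+ E') :
    EvSum (fun n => f (g n)) (f s) := by
  filter_upwards [h] with N h
  rw [← h, map_sum]

theorem EvSum.mapₗ {R : Type*} [Semiring R] [Module R E] [Module R E'] {g : ℕ → E} {s : E}
    (h : EvSum g s) (f : E →ₗ[R] E') : EvSum (fun n => f (g n)) (f s) :=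
  h.map f.toAddMonoidHom

theorem EvSum.neg {g : ℕ → E} {s : E} (h : EvSum g s) : EvSum (fun n => -g n) (-s) :=
  h.map (negAddMonoidHom)

theorem EvSum.sub {g g' : ℕ → E} {s s' : E} (h : EvSum g s) (h' : EvSum g' s') :
    EvSum (fun n => g n - g' n) (s - s') := by
  simpa only [sub_eq_add_neg] using h.add h'.neg

theorem EvSum.smul [Module ℂ E] {g : ℕ → E} {s : E} (h : EvSum g s) (r : ℂ) :
    EvSum (fun n => r • g n) (r • s) :=
  h.mapₗ (r • (LinearMap.id : E →ₗ[ℂ] E))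

theorem EvSum.sum {J : Type*} {t : Finset J} {g : J → ℕ → E} {s : J → E}
    (h : ∀ j ∈ t, EvSum (g j) (s j)) : EvSum (fun n => ∑ j ∈ t, g j n) (∑ j ∈ t, s j) := by
  filter_upwards [(Filter.eventually_all_finset t).2 h] with N h
  rw [Finset.sum_comm]
  exact Finset.sum_congr rfl h

theorem EvSum.of_zero {g : ℕ → E} {N : ℕ} (h : ∀ n ≥ N, g n = 0) :
    EvSum g (∑ i ∈ Finset.range N, g i) := by
  filter_upwards [Filter.eventually_ge_atTop N] with M hM
  refine (Finset.sum_subset (Finset.range_mono hM) fun n _ hn => h n ?_).symm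
  simpa using hn

theorem EvSum.of_eq_zero {g : ℕ → E} (h : ∀ n, g n = 0) : EvSum g 0 := by
  rw [funext h]; exact EvSum.zero

theorem EvSum.single {g : ℕ → E} (k : ℕ) (h : ∀ n, n ≠ k → g n = 0) : EvSum g (g k) := by
  filter_upwards [Filter.eventually_gt_atTop k] with M hM
  exact Finset.sum_eq_single k (fun n _ hn => h n hn) (fun h => absurd (by simpa using hM) h)

theorem EvSum.eventually_zero {g : ℕ → E} {s : E} (h : EvSum g s) : ∃ N, ∀ n ≥ N, g n = 0 := by
  obtain ⟨N, hN⟩ := Filter.eventually_atTop.1 h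
  refine ⟨N, fun n hn => ?_⟩
  have h1 := hN (n + 1) (by omega)
  rwa [Finset.sum_range_succ, hN n hn, add_eq_left] at h1

theorem evSum_add_iff {g : ℕ → E} {s : E} (j : ℕ) :
    EvSum (fun i => g (i + j)) s ↔ EvSum g (∑ i ∈ Finset.range j, g i + s) := by
  unfold EvSum
  conv_rhs => rw [← Filter.map_add_atTop_eq_nat j, Filter.eventually_map]
  refine Filter.eventually_congr (Filter.Eventually.of_forall fun N => ?_)
  rw [add_comm N j, Finset.sum_range_add g j N, add_right_inj]
  simp only [add_comm j]

theorem evSum_shift_iff {g : ℕ → E} {s : E} (j : ℕ) (h : ∀ i < j, g i = 0) :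
    EvSum (fun i => g (i + j)) s ↔ EvSum g s := by
  rw [evSum_add_iff, Finset.sum_eq_zero fun i hi => h i (by simpa using hi), zero_add]

/-- Exchange of summations for a double family supported in a finite square. Separate finiteness of
rows and columns would not suffice, hence the joint bound N. -/
theorem EvSum.comm {a : ℕ → ℕ → E} {r s : ℕ → E} {R : E}
    (ha : ∃ N, ∀ m k, N ≤ m ∨ N ≤ k → a m k = 0) (hr : ∀ m, EvSum (a m) (r m))
    (hs : ∀ k, EvSum (fun m => a m k) (s k)) (hR : EvSum r R) : EvSum s R := by
  obtain ⟨N, hN⟩ := ha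
  have h1 (m) : r m = ∑ k ∈ Finset.range N, a m k :=
    (hr m).unique (EvSum.of_zero fun k hk => hN m k (Or.inr hk))
  have h2 (k) : s k = ∑ m ∈ Finset.range N, a m k :=
    (hs k).unique (EvSum.of_zero fun m hm => hN m k (Or.inl hm))
  have h3 : R = ∑ m ∈ Finset.range N, r m := hR.unique (EvSum.of_zero fun m hm => by
    rw [h1]; exact Finset.sum_eq_zero fun k _ => hN m k (Or.inl hm))
  rw [h3, Finset.sum_congr rfl fun m _ => h1 m, Finset.sum_comm,
    ← Finset.sum_congr rfl fun k _ => h2 k]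
  refine EvSum.of_zero fun k hk => ?_
  rw [h2]; exact Finset.sum_eq_zero fun m _ => hN m k (Or.inr hk)

end EvSum

/-! ## Sequences as functions on the real line -/

section NatExt

variable {E : Type*} [AddCommGroup E]

/-- The extension by zero of a sequence to the real line. -/
def natExt (g : ℕ → E) (x : ℝ) : E := if x = (⌊x⌋₊ : ℝ) then g ⌊x⌋₊ else 0

@[simp] theorem natExt_natCast (g : ℕ → E) (n : ℕ) : natExt g n = g n := by simp [natExt]

theorem natExt_of_ne {g : ℕ → E} {x : ℝ} (h : ∀ n : ℕ, x ≠ n) : natExt g x = 0 := if_neg (h _)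

theorem natExt_of_neg {g : ℕ → E} {x : ℝ} (h : x < 0) : natExt g x = 0 :=
  natExt_of_ne fun n hn => by
    have : (0 : ℝ) ≤ n := n.cast_nonneg
    linarith

theorem natExt_ne_zero {g : ℕ → E} {x : ℝ} (h : natExt g x ≠ 0) : ∃ n : ℕ, x = n := by
  by_contra! hx
  exact h (natExt_of_ne hx)

theorem natExt_sub {g : ℕ → E} {n k : ℕ} :
    natExt g ((n : ℝ) - k) = if k ≤ n then g (n - k) else 0 := by
  split_ifs with h
  · rw [← Nat.cast_sub h, natExt_natCast]
  · exact natExt_of_neg (by rw [sub_neg]; exact_mod_cast not_le.1 h)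

end NatExt

/-! ## Binomial coefficients -/

section Binomial

theorem choose_mul_choose (r : ℂ) (m n : ℕ) (h : n ≤ m) :
    Ring.choose r m * Ring.choose (m : ℂ) n = Ring.choose r n * Ring.choose (r - n) (m - n) := by
  have := Ring.choose_smul_choose r h
  rw [nsmul_eq_mul] at this
  rw [Ring.choose_natCast, mul_comm, this]

theorem choose_natCast_of_lt {m n : ℕ} (h : m < n) : Ring.choose (m : ℂ) n = 0 := by
  rw [Ring.choose_natCast, Nat.choose_eq_zero_of_lt h, Nat.cast_zero]

theorem choose_neg_sub_one (m n : ℕ) :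
    Ring.choose (-(m : ℂ) - 1) n = (-1) ^ n * Ring.choose ((m : ℂ) + n) n := by
  rw [show -(m : ℂ) - 1 = -((m : ℂ) + 1) by ring, Ring.choose_neg, Int.negOnePow_def]
  simp only [zpow_natCast, Units.smul_def, Units.val_pow_eq_pow_val, Units.val_neg, Units.val_one]
  rw [zsmul_eq_mul]
  push_cast
  congr 2
  ring

theorem succ_mul_choose (t : ℂ) (k : ℕ) :
    ((k : ℂ) + 1) * Ring.choose t (k + 1) = t * Ring.choose (t - 1) k := by
  have := Ring.choose_smul_choose t (n := k + 1) (k := 1) (by omega)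
  rw [Nat.choose_one_right, nsmul_eq_mul, Ring.choose_one_right] at this
  simpa using this

theorem alternating_sum_choose (t : ℂ) (k : ℕ) :
    ∑ i ∈ Finset.range (k + 1), (-1) ^ i * Ring.choose t i = (-1) ^ k * Ring.choose (t - 1) k := by
  induction k with
  | zero => simp
  | succ k ih =>
    have := Ring.choose_succ_succ (t - 1) k
    rw [sub_add_cancel] at this
    rw [Finset.sum_range_succ, ih, this]
    ring

/-- Up to sign both sides are the trinomial coefficient (n + j + i)!/(n! j! i!) with m = j + i. This
compares derivatives in z₁ and z₂ of the expansion of 1/(z₁ - z₂) with the expansion of (z₁ -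
z₂)^(-n-j-1). -/
theorem choose_neg_mul_choose (m n j : ℕ) :
    Ring.choose (-(m : ℂ) - 1) n * Ring.choose (m : ℂ) j =
      if j ≤ m then (-1) ^ n * Ring.choose ((n : ℂ) + j) n *
        ((-1) ^ (m - j) * Ring.choose (-((n : ℂ) + j) - 1) (m - j)) else 0 := by
  split_ifs with h
  · obtain ⟨i, rfl⟩ := Nat.exists_eq_add_of_le h
    have e1 := choose_neg_sub_one (n + j) i
    have e2 := choose_neg_sub_one (j + i) n
    push_cast at e1 e2 ⊢
    rw [add_tsub_cancel_left, e1, e2]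
    have h1 : (-1 : ℂ) ^ i * (-1) ^ i = 1 := by rw [← mul_pow]; simp
    rw [← mul_assoc ((-1 : ℂ) ^ i), h1, one_mul, mul_assoc, mul_assoc]
    congr 1
    have e3 : ((j + i + n).choose n) * ((j + i).choose j) =
        ((n + j).choose n) * ((n + j + i).choose i) := by
      have h3 := Nat.choose_mul (n := n + j + i) (k := n + j) (s := n) (by omega)
      rw [show n + j + i - n = j + i by omega, show n + j - n = j by omega] at h3
      rw [show j + i + n = n + j + i by ring, ← h3, mul_comm]
      congr 1
      exact Nat.choose_symm_add
    rw [← Nat.cast_add, ← Nat.cast_add, ← Nat.cast_add, ← Nat.cast_add, Ring.choose_natCast,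
      Ring.choose_natCast, Ring.choose_natCast, Ring.choose_natCast]
    exact_mod_cast e3
  · rw [choose_natCast_of_lt (not_le.1 h), mul_zero]

end Binomial

/-! ## Locally finite sums of operators and exponential recursions -/

section Recursion

variable {F : Type*} [AddCommGroup F] [Module ℂ F]

/-- Every vector is killed by almost all members of the sequence. -/
def LocFin (g : ℕ → Module.End ℂ F) : Prop := ∀ w, ∃ N, ∀ n ≥ N, g n w = 0

open Classical in
/-- The sum of a locally finite sequence of operators. -/
def lfsum (g : ℕ → Module.End ℂ F) : Module.End ℂ F :=
  if h : ∃ T : Module.End ℂ F, ∀ w, EvSum (fun n => g n w) (T w) then h.choose else 0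

/-- Under local finiteness the pointwise sums are linear by uniqueness, so the default value 0 of
`lfsum` is never taken. -/
theorem lfsum_spec {g : ℕ → Module.End ℂ F} (h : LocFin g) (w : F) :
    EvSum (fun n => g n w) (lfsum g w) := by
  have h1 : ∃ T : Module.End ℂ F, ∀ w, EvSum (fun n => g n w) (T w) := by
    choose N hN using h
    have hs (w) := EvSum.of_zero (hN w)
    exact ⟨{ toFun := fun w => ∑ i ∈ Finset.range (N w), g i w
             map_add' := fun v w => (hs (v + w)).unique
               (((hs v).add (hs w)).congr (fun n => (map_add (g n) v w).symm) rfl)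
             map_smul' := fun r v => (hs (r • v)).unique
               (((hs v).smul r).congr (fun n => (map_smul (g n) r v).symm) rfl) }, hs⟩
  rw [lfsum, dif_pos h1]
  exact h1.choose_spec w

/-- The coefficients of the exponential `exp (∑ d_m z^(m+1)/(m+1))`. -/
def recSeq (d : ℕ → Module.End ℂ F) : ℕ → Module.End ℂ F
  | 0 => 1
  | n + 1 => ((n : ℂ) + 1)⁻¹ • ∑ m : Fin (n + 1), d m * recSeq d (n - m)

theorem recSeq_zero (d : ℕ → Module.End ℂ F) : recSeq d 0 = 1 := by rw [recSeq]

theorem recSeq_succ (d : ℕ → Module.End ℂ F) (n : ℕ) :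
    ((n : ℂ) + 1) • recSeq d (n + 1) = ∑ m ∈ Finset.range (n + 1), d m * recSeq d (n - m) := by
  rw [recSeq, smul_smul, mul_inv_cancel₀ (Nat.cast_add_one_ne_zero n), one_smul,
    Finset.sum_range fun m => d m * recSeq d (n - m)]

theorem eq_of_succ_smul {E : Type*} [AddCommGroup E] [Module ℂ E] (n : ℕ) {x y : E}
    (h : ((n : ℂ) + 1) • x = ((n : ℂ) + 1) • y) : x = y :=
  smul_right_injective E (Nat.cast_add_one_ne_zero n) h

/-- Uniqueness of solutions of the recursion. -/
theorem eq_recSeq_mul {d e : ℕ → Module.End ℂ F}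
    (h : ∀ n : ℕ, ((n : ℂ) + 1) • e (n + 1) = ∑ m ∈ Finset.range (n + 1), d m * e (n - m)) (n) :
    e n = recSeq d n * e 0 := by
  induction n using Nat.strong_induction_on with
  | _ n ih =>
    rcases n with _ | n
    · rw [recSeq_zero, one_mul]
    · refine eq_of_succ_smul n ?_
      rw [h, ← smul_mul_assoc, recSeq_succ, Finset.sum_mul]
      refine Finset.sum_congr rfl fun m hm => ?_
      rw [ih (n - m) (by omega), mul_assoc]

theorem recSeq_evSum (d : ℕ → Module.End ℂ F) (x : ℝ) (w : F) :
    EvSum (fun m : ℕ => d m (natExt (recSeq d) (x - m - 1) w))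
      ((x : ℂ) • natExt (recSeq d) x w) := by
  have hz (m : ℕ) (hm : x - m - 1 < 0) : d m (natExt (recSeq d) (x - m - 1) w) = 0 := by
    rw [natExt_of_neg hm, LinearMap.zero_apply, map_zero]
  by_cases hx : ∃ n : ℕ, x = n
  · obtain ⟨n, rfl⟩ := hx
    rcases n with _ | n
    · rw [Nat.cast_zero, Complex.ofReal_zero, zero_smul]
      refine EvSum.of_eq_zero fun m => ?_
      have := hz m (by push_cast; linarith [(m.cast_nonneg : (0 : ℝ) ≤ m)])
      simpa using this
    · have h1 := EvSum.of_zero (g := fun m : ℕ =>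
        d m (natExt (recSeq d) (((n + 1 : ℕ) : ℝ) - m - 1) w)) (N := n + 1) fun m hm => by
          refine hz m ?_
          have : ((n + 1 : ℕ) : ℝ) ≤ m := by exact_mod_cast hm
          linarith
      refine h1.congr (fun _ => rfl) ?_
      rw [natExt_natCast]
      have h2 := LinearMap.congr_fun (recSeq_succ d n) w
      rw [LinearMap.smul_apply, LinearMap.sum_apply] at h2
      push_cast
      rw [h2]
      refine Finset.sum_congr rfl fun m hm => ?_
      rw [show ((n : ℝ) + 1 - m - 1) = ((n - m : ℕ) : ℝ) by
        rw [Nat.cast_sub (by simpa [Nat.lt_succ_iff] using hm)]; ring, natExt_natCast]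
      rfl
  · push Not at hx
    rw [natExt_of_ne hx, LinearMap.zero_apply, smul_zero]
    refine EvSum.of_eq_zero fun m => ?_
    rw [natExt_of_ne fun n hn => hx (n + m + 1) (by push_cast; linarith), LinearMap.zero_apply,
      map_zero]

theorem recSeq_comm_of_comm {d : ℕ → Module.End ℂ F} {D : Module.End ℂ F}
    (h : ∀ m, D * d m = d m * D) (n : ℕ) : D * recSeq d n = recSeq d n * D := by
  induction n using Nat.strong_induction_on with
  | _ n ih =>
    rcases n with _ | n
    · rw [recSeq_zero, one_mul, mul_one]
    · refine eq_of_succ_smul n ?_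
      rw [← mul_smul_comm, ← smul_mul_assoc, recSeq_succ, Finset.mul_sum, Finset.sum_mul]
      refine Finset.sum_congr rfl fun m hm => ?_
      rw [← mul_assoc, h, mul_assoc, ih _ (by omega), mul_assoc]

/-- The commutator with an operator whose commutators with the exponents are scalars. -/
theorem recSeq_comm_succ {d : ℕ → Module.End ℂ F} {D : Module.End ℂ F} {M : ℕ} {κ : ℂ}
    (h : ∀ m, D * d m = d m * D + (if m = M then ((M : ℂ) + 1) * κ else 0) • 1) (n : ℕ) :
    D * recSeq d n = recSeq d n * D + (if M + 1 ≤ n then κ • recSeq d (n - (M + 1)) else 0) := by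
  induction n using Nat.strong_induction_on with
  | _ n ih =>
    rcases n with _ | n
    · simp [recSeq_zero]
    · refine eq_of_succ_smul n ?_
      rw [smul_add, ← mul_smul_comm, ← smul_mul_assoc, recSeq_succ, Finset.mul_sum, Finset.sum_mul]
      have h1 : ∀ m ∈ Finset.range (n + 1), D * (d m * recSeq d (n - m)) =
          d m * recSeq d (n - m) * D +
          (d m * (if M + 1 ≤ n - m then κ • recSeq d (n - m - (M + 1)) else 0) +
           if m = M then (((M : ℂ) + 1) * κ) • recSeq d (n - m) else 0) := by
        intro m hm
        rw [← mul_assoc, h, add_mul, mul_assoc, ih (n - m) (by omega), mul_add, mul_assoc,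
          add_assoc]
        congr 2
        split_ifs <;> simp
      rw [Finset.sum_congr rfl h1, Finset.sum_add_distrib, add_right_inj, Finset.sum_add_distrib,
        Finset.sum_ite_eq']
      by_cases hM : M ≤ n
      · rw [if_pos (by simpa [Nat.lt_succ_iff] using hM), if_pos (by omega)]
        rcases hM.eq_or_lt with rfl | hM
        · rw [Finset.sum_eq_zero fun m _ => by rw [if_neg (by omega), mul_zero]]
          rw [zero_add, Nat.sub_self, Nat.sub_self, smul_smul]
        · obtain ⟨k, rfl⟩ : ∃ k, n = M + 1 + k := ⟨n - (M + 1), by omega⟩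
          rw [← Finset.sum_subset (Finset.range_mono (show k + 1 ≤ M + 1 + k + 1 by omega))
            fun m _ hm => by rw [if_neg (by simp at hm; omega), mul_zero]]
          -- With n = M + 1 + k, the recursion turns the remaining sum into κ(k + 1) times the term
          -- of index k + 1. Together with (M + 1)κ from m = M this is (n + 1)κ, and the factor n +
          -- 1 cancels.
          have h2 : ∑ m ∈ Finset.range (k + 1), d m * (if M + 1 ≤ M + 1 + k - m then
              κ • recSeq d (M + 1 + k - m - (M + 1)) else 0) = κ • (((k : ℂ) + 1) •
                recSeq d (k + 1)) := by
            rw [recSeq_succ, Finset.smul_sum]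
            refine Finset.sum_congr rfl fun m hm => ?_
            have : m ≤ k := by simpa [Nat.lt_succ_iff] using hm
            rw [if_pos (by omega), show M + 1 + k - m - (M + 1) = k - m by omega, mul_smul_comm]
          rw [h2, show M + 1 + k - M = k + 1 by omega, show M + 1 + k + 1 - (M + 1) = k + 1 by omega,
            smul_smul, smul_smul, ← add_smul]
          congr 1
          push_cast; ring
      · rw [if_neg (by simp; omega), if_neg (by omega), smul_zero, add_zero]
        exact Finset.sum_eq_zero fun m _ => by rw [if_neg (by omega), mul_zero]

theorem recSeq_recSeq_comm {d d' : ℕ → Module.End ℂ F} (h : ∀ m n, d m * d' n = d' n * d m)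
    (n k : ℕ) : recSeq d n * recSeq d' k = recSeq d' k * recSeq d n :=
  recSeq_comm_of_comm (fun m => (recSeq_comm_of_comm (fun m' => (h m' m).symm) n).symm) k

theorem recSeq_of_zero {d : ℕ → Module.End ℂ F} (h : ∀ m, d m = 0) (n : ℕ) :
    recSeq d (n + 1) = 0 := by
  refine eq_of_succ_smul n ?_
  rw [recSeq_succ, smul_zero]
  exact Finset.sum_eq_zero fun m _ => by rw [h, zero_mul]

end Recursion

end
end AHVertex

open scoped TensorProduct
namespace AHVertex
noncomputable section

/-! ## Exponentials of power series -/

section ExpSeries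

theorem mvPowerSeries_commute {σ R : Type*} [Semiring R] {Z W : MvPowerSeries σ R}
    (h : ∀ d e, MvPowerSeries.coeff d Z * MvPowerSeries.coeff e W =
      MvPowerSeries.coeff e W * MvPowerSeries.coeff d Z) : Commute Z W := by
  classical
  refine MvPowerSeries.ext fun d => ?_
  rw [MvPowerSeries.coeff_mul, MvPowerSeries.coeff_mul]
  refine Finset.sum_nbij' Prod.swap Prod.swap ?_ ?_ ?_ ?_ fun q _ => h _ _ <;>
    simp [add_comm]

/-- The Euler operator of the variable `i`. -/
def mvEuler {σ R : Type*} [Semiring R] (i : σ) (Z : MvPowerSeries σ R) : MvPowerSeries σ R :=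
  fun d => d i • MvPowerSeries.coeff d Z

theorem coeff_mvEuler {σ R : Type*} [Semiring R] (i : σ) (Z : MvPowerSeries σ R) (d : σ →₀ ℕ) :
    MvPowerSeries.coeff d (mvEuler i Z) = d i • MvPowerSeries.coeff d Z := rfl

theorem mvEuler_mul {σ R : Type*} [Semiring R] (i : σ) (Z W : MvPowerSeries σ R) :
    mvEuler i (Z * W) = mvEuler i Z * W + Z * mvEuler i W := by
  classical
  refine MvPowerSeries.ext fun d => ?_
  simp only [map_add, coeff_mvEuler, MvPowerSeries.coeff_mul, Finset.smul_sum,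
    ← Finset.sum_add_distrib]
  refine Finset.sum_congr rfl fun q hq => ?_
  rw [← Finset.HasAntidiagonal.mem_antidiagonal.1 hq, Finsupp.add_apply, add_smul, smul_mul_assoc, mul_smul_comm]

theorem mvEuler_pow {σ R : Type*} [Semiring R] (i : σ) {Z : MvPowerSeries σ R}
    (h : Commute Z (mvEuler i Z)) (k : ℕ) :
    mvEuler i (Z ^ (k + 1)) = (k + 1) • (mvEuler i Z * Z ^ k) := by
  induction k with
  | zero => simp
  | succ k ih =>
    rw [pow_succ', mvEuler_mul, ih, mul_smul_comm, ← mul_assoc Z, h.eq, mul_assoc, ← pow_succ']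
    rw [add_smul (k + 1) 1, one_smul, add_comm]

theorem coeff_pow_eq_zero {σ R : Type*} [Semiring R] {Z : MvPowerSeries σ R}
    (h : MvPowerSeries.coeff 0 Z = 0) (k : ℕ) (d : σ →₀ ℕ) (hd : d.degree < k) :
    MvPowerSeries.coeff d (Z ^ k) = 0 := by
  classical
  induction k generalizing d with
  | zero => omega
  | succ k ih =>
    rw [pow_succ', MvPowerSeries.coeff_mul]
    refine Finset.sum_eq_zero fun q hq => ?_
    by_cases h1 : q.1 = 0
    · rw [h1, h, zero_mul]
    · rw [ih, mul_zero]
      have h2 := congrArg Finsupp.degree (Finset.HasAntidiagonal.mem_antidiagonal.1 hq)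
      rw [map_add] at h2
      have h3 : q.1.degree ≠ 0 := fun h => h1 ((Finsupp.degree_eq_zero_iff _).1 h)
      omega

variable {F : Type*} [AddCommGroup F] [Module ℂ F]

theorem coeff_expSeries {X : MvPowerSeries (Fin 2) (Module.End ℂ F)}
    (h : MvPowerSeries.coeff 0 X = 0) (d : Fin 2 →₀ ℕ) {N : ℕ} (hN : d.degree < N) :
    MvPowerSeries.coeff d (expSeries X) =
      ∑ k ∈ Finset.range N, ((k.factorial : ℂ)⁻¹) • MvPowerSeries.coeff d (X ^ k) := by
  change ∑ k ∈ Finset.range (d.degree + 1), _ = _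
  refine Finset.sum_subset (Finset.range_mono hN) fun k _ hk => ?_
  rw [coeff_pow_eq_zero h k d (by simpa using hk), smul_zero]

/-- The differential equation of the exponential, z_i ∂_i exp X = (z_i ∂_i X) exp X, valid since the
coefficients of X commute. The hypotheses on D say that z_i ∂_i X involves the variable z_i alone.
-/
theorem euler_expSeries {X : MvPowerSeries (Fin 2) (Module.End ℂ F)}
    (h0 : MvPowerSeries.coeff 0 X = 0) (hc : ∀ d e, MvPowerSeries.coeff d X *
      MvPowerSeries.coeff e X = MvPowerSeries.coeff e X * MvPowerSeries.coeff d X)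
    (i : Fin 2) (D : ℕ → Module.End ℂ F)
    (hD : ∀ d : Fin 2 →₀ ℕ, (∀ m, d ≠ Finsupp.single i (m + 1)) → d i • MvPowerSeries.coeff d X = 0)
    (hD' : ∀ m : ℕ, ((m : ℂ) + 1) • MvPowerSeries.coeff (Finsupp.single i (m + 1)) X = D m)
    (d : Fin 2 →₀ ℕ) (n : ℕ) (hd : d i = n + 1) :
    ((n : ℂ) + 1) • MvPowerSeries.coeff d (expSeries X) = ∑ m ∈ Finset.range (n + 1),
      D m * MvPowerSeries.coeff (d - Finsupp.single i (m + 1)) (expSeries X) := by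
  have hcomm : Commute X (mvEuler i X) := mvPowerSeries_commute fun d e => by
    rw [coeff_mvEuler, mul_smul_comm, hc, smul_mul_assoc]
  -- One more term is kept than in the definition, so that after splitting off k = 0 the remaining
  -- range still computes every coefficient of exp X of degree at most that of d.
  rw [coeff_expSeries h0 d (Nat.lt_succ_of_lt (Nat.lt_succ_self d.degree)), Finset.sum_range_succ']
  have h1 : MvPowerSeries.coeff d (X ^ 0) = 0 := by
    rw [pow_zero, MvPowerSeries.coeff_one, if_neg]
    rintro rfl
    simp at hd
  have h2 (k : ℕ) : ((n : ℂ) + 1) • (((k + 1).factorial : ℂ)⁻¹ •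
      MvPowerSeries.coeff d (X ^ (k + 1))) = ∑ q ∈ Finset.HasAntidiagonal.antidiagonal d,
        MvPowerSeries.coeff q.1 (mvEuler i X) *
          ((k.factorial : ℂ)⁻¹ • MvPowerSeries.coeff q.2 (X ^ k)) := by
    have h3 := congrArg (MvPowerSeries.coeff d) (mvEuler_pow i hcomm k)
    rw [coeff_mvEuler, hd, ← Nat.cast_smul_eq_nsmul ℂ, map_nsmul, ← Nat.cast_smul_eq_nsmul ℂ,
      MvPowerSeries.coeff_mul] at h3
    rw [smul_comm, ← Nat.cast_add_one, h3, smul_smul, Nat.factorial_succ, Finset.smul_sum]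
    refine Finset.sum_congr rfl fun q _ => ?_
    rw [mul_smul_comm]
    congr 1
    have := Nat.cast_add_one_ne_zero (R := ℂ) k
    have := Nat.factorial_ne_zero k
    push_cast
    field_simp
  rw [h1, smul_zero, add_zero, Finset.smul_sum, Finset.sum_congr rfl fun k _ => h2 k,
    Finset.sum_comm]
  symm
  refine Finset.sum_of_injOn
    (fun m => (Finsupp.single i (m + 1), d - Finsupp.single i (m + 1))) ?_ ?_ ?_ ?_
  · intro m _ m' _ h
    have := DFunLike.congr_fun (Prod.ext_iff.1 h).1 i
    simpa using this
  · intro m hm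
    have : Finsupp.single i (m + 1) ≤ d := by
      rw [Finsupp.single_le_iff, hd]; simpa [Nat.lt_succ_iff] using hm
    exact Finset.HasAntidiagonal.mem_antidiagonal.2 (add_tsub_cancel_of_le this)
  · intro q hq hq'
    refine Finset.sum_eq_zero fun k _ => ?_
    rw [coeff_mvEuler, hD, zero_mul]
    rintro m hm
    have h1 := Finset.HasAntidiagonal.mem_antidiagonal.1 hq
    refine hq' ⟨m, ?_, Prod.ext hm.symm ?_⟩
    · have := DFunLike.congr_fun h1 i
      rw [Finsupp.add_apply, hm, hd, Finsupp.single_eq_same] at this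
      simp; omega
    · rw [← h1, hm]; exact add_tsub_cancel_left _ _
  · intro m hm
    have hle : Finsupp.single i (m + 1) ≤ d := by
      rw [Finsupp.single_le_iff, hd]; simpa [Nat.lt_succ_iff] using hm
    rw [← Finset.mul_sum, ← coeff_expSeries h0, coeff_mvEuler, Finsupp.single_eq_same,
      ← Nat.cast_smul_eq_nsmul ℂ, Nat.cast_add_one, hD']
    exact Nat.lt_succ_of_le (by
      have := congrArg Finsupp.degree (tsub_add_cancel_of_le hle)
      rw [map_add] at this
      dsimp only
      omega)

/-- X is a series in the first variable plus a series in the second. The Euler equation in each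
variable is the recursion defining `recSeq`, and solutions are determined by their initial term. -/
theorem coeff_expSeries_eq {X : MvPowerSeries (Fin 2) (Module.End ℂ F)}
    (dl dr : ℕ → Module.End ℂ F)
    (hl : ∀ m n, dl m * dl n = dl n * dl m) (hr : ∀ m n, dr m * dr n = dr n * dr m)
    (hlr : ∀ m n, dl m * dr n = dr n * dl m)
    (hX : ∀ d : Fin 2 →₀ ℕ, MvPowerSeries.coeff d X =
      (if 1 ≤ d 0 ∧ d 1 = 0 then ((d 0 : ℂ)⁻¹) • dl (d 0 - 1) else 0) +
      (if d 0 = 0 ∧ 1 ≤ d 1 then ((d 1 : ℂ)⁻¹) • dr (d 1 - 1) else 0)) (d : Fin 2 →₀ ℕ) :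
    MvPowerSeries.coeff d (expSeries X) = recSeq dl (d 0) * recSeq dr (d 1) := by
  have h0 : MvPowerSeries.coeff 0 X = 0 := by rw [hX]; simp
  have hc (d e) : MvPowerSeries.coeff d X * MvPowerSeries.coeff e X =
      MvPowerSeries.coeff e X * MvPowerSeries.coeff d X := by
    rw [hX d, hX e]
    change Commute _ _
    refine Commute.add_left (Commute.add_right ?_ ?_) (Commute.add_right ?_ ?_) <;>
      split_ifs <;> first
        | exact Commute.zero_left _
        | exact Commute.zero_right _
        | exact ((show Commute _ _ from hl _ _).smul_left _).smul_right _
        | exact ((show Commute _ _ from hr _ _).smul_left _).smul_right _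
        | exact ((show Commute _ _ from hlr _ _).smul_left _).smul_right _
        | exact ((show Commute _ _ from (hlr _ _).symm).smul_left _).smul_right _
  let P (i j : ℕ) : Fin 2 →₀ ℕ := Finsupp.single 0 i + Finsupp.single 1 j
  have hP (i j : ℕ) : P i j 0 = i ∧ P i j 1 = j := by simp [P]
  have hd : d = P (d 0) (d 1) := by ext i; fin_cases i <;> simp [P]
  have e0 (j n : ℕ) : ((n : ℂ) + 1) • MvPowerSeries.coeff (P (n + 1) j) (expSeries X) =
      ∑ m ∈ Finset.range (n + 1), dl m * MvPowerSeries.coeff (P (n - m) j) (expSeries X) := by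
    rw [euler_expSeries h0 hc 0 dl ?_ ?_ (P (n + 1) j) n (hP _ _).1]
    · refine Finset.sum_congr rfl fun m hm => ?_
      congr 3
      ext i; fin_cases i <;> simp [P]
    · intro d hd'
      rw [hX]
      by_cases h : 1 ≤ d 0 ∧ d 1 = 0
      · refine absurd ?_ (hd' (d 0 - 1))
        ext i; fin_cases i
        · simp; omega
        · simp [h.2]
      · rw [if_neg h, zero_add]
        split_ifs with h'
        · simp [h'.1]
        · simp
    · intro m
      rw [hX]
      have := Nat.cast_add_one_ne_zero (R := ℂ) m
      simp [smul_smul, mul_inv_cancel₀ this]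
  have e1 (j n : ℕ) : ((n : ℂ) + 1) • MvPowerSeries.coeff (P j (n + 1)) (expSeries X) =
      ∑ m ∈ Finset.range (n + 1), dr m * MvPowerSeries.coeff (P j (n - m)) (expSeries X) := by
    rw [euler_expSeries h0 hc 1 dr ?_ ?_ (P j (n + 1)) n (hP _ _).2]
    · refine Finset.sum_congr rfl fun m hm => ?_
      congr 3
      ext i; fin_cases i <;> simp [P]
    · intro d hd'
      rw [hX]
      by_cases h : d 0 = 0 ∧ 1 ≤ d 1
      · refine absurd ?_ (hd' (d 1 - 1))
        ext i; fin_cases i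
        · simp [h.1]
        · simp; omega
      · rw [if_neg h, add_zero]
        split_ifs with h'
        · simp [h'.2]
        · simp
    · intro m
      rw [hX]
      have := Nat.cast_add_one_ne_zero (R := ℂ) m
      simp [smul_smul, mul_inv_cancel₀ this]
  have h00 : MvPowerSeries.coeff (P 0 0) (expSeries X) = 1 := by
    rw [coeff_expSeries h0 (P 0 0) (N := 1) (by simp [P])]
    simp [P]
  rw [hd, eq_recSeq_mul (e := fun n => MvPowerSeries.coeff (P n (d 1)) (expSeries X)) (e0 (d 1)),
    eq_recSeq_mul (e := fun n => MvPowerSeries.coeff (P 0 n) (expSeries X)) (e1 0), h00, mul_one,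
    (hP _ _).1, (hP _ _).2]

end ExpSeries

end
end AHVertex

open scoped TensorProduct
namespace AHVertex
noncomputable section

/-! ## The vertex operator factors -/

section Factors

variable {H : Type*} [AddCommGroup H] [Module ℝ H] {A : Type*} [Ring A] [Algebra ℂ A]
variable (B : LinearMap.BilinForm ℝ H) (hB : B.IsSymm) (p : Module.End ℝ H)
variable (𝒜 : H → Submodule ℂ A)

/-- The coefficients of `exp (∑ h(-n) z^n / n)`. -/
def eS (h : H) : ℕ → Module.End ℂ (Induced B hB p 𝒜) :=
  recSeq fun m => heis B hB p 𝒜 (-(m : ℤ) - 1) h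

/-- The coefficients of `exp (-∑ h(n) z^(-n) / n)`, a series in `z⁻¹`. -/
def fS (h : H) : ℕ → Module.End ℂ (Induced B hB p 𝒜) :=
  recSeq fun m => -heis B hB p 𝒜 (m + 1) h

theorem heis_zero_right (n : ℤ) : heis B hB p 𝒜 n 0 = 0 := map_zero (heisHom B hB p 𝒜 n)

theorem heis_mul_heis (n m : ℤ) (h k : H) :
    heis B hB p 𝒜 n h * heis B hB p 𝒜 m k = heis B hB p 𝒜 m k * heis B hB p 𝒜 n h +
      (if n + m = 0 then (n : ℂ) * twistedForm B p h k else 0) • 1 :=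
  LinearMap.ext fun v => heis_comm_apply B hB p 𝒜 n m h k v

theorem heis_mul_comm {n m : ℤ} {h k : H} (hnm : n + m = 0 → (n : ℂ) * twistedForm B p h k = 0) :
    heis B hB p 𝒜 n h * heis B hB p 𝒜 m k = heis B hB p 𝒜 m k * heis B hB p 𝒜 n h := by
  rw [heis_mul_heis]
  split_ifs with h0
  · rw [hnm h0, zero_smul, add_zero]
  · rw [zero_smul, add_zero]

theorem heis_eS_comm {n : ℤ} {h k : H} (hn : n ≤ 0 ∨ twistedForm B p h k = 0) (j : ℕ) :
    heis B hB p 𝒜 n h * eS B hB p 𝒜 k j = eS B hB p 𝒜 k j * heis B hB p 𝒜 n h := by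
  refine recSeq_comm_of_comm (fun m => heis_mul_comm B hB p 𝒜 fun h0 => ?_) j
  rcases hn with hn | hn
  · omega
  · rw [hn]; simp

theorem heis_fS_comm {n : ℤ} {h k : H} (hn : 0 ≤ n ∨ twistedForm B p h k = 0) (j : ℕ) :
    heis B hB p 𝒜 n h * fS B hB p 𝒜 k j = fS B hB p 𝒜 k j * heis B hB p 𝒜 n h := by
  refine recSeq_comm_of_comm (fun m => ?_) j
  rw [mul_neg, neg_mul, heis_mul_comm B hB p 𝒜 fun h0 => ?_]
  rcases hn with hn | hn
  · omega
  · rw [hn]; simp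

/-- The coefficient form of [h(M+1), exp(∑ k(-n) z^n/n)] = (h, k)_p z^(M+1) exp(∑ k(-n) z^n/n): the
commutators with the exponents are scalars. -/
theorem heis_eS_succ (M : ℕ) (h k : H) (j : ℕ) :
    heis B hB p 𝒜 (M + 1) h * eS B hB p 𝒜 k j = eS B hB p 𝒜 k j * heis B hB p 𝒜 (M + 1) h +
      if M + 1 ≤ j then (twistedForm B p h k : ℂ) • eS B hB p 𝒜 k (j - (M + 1)) else 0 := by
  refine recSeq_comm_succ (fun m => ?_) j
  rw [heis_mul_heis]
  by_cases h0 : m = M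
  · subst h0; rw [if_pos (by omega), if_pos rfl]; push_cast; rfl
  · rw [if_neg (by omega), if_neg h0]

theorem heis_fS_succ (M : ℕ) (h k : H) (j : ℕ) :
    heis B hB p 𝒜 (-(M : ℤ) - 1) h * fS B hB p 𝒜 k j =
      fS B hB p 𝒜 k j * heis B hB p 𝒜 (-(M : ℤ) - 1) h +
      if M + 1 ≤ j then (twistedForm B p h k : ℂ) • fS B hB p 𝒜 k (j - (M + 1)) else 0 := by
  refine recSeq_comm_succ (fun m => ?_) j
  rw [mul_neg, neg_mul, heis_mul_heis, neg_add, ← neg_smul]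
  by_cases h0 : m = M
  · subst h0; rw [if_pos (by omega), if_pos rfl]; push_cast; congr 2; ring
  · rw [if_neg (by omega), if_neg h0, neg_zero]

theorem eS_eS_comm (h k : H) (i j : ℕ) :
    eS B hB p 𝒜 h i * eS B hB p 𝒜 k j = eS B hB p 𝒜 k j * eS B hB p 𝒜 h i :=
  recSeq_recSeq_comm (fun _ _ => heis_mul_comm B hB p 𝒜 fun h0 => by omega) i j

theorem fS_fS_comm (h k : H) (i j : ℕ) :
    fS B hB p 𝒜 h i * fS B hB p 𝒜 k j = fS B hB p 𝒜 k j * fS B hB p 𝒜 h i :=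
  recSeq_recSeq_comm (fun _ _ => by
    rw [neg_mul_neg, neg_mul_neg]; exact heis_mul_comm B hB p 𝒜 fun h0 => by omega) i j

theorem eS_fS_comm {h k : H} (hk : twistedForm B p h k = 0) (i j : ℕ) :
    eS B hB p 𝒜 h i * fS B hB p 𝒜 k j = fS B hB p 𝒜 k j * eS B hB p 𝒜 h i :=
  recSeq_recSeq_comm (fun _ _ => by
    rw [mul_neg, neg_mul, heis_mul_comm B hB p 𝒜 fun h0 => by rw [hk]; simp]) i j

theorem heis_eS_apply {n : ℤ} (hn : 0 < n) (h k : H) (x : ℝ) (w : Induced B hB p 𝒜) :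
    heis B hB p 𝒜 n h (natExt (eS B hB p 𝒜 k) x w) =
      natExt (eS B hB p 𝒜 k) x (heis B hB p 𝒜 n h w) +
        (twistedForm B p h k : ℂ) • natExt (eS B hB p 𝒜 k) (x - n) w := by
  obtain ⟨M, rfl⟩ : ∃ M : ℕ, n = M + 1 := ⟨(n - 1).toNat, by omega⟩
  by_cases hx : ∃ j : ℕ, x = j
  · obtain ⟨j, rfl⟩ := hx
    have := LinearMap.congr_fun (heis_eS_succ B hB p 𝒜 M h k j) w
    rw [show (j : ℝ) - ((M + 1 : ℤ) : ℝ) = (j : ℝ) - (M + 1 : ℕ) by push_cast; ring, natExt_sub,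
      natExt_natCast]
    refine Eq.trans this ?_
    rw [LinearMap.add_apply]
    split_ifs <;> simp
  · push Not at hx
    rw [natExt_of_ne hx, natExt_of_ne fun i hi => hx (i + M + 1) (by push_cast at hi ⊢; linarith)]
    simp

theorem heis_eS_comm_apply {n : ℤ} {h k : H} (hn : n ≤ 0 ∨ twistedForm B p h k = 0) (x : ℝ)
    (w : Induced B hB p 𝒜) :
    heis B hB p 𝒜 n h (natExt (eS B hB p 𝒜 k) x w) =
      natExt (eS B hB p 𝒜 k) x (heis B hB p 𝒜 n h w) := by
  unfold natExt
  split_ifs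
  · exact LinearMap.congr_fun (heis_eS_comm B hB p 𝒜 hn _) w
  · simp

variable [DecidableEq H] [GradedAlgebra 𝒜]

/-- Annihilation operators are locally nilpotent. -/
theorem heis_locFin (h : H) : LocFin fun n : ℕ => heis B hB p 𝒜 n h := by
  intro w
  induction w using create_induction with
  | zero => exact ⟨0, fun n _ => map_zero _⟩
  | add v w hv hw =>
    obtain ⟨N, hN⟩ := hv
    obtain ⟨M, hM⟩ := hw
    exact ⟨max N M, fun n hn => by
      rw [map_add, hN n (le_of_max_le_left hn), hM n (le_of_max_le_right hn), add_zero]⟩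
  | smul r v hv =>
    obtain ⟨N, hN⟩ := hv
    exact ⟨N, fun n hn => by rw [map_smul, hN n hn, smul_zero]⟩
  | incl α a ha => exact ⟨1, fun n hn => heis_incl_pos B hB p 𝒜 (by exact_mod_cast hn) h a⟩
  | heis m k v hv =>
    obtain ⟨N, hN⟩ := hv
    refine ⟨max N (m + 2), fun n hn => ?_⟩
    rw [heis_comm_apply, hN n (le_of_max_le_left hn), map_zero,
      if_neg (by have := le_of_max_le_right hn; omega), zero_smul, add_zero]

theorem fS_incl (h : H) (a : A) (n : ℕ) : fS B hB p 𝒜 h (n + 1) (incl B hB p 𝒜 a) = 0 := by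
  induction n using Nat.strong_induction_on with
  | _ n ih =>
    refine eq_of_succ_smul n ?_
    have h1 := LinearMap.congr_fun (recSeq_succ (fun m : ℕ => -heis B hB p 𝒜 (m + 1) h) n)
      (incl B hB p 𝒜 a)
    rw [smul_zero]
    refine Eq.trans h1 ?_
    rw [LinearMap.sum_apply]
    refine Finset.sum_eq_zero fun m hm => ?_
    have hm : m ≤ n := by simpa [Nat.lt_succ_iff] using hm
    rw [Module.End.mul_apply]
    rcases hm.eq_or_lt with rfl | hm
    · rw [Nat.sub_self, recSeq_zero, Module.End.one_apply, LinearMap.neg_apply,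
        heis_incl_pos B hB p 𝒜 (by omega), neg_zero]
    · obtain ⟨j, hj⟩ : ∃ j, n - m = j + 1 := ⟨n - m - 1, by omega⟩
      have := ih j (by omega)
      rw [fS] at this
      rw [hj, this, map_zero]

/-- Moving the annihilation exponential past a creation operator of index m lowers its order by 0 or
m + 1, so a bound N becomes N + m + 1. -/
theorem fS_locFin (h : H) : LocFin (fS B hB p 𝒜 h) := by
  intro w
  induction w using create_induction with
  | zero => exact ⟨0, fun n _ => map_zero _⟩
  | add v w hv hw =>
    obtain ⟨N, hN⟩ := hv
    obtain ⟨M, hM⟩ := hw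
    exact ⟨max N M, fun n hn => by
      rw [map_add, hN n (le_of_max_le_left hn), hM n (le_of_max_le_right hn), add_zero]⟩
  | smul r v hv =>
    obtain ⟨N, hN⟩ := hv
    exact ⟨N, fun n hn => by rw [map_smul, hN n hn, smul_zero]⟩
  | incl α a ha =>
    refine ⟨1, fun n hn => ?_⟩
    obtain ⟨n, rfl⟩ := Nat.exists_eq_add_of_le' hn
    exact fS_incl B hB p 𝒜 h a n
  | heis m k v hv =>
    obtain ⟨N, hN⟩ := hv
    refine ⟨N + m + 1, fun n hn => ?_⟩
    have h1 := LinearMap.congr_fun (heis_fS_succ B hB p 𝒜 m k h n) v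
    rw [if_pos (by omega), LinearMap.add_apply, Module.End.mul_apply, Module.End.mul_apply,
      hN n (by omega), map_zero, LinearMap.smul_apply, hN _ (by omega), smul_zero, add_zero] at h1
    exact h1.symm

/-- The coefficient of `z^x` in `exp (∑ h(-n) z^n / n) exp (-∑ h(n) z^(-n) / n)`. -/
def vl (h : H) (x : ℝ) : Module.End ℂ (Induced B hB p 𝒜) :=
  lfsum fun j : ℕ => natExt (eS B hB p 𝒜 h) (x + j) * fS B hB p 𝒜 h j

theorem vl_evSum (h : H) (x : ℝ) (w : Induced B hB p 𝒜) :
    EvSum (fun j : ℕ => natExt (eS B hB p 𝒜 h) (x + j) (fS B hB p 𝒜 h j w))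
      (vl B hB p 𝒜 h x w) :=
  lfsum_spec (fun w => (fS_locFin B hB p 𝒜 h w).imp fun N hN n hn => by
    rw [Module.End.mul_apply, hN n hn, map_zero]) w

theorem heis_zero_vl (h k : H) (x : ℝ) (w : Induced B hB p 𝒜) :
    heis B hB p 𝒜 0 h (vl B hB p 𝒜 k x w) = vl B hB p 𝒜 k x (heis B hB p 𝒜 0 h w) := by
  refine (((vl_evSum B hB p 𝒜 k x w).mapₗ (heis B hB p 𝒜 0 h)).congr (fun j => ?_) rfl).unique
    (vl_evSum B hB p 𝒜 k x (heis B hB p 𝒜 0 h w))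
  rw [heis_eS_comm_apply B hB p 𝒜 (Or.inl le_rfl)]
  congr 1
  exact LinearMap.congr_fun (heis_fS_comm B hB p 𝒜 (Or.inl le_rfl) j) w

theorem heis_vl_comm {h k : H} (hk : twistedForm B p h k = 0) (n : ℤ) (x : ℝ)
    (w : Induced B hB p 𝒜) :
    heis B hB p 𝒜 n h (vl B hB p 𝒜 k x w) = vl B hB p 𝒜 k x (heis B hB p 𝒜 n h w) := by
  refine (((vl_evSum B hB p 𝒜 k x w).mapₗ (heis B hB p 𝒜 n h)).congr (fun j => ?_) rfl).unique
    (vl_evSum B hB p 𝒜 k x (heis B hB p 𝒜 n h w))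
  rw [heis_eS_comm_apply B hB p 𝒜 (Or.inr hk)]
  congr 1
  exact LinearMap.congr_fun (heis_fS_comm B hB p 𝒜 (Or.inr hk) j) w

/-- A negative mode commutes with the creation exponential and picks up its scalar from the
annihilation exponential; a positive mode does the reverse. For n = 0 there is no such term: in the
full vertex operator it comes from the shift of charge by `lmap`. -/
theorem heis_vl {n : ℤ} (hn : n ≠ 0) (h k : H) (x : ℝ) (w : Induced B hB p 𝒜) :
    heis B hB p 𝒜 n h (vl B hB p 𝒜 k x w) = vl B hB p 𝒜 k x (heis B hB p 𝒜 n h w) +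
      (twistedForm B p h k : ℂ) • vl B hB p 𝒜 k (x - n) w := by
  have h1 := (vl_evSum B hB p 𝒜 k x w).mapₗ (heis B hB p 𝒜 n h)
  have h2 := vl_evSum B hB p 𝒜 k x (heis B hB p 𝒜 n h w)
  have h3 := (vl_evSum B hB p 𝒜 k (x - n) w).smul (twistedForm B p h k : ℂ)
  rcases hn.lt_or_gt with hn | hn
  · obtain ⟨M, rfl⟩ : ∃ M : ℕ, n = -(M : ℤ) - 1 := ⟨(-n - 1).toNat, by omega⟩
    have h4 : EvSum (fun j : ℕ => natExt (eS B hB p 𝒜 k) (x + j) (if M + 1 ≤ j then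
        (twistedForm B p h k : ℂ) • fS B hB p 𝒜 k (j - (M + 1)) w else 0))
        ((twistedForm B p h k : ℂ) • vl B hB p 𝒜 k (x - (-(M : ℤ) - 1 : ℤ)) w) := by
      rw [← evSum_shift_iff (M + 1)]
      · refine h3.congr (fun j => ?_) rfl
        rw [if_pos (by omega), Nat.add_sub_cancel, map_smul]
        congr 3
        push_cast; ring
      · intro i hi
        rw [if_neg (by omega), map_zero]
    refine h1.unique ((h2.add h4).congr (fun j => ?_) rfl)
    rw [heis_eS_comm_apply B hB p 𝒜 (Or.inl (by omega)), ← map_add]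
    congr 1
    have h5 := LinearMap.congr_fun (heis_fS_succ B hB p 𝒜 M h k j) w
    refine Eq.symm (Eq.trans h5 ?_)
    rw [LinearMap.add_apply]
    split_ifs <;> simp
  · refine h1.unique ((h2.add h3).congr (fun j => ?_) rfl)
    rw [heis_eS_apply B hB p 𝒜 hn, show x - n + j = x + j - n by ring]
    congr 2
    exact (LinearMap.congr_fun (heis_fS_comm B hB p 𝒜 (Or.inl hn.le) j) w).symm

theorem vl_vl_comm {h k : H} (hk : twistedForm B p h k = 0) (hk' : twistedForm B p k h = 0)
    (x y : ℝ) (w : Induced B hB p 𝒜) :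
    vl B hB p 𝒜 h x (vl B hB p 𝒜 k y w) = vl B hB p 𝒜 k y (vl B hB p 𝒜 h x w) := by
  have e1 (j : ℕ) (v) : fS B hB p 𝒜 h j (vl B hB p 𝒜 k y v) =
      vl B hB p 𝒜 k y (fS B hB p 𝒜 h j v) := by
    refine (((vl_evSum B hB p 𝒜 k y v).mapₗ (fS B hB p 𝒜 h j)).congr (fun i => ?_) rfl).unique
      (vl_evSum B hB p 𝒜 k y (fS B hB p 𝒜 h j v))
    rw [show fS B hB p 𝒜 k i (fS B hB p 𝒜 h j v) = _ from
      LinearMap.congr_fun (fS_fS_comm B hB p 𝒜 k h i j) v]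
    unfold natExt
    split_ifs
    · exact (LinearMap.congr_fun (eS_fS_comm B hB p 𝒜 hk' _ j) _).symm
    · simp
  have e2 (x : ℝ) (v) : natExt (eS B hB p 𝒜 h) x (vl B hB p 𝒜 k y v) =
      vl B hB p 𝒜 k y (natExt (eS B hB p 𝒜 h) x v) := by
    refine (((vl_evSum B hB p 𝒜 k y v).mapₗ (natExt (eS B hB p 𝒜 h) x)).congr (fun i => ?_)
      rfl).unique (vl_evSum B hB p 𝒜 k y _)
    unfold natExt
    split_ifs
    · rw [← Module.End.mul_apply, eS_eS_comm, Module.End.mul_apply]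
      congr 1
      exact LinearMap.congr_fun (eS_fS_comm B hB p 𝒜 hk _ i) _
    · simp
    · simp
    · simp
  refine ((vl_evSum B hB p 𝒜 h x _).congr (fun j => ?_) rfl).unique
    ((vl_evSum B hB p 𝒜 h x w).mapₗ (vl B hB p 𝒜 k y))
  rw [e1, e2]

end Factors

end
end AHVertex

open scoped TensorProduct
namespace AHVertex
noncomputable section

/-! ## Products of the series in the definition of the vertex operators -/

section OpMul

variable {H : Type*} [AddCommGroup H] [Module ℝ H] {A : Type*} [Ring A] [Algebra ℂ A]
variable (B : LinearMap.BilinForm ℝ H) (hB : B.IsSymm) (p : Module.End ℝ H)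
variable (𝒜 : H → Submodule ℂ A)

theorem twistedForm_left_right {h k : H} (hh : h ∈ LinearMap.ker (1 - p))
    (hk : k ∈ LinearMap.ker p) : twistedForm B p h k = 0 := by
  rw [LinearMap.mem_ker] at hh hk
  simp [twistedForm, -LinearMap.sub_apply, hh, hk]

theorem twistedForm_right_left {h k : H} (hh : h ∈ LinearMap.ker (1 - p))
    (hk : k ∈ LinearMap.ker p) : twistedForm B p k h = 0 := by
  rw [LinearMap.mem_ker] at hh hk
  simp [twistedForm, -LinearMap.sub_apply, hh, hk]

variable {p} in
theorem proj_mem_left (hp : p ∈ projections B) (h : H) : p h ∈ LinearMap.ker (1 - p) := by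
  have := LinearMap.congr_fun hp.1 h
  rw [Module.End.mul_apply] at this
  rw [LinearMap.mem_ker, LinearMap.sub_apply, Module.End.one_apply, this, sub_self]

variable {p} in
theorem proj_mem_right (hp : p ∈ projections B) (h : H) : (1 - p) h ∈ LinearMap.ker p := by
  have := LinearMap.congr_fun hp.1 h
  rw [Module.End.mul_apply] at this
  rw [LinearMap.mem_ker, LinearMap.sub_apply, Module.End.one_apply, map_sub, this, sub_self]

theorem left_proj {h : H} (hh : h ∈ LinearMap.ker (1 - p)) : p h = h := by
  rw [LinearMap.mem_ker, LinearMap.sub_apply, Module.End.one_apply, sub_eq_zero] at hh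
  exact hh.symm

theorem coeff_exp_minus (h : H) (d : Fin 2 →₀ ℕ) :
    MvPowerSeries.coeff d (expSeries (expArg B hB p 𝒜 (-1) h)) =
      eS B hB p 𝒜 (p h) (d 0) * eS B hB p 𝒜 ((1 - p) h) (d 1) := by
  refine coeff_expSeries_eq _ _ (fun m n => ?_) (fun m n => ?_) (fun m n => ?_) (fun d => ?_) d
  · exact heis_mul_comm B hB p 𝒜 fun h0 => by omega
  · exact heis_mul_comm B hB p 𝒜 fun h0 => by omega
  · exact heis_mul_comm B hB p 𝒜 fun h0 => by omega
  · change -(_ + _) = _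
    rw [neg_add]
    congr 1
    · by_cases h0 : 1 ≤ d 0 ∧ d 1 = 0
      · rw [if_pos h0, if_pos h0, ← neg_smul, show -1 * (d 0 : ℤ) = -((d 0 - 1 : ℕ) : ℤ) - 1 by omega]
        congr 1
        rw [← inv_neg, Nat.cast_sub h0.1]; push_cast; congr 1; ring
      · rw [if_neg h0, if_neg h0, neg_zero]
    · by_cases h0 : d 0 = 0 ∧ 1 ≤ d 1
      · rw [if_pos h0, if_pos h0, ← neg_smul, show -1 * (d 1 : ℤ) = -((d 1 - 1 : ℕ) : ℤ) - 1 by omega]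
        congr 1
        rw [← inv_neg, Nat.cast_sub h0.2]; push_cast; congr 1; ring
      · rw [if_neg h0, if_neg h0, neg_zero]

theorem coeff_exp_plus (h : H) (d : Fin 2 →₀ ℕ) :
    MvPowerSeries.coeff d (expSeries (expArg B hB p 𝒜 1 h)) =
      fS B hB p 𝒜 (p h) (d 0) * fS B hB p 𝒜 ((1 - p) h) (d 1) := by
  refine coeff_expSeries_eq _ _ (fun m n => ?_) (fun m n => ?_) (fun m n => ?_) (fun d => ?_) d
  · rw [neg_mul_neg, neg_mul_neg]; exact heis_mul_comm B hB p 𝒜 fun h0 => by omega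
  · rw [neg_mul_neg, neg_mul_neg]; exact heis_mul_comm B hB p 𝒜 fun h0 => by omega
  · rw [neg_mul_neg, neg_mul_neg]; exact heis_mul_comm B hB p 𝒜 fun h0 => by omega
  · change -(_ + _) = _
    rw [neg_add]
    congr 1
    · by_cases h0 : 1 ≤ d 0 ∧ d 1 = 0
      · rw [if_pos h0, if_pos h0, smul_neg, show 1 * (d 0 : ℤ) = ((d 0 - 1 : ℕ) : ℤ) + 1 by omega]
        congr 3
        rw [Nat.cast_sub h0.1]; push_cast; ring
      · rw [if_neg h0, if_neg h0, neg_zero]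
    · by_cases h0 : d 0 = 0 ∧ 1 ≤ d 1
      · rw [if_pos h0, if_pos h0, smul_neg, show 1 * (d 1 : ℤ) = ((d 1 - 1 : ℕ) : ℤ) + 1 by omega]
        congr 3
        rw [Nat.cast_sub h0.2]; push_cast; ring
      · rw [if_neg h0, if_neg h0, neg_zero]

open Classical in
theorem finsum_index {E : Type*} [AddCommGroup E] (g : (Fin 2 →₀ ℕ) → E) (x y : ℝ)
    (f : ℕ → ℕ → E) (hf : ∀ d, g d = f (d 0) (d 1)) :
    (∑ᶠ d : Fin 2 →₀ ℕ, if x = (d 0 : ℝ) ∧ y = (d 1 : ℝ) then g d else 0) =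
      natExt (fun i => natExt (fun j => f i j) y) x := by
  by_cases hx : ∃ i : ℕ, x = i
  · by_cases hy : ∃ j : ℕ, y = j
    · obtain ⟨i, rfl⟩ := hx
      obtain ⟨j, rfl⟩ := hy
      rw [finsum_eq_single _ (Finsupp.single 0 i + Finsupp.single 1 j)]
      · simp [hf]
      · intro d hd
        rw [if_neg]
        rintro ⟨h1, h2⟩
        refine hd ?_
        ext q; fin_cases q
        · simpa using (Nat.cast_injective h1).symm
        · simpa using (Nat.cast_injective h2).symm
    · push Not at hy
      rw [finsum_eq_zero_of_forall_eq_zero fun d => if_neg fun h => hy _ h.2]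
      simp only [natExt, if_neg (hy _), ite_self]
  · push Not at hx
    rw [finsum_eq_zero_of_forall_eq_zero fun d => if_neg fun h => hx _ h.1, natExt_of_ne hx]

theorem EMinus_eq (h : H) (x y : ℝ) : EMinus B hB p 𝒜 h x y =
    natExt (eS B hB p 𝒜 (p h)) x * natExt (eS B hB p 𝒜 ((1 - p) h)) y := by
  rw [EMinus, finsum_index _ x y (fun i j => eS B hB p 𝒜 (p h) i * eS B hB p 𝒜 ((1 - p) h) j)
    (coeff_exp_minus B hB p 𝒜 h)]
  unfold natExt
  split_ifs <;> simp

theorem EPlus_eq (h : H) (x y : ℝ) : EPlus B hB p 𝒜 h x y =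
    natExt (fS B hB p 𝒜 (p h)) (-x) * natExt (fS B hB p 𝒜 ((1 - p) h)) (-y) := by
  have := finsum_index _ (-x) (-y)
    (fun i j => fS B hB p 𝒜 (p h) i * fS B hB p 𝒜 ((1 - p) h) j) (coeff_exp_plus B hB p 𝒜 h)
  simp only [neg_eq_iff_eq_neg] at this
  rw [EPlus, this]
  unfold natExt
  split_ifs <;> simp

variable [DecidableEq H] [GradedAlgebra 𝒜]

/-- Local finiteness of the annihilation exponentials reduces both sides to the same finite double
sum; left and right factors can be separated because H_l and H_r are orthogonal for (-,-)_p. -/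
theorem opMul_exp {p : Module.End ℝ H} (hp : p ∈ projections B) (h : H) (x y : ℝ)
    (w : Induced B hB p 𝒜) : opMul (EMinus B hB p 𝒜 h) (EPlus B hB p 𝒜 h) x y w =
      vl B hB p 𝒜 (p h) x (vl B hB p 𝒜 ((1 - p) h) y w) := by
  have hc := twistedForm_left_right B p (proj_mem_left B hp h) (proj_mem_right B hp h)
  have hc' := twistedForm_right_left B p (proj_mem_left B hp h) (proj_mem_right B hp h)
  obtain ⟨N, hN⟩ := fS_locFin B hB p 𝒜 (p h) w
  obtain ⟨M, hM⟩ := fS_locFin B hB p 𝒜 ((1 - p) h) w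
  set eL := eS B hB p 𝒜 (p h)
  set eR := eS B hB p 𝒜 ((1 - p) h)
  set fL := fS B hB p 𝒜 (p h)
  set fR := fS B hB p 𝒜 ((1 - p) h)
  have ff (i j : ℕ) (v) : fL i (fR j v) = fR j (fL i v) :=
    LinearMap.congr_fun (fS_fS_comm B hB p 𝒜 _ _ i j) v
  have fe (i : ℕ) (y : ℝ) (v) : fL i (natExt eR y v) = natExt eR y (fL i v) := by
    unfold natExt
    split_ifs
    · exact (LinearMap.congr_fun (eS_fS_comm B hB p 𝒜 hc' _ i) v).symm
    · simp
  have h1 : vl B hB p 𝒜 ((1 - p) h) y w = ∑ j ∈ Finset.range M, natExt eR (y + j) (fR j w) :=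
    (vl_evSum B hB p 𝒜 _ y w).unique (EvSum.of_zero fun n hn => by
      change natExt eR (y + n) (fR n w) = 0
      rw [hM n hn, map_zero])
  have h2 : vl B hB p 𝒜 (p h) x (vl B hB p 𝒜 ((1 - p) h) y w) =
      ∑ i ∈ Finset.range N, ∑ j ∈ Finset.range M,
        natExt eL (x + i) (natExt eR (y + j) (fL i (fR j w))) := by
    have h3 := (vl_evSum B hB p 𝒜 (p h) x (vl B hB p 𝒜 ((1 - p) h) y w))
    rw [h1] at h3 ⊢
    refine (h3.congr (fun i => ?_) rfl).unique (EvSum.of_zero (g := fun i : ℕ =>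
      ∑ j ∈ Finset.range M, natExt eL (x + i) (natExt eR (y + j) (fL i (fR j w)))) fun n hn => ?_)
    · change natExt eL (x + i) (fL i _) = _
      rw [map_sum, map_sum]
      exact Finset.sum_congr rfl fun j _ => by rw [fe]
    · exact Finset.sum_eq_zero fun j _ => by rw [ff, hN n hn, map_zero, map_zero, map_zero]
  rw [h2, ← Finset.sum_product', opMul]
  classical
  have hinj : Function.Injective fun q : ℕ × ℕ => (x + q.1, y + q.2) := by
    intro a b hab
    have h3 := (Prod.ext_iff.1 hab)
    exact Prod.ext (by simpa using h3.1) (by simpa using h3.2)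
  -- A pair q contributes only if x - q.1 = -i and y - q.2 = -j for natural numbers i < N and j < M,
  -- that is, if q = (x + i, y + j).
  rw [finsum_eq_sum_of_support_subset (s := (Finset.range N ×ˢ Finset.range M).image
    fun q : ℕ × ℕ => (x + q.1, y + q.2)), Finset.sum_image fun a _ b _ hab => hinj hab]
  · refine Finset.sum_congr rfl fun q _ => ?_
    rw [EMinus_eq, EPlus_eq]
    simp [eL, eR, fL, fR]
  · intro q hq
    rw [Function.mem_support, EMinus_eq, EPlus_eq, Module.End.mul_apply, Module.End.mul_apply] at hq
    have h3 : natExt fL (-(x - q.1)) ≠ 0 := fun h0 => hq (by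
      change natExt eL _ (natExt eR _ (natExt fL _ _)) = 0
      rw [h0]; simp)
    have h4 : natExt fR (-(y - q.2)) ≠ 0 := fun h0 => hq (by
      change natExt eL _ (natExt eR _ (natExt fL _ (natExt fR _ _))) = 0
      rw [h0]; simp)
    obtain ⟨i, hi⟩ := natExt_ne_zero h3
    obtain ⟨j, hj⟩ := natExt_ne_zero h4
    have h5 : fL i (fR j w) ≠ 0 := fun h0 => hq (by
      change natExt eL _ (natExt eR _ (natExt fL _ (natExt fR _ _))) = 0
      rw [hi, hj, natExt_natCast, natExt_natCast, h0, map_zero, map_zero])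
    simp only [Finset.coe_image, Finset.coe_product, Set.mem_image]
    refine ⟨(i, j), ⟨?_, ?_⟩, Prod.ext (by simp; linarith) (by simp; linarith)⟩
    · by_contra hi'
      exact h5 (by rw [ff, hN i (by simpa using hi'), map_zero])
    · by_contra hj'
      exact h5 (by rw [hM j (by simpa using hj'), map_zero])

end OpMul

end
end AHVertex

open scoped TensorProduct
namespace AHVertex
noncomputable section

/-! ## Fields and normally ordered products -/

section Fields

variable {F : Type*} [AddCommGroup F] [Module ℂ F]

/-- The truncation condition for operator valued series. -/
def IsField (φ : OpSeries F) : Prop :=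
  ∀ w, ∃ N : ℝ, ∀ x y, (x < N ∨ y < N) → φ x y w = 0

/-- The space of fields. -/
def fieldSpace (F : Type*) [AddCommGroup F] [Module ℂ F] : Submodule ℂ (OpSeries F) where
  carrier := {φ | IsField φ}
  zero_mem' := fun _ => ⟨0, fun _ _ _ => rfl⟩
  add_mem' := fun {φ ψ} hφ hψ w => by
    obtain ⟨N, hN⟩ := hφ w
    obtain ⟨M, hM⟩ := hψ w
    refine ⟨min N M, fun x y h => ?_⟩
    change φ x y w + ψ x y w = 0
    rw [hN x y (h.imp (lt_of_lt_of_le · (min_le_left _ _)) (lt_of_lt_of_le · (min_le_left _ _))),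
      hM x y (h.imp (lt_of_lt_of_le · (min_le_right _ _)) (lt_of_lt_of_le · (min_le_right _ _))),
      add_zero]
  smul_mem' := fun r φ hφ w => by
    obtain ⟨N, hN⟩ := hφ w
    exact ⟨N, fun x y h => by change r • φ x y w = 0; rw [hN x y h, smul_zero]⟩

theorem IsField.uniform {φ : OpSeries F} (hφ : IsField φ) (w : ℕ → F) (M : ℕ) :
    ∃ N : ℝ, ∀ m < M, ∀ x y, (x < N ∨ y < N) → φ x y (w m) = 0 := by
  induction M with
  | zero => exact ⟨0, fun m hm => absurd hm (by omega)⟩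
  | succ M ih =>
    obtain ⟨N, hN⟩ := ih
    obtain ⟨N', hN'⟩ := hφ (w M)
    refine ⟨min N N', fun m hm x y h => ?_⟩
    rcases (Nat.lt_succ_iff.1 hm).lt_or_eq with hm | rfl
    · exact hN m hm x y
        (h.imp (lt_of_lt_of_le · (min_le_left _ _)) (lt_of_lt_of_le · (min_le_left _ _)))
    · exact hN' x y
        (h.imp (lt_of_lt_of_le · (min_le_right _ _)) (lt_of_lt_of_le · (min_le_right _ _)))

/-- The exponents of `z` and `z̄` for the two chiralities. -/
def dir : Bool → ℝ × ℝ
  | true => (1, 0)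
  | false => (0, 1)

/-- The coefficients of `(1/n!) (dⁿ/dzⁿ) (∑ c_m z^m) φ`, where `z` stands for `z̄` if `ε = false`. -/
def lmulS (c : ℕ → Module.End ℂ F) (ε : Bool) (n : ℕ) (φ : OpSeries F) : OpSeries F := fun x y =>
  lfsum fun m : ℕ => Ring.choose (m : ℂ) n •
    (c m * φ (x - (dir ε).1 * (m - n)) (y - (dir ε).2 * (m - n)))

/-- The coefficients of `φ (1/n!) (dⁿ/dzⁿ) (∑ a_m z^(-m-1))`, where `z` stands for `z̄` if
`ε = false`. -/
def rmulS (a : ℕ → Module.End ℂ F) (ε : Bool) (n : ℕ) (φ : OpSeries F) : OpSeries F := fun x y =>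
  lfsum fun m : ℕ => Ring.choose (-(m : ℂ) - 1) n •
    (φ (x + (dir ε).1 * (m + 1 + n)) (y + (dir ε).2 * (m + 1 + n)) * a m)

theorem exists_nat_shift (ε : Bool) (x y N : ℝ) (n : ℝ) : ∃ M : ℕ, ∀ m : ℕ, M ≤ m →
    (x - (dir ε).1 * (m - n) < N ∨ y - (dir ε).2 * (m - n) < N) := by
  obtain ⟨M, hM⟩ := exists_nat_gt (max (x + n - N) (y + n - N))
  refine ⟨M, fun m hm => ?_⟩
  have h1 : max (x + n - N) (y + n - N) < m := lt_of_lt_of_le hM (by exact_mod_cast hm)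
  rw [max_lt_iff] at h1
  cases ε
  · right; simp only [dir]; linarith
  · left; simp only [dir]; linarith

/-- Here truncation of the field provides local finiteness; for multiplication on the right it is
the annihilation operators that do. -/
theorem lmulS_evSum (c : ℕ → Module.End ℂ F) (ε : Bool) (n : ℕ) {φ : OpSeries F} (hφ : IsField φ)
    (x y : ℝ) (w : F) : EvSum (fun m : ℕ => Ring.choose (m : ℂ) n •
      c m (φ (x - (dir ε).1 * (m - n)) (y - (dir ε).2 * (m - n)) w)) (lmulS c ε n φ x y w) := by
  refine lfsum_spec (g := fun m : ℕ => Ring.choose (m : ℂ) n •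
    (c m * φ (x - (dir ε).1 * (m - n)) (y - (dir ε).2 * (m - n)))) (fun w => ?_) w
  obtain ⟨N, hN⟩ := hφ w
  obtain ⟨M, hM⟩ := exists_nat_shift ε x y N n
  exact ⟨M, fun m hm => by
    rw [LinearMap.smul_apply, Module.End.mul_apply, hN _ _ (hM m hm), map_zero, smul_zero]⟩

theorem rmulS_evSum {a : ℕ → Module.End ℂ F} (ha : LocFin a) (ε : Bool) (n : ℕ) (φ : OpSeries F)
    (x y : ℝ) (w : F) : EvSum (fun m : ℕ => Ring.choose (-(m : ℂ) - 1) n •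
      φ (x + (dir ε).1 * (m + 1 + n)) (y + (dir ε).2 * (m + 1 + n)) (a m w))
      (rmulS a ε n φ x y w) := by
  refine lfsum_spec (g := fun m : ℕ => Ring.choose (-(m : ℂ) - 1) n •
    (φ (x + (dir ε).1 * (m + 1 + n)) (y + (dir ε).2 * (m + 1 + n)) * a m)) (fun w => ?_) w
  obtain ⟨N, hN⟩ := ha w
  exact ⟨N, fun m hm => by
    rw [LinearMap.smul_apply, Module.End.mul_apply, hN _ hm, map_zero, smul_zero]⟩

/-- The binomial coefficient kills the terms with m < n, which are the only ones that could lower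
the exponents. -/
theorem IsField.lmulS {φ : OpSeries F} (hφ : IsField φ) (c : ℕ → Module.End ℂ F) (ε : Bool)
    (n : ℕ) : IsField (lmulS c ε n φ) := by
  intro w
  obtain ⟨N, hN⟩ := hφ w
  refine ⟨N, fun x y h => (lmulS_evSum c ε n hφ x y w).unique (EvSum.of_eq_zero fun m => ?_)⟩
  rcases lt_or_ge m n with hm | hm
  · rw [choose_natCast_of_lt hm, zero_smul]
  · have : (n : ℝ) ≤ m := by exact_mod_cast hm
    rw [hN, map_zero, smul_zero]
    cases ε
    · refine h.imp (fun h => ?_) (fun h => ?_) <;> simp only [dir] <;> linarith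
    · refine h.imp (fun h => ?_) (fun h => ?_) <;> simp only [dir] <;> linarith

theorem IsField.rmulS {φ : OpSeries F} (hφ : IsField φ) {a : ℕ → Module.End ℂ F} (ha : LocFin a)
    (ε : Bool) (n : ℕ) : IsField (rmulS a ε n φ) := by
  intro w
  obtain ⟨M, hM⟩ := ha w
  obtain ⟨N, hN⟩ := hφ.uniform (fun m => a m w) M
  refine ⟨N - M - 1 - n, fun x y h =>
    (rmulS_evSum ha ε n φ x y w).unique (EvSum.of_eq_zero fun m => ?_)⟩
  rcases lt_or_ge m M with hm | hm
  · have h1 : (m : ℝ) ≤ M := by exact_mod_cast hm.le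
    have h2 : (0 : ℝ) ≤ m := m.cast_nonneg
    have h3 : (0 : ℝ) ≤ n := n.cast_nonneg
    rw [hN m hm, smul_zero]
    cases ε
    · refine h.imp (fun h => ?_) (fun h => ?_) <;> simp only [dir] <;> linarith
    · refine h.imp (fun h => ?_) (fun h => ?_) <;> simp only [dir] <;> linarith
  · rw [hM m hm, map_zero, smul_zero]

/-- The sums may be exchanged because each index can raise the argument of φ by at most n
(respectively n'), while a large value of either index pushes it below the truncation bound. -/
theorem lmulS_lmulS {c c' : ℕ → Module.End ℂ F} (hc : ∀ m k, c m * c' k = c' k * c m)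
    (ε ε' : Bool) (n n' : ℕ) {φ : OpSeries F} (hφ : IsField φ) :
    lmulS c ε n (lmulS c' ε' n' φ) = lmulS c' ε' n' (lmulS c ε n φ) := by
  funext x y
  refine LinearMap.ext fun w => ?_
  obtain ⟨N, hN⟩ := hφ w
  have hR := lmulS_evSum c ε n (hφ.lmulS c' ε' n') x y w
  have hR' := lmulS_evSum c' ε' n' (hφ.lmulS c ε n) x y w
  refine (EvSum.comm (a := fun m k : ℕ => Ring.choose (m : ℂ) n • c m (Ring.choose (k : ℂ) n' •
    c' k (φ (x - (dir ε).1 * (m - n) - (dir ε').1 * (k - n'))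
      (y - (dir ε).2 * (m - n) - (dir ε').2 * (k - n')) w))) ?_ (fun m => ?_) (fun k => ?_)
      hR).unique hR'
  · obtain ⟨M, hM⟩ := exists_nat_shift ε (x + n') (y + n') N n
    obtain ⟨K, hK⟩ := exists_nat_shift ε' (x + n) (y + n) N n'
    have hd (ε : Bool) (u v : ℝ) (huv : -v ≤ u) (hv : 0 ≤ v) :
        -v ≤ (dir ε).1 * u ∧ -v ≤ (dir ε).2 * u := by
      cases ε <;> simp only [dir] <;> constructor <;> linarith
    refine ⟨max M K, fun m k h => ?_⟩
    rw [hN, map_zero, smul_zero, map_zero, smul_zero]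
    have h1 := hd ε (m - n) n (by linarith [(m.cast_nonneg : (0 : ℝ) ≤ m)]) n.cast_nonneg
    have h2 := hd ε' (k - n') n' (by linarith [(k.cast_nonneg : (0 : ℝ) ≤ k)]) n'.cast_nonneg
    rcases h with h | h
    · exact (hM m (le_of_max_le_left h)).imp (fun h => by linarith) (fun h => by linarith)
    · exact (hK k (le_of_max_le_right h)).imp (fun h => by linarith) (fun h => by linarith)
  · exact ((lmulS_evSum c' ε' n' hφ _ _ w).mapₗ (c m)).smul _
  · refine (((lmulS_evSum c ε n hφ (x - (dir ε').1 * (k - n')) (y - (dir ε').2 * (k - n')) w).mapₗ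
      (c' k)).smul (Ring.choose (k : ℂ) n')).congr (fun m => ?_) rfl
    rw [map_smul, map_smul, ← Module.End.mul_apply, ← hc, Module.End.mul_apply, smul_comm]
    congr 5 <;> ring_nf

theorem rmulS_rmulS {a a' : ℕ → Module.End ℂ F} (ha : LocFin a) (ha' : LocFin a')
    (hc : ∀ m k, a m * a' k = a' k * a m) (ε ε' : Bool) (n n' : ℕ) (φ : OpSeries F) :
    rmulS a ε n (rmulS a' ε' n' φ) = rmulS a' ε' n' (rmulS a ε n φ) := by
  funext x y
  refine LinearMap.ext fun w => ?_
  have hc' (m k v) : a m (a' k v) = a' k (a m v) := LinearMap.congr_fun (hc m k) v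
  have hR := rmulS_evSum ha ε n (rmulS a' ε' n' φ) x y w
  have hR' := rmulS_evSum ha' ε' n' (rmulS a ε n φ) x y w
  refine (EvSum.comm (a := fun m k : ℕ => Ring.choose (-(m : ℂ) - 1) n •
    (Ring.choose (-(k : ℂ) - 1) n' •
      φ (x + (dir ε).1 * (m + 1 + n) + (dir ε').1 * (k + 1 + n'))
      (y + (dir ε).2 * (m + 1 + n) + (dir ε').2 * (k + 1 + n')) (a' k (a m w)))) ?_ (fun m => ?_)
      (fun k => ?_) hR).unique hR'
  · obtain ⟨M, hM⟩ := ha w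
    obtain ⟨K, hK⟩ := ha' w
    refine ⟨max M K, fun m k h => ?_⟩
    rcases h with h | h
    · rw [hM m (le_of_max_le_left h), map_zero, map_zero, smul_zero, smul_zero]
    · rw [← hc', hK k (le_of_max_le_right h), map_zero,
        map_zero, smul_zero, smul_zero]
  · exact (rmulS_evSum ha' ε' n' φ _ _ (a m w)).smul _
  · refine ((rmulS_evSum ha ε n φ (x + (dir ε').1 * (k + 1 + n')) (y + (dir ε').2 * (k + 1 + n'))
      (a' k w)).smul (Ring.choose (-(k : ℂ) - 1) n')).congr (fun m => ?_) rfl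
    rw [hc', smul_comm]
    congr 4 <;> ring_nf

/-- Operations on opposite sides of φ commute by associativity, without any relation between c and
a; only the joint finiteness of the double sum has to be checked. -/
theorem lmulS_rmulS (c : ℕ → Module.End ℂ F) {a : ℕ → Module.End ℂ F} (ha : LocFin a)
    (ε ε' : Bool) (n n' : ℕ) {φ : OpSeries F} (hφ : IsField φ) :
    lmulS c ε n (rmulS a ε' n' φ) = rmulS a ε' n' (lmulS c ε n φ) := by
  funext x y
  refine LinearMap.ext fun w => ?_
  have hR := lmulS_evSum c ε n (hφ.rmulS ha ε' n') x y w
  have hR' := rmulS_evSum ha ε' n' (lmulS c ε n φ) x y w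
  refine (EvSum.comm (a := fun m k : ℕ => Ring.choose (m : ℂ) n • c m
    (Ring.choose (-(k : ℂ) - 1) n' •
      φ (x - (dir ε).1 * (m - n) + (dir ε').1 * (k + 1 + n'))
      (y - (dir ε).2 * (m - n) + (dir ε').2 * (k + 1 + n')) (a k w))) ?_ (fun m => ?_)
      (fun k => ?_) hR).unique hR'
  · obtain ⟨K, hK⟩ := ha w
    obtain ⟨N, hN⟩ := hφ.uniform (fun m => a m w) K
    obtain ⟨M, hM⟩ := exists_nat_shift ε (x + K + 1 + n') (y + K + 1 + n') N n
    refine ⟨max M K, fun m k h => ?_⟩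
    rcases lt_or_ge k K with hk | hk
    · rw [hN k hk, smul_zero, map_zero, smul_zero]
      have h0 : (k : ℝ) ≤ K := by exact_mod_cast hk.le
      have h1 : (0 : ℝ) ≤ k := k.cast_nonneg
      have h2 : (0 : ℝ) ≤ n' := n'.cast_nonneg
      have hd : (dir ε').1 * (k + 1 + n') ≤ K + 1 + n' ∧ (dir ε').2 * (k + 1 + n') ≤ K + 1 + n' := by
        cases ε' <;> simp only [dir] <;> constructor <;> linarith
      have hm : M ≤ m := by
        rcases h with h | h
        · exact le_of_max_le_left h
        · exact absurd (le_of_max_le_right h) (by omega)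
      exact (hM m hm).imp (fun h => by linarith) (fun h => by linarith)
    · rw [hK k hk, map_zero, smul_zero, map_zero, smul_zero]
  · exact ((rmulS_evSum ha ε' n' φ _ _ w).mapₗ (c m)).smul _
  · refine ((lmulS_evSum c ε n hφ (x + (dir ε').1 * (k + 1 + n')) (y + (dir ε').2 * (k + 1 + n'))
      (a k w)).smul (Ring.choose (-(k : ℂ) - 1) n')).congr (fun m => ?_) rfl
    rw [map_smul, smul_comm]
    congr 5 <;> ring_nf

/-- The normally ordered product of a derivative of a current with a field. -/
def normS (c a : ℕ → Module.End ℂ F) (ε : Bool) (n : ℕ) (φ : OpSeries F) : OpSeries F :=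
  lmulS c ε n φ + rmulS a ε n φ

theorem normS_add (c a : ℕ → Module.End ℂ F) (ha : LocFin a) (ε : Bool) (n : ℕ) {φ ψ : OpSeries F}
    (hφ : IsField φ) (hψ : IsField ψ) :
    normS c a ε n (φ + ψ) = normS c a ε n φ + normS c a ε n ψ := by
  have h1 : lmulS c ε n (φ + ψ) = lmulS c ε n φ + lmulS c ε n ψ := by
    funext x y
    refine LinearMap.ext fun w => (lmulS_evSum c ε n ((fieldSpace F).add_mem hφ hψ) x y w).unique ?_
    refine ((lmulS_evSum c ε n hφ x y w).add (lmulS_evSum c ε n hψ x y w)).congr (fun m => ?_) rfl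
    simp
  have h2 : rmulS a ε n (φ + ψ) = rmulS a ε n φ + rmulS a ε n ψ := by
    funext x y
    refine LinearMap.ext fun w => (rmulS_evSum ha ε n (φ + ψ) x y w).unique ?_
    refine ((rmulS_evSum ha ε n φ x y w).add (rmulS_evSum ha ε n ψ x y w)).congr (fun m => ?_) rfl
    simp
  rw [normS, h1, h2, normS, normS]
  abel

theorem normS_smul (c a : ℕ → Module.End ℂ F) (ha : LocFin a) (ε : Bool) (n : ℕ) (r : ℂ)
    {φ : OpSeries F} (hφ : IsField φ) : normS c a ε n (r • φ) = r • normS c a ε n φ := by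
  have h1 : lmulS c ε n (r • φ) = r • lmulS c ε n φ := by
    funext x y
    refine LinearMap.ext fun w => (lmulS_evSum c ε n ((fieldSpace F).smul_mem r hφ) x y w).unique ?_
    refine ((lmulS_evSum c ε n hφ x y w).smul r).congr (fun m => ?_) rfl
    simp [smul_comm r]
  have h2 : rmulS a ε n (r • φ) = r • rmulS a ε n φ := by
    funext x y
    refine LinearMap.ext fun w => (rmulS_evSum ha ε n (r • φ) x y w).unique ?_
    refine ((rmulS_evSum ha ε n φ x y w).smul r).congr (fun m => ?_) rfl
    simp [smul_comm r]
  rw [normS, h1, h2, normS, smul_add]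

/-- The normally ordered product as an operator on the space of fields. -/
def normHom (c a : ℕ → Module.End ℂ F) (ha : LocFin a) (ε : Bool) (n : ℕ) :
    Module.End ℂ (fieldSpace F) where
  toFun φ := ⟨normS c a ε n φ.1,
    (fieldSpace F).add_mem (IsField.lmulS φ.2 c ε n) (IsField.rmulS φ.2 ha ε n)⟩
  map_add' φ ψ := Subtype.ext (normS_add c a ha ε n φ.2 ψ.2)
  map_smul' r φ := Subtype.ext (normS_smul c a ha ε n r φ.2)

/-- All creation parts stay to the left and all annihilation parts to the right of φ, so no
commutator between the two kinds appears. This is the compatibility needed to define Y on products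
of creation operators in any order. -/
theorem normHom_comm {c a c' a' : ℕ → Module.End ℂ F} (ha : LocFin a) (ha' : LocFin a')
    (hc : ∀ m k, c m * c' k = c' k * c m) (hac : ∀ m k, a m * a' k = a' k * a m)
    (ε ε' : Bool) (n n' : ℕ) (φ : fieldSpace F) :
    normHom c a ha ε n (normHom c' a' ha' ε' n' φ) =
      normHom c' a' ha' ε' n' (normHom c a ha ε n φ) := by
  obtain ⟨φ, hφ⟩ := φ
  have e1 : normS c a ε n (normS c' a' ε' n' φ) =
      lmulS c ε n (lmulS c' ε' n' φ) + rmulS a ε n (lmulS c' ε' n' φ) +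
      (lmulS c ε n (rmulS a' ε' n' φ) + rmulS a ε n (rmulS a' ε' n' φ)) :=
    normS_add c a ha ε n (hφ.lmulS _ _ _) (hφ.rmulS ha' _ _)
  have e2 : normS c' a' ε' n' (normS c a ε n φ) =
      lmulS c' ε' n' (lmulS c ε n φ) + rmulS a' ε' n' (lmulS c ε n φ) +
      (lmulS c' ε' n' (rmulS a ε n φ) + rmulS a' ε' n' (rmulS a ε n φ)) :=
    normS_add c' a' ha' ε' n' (hφ.lmulS _ _ _) (hφ.rmulS ha _ _)
  refine Subtype.ext ?_
  change normS c a ε n (normS c' a' ε' n' φ) = normS c' a' ε' n' (normS c a ε n φ)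
  rw [e1, e2, lmulS_lmulS hc ε ε' n n' hφ, rmulS_rmulS ha ha' hac, lmulS_rmulS c ha' ε ε' n n' hφ,
    ← lmulS_rmulS c' ha ε' ε n' n hφ]
  abel

end Fields

end
end AHVertex

open scoped TensorProduct
namespace AHVertex
noncomputable section

/-! ## Sectors and multiplication by elements of `A` -/

section Sector

variable {H : Type*} [AddCommGroup H] [Module ℝ H] {A : Type*} [Ring A] [Algebra ℂ A]
variable (B : LinearMap.BilinForm ℝ H) (hB : B.IsSymm) (p : Module.End ℝ H)
variable (𝒜 : H → Submodule ℂ A) [DecidableEq H] [GradedAlgebra 𝒜]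

/-- One lift provides two structures: the tag β records the charge of v, and the value at β is the
product of a with the component of v of charge β. Taking a = 1 gives the charge projections,
forgetting the tags gives left multiplication by a. -/
theorem exists_secMul : ∃ T : Induced B hB p 𝒜 →ₗ[ℂ] A →ₗ[ℂ] (H →₀ Induced B hB p 𝒜),
    (∀ β, ∀ b ∈ 𝒜 β, ∀ a, T (incl B hB p 𝒜 b) a = Finsupp.single β (incl B hB p 𝒜 (a * b))) ∧
    ∀ (n : ℕ) h v a, T (heis B hB p 𝒜 (-(n : ℤ) - 1) h v) a =
      Finsupp.mapRange.linearMap (heis B hB p 𝒜 (-(n : ℤ) - 1) h) (T v a) := by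
  obtain ⟨T, h1, h2⟩ := exists_creation_lift B hB p 𝒜 (X := A →ₗ[ℂ] (H →₀ Induced B hB p 𝒜))
    (fun n => AddMonoidHom.mk' (fun h => LinearMap.llcomp ℂ A (H →₀ Induced B hB p 𝒜)
      (H →₀ Induced B hB p 𝒜)
      (Finsupp.mapRange.linearMap (heis B hB p 𝒜 (-(n : ℤ) - 1) h)))
      fun h k => by ext; simp [heis_add])
    (fun n r h => by ext; simp [heis_smul])
    (fun n m h k x => by
      ext a β
      simp only [AddMonoidHom.mk'_apply, LinearMap.llcomp_apply,
        Finsupp.mapRange.linearMap_apply, Finsupp.mapRange_apply]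
      exact LinearMap.congr_fun (heis_mul_comm B hB p 𝒜 fun h0 => by omega) _)
    (gradedLift 𝒜 fun β => ((LinearMap.mul ℂ A).flip.compr₂
      (Finsupp.lsingle β ∘ₗ inclHom B hB p 𝒜)) ∘ₗ (𝒜 β).subtype)
  refine ⟨T, fun β b hb a => ?_, fun n h v a => ?_⟩
  · rw [h1, gradedLift_apply 𝒜 _ hb]; rfl
  · rw [h2]; rfl

/-- The sector components of the products `a v`. -/
def secMul : Induced B hB p 𝒜 →ₗ[ℂ] A →ₗ[ℂ] (H →₀ Induced B hB p 𝒜) :=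
  (exists_secMul B hB p 𝒜).choose

theorem secMul_incl {β : H} {b : A} (hb : b ∈ 𝒜 β) (a : A) :
    secMul B hB p 𝒜 (incl B hB p 𝒜 b) a = Finsupp.single β (incl B hB p 𝒜 (a * b)) :=
  (exists_secMul B hB p 𝒜).choose_spec.1 β b hb a

theorem secMul_heis_neg (n : ℕ) (h : H) (v) (a : A) :
    secMul B hB p 𝒜 (heis B hB p 𝒜 (-(n : ℤ) - 1) h v) a =
      Finsupp.mapRange.linearMap (heis B hB p 𝒜 (-(n : ℤ) - 1) h) (secMul B hB p 𝒜 v a) :=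
  (exists_secMul B hB p 𝒜).choose_spec.2 n h v a

theorem secMul_heis {n : ℤ} (hn : n ≠ 0) (h : H) (v) (a : A) (β : H) :
    secMul B hB p 𝒜 (heis B hB p 𝒜 n h v) a β = heis B hB p 𝒜 n h (secMul B hB p 𝒜 v a β) := by
  induction v using create_induction with
  | zero => simp
  | add v w hv hw => simp [hv, hw]
  | smul r v hv => simp [hv]
  | incl γ b hb =>
    rcases lt_or_ge n 0 with hn | hn
    · obtain ⟨m, rfl⟩ : ∃ m : ℕ, n = -(m : ℤ) - 1 := ⟨(-n - 1).toNat, by omega⟩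
      rw [secMul_heis_neg]; rfl
    · rw [heis_incl_pos B hB p 𝒜 (by omega), secMul_incl B hB p 𝒜 hb, map_zero,
        LinearMap.zero_apply, Finsupp.zero_apply, Finsupp.single_apply]
      split_ifs
      · rw [heis_incl_pos B hB p 𝒜 (by omega)]
      · rw [map_zero]
  | heis m k v hv =>
    rw [heis_comm_apply, map_add, LinearMap.add_apply, Finsupp.add_apply, secMul_heis_neg,
      secMul_heis_neg]
    simp only [Finsupp.mapRange.linearMap_apply, Finsupp.mapRange_apply]
    rw [hv, heis_comm_apply B hB p 𝒜 n (-(m : ℤ) - 1) h k (secMul B hB p 𝒜 v a β)]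
    split_ifs <;> simp

/-- The zero mode measures charge, which multiplication by a ∈ A^α raises by α. -/
theorem secMul_heis_zero {α : H} {a : A} (ha : a ∈ 𝒜 α) (h : H) (v) (β : H) :
    secMul B hB p 𝒜 (heis B hB p 𝒜 0 h v) a β = heis B hB p 𝒜 0 h (secMul B hB p 𝒜 v a β) -
      (twistedForm B p h α : ℂ) • secMul B hB p 𝒜 v a β := by
  induction v using create_induction with
  | zero => simp
  | add v w hv hw => simp [hv, hw]; abel
  | smul r v hv => simp [hv, smul_sub, smul_comm r]
  | incl γ b hb =>
    rw [heis_zero_incl B hB p 𝒜 h γ hb, map_smul, LinearMap.smul_apply, secMul_incl B hB p 𝒜 hb,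
      Finsupp.smul_apply, Finsupp.single_apply]
    split_ifs
    · rw [heis_zero_incl B hB p 𝒜 h (α + γ) (SetLike.mul_mem_graded ha hb), map_add, ← sub_smul]
      congr 1
      push_cast; ring
    · simp
  | heis m k v hv =>
    rw [heis_comm_apply, map_add, LinearMap.add_apply, Finsupp.add_apply, secMul_heis_neg,
      secMul_heis_neg]
    simp only [Finsupp.mapRange.linearMap_apply, Finsupp.mapRange_apply]
    rw [hv, heis_comm_apply]
    simp

/-- The subspace of vectors of charge `γ`. -/
def sector (γ : H) : Submodule ℂ (Induced B hB p 𝒜) :=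
  LinearMap.ker ((secMul B hB p 𝒜).flip 1 - Finsupp.lsingle γ)

theorem mem_sector {γ : H} {v : Induced B hB p 𝒜} :
    v ∈ sector B hB p 𝒜 γ ↔ secMul B hB p 𝒜 v 1 = Finsupp.single γ v := by
  rw [sector, LinearMap.mem_ker, LinearMap.sub_apply, sub_eq_zero]; rfl

theorem incl_mem_sector {γ : H} {a : A} (ha : a ∈ 𝒜 γ) :
    incl B hB p 𝒜 a ∈ sector B hB p 𝒜 γ := by
  rw [mem_sector, secMul_incl B hB p 𝒜 ha, one_mul]

theorem heis_mem_sector {γ : H} {v : Induced B hB p 𝒜} (hv : v ∈ sector B hB p 𝒜 γ) (n : ℤ)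
    (h : H) : heis B hB p 𝒜 n h v ∈ sector B hB p 𝒜 γ := by
  rw [mem_sector] at hv ⊢
  ext β
  by_cases hn : n = 0
  · subst hn
    rw [secMul_heis_zero B hB p 𝒜 (SetLike.one_mem_graded 𝒜), hv, map_zero, Finsupp.single_apply,
      Finsupp.single_apply]
    split_ifs <;> simp
  · rw [secMul_heis B hB p 𝒜 hn, hv, Finsupp.single_apply, Finsupp.single_apply]
    split_ifs <;> simp

theorem secMul_mem_sector (v : Induced B hB p 𝒜) (γ : H) :
    secMul B hB p 𝒜 v 1 γ ∈ sector B hB p 𝒜 γ := by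
  induction v using create_induction with
  | zero => simp
  | add v w hv hw => simpa using Submodule.add_mem _ hv hw
  | smul r v hv => simpa using Submodule.smul_mem _ r hv
  | incl β b hb =>
    rw [secMul_incl B hB p 𝒜 hb, Finsupp.single_apply, one_mul]
    split_ifs with h
    · exact incl_mem_sector B hB p 𝒜 (h ▸ hb)
    · exact Submodule.zero_mem _
  | heis m k v hv =>
    rw [secMul_heis B hB p 𝒜 (by omega)]
    exact heis_mem_sector B hB p 𝒜 hv _ _

/-- The induction runs over all of F with the predicate applied to the component of charge γ, which
for a vector of the sector is the vector itself. -/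
theorem sector_induction {γ : H} {C : Induced B hB p 𝒜 → Prop}
    (incl : ∀ a ∈ 𝒜 γ, C (incl B hB p 𝒜 a))
    (heis : ∀ (n : ℕ) h, ∀ v ∈ sector B hB p 𝒜 γ, C v → C (heis B hB p 𝒜 (-(n : ℤ) - 1) h v))
    (zero : C 0) (add : ∀ v w, C v → C w → C (v + w)) (smul : ∀ (r : ℂ) v, C v → C (r • v)) (v)
    (hv : v ∈ sector B hB p 𝒜 γ) : C v := by
  have h1 (v : Induced B hB p 𝒜) : C (secMul B hB p 𝒜 v 1 γ) := by
    induction v using create_induction with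
    | zero => simpa using zero
    | add v w hv hw => simpa using add _ _ hv hw
    | smul r v hv => simpa using smul r _ hv
    | incl β b hb =>
      rw [secMul_incl B hB p 𝒜 hb, Finsupp.single_apply, one_mul]
      split_ifs with h
      · exact incl _ (h ▸ hb)
      · exact zero
    | heis m k v hv =>
      rw [secMul_heis B hB p 𝒜 (by omega)]
      exact heis _ _ _ (secMul_mem_sector B hB p 𝒜 v γ) hv
  have h2 := h1 v
  rwa [(mem_sector B hB p 𝒜).1 hv, Finsupp.single_eq_same] at h2

theorem sum_secMul (v : Induced B hB p 𝒜) :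
    (secMul B hB p 𝒜 v 1).sum (fun _ x => x) = v := by
  have : Finsupp.lsum ℂ (fun _ => LinearMap.id) ∘ₗ (secMul B hB p 𝒜).flip 1 = LinearMap.id := by
    refine LinearMap.ext fun v => ?_
    induction v using create_induction with
    | zero => simp
    | add v w hv hw => rw [map_add, hv, hw, map_add]
    | smul r v hv => rw [map_smul, hv, map_smul]
    | incl β b hb => simp [secMul_incl B hB p 𝒜 hb]
    | heis m k v hv =>
      have h1 := congrArg (heis B hB p 𝒜 (-(m : ℤ) - 1) k) hv
      simp only [LinearMap.comp_apply, LinearMap.flip_apply, secMul_heis_neg] at h1 ⊢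
      rw [LinearMap.id_apply] at h1
      rw [LinearMap.id_apply, ← h1, Finsupp.lsum_apply, Finsupp.lsum_apply,
        Finsupp.mapRange.linearMap_apply, Finsupp.sum_mapRange_index (by simp), Finsupp.sum,
        Finsupp.sum, map_sum]
      rfl
  exact LinearMap.congr_fun this v

/-- The module is the sum of its sectors. -/
theorem sector_span {C : Induced B hB p 𝒜 → Prop} (zero : C 0)
    (add : ∀ v w, C v → C w → C (v + w)) (sector : ∀ γ, ∀ v ∈ sector B hB p 𝒜 γ, C v) (v) :
    C v := by
  rw [← sum_secMul B hB p 𝒜 v]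
  exact Finset.sum_induction _ C add zero fun γ _ => sector γ _ (secMul_mem_sector B hB p 𝒜 v γ)

/-- Multiplication by `a`. -/
def lmap (a : A) : Module.End ℂ (Induced B hB p 𝒜) :=
  Finsupp.lsum ℂ (fun _ => LinearMap.id) ∘ₗ (secMul B hB p 𝒜).flip a

/-- Tags start as the charge of the element of A and are untouched by creation operators. -/
theorem secMul_sector {γ : H} {v : Induced B hB p 𝒜} (hv : v ∈ sector B hB p 𝒜 γ) (a : A) :
    secMul B hB p 𝒜 v a = Finsupp.single γ (lmap B hB p 𝒜 a v) := by
  suffices ∀ β, β ≠ γ → secMul B hB p 𝒜 v a β = 0 by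
    have h1 : secMul B hB p 𝒜 v a = Finsupp.single γ (secMul B hB p 𝒜 v a γ) := by
      ext β
      rw [Finsupp.single_apply]
      split_ifs with h
      · rw [h]
      · exact this β (Ne.symm h)
    rw [lmap, LinearMap.comp_apply, LinearMap.flip_apply, h1]
    simp
  intro β hβ
  refine sector_induction B hB p 𝒜
    (C := fun v => secMul B hB p 𝒜 v a β = 0) ?incl ?heis ?zero ?add ?smul v hv
  case zero => simp
  case add =>
    intro v w hv hw
    simp [hv, hw]
  case smul =>
    intro r v hv
    simp [hv]
  case incl =>
    intro b hb
    rw [secMul_incl B hB p 𝒜 hb, Finsupp.single_apply, if_neg (Ne.symm hβ)]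
  case heis =>
    intro m k v _ hv
    rw [secMul_heis B hB p 𝒜 (by omega), hv, map_zero]

theorem lmap_incl (a b : A) : lmap B hB p 𝒜 a (incl B hB p 𝒜 b) = incl B hB p 𝒜 (a * b) := by
  refine LinearMap.congr_fun (f := lmap B hB p 𝒜 a ∘ₗ inclHom B hB p 𝒜)
    (g := inclHom B hB p 𝒜 ∘ₗ LinearMap.mulLeft ℂ a) (graded_hom_ext 𝒜 fun β b hb => ?_) b
  change lmap B hB p 𝒜 a (incl B hB p 𝒜 b) = incl B hB p 𝒜 (a * b)
  simp [lmap, secMul_incl B hB p 𝒜 hb]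

theorem lmap_heis (a : A) {n : ℤ} (hn : n ≠ 0) (h : H) (v) :
    lmap B hB p 𝒜 a (heis B hB p 𝒜 n h v) = heis B hB p 𝒜 n h (lmap B hB p 𝒜 a v) := by
  induction v using sector_span with
  | zero => simp
  | add v w hv hw => simp [hv, hw]
  | sector γ v hv =>
    have h1 := secMul_heis B hB p 𝒜 hn h v a γ
    rwa [secMul_sector B hB p 𝒜 hv, secMul_sector B hB p 𝒜 (heis_mem_sector B hB p 𝒜 hv _ _),
      Finsupp.single_eq_same, Finsupp.single_eq_same] at h1

theorem lmap_heis_zero {α : H} {a : A} (ha : a ∈ 𝒜 α) (h : H) (v) :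
    lmap B hB p 𝒜 a (heis B hB p 𝒜 0 h v) = heis B hB p 𝒜 0 h (lmap B hB p 𝒜 a v) -
      (twistedForm B p h α : ℂ) • lmap B hB p 𝒜 a v := by
  induction v using sector_span with
  | zero => simp
  | add v w hv hw => simp [hv, hw]; abel
  | sector γ v hv =>
    have h1 := secMul_heis_zero B hB p 𝒜 ha h v γ
    rwa [secMul_sector B hB p 𝒜 hv, secMul_sector B hB p 𝒜 (heis_mem_sector B hB p 𝒜 hv _ _),
      Finsupp.single_eq_same, Finsupp.single_eq_same] at h1

theorem lmap_mem_sector {α γ : H} {a : A} (ha : a ∈ 𝒜 α) {v : Induced B hB p 𝒜}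
    (hv : v ∈ sector B hB p 𝒜 γ) : lmap B hB p 𝒜 a v ∈ sector B hB p 𝒜 (α + γ) := by
  refine sector_induction B hB p 𝒜
    (C := fun v => lmap B hB p 𝒜 a v ∈ sector B hB p 𝒜 (α + γ)) ?incl ?heis ?zero ?add ?smul v hv
  case zero => simp
  case add =>
    intro v w hv hw
    rw [map_add]; exact Submodule.add_mem _ hv hw
  case smul =>
    intro r v hv
    rw [map_smul]; exact Submodule.smul_mem _ r hv
  case incl =>
    intro b hb
    rw [lmap_incl]; exact incl_mem_sector B hB p 𝒜 (SetLike.mul_mem_graded ha hb)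
  case heis =>
    intro m k v _ hv
    rw [lmap_heis B hB p 𝒜 a (by omega)]; exact heis_mem_sector B hB p 𝒜 hv _ _

theorem create_mem_sector {γ : H} (L : List (ℕ × H)) {v : Induced B hB p 𝒜}
    (hv : v ∈ sector B hB p 𝒜 γ) : create B hB p 𝒜 L v ∈ sector B hB p 𝒜 γ := by
  induction L with
  | nil => exact hv
  | cons q L ih => exact heis_mem_sector B hB p 𝒜 ih _ _

theorem lmap_create (a : A) (L : List (ℕ × H)) (v : Induced B hB p 𝒜) :
    lmap B hB p 𝒜 a (create B hB p 𝒜 L v) = create B hB p 𝒜 L (lmap B hB p 𝒜 a v) := by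
  induction L with
  | nil => rfl
  | cons q L ih =>
    change lmap B hB p 𝒜 a (heis B hB p 𝒜 _ _ (create B hB p 𝒜 L v)) = _
    rw [lmap_heis B hB p 𝒜 a (by omega), ih]; rfl

end Sector

end
end AHVertex

open scoped TensorProduct
namespace AHVertex
noncomputable section

/-! ## Construction of the vertex operators -/

section NormHom

variable {F : Type*} [AddCommGroup F] [Module ℂ F]

theorem normS_add_coeff (c c' a a' : ℕ → Module.End ℂ F) (ha : LocFin a) (ha' : LocFin a')
    (ε : Bool) (n : ℕ) {φ : OpSeries F} (hφ : IsField φ) :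
    normS (c + c') (a + a') ε n φ = normS c a ε n φ + normS c' a' ε n φ := by
  have haa : LocFin (a + a') := fun w => by
    obtain ⟨N, hN⟩ := ha w
    obtain ⟨M, hM⟩ := ha' w
    exact ⟨max N M, fun n hn => by
      rw [Pi.add_apply, LinearMap.add_apply, hN n (le_of_max_le_left hn),
        hM n (le_of_max_le_right hn), add_zero]⟩
  have h1 : lmulS (c + c') ε n φ = lmulS c ε n φ + lmulS c' ε n φ := by
    funext x y
    refine LinearMap.ext fun w => (lmulS_evSum (c + c') ε n hφ x y w).unique ?_
    refine ((lmulS_evSum c ε n hφ x y w).add (lmulS_evSum c' ε n hφ x y w)).congr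
      (fun m => ?_) rfl
    simp
  have h2 : rmulS (a + a') ε n φ = rmulS a ε n φ + rmulS a' ε n φ := by
    funext x y
    refine LinearMap.ext fun w => (rmulS_evSum haa ε n φ x y w).unique ?_
    refine ((rmulS_evSum ha ε n φ x y w).add (rmulS_evSum ha' ε n φ x y w)).congr
      (fun m => ?_) rfl
    simp
  rw [normS, normS, normS, h1, h2]; abel

theorem normS_smul_coeff (c a : ℕ → Module.End ℂ F) (ha : LocFin a) (r : ℂ)
    (ε : Bool) (n : ℕ) {φ : OpSeries F} (hφ : IsField φ) :
    normS (r • c) (r • a) ε n φ = r • normS c a ε n φ := by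
  have haa : LocFin (r • a) := fun w => by
    obtain ⟨N, hN⟩ := ha w
    exact ⟨N, fun n hn => by rw [Pi.smul_apply, LinearMap.smul_apply, hN n hn, smul_zero]⟩
  have h1 : lmulS (r • c) ε n φ = r • lmulS c ε n φ := by
    funext x y
    refine LinearMap.ext fun w => (lmulS_evSum (r • c) ε n hφ x y w).unique ?_
    refine ((lmulS_evSum c ε n hφ x y w).smul r).congr (fun m => ?_) rfl
    simp [smul_comm r]
  have h2 : rmulS (r • a) ε n φ = r • rmulS a ε n φ := by
    funext x y
    refine LinearMap.ext fun w => (rmulS_evSum haa ε n φ x y w).unique ?_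
    refine ((rmulS_evSum ha ε n φ x y w).smul r).congr (fun m => ?_) rfl
    simp [smul_comm r]
  rw [normS, normS, h1, h2, smul_add]

end NormHom

section Construction

variable {H : Type*} [AddCommGroup H] [Module ℝ H] {A : Type*} [Ring A] [Algebra ℂ A]
variable (B : LinearMap.BilinForm ℝ H) (hB : B.IsSymm) (p : Module.End ℝ H)
variable (𝒜 : H → Submodule ℂ A) [DecidableEq H] [GradedAlgebra 𝒜]

/-- The creation operators of `h`. -/
def cre (h : H) : ℕ → Module.End ℂ (Induced B hB p 𝒜) := fun m => heis B hB p 𝒜 (-(m : ℤ) - 1) h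

/-- The annihilation operators of `h`. -/
def ann (h : H) : ℕ → Module.End ℂ (Induced B hB p 𝒜) := fun m => heis B hB p 𝒜 m h

theorem cre_comm (h k : H) (m n : ℕ) :
    cre B hB p 𝒜 h m * cre B hB p 𝒜 k n = cre B hB p 𝒜 k n * cre B hB p 𝒜 h m :=
  heis_mul_comm B hB p 𝒜 fun h0 => by omega

theorem ann_comm (h k : H) (m n : ℕ) :
    ann B hB p 𝒜 h m * ann B hB p 𝒜 k n = ann B hB p 𝒜 k n * ann B hB p 𝒜 h m :=
  heis_mul_comm B hB p 𝒜 fun h0 => by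
    rw [show (m : ℤ) = 0 by omega, Int.cast_zero, zero_mul]

theorem ann_locFin (h : H) : LocFin (ann B hB p 𝒜 h) := heis_locFin B hB p 𝒜 h

/-- Normally ordered product with the `n`-th derivative of the current of `h` of chirality `ε`. -/
def curHom (ε : Bool) (n : ℕ) : H →+ Module.End ℂ (fieldSpace (Induced B hB p 𝒜)) :=
  AddMonoidHom.mk' (fun h => normHom (cre B hB p 𝒜 h) (ann B hB p 𝒜 h)
    (ann_locFin B hB p 𝒜 h) ε n) fun h k => LinearMap.ext fun φ => Subtype.ext (by
      have h1 : cre B hB p 𝒜 (h + k) = cre B hB p 𝒜 h + cre B hB p 𝒜 k :=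
        funext fun m => heis_add B hB p 𝒜 _ h k
      have h2 : ann B hB p 𝒜 (h + k) = ann B hB p 𝒜 h + ann B hB p 𝒜 k :=
        funext fun m => heis_add B hB p 𝒜 _ h k
      change normS _ _ _ _ _ = normS _ _ _ _ _ + normS _ _ _ _ _
      rw [h1, h2, normS_add_coeff _ _ _ _ (ann_locFin B hB p 𝒜 h) (ann_locFin B hB p 𝒜 k) ε n
        φ.2])

theorem curHom_smul (ε : Bool) (n : ℕ) (r : ℝ) (h : H) :
    curHom B hB p 𝒜 ε n (r • h) = (r : ℂ) • curHom B hB p 𝒜 ε n h :=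
  LinearMap.ext fun φ => Subtype.ext (by
    have h1 : cre B hB p 𝒜 (r • h) = (r : ℂ) • cre B hB p 𝒜 h :=
      funext fun m => heis_smul B hB p 𝒜 _ r h
    have h2 : ann B hB p 𝒜 (r • h) = (r : ℂ) • ann B hB p 𝒜 h :=
      funext fun m => heis_smul B hB p 𝒜 _ r h
    change normS _ _ _ _ _ = (r : ℂ) • normS _ _ _ _ _
    rw [h1, h2, normS_smul_coeff _ _ (ann_locFin B hB p 𝒜 h) _ ε n φ.2])

theorem curHom_comm (ε ε' : Bool) (n n' : ℕ) (h k : H) (φ) :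
    curHom B hB p 𝒜 ε n h (curHom B hB p 𝒜 ε' n' k φ) =
      curHom B hB p 𝒜 ε' n' k (curHom B hB p 𝒜 ε n h φ) :=
  normHom_comm (ann_locFin B hB p 𝒜 h) (ann_locFin B hB p 𝒜 k) (cre_comm B hB p 𝒜 h k) (ann_comm B hB p 𝒜 h k) ε ε' n n' φ

theorem vl_trunc (h : H) (w : Induced B hB p 𝒜) : ∃ N : ℝ, ∀ x < N, vl B hB p 𝒜 h x w = 0 := by
  obtain ⟨M, hM⟩ := fS_locFin B hB p 𝒜 h w
  refine ⟨-M, fun x hx => (vl_evSum B hB p 𝒜 h x w).unique (EvSum.of_eq_zero fun j => ?_)⟩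
  rcases lt_or_ge j M with hj | hj
  · have : (j : ℝ) < M := by exact_mod_cast hj
    rw [natExt_of_neg (by linarith), LinearMap.zero_apply]
  · rw [hM j hj, map_zero]

variable {p} in
theorem twistedForm_proj (hp : p ∈ projections B) (α β : H) :
    twistedForm B p (p α) ((1 - p) β) = 0 ∧ twistedForm B p ((1 - p) α) (p β) = 0 :=
  ⟨twistedForm_left_right B p (proj_mem_left B hp α) (proj_mem_right B hp β),
    twistedForm_right_left B p (proj_mem_left B hp β) (proj_mem_right B hp α)⟩

/-- The vertex operators of elements of `A^α`. -/
def baseField (α : H) : A →ₗ[ℂ] OpSeries (Induced B hB p 𝒜) where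
  toFun a x y := (Finsupp.lsum ℂ fun β =>
    vl B hB p 𝒜 (p α) (x - twistedForm B p (p α) (p β)) ∘ₗ
      vl B hB p 𝒜 ((1 - p) α) (y - twistedForm B p ((1 - p) α) ((1 - p) β))) ∘ₗ
    (secMul B hB p 𝒜).flip a
  map_add' a b := by
    funext x y
    simp only [map_add, LinearMap.comp_add]; rfl
  map_smul' r a := by
    funext x y
    simp only [map_smul, LinearMap.comp_smul]; rfl

theorem baseField_apply (α : H) (a : A) (x y : ℝ) {β : H} {w : Induced B hB p 𝒜}
    (hw : w ∈ sector B hB p 𝒜 β) : baseField B hB p 𝒜 α a x y w =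
      vl B hB p 𝒜 (p α) (x - twistedForm B p (p α) (p β))
        (vl B hB p 𝒜 ((1 - p) α) (y - twistedForm B p ((1 - p) α) ((1 - p) β))
          (lmap B hB p 𝒜 a w)) := by
  change Finsupp.lsum ℂ _ (secMul B hB p 𝒜 w a) = _
  rw [secMul_sector B hB p 𝒜 hw]
  simp

theorem baseField_isField {p : Module.End ℝ H} (hp : p ∈ projections B) (α : H) (a : A) :
    IsField (baseField B hB p 𝒜 α a) := by
  intro w
  induction w using sector_span with
  | zero => exact ⟨0, fun x y _ => map_zero _⟩
  | add v w hv hw =>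
    obtain ⟨N, hN⟩ := hv
    obtain ⟨M, hM⟩ := hw
    refine ⟨min N M, fun x y h => ?_⟩
    rw [lt_min_iff, lt_min_iff] at h
    rw [map_add, hN x y (h.imp And.left And.left), hM x y (h.imp And.right And.right), add_zero]
  | sector β w hw =>
    obtain ⟨N, hN⟩ := vl_trunc B hB p 𝒜 (p α) (lmap B hB p 𝒜 a w)
    obtain ⟨M, hM⟩ := vl_trunc B hB p 𝒜 ((1 - p) α) (lmap B hB p 𝒜 a w)
    refine ⟨min (N + twistedForm B p (p α) (p β))
      (M + twistedForm B p ((1 - p) α) ((1 - p) β)), fun x y h => ?_⟩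
    rw [lt_min_iff, lt_min_iff] at h
    rw [baseField_apply B hB p 𝒜 α a x y hw]
    rcases h with h | h
    · rw [vl_vl_comm B hB p 𝒜 (twistedForm_proj B hp α α).1 (twistedForm_proj B hp α α).2,
        hN _ (by linarith), map_zero]
    · rw [hM _ (by linarith), map_zero]

/-- `Y` is given by `Y(a, z) = E^-(α, z) E^+(α, z) l_a z^(pα) z̄^(p̄α)` and normal ordering. -/
structure IsVertexField (Y : Induced B hB p 𝒜 →ₗ[ℂ] OpSeries (Induced B hB p 𝒜)) : Prop where
  isField : ∀ v, IsField (Y v)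
  base : ∀ α, ∀ a ∈ 𝒜 α, ∀ β, ∀ w ∈ sector B hB p 𝒜 β, ∀ x y, Y (incl B hB p 𝒜 a) x y w =
    vl B hB p 𝒜 (p α) (x - twistedForm B p (p α) (p β))
      (vl B hB p 𝒜 ((1 - p) α) (y - twistedForm B p ((1 - p) α) ((1 - p) β))
        (lmap B hB p 𝒜 a w))
  left : ∀ h ∈ LinearMap.ker (1 - p), ∀ (n : ℕ) v, Y (heis B hB p 𝒜 (-(n : ℤ) - 1) h v) =
    normS (cre B hB p 𝒜 h) (ann B hB p 𝒜 h) true n (Y v)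
  right : ∀ h ∈ LinearMap.ker p, ∀ (n : ℕ) v, Y (heis B hB p 𝒜 (-(n : ℤ) - 1) h v) =
    normS (cre B hB p 𝒜 h) (ann B hB p 𝒜 h) false n (Y v)

/-- The operator assigned to h(-n-1) is the holomorphic normal ordering for ph plus the
antiholomorphic one for (1 - p)h. These commute for all h and n, so freeness applies. -/
theorem exists_isVertexField {p : Module.End ℝ H} (hp : p ∈ projections B) :
    ∃ Y, IsVertexField B hB p 𝒜 Y := by
  obtain ⟨T, h1, h2⟩ := exists_creation_lift B hB p 𝒜 (X := fieldSpace (Induced B hB p 𝒜))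
    (fun n => (curHom B hB p 𝒜 true n).comp p.toAddMonoidHom +
      (curHom B hB p 𝒜 false n).comp (1 - p : Module.End ℝ H).toAddMonoidHom)
    (fun n r h => by
      simp only [AddMonoidHom.add_apply, AddMonoidHom.comp_apply, LinearMap.toAddMonoidHom_coe]
      rw [LinearMap.map_smul p, LinearMap.map_smul (1 - p), curHom_smul, curHom_smul, smul_add])
    (fun n m h k φ => by
      simp only [AddMonoidHom.add_apply, AddMonoidHom.comp_apply, LinearMap.toAddMonoidHom_coe,
        LinearMap.add_apply, map_add, curHom_comm B hB p 𝒜 _ _ n m]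
      abel)
    (gradedLift 𝒜 fun α => ((baseField B hB p 𝒜 α).codRestrict (fieldSpace _)
      fun a => baseField_isField B hB 𝒜 hp α a) ∘ₗ (𝒜 α).subtype)
  refine ⟨(fieldSpace _).subtype ∘ₗ T, fun v => (T v).2, fun α a ha β w hw x y => ?_,
    fun h hh n v => ?_, fun h hh n v => ?_⟩
  · rw [LinearMap.comp_apply, h1, gradedLift_apply 𝒜 _ ha]
    exact baseField_apply B hB p 𝒜 α a x y hw
  · have e1 : p h = h := left_proj p hh
    have e2 : (1 - p) h = 0 := hh
    rw [LinearMap.comp_apply, h2]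
    simp only [AddMonoidHom.add_apply, AddMonoidHom.comp_apply, LinearMap.toAddMonoidHom_coe, e1,
      e2, map_zero, add_zero]
    rfl
  · have e1 : p h = 0 := hh
    have e2 : (1 - p) h = h := by rw [LinearMap.sub_apply, e1, sub_zero]; rfl
    rw [LinearMap.comp_apply, h2]
    simp only [AddMonoidHom.add_apply, AddMonoidHom.comp_apply, LinearMap.toAddMonoidHom_coe, e1,
      e2, map_zero, zero_add]
    rfl

end Construction

end
end AHVertex

open scoped TensorProduct
namespace AHVertex
noncomputable section

/-! ## Commutators of currents and fields -/

section Commutator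

variable {F : Type*} [AddCommGroup F] [Module ℂ F]

/-- The commutator formula `[c_m, Y(v, z)] = ∑ (m choose j) Y(c_j v, z) z^(m-j)`, where `z` stands
for `z̄` if `ε = false`. -/
def HasCommutator (ε : Bool) (c : ℤ → Module.End ℂ F) (Y : F →ₗ[ℂ] OpSeries F) (v : F) : Prop :=
  ∀ (m : ℤ) (x y : ℝ) (w : F), EvSum (fun j : ℕ => Ring.choose (m : ℂ) j •
    Y (c j v) (x - (dir ε).1 * (m - j)) (y - (dir ε).2 * (m - j)) w)
    (c m (Y v x y w) - Y v x y (c m w))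

/-- The central part of [c_m, d(-n-1)] reappears on the other side through the modes of the current
of d: for m > 0 from its creation operator l = m - 1, for m ≤ 0 from its annihilation operator l =
-m. For currents of opposite chirality κ vanishes. -/
theorem central_terms (φ : OpSeries F) (ε ε' : Bool) (κ : ℂ) (hκ : ε ≠ ε' → κ = 0) (m : ℤ) (n : ℕ)
    (x y : ℝ) (w : F) : ∃ K₁ K₂ : F,
    EvSum (fun l : ℕ => Ring.choose (l : ℂ) n • (if m + (-(l : ℤ) - 1) = 0 then (m : ℂ) * κ else 0) •
      φ (x - (dir ε').1 * (l - n)) (y - (dir ε').2 * (l - n)) w) K₁ ∧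
    EvSum (fun l : ℕ => Ring.choose (-(l : ℂ) - 1) n •
      (if m + (l : ℤ) = 0 then (m : ℂ) * κ else 0) •
      φ (x + (dir ε').1 * (l + 1 + n)) (y + (dir ε').2 * (l + 1 + n)) w) K₂ ∧
    Ring.choose (m : ℂ) (n + 1) • (((n : ℂ) + 1) * κ) •
      φ (x - (dir ε).1 * (m - (n + 1))) (y - (dir ε).2 * (m - (n + 1))) w = K₁ + K₂ := by
  by_cases h : ε = ε'
  · subst h
    have h0 := succ_mul_choose (m : ℂ) n
    rcases lt_or_ge 0 m with hm | hm
    · obtain ⟨l, rfl⟩ : ∃ l : ℕ, m = l + 1 := ⟨(m - 1).toNat, by omega⟩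
      refine ⟨_, 0, EvSum.single l fun i hi => ?_, EvSum.of_eq_zero fun i => ?_, ?_⟩
      · rw [if_neg (by omega), zero_smul, smul_zero]
      · rw [if_neg (by omega), zero_smul, smul_zero]
      · rw [if_pos (by omega), add_zero, smul_smul, smul_smul]
        congr 1
        · push_cast at h0 ⊢
          rw [add_sub_cancel_right] at h0
          linear_combination κ * h0
        · push_cast; congr 2 <;> ring
    · obtain ⟨l, rfl⟩ : ∃ l : ℕ, m = -l := ⟨(-m).toNat, by omega⟩
      refine ⟨0, _, EvSum.of_eq_zero fun i => ?_, EvSum.single l fun i hi => ?_, ?_⟩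
      · rw [if_neg (by omega), zero_smul, smul_zero]
      · rw [if_neg (by omega), zero_smul, smul_zero]
      · rw [if_pos (by omega), zero_add, smul_smul, smul_smul]
        congr 1
        · push_cast at h0 ⊢
          linear_combination κ * h0
        · push_cast; congr 2 <;> ring
  · have h0 := hκ h
    subst h0
    exact ⟨0, 0, EvSum.of_eq_zero fun i => by simp, EvSum.of_eq_zero fun i => by simp, by simp⟩

/-- Commuting c_m with a normally ordered product acts on each factor in turn. On the field it gives
the formula for v; on the current it gives the scalars of `central_terms`, which match the central
term of c_j d(-n-1)v at j = n + 1. -/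
theorem HasCommutator.creation {ε ε' : Bool} {c d : ℤ → Module.End ℂ F} {κ : ℂ}
    (hcd : ∀ m k v, c m (d k v) = d k (c m v) + (if m + k = 0 then (m : ℂ) * κ else 0) • v)
    (hκ : ε ≠ ε' → κ = 0) (hc : LocFin fun n : ℕ => c n) (hd : LocFin fun n : ℕ => d n)
    {Y : F →ₗ[ℂ] OpSeries F} (hY : ∀ v, IsField (Y v))
    (hn : ∀ (n : ℕ) v, Y (d (-(n : ℤ) - 1) v) =
      normS (fun m => d (-(m : ℤ) - 1)) (fun m => d m) ε' n (Y v))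
    {v : F} (hv : HasCommutator ε c Y v) (n : ℕ) :
    HasCommutator ε c Y (d (-(n : ℤ) - 1) v) := by
  intro m x y w
  obtain ⟨J, hJ⟩ := hc v
  have hz (j : ℕ) (hj : J ≤ j) (x y w) : Y (c j v) x y w = 0 := by rw [hJ j hj, map_zero]; rfl
  obtain ⟨K₁, K₂, hK₁, hK₂, hK⟩ := central_terms (Y v) ε ε' κ hκ m n x y w
  have hL := lmulS_evSum (fun m => d (-(m : ℤ) - 1)) ε' n (hY v) x y
  have hR := rmulS_evSum hd ε' n (Y v) x y
  set L := lmulS (fun m => d (-(m : ℤ) - 1)) ε' n (Y v) x y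
  set R := rmulS (fun m : ℕ => d m) ε' n (Y v) x y
  have e1 : EvSum (fun j : ℕ => Ring.choose (m : ℂ) j •
      lmulS (fun m => d (-(m : ℤ) - 1)) ε' n (Y (c j v)) (x - (dir ε).1 * (m - j))
        (y - (dir ε).2 * (m - j)) w) (c m (L w) - K₁ - L (c m w)) := by
    refine EvSum.comm (a := fun l j : ℕ => Ring.choose (m : ℂ) j • Ring.choose (l : ℂ) n •
      d (-(l : ℤ) - 1) (Y (c j v) (x - (dir ε).1 * (m - j) - (dir ε').1 * (l - n))
        (y - (dir ε).2 * (m - j) - (dir ε').2 * (l - n)) w)) ?_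
      (r := fun l : ℕ => Ring.choose (l : ℂ) n • d (-(l : ℤ) - 1)
        (c m (Y v (x - (dir ε').1 * (l - n)) (y - (dir ε').2 * (l - n)) w) -
          Y v (x - (dir ε').1 * (l - n)) (y - (dir ε').2 * (l - n)) (c m w))) ?_ ?_ ?_
    -- Joint finiteness: c_j v vanishes for j ≥ J, and for each of the finitely many other j
    -- truncation bounds l.
    · have h1 : ∀ J : ℕ, ∃ N, ∀ l j : ℕ, N ≤ l → j < J →
          Y (c j v) (x - (dir ε).1 * (m - j) - (dir ε').1 * (l - n))
          (y - (dir ε).2 * (m - j) - (dir ε').2 * (l - n)) w = 0 := by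
        intro J
        induction J with
        | zero => exact ⟨0, fun l j _ h => absurd h (by omega)⟩
        | succ J ih =>
          obtain ⟨N, hN⟩ := ih
          obtain ⟨M, hM⟩ := hY (c J v) w
          obtain ⟨M', hM'⟩ := exists_nat_shift ε' (x - (dir ε).1 * (m - J))
            (y - (dir ε).2 * (m - J)) M n
          refine ⟨max N M', fun l j hl hj => ?_⟩
          rcases Nat.lt_succ_iff_lt_or_eq.1 hj with hj | rfl
          · exact hN l j (le_of_max_le_left hl) hj
          · exact hM _ _ (hM' l (le_of_max_le_right hl))
      obtain ⟨N, hN⟩ := h1 J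
      refine ⟨max N J, fun l j h => ?_⟩
      rcases lt_or_ge j J with hj | hj
      · rcases h with h | h
        · rw [hN l j (le_of_max_le_left h) hj, map_zero, smul_zero, smul_zero]
        · exact absurd (le_of_max_le_right h) (by omega)
      · rw [hz j hj, map_zero, smul_zero, smul_zero]
    · intro l
      refine ((hv m (x - (dir ε').1 * (l - n)) (y - (dir ε').2 * (l - n)) w).mapₗ
        (Ring.choose (l : ℂ) n • d (-(l : ℤ) - 1))).congr (fun j => ?_) rfl
      rw [map_smul]
      congr 2
      simp only [sub_right_comm]
      rfl
    · intro j
      exact (lmulS_evSum (fun m => d (-(m : ℤ) - 1)) ε' n (hY (c j v)) (x - (dir ε).1 * (m - j))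
        (y - (dir ε).2 * (m - j)) w).smul _
    · refine ((((hL w).mapₗ (c m)).sub hK₁).sub (hL (c m w))).congr (fun l => ?_) rfl
      rw [map_smul, hcd, map_sub, smul_sub, smul_add]
      abel
  have e2 : EvSum (fun j : ℕ => Ring.choose (m : ℂ) j •
      rmulS (fun m : ℕ => d m) ε' n (Y (c j v)) (x - (dir ε).1 * (m - j))
        (y - (dir ε).2 * (m - j)) w) (c m (R w) - K₂ - R (c m w)) := by
    refine EvSum.comm (a := fun l j : ℕ => Ring.choose (m : ℂ) j • Ring.choose (-(l : ℂ) - 1) n •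
      Y (c j v) (x - (dir ε).1 * (m - j) + (dir ε').1 * (l + 1 + n))
        (y - (dir ε).2 * (m - j) + (dir ε').2 * (l + 1 + n)) (d l w)) ?_
      (r := fun l : ℕ => Ring.choose (-(l : ℂ) - 1) n •
        (c m (Y v (x + (dir ε').1 * (l + 1 + n)) (y + (dir ε').2 * (l + 1 + n)) (d l w)) -
          Y v (x + (dir ε').1 * (l + 1 + n)) (y + (dir ε').2 * (l + 1 + n)) (c m (d l w)))) ?_ ?_ ?_
    · obtain ⟨N, hN⟩ := hd w
      refine ⟨max N J, fun l j h => ?_⟩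
      rcases h with h | h
      · have := hN l (le_of_max_le_left h)
        dsimp only at this
        rw [this, map_zero, smul_zero, smul_zero]
      · rw [hz j (le_of_max_le_right h), smul_zero, smul_zero]
    · intro l
      refine ((hv m (x + (dir ε').1 * (l + 1 + n)) (y + (dir ε').2 * (l + 1 + n)) (d l w)).smul
        (Ring.choose (-(l : ℂ) - 1) n)).congr (fun j => ?_) rfl
      rw [smul_comm, sub_add_eq_add_sub, sub_add_eq_add_sub]
    · intro j
      exact (rmulS_evSum hd ε' n (Y (c j v)) (x - (dir ε).1 * (m - j))
        (y - (dir ε).2 * (m - j)) w).smul _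
    · refine ((((hR w).mapₗ (c m)).sub hK₂).sub (hR (c m w))).congr (fun l => ?_) rfl
      rw [map_smul, hcd, map_add, map_smul, smul_sub, smul_add]
      abel
  have e3 : EvSum (fun j : ℕ => Ring.choose (m : ℂ) j •
      (if (j : ℤ) + (-(n : ℤ) - 1) = 0 then (j : ℂ) * κ else 0) •
        Y v (x - (dir ε).1 * (m - j)) (y - (dir ε).2 * (m - j)) w) (K₁ + K₂) := by
    refine (EvSum.single (n + 1) fun j hj => ?_).congr (fun _ => rfl) ?_
    · rw [if_neg (by omega), zero_smul, smul_zero]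
    · rw [if_pos (by omega), ← hK]
      push_cast
      rfl
  refine ((e1.add e2).add e3).congr (fun j => ?_) ?_
  · have e4 := hcd j (-(n : ℤ) - 1) v
    rw [e4, map_add, map_smul, hn, normS, ← smul_add, ← smul_add]
    split_ifs <;> simp
  · rw [hn, normS]
    change _ = c m (L w + R w) - (L (c m w) + R (c m w))
    rw [map_add]
    abel

end Commutator

section VertexField

variable {H : Type*} [AddCommGroup H] [Module ℝ H] {A : Type*} [Ring A] [Algebra ℂ A]
variable {B : LinearMap.BilinForm ℝ H} {hB : B.IsSymm} {p : Module.End ℝ H}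
variable {𝒜 : H → Submodule ℂ A} [DecidableEq H] [GradedAlgebra 𝒜]
variable {Y : Induced B hB p 𝒜 →ₗ[ℂ] OpSeries (Induced B hB p 𝒜)}

theorem HasCommutator.add {F : Type*} [AddCommGroup F] [Module ℂ F] {ε : Bool}
    {c : ℤ → Module.End ℂ F} {Y : F →ₗ[ℂ] OpSeries F} {v w : F} (hv : HasCommutator ε c Y v)
    (hw : HasCommutator ε c Y w) : HasCommutator ε c Y (v + w) := fun m x y u => by
  refine ((hv m x y u).add (hw m x y u)).congr (fun j => ?_) ?_
  · simp
  · simp only [map_add, Pi.add_apply, LinearMap.add_apply]; abel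

theorem HasCommutator.smul {F : Type*} [AddCommGroup F] [Module ℂ F] {ε : Bool}
    {c : ℤ → Module.End ℂ F} {Y : F →ₗ[ℂ] OpSeries F} {v : F} (r : ℂ)
    (hv : HasCommutator ε c Y v) : HasCommutator ε c Y (r • v) := fun m x y u => by
  refine ((hv m x y u).smul r).congr (fun j => ?_) ?_
  · simp [smul_comm r]
  · simp [smul_sub]

theorem HasCommutator.zero {F : Type*} [AddCommGroup F] [Module ℂ F] {ε : Bool}
    {c : ℤ → Module.End ℂ F} {Y : F →ₗ[ℂ] OpSeries F} : HasCommutator ε c Y 0 :=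
  fun m x y u => EvSum.zero.congr (fun j => by simp) (by simp)

/-- The chirality condition on vectors of `H`. -/
def IsChiral (p : Module.End ℝ H) : Bool → H → Prop
  | true, h => h ∈ LinearMap.ker (1 - p)
  | false, h => h ∈ LinearMap.ker p

theorem IsVertexField.chiral (hY : IsVertexField B hB p 𝒜 Y) {ε : Bool} {h : H}
    (hh : IsChiral p ε h) (n : ℕ) (v) : Y (heis B hB p 𝒜 (-(n : ℤ) - 1) h v) =
      normS (cre B hB p 𝒜 h) (ann B hB p 𝒜 h) ε n (Y v) := by
  cases ε
  · exact hY.right h hh n v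
  · exact hY.left h hh n v

theorem twistedForm_chiral (B : LinearMap.BilinForm ℝ H) {ε ε' : Bool} {h k : H}
    (hh : IsChiral p ε h) (hk : IsChiral p ε' k) (hε : ε ≠ ε') : twistedForm B p h k = 0 := by
  cases ε <;> cases ε'
  · exact absurd rfl hε
  · exact twistedForm_right_left B p hk hh
  · exact twistedForm_left_right B p hh hk
  · exact absurd rfl hε

theorem chiral_induction (hp : p ∈ projections B) {C : Induced B hB p 𝒜 → Prop}
    (incl : ∀ α, ∀ a ∈ 𝒜 α, C (incl B hB p 𝒜 a))
    (heis : ∀ (n : ℕ) (ε : Bool) h, IsChiral p ε h → ∀ v, C v →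
      C (heis B hB p 𝒜 (-(n : ℤ) - 1) h v))
    (zero : C 0) (add : ∀ v w, C v → C w → C (v + w)) (smul : ∀ (r : ℂ) v, C v → C (r • v)) (v) :
    C v := by
  refine create_induction B hB p 𝒜 incl (fun n h v hv => ?_) zero add smul v
  have e : AHVertex.heis B hB p 𝒜 (-(n : ℤ) - 1) h =
      AHVertex.heis B hB p 𝒜 (-(n : ℤ) - 1) (p h) +
        AHVertex.heis B hB p 𝒜 (-(n : ℤ) - 1) ((1 - p) h) := by
    rw [← heis_add, LinearMap.sub_apply, Module.End.one_apply, add_sub_cancel]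
  rw [e]
  exact add _ _ (heis n true _ (proj_mem_left B hp h) v hv)
    (heis n false _ (proj_mem_right B hp h) v hv)

theorem IsChiral.twistedForm_eq {h : H} (hh : IsChiral p true h) (hp : p ∈ projections B) (α : H) :
    twistedForm B p h α = twistedForm B p h (p α) := by
  have h1 := twistedForm_left_right B p hh (proj_mem_right B hp α)
  rw [LinearMap.sub_apply, map_sub, Module.End.one_apply, sub_eq_zero] at h1
  exact h1

theorem IsChiral.twistedForm_eq_right {h : H} (hh : IsChiral p false h) (hp : p ∈ projections B)
    (α : H) : twistedForm B p h α = twistedForm B p h ((1 - p) α) := by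
  have h1 := twistedForm_right_left B p (proj_mem_left B hp α) hh
  rw [LinearMap.sub_apply, map_sub, Module.End.one_apply, h1, sub_zero]

/-- Elements of A are primary. For m ≠ 0 the scalar comes from the exponential of the chirality of
h, for m = 0 from the shift of charge. -/
theorem IsVertexField.incl_comm (hY : IsVertexField B hB p 𝒜 Y) (hp : p ∈ projections B)
    {ε : Bool} {h : H} (hh : IsChiral p ε h) {α : H} {a : A} (ha : a ∈ 𝒜 α) (m : ℤ) (x y : ℝ)
    (w : Induced B hB p 𝒜) : heis B hB p 𝒜 m h (Y (incl B hB p 𝒜 a) x y w) =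
      Y (incl B hB p 𝒜 a) x y (heis B hB p 𝒜 m h w) + (twistedForm B p h α : ℂ) •
        Y (incl B hB p 𝒜 a) (x - (dir ε).1 * m) (y - (dir ε).2 * m) w := by
  induction w using sector_span with
  | zero => simp
  | add v w hv hw => rw [map_add, map_add, hv, hw, map_add, map_add, map_add, smul_add]; abel
  | sector β w hw =>
    rw [hY.base α a ha β w hw, hY.base α a ha β _ (heis_mem_sector B hB p 𝒜 hw m h),
      hY.base α a ha β w hw]
    by_cases hm : m = 0
    · subst hm
      rw [heis_zero_vl, heis_zero_vl, lmap_heis_zero B hB p 𝒜 ha, map_sub, map_sub, map_smul,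
        map_smul]
      simp
    · rw [lmap_heis B hB p 𝒜 a hm]
      cases ε
      · rw [heis_vl_comm B hB p 𝒜 (twistedForm_chiral B hh (ε' := true) (proj_mem_left B hp α)
          (by simp)), heis_vl B hB p 𝒜 hm, ← IsChiral.twistedForm_eq_right hh hp, map_add, map_smul]
        simp only [dir, one_mul, zero_mul, sub_zero, sub_right_comm]
      · rw [heis_vl B hB p 𝒜 hm, heis_vl_comm B hB p 𝒜 (twistedForm_chiral B hh (ε' := false)
          (proj_mem_right B hp α) (by simp)), ← IsChiral.twistedForm_eq hh hp]
        simp only [dir, one_mul, zero_mul, sub_zero, sub_right_comm]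

theorem IsVertexField.hasCommutator (hY : IsVertexField B hB p 𝒜 Y) (hp : p ∈ projections B)
    {ε : Bool} {h : H} (hh : IsChiral p ε h) (v : Induced B hB p 𝒜) :
    HasCommutator ε (fun m => heis B hB p 𝒜 m h) Y v := by
  refine chiral_induction hp ?_ ?_ HasCommutator.zero (fun v w => HasCommutator.add)
    (fun r v => HasCommutator.smul r) v
  · intro α a ha m x y w
    refine (EvSum.single 0 fun j hj => ?_).congr (fun _ => rfl) ?_
    · rw [heis_incl_pos B hB p 𝒜 (by omega), map_zero]; simp
    · rw [hY.incl_comm hp hh ha, add_sub_cancel_left, Nat.cast_zero,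
        heis_zero_incl B hB p 𝒜 h α ha, map_smul]
      simp
  · intro n ε' k hk v hv
    exact hv.creation (d := fun m => heis B hB p 𝒜 m k) (κ := twistedForm B p h k)
      (fun m l v => heis_comm_apply B hB p 𝒜 m l h k v)
      (fun hε => by rw [twistedForm_chiral B hh hk hε, Complex.ofReal_zero])
      (heis_locFin B hB p 𝒜 h) (heis_locFin B hB p 𝒜 k) hY.isField (hY.chiral hk) n

end VertexField

end
end AHVertex

open scoped TensorProduct
namespace AHVertex
noncomputable section

/-! ## Comparison with the normal ordering formulas -/

section Compare

/-- The bridge to the products in the definition of the vertex operators, which are `finsum`s over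
pairs of real exponents supported on a sequence of points. -/
theorem finsum_of_evSum {E X : Type*} [AddCommGroup E] {f : X → E} {i : ℕ → X} {s : E}
    (hi : Function.Injective i) (hf : ∀ q, f q ≠ 0 → ∃ m, i m = q)
    (h : EvSum (fun m => f (i m)) s) : ∑ᶠ q, f q = s := by
  classical
  obtain ⟨N, hN⟩ := h.eventually_zero
  rw [finsum_eq_finset_sum_of_support_subset (s := (Finset.range N).image i), Finset.sum_image
    fun _ _ _ _ h => hi h]
  · exact (EvSum.of_zero hN).unique h
  · intro q hq
    obtain ⟨m, rfl⟩ := hf q hq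
    rw [Finset.coe_image]
    refine ⟨m, ?_, rfl⟩
    by_contra hm
    exact hq (hN m (by simpa using hm))

theorem choose_succ_mul (t : ℂ) (n : ℕ) :
    ((n : ℂ) + 1) * Ring.choose t (n + 1) = (t - n) * Ring.choose t n := by
  have := Ring.choose_smul_choose t (n := n + 1) (k := n) (by omega)
  rw [Nat.choose_succ_self_right, nsmul_eq_mul, Nat.add_sub_cancel_left,
    Ring.choose_one_right] at this
  push_cast at this
  rw [this, mul_comm]

variable {F : Type*} [AddCommGroup F] [Module ℂ F]

/-- `d/dz`, or `d/dz̄` if `ε = false`. -/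
def ddS (ε : Bool) : OpSeries F → OpSeries F := cond ε ddz ddzbar

/-- Each derivative multiplies by the next exponent, so the n-th divided derivative multiplies by a
binomial coefficient in the exponent of the chosen chirality. -/
theorem ddS_iterate (ε : Bool) (S : OpSeries F) (n : ℕ) (x y : ℝ) :
    ((n.factorial : ℂ)⁻¹ • (ddS ε)^[n] S) x y =
      Ring.choose ((((dir ε).1 * x + (dir ε).2 * y : ℝ) : ℂ) + n) n •
        S (x + (dir ε).1 * n) (y + (dir ε).2 * n) := by
  induction n generalizing x y with
  | zero => simp
  | succ n ih =>
    have h1 : ((n : ℂ) + 1) • (((n + 1).factorial : ℂ)⁻¹ • (ddS ε)^[n + 1] S) x y =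
        ddS ε ((n.factorial : ℂ)⁻¹ • (ddS ε)^[n] S) x y := by
      rw [Function.iterate_succ_apply']
      have h0 : (n.factorial : ℂ) ≠ 0 := by exact_mod_cast n.factorial_ne_zero
      have h2 : (n : ℂ) + 1 ≠ 0 := Nat.cast_add_one_ne_zero n
      have h3 : ((n : ℂ) + 1) * ((n + 1).factorial : ℂ)⁻¹ = (n.factorial : ℂ)⁻¹ := by
        rw [Nat.factorial_succ]; push_cast; field_simp
      generalize (ddS ε)^[n] S = X
      rw [Pi.smul_apply, Pi.smul_apply, smul_smul, h3]
      cases ε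
      · exact smul_comm _ ((y + 1 : ℝ) : ℂ) (X x (y + 1))
      · exact smul_comm _ ((x + 1 : ℝ) : ℂ) (X (x + 1) y)
    refine eq_of_succ_smul n (h1.trans ?_)
    cases ε
    · change ((y + 1 : ℝ) : ℂ) • _ = _
      rw [ih, smul_smul, smul_smul, choose_succ_mul]
      simp only [dir]
      push_cast
      congr 1
      · ring_nf
      · congr 1 <;> ring
    · change ((x + 1 : ℝ) : ℂ) • _ = _
      rw [ih, smul_smul, smul_smul, choose_succ_mul]
      simp only [dir]
      push_cast
      congr 1
      · ring_nf
      · congr 1 <;> ring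

end Compare

section VertexOperator

variable {H : Type*} [AddCommGroup H] [Module ℝ H] {A : Type*} [Ring A] [Algebra ℂ A]
variable {B : LinearMap.BilinForm ℝ H} {hB : B.IsSymm} {p : Module.End ℝ H}
variable {𝒜 : H → Submodule ℂ A} [DecidableEq H] [GradedAlgebra 𝒜]

open Classical in
theorem finsum_single_natExt {E : Type*} [AddCommGroup E] (g : ℕ → E) (x : ℝ) :
    (∑ᶠ n : ℕ, if x = (n : ℝ) then g n else 0) = natExt g x := by
  by_cases hx : ∃ n : ℕ, x = n
  · obtain ⟨n, rfl⟩ := hx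
    rw [natExt_natCast, finsum_eq_single _ n fun m hm => if_neg fun h => hm
      (by exact_mod_cast h.symm), if_pos rfl]
  · push Not at hx
    rw [natExt_of_ne hx]
    simp [hx]

open Classical in
theorem hMinus_chiral {ε : Bool} {h : H} (hh : IsChiral p ε h) (x y : ℝ) :
    hMinus B hB p 𝒜 h x y = if (dir ε).2 * x + (dir ε).1 * y = 0 then
      natExt (cre B hB p 𝒜 h) ((dir ε).1 * x + (dir ε).2 * y) else 0 := by
  cases ε
  · have e1 : p h = 0 := hh
    have e2 : (1 - p) h = h := by rw [LinearMap.sub_apply, e1, sub_zero]; rfl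
    simp only [hMinus, e1, e2, heis_zero_right, dir, one_mul, zero_mul, zero_add, add_zero,
      ite_self]
    split_ifs with h0
    · simp only [h0, true_and]; exact finsum_single_natExt (cre B hB p 𝒜 h) y
    · simp [h0]
  · have e1 : p h = h := left_proj p hh
    have e2 : (1 - p) h = 0 := hh
    simp only [hMinus, e1, e2, heis_zero_right, dir, one_mul, zero_mul, zero_add, add_zero,
      ite_self]
    split_ifs with h0
    · simp only [h0, and_true]; exact finsum_single_natExt (cre B hB p 𝒜 h) x
    · simp [h0]

open Classical in
theorem hPlus_chiral {ε : Bool} {h : H} (hh : IsChiral p ε h) (x y : ℝ) :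
    hPlus B hB p 𝒜 h x y = if (dir ε).2 * x + (dir ε).1 * y = 0 then
      natExt (ann B hB p 𝒜 h) (-((dir ε).1 * x + (dir ε).2 * y) - 1) else 0 := by
  have e (x : ℝ) (n : ℕ) : x = -(n : ℝ) - 1 ↔ -x - 1 = n := by
    constructor <;> intro h <;> linarith
  cases ε
  · have e1 : p h = 0 := hh
    have e2 : (1 - p) h = h := by rw [LinearMap.sub_apply, e1, sub_zero]; rfl
    simp only [hPlus, e1, e2, heis_zero_right, dir, one_mul, zero_mul, zero_add, add_zero,
      ite_self, e]
    split_ifs with h0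
    · simp only [h0, true_and]; exact finsum_single_natExt (ann B hB p 𝒜 h) _
    · simp [h0]
  · have e1 : p h = h := left_proj p hh
    have e2 : (1 - p) h = 0 := hh
    simp only [hPlus, e1, e2, heis_zero_right, dir, one_mul, zero_mul, zero_add, add_zero,
      ite_self, e]
    split_ifs with h0
    · simp only [h0, and_true]; exact finsum_single_natExt (ann B hB p 𝒜 h) _
    · simp [h0]

theorem opMul_hMinus {ε : Bool} {h : H} (hh : IsChiral p ε h) (n : ℕ)
    {φ : OpSeries (Induced B hB p 𝒜)} (hφ : IsField φ) (x y : ℝ) (w) :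
    opMul ((n.factorial : ℂ)⁻¹ • (ddS ε)^[n] (hMinus B hB p 𝒜 h)) φ x y w =
      lmulS (cre B hB p 𝒜 h) ε n φ x y w := by
  refine finsum_of_evSum (i := fun m : ℕ =>
    (((dir ε).1 * ((m : ℝ) - n), (dir ε).2 * ((m : ℝ) - n)) : ℝ × ℝ)) (fun i j hij => ?_)
    (fun q hq => ?_) ((lmulS_evSum (cre B hB p 𝒜 h) ε n hφ x y w).congr (fun m => ?_) rfl)
  · cases ε <;> simpa [dir] using hij
  · rw [ddS_iterate, hMinus_chiral hh] at hq
    have h1 : (dir ε).2 * (q.1 + (dir ε).1 * n) + (dir ε).1 * (q.2 + (dir ε).2 * n) = 0 := by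
      by_contra h0
      rw [if_neg h0] at hq
      simp at hq
    rw [if_pos h1] at hq
    obtain ⟨m, hm⟩ := natExt_ne_zero (g := cre B hB p 𝒜 h) fun h0 => hq (by rw [h0]; simp)
    refine ⟨m, ?_⟩
    cases ε <;> simp only [dir, one_mul, zero_mul, zero_add, add_zero] at h1 hm ⊢ <;>
      ext <;> simp <;> linarith
  · rw [ddS_iterate, hMinus_chiral hh, if_pos (by cases ε <;> simp [dir]),
      show (dir ε).1 * ((dir ε).1 * ((m : ℝ) - n) + (dir ε).1 * n) +
        (dir ε).2 * ((dir ε).2 * ((m : ℝ) - n) + (dir ε).2 * n) = m by cases ε <;> simp [dir],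
      show (dir ε).1 * ((dir ε).1 * ((m : ℝ) - n)) +
        (dir ε).2 * ((dir ε).2 * ((m : ℝ) - n)) = m - n by cases ε <;> simp [dir], natExt_natCast]
    simp

theorem opMul_hPlus {ε : Bool} {h : H} (hh : IsChiral p ε h) (n : ℕ)
    (φ : OpSeries (Induced B hB p 𝒜)) (x y : ℝ) (w) :
    opMul φ ((n.factorial : ℂ)⁻¹ • (ddS ε)^[n] (hPlus B hB p 𝒜 h)) x y w =
      rmulS (ann B hB p 𝒜 h) ε n φ x y w := by
  refine finsum_of_evSum (i := fun m : ℕ =>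
    ((x + (dir ε).1 * ((m : ℝ) + 1 + n), y + (dir ε).2 * ((m : ℝ) + 1 + n)) : ℝ × ℝ))
    (fun i j hij => ?_) (fun q hq => ?_)
    ((rmulS_evSum (ann_locFin B hB p 𝒜 h) ε n φ x y w).congr (fun m => ?_) rfl)
  · cases ε <;> simpa [dir] using hij
  · rw [ddS_iterate, hPlus_chiral hh] at hq
    have h1 : (dir ε).2 * (x - q.1 + (dir ε).1 * n) + (dir ε).1 * (y - q.2 + (dir ε).2 * n) = 0 := by
      by_contra h0
      rw [if_neg h0] at hq
      simp at hq
    rw [if_pos h1] at hq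
    obtain ⟨m, hm⟩ := natExt_ne_zero (g := ann B hB p 𝒜 h) fun h0 => hq (by rw [h0]; simp)
    refine ⟨m, ?_⟩
    cases ε <;> simp only [dir, one_mul, zero_mul, zero_add, add_zero] at h1 hm ⊢ <;>
      ext <;> simp <;> linarith
  · rw [ddS_iterate, hPlus_chiral hh, if_pos (by cases ε <;> simp [dir]),
      show -((dir ε).1 * (x - (x + (dir ε).1 * ((m : ℝ) + 1 + n)) + (dir ε).1 * n) +
        (dir ε).2 * (y - (y + (dir ε).2 * ((m : ℝ) + 1 + n)) + (dir ε).2 * n)) - 1 = m by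
        cases ε <;> simp [dir],
      show (dir ε).1 * (x - (x + (dir ε).1 * ((m : ℝ) + 1 + n))) +
        (dir ε).2 * (y - (y + (dir ε).2 * ((m : ℝ) + 1 + n))) = -m - 1 - n by
        cases ε <;> simp [dir] <;> ring_nf, natExt_natCast]
    simp

/-- The modes of a field map. -/
def modes {F : Type*} [AddCommGroup F] [Module ℂ F] (Y : F →ₗ[ℂ] OpSeries F) :
    F →ₗ[ℂ] (ℝ → ℝ → Module.End ℂ F) where
  toFun v r s := Y v (-r - 1) (-s - 1)
  map_add' v w := by simp only [map_add]; rfl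
  map_smul' r v := by simp only [map_smul]; rfl

theorem fieldSeries_modes {F : Type*} [AddCommGroup F] [Module ℂ F] (Y : F →ₗ[ℂ] OpSeries F)
    (v : F) : fieldSeries (modes Y) v = Y v := by
  funext x y
  change Y v (-(-x - 1) - 1) (-(-y - 1) - 1) = Y v x y
  congr 1 <;> ring

theorem IsVertexField.isVertexOperator {Y : Induced B hB p 𝒜 →ₗ[ℂ] OpSeries (Induced B hB p 𝒜)}
    (hY : IsVertexField B hB p 𝒜 Y) (hp : p ∈ projections B) :
    IsVertexOperator B hB p 𝒜 (modes Y) := by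
  refine ⟨fun α a ha β b hb L x y => ?_, fun h hh n v x y w => ?_, fun h hh n v x y w => ?_⟩
  · rw [fieldSeries_modes, opMul_exp B hB 𝒜 hp, hY.base α a ha β _
      (create_mem_sector B hB p 𝒜 L (incl_mem_sector B hB p 𝒜 hb)), lmap_create, lmap_incl]
  · rw [fieldSeries_modes, fieldSeries_modes, hY.left h hh]
    have e1 := opMul_hMinus (B := B) (hB := hB) (𝒜 := 𝒜) (p := p) (ε := true) hh n (hY.isField v)
      x y w
    have e2 := opMul_hPlus (B := B) (hB := hB) (𝒜 := 𝒜) (p := p) (ε := true) hh n (Y v) x y w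
    exact (congrArg₂ (· + ·) e1 e2).symm
  · rw [fieldSeries_modes, fieldSeries_modes, hY.right h hh]
    have e1 := opMul_hMinus (B := B) (hB := hB) (𝒜 := 𝒜) (p := p) (ε := false) hh n (hY.isField v)
      x y w
    have e2 := opMul_hPlus (B := B) (hB := hB) (𝒜 := 𝒜) (p := p) (ε := false) hh n (Y v) x y w
    exact (congrArg₂ (· + ·) e1 e2).symm

/-- The induction is on the vector with the list L arbitrary: an operator peeled off the vector is
appended at the end of the list. -/
theorem create_ext {X : Type*} [AddCommGroup X] [Module ℂ X] {f g : Induced B hB p 𝒜 →ₗ[ℂ] X}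
    (h : ∀ β, ∀ b ∈ 𝒜 β, ∀ L, f (create B hB p 𝒜 L (incl B hB p 𝒜 b)) =
      g (create B hB p 𝒜 L (incl B hB p 𝒜 b))) : f = g := by
  have hc (L : List (ℕ × H)) : ∃ T : Module.End ℂ (Induced B hB p 𝒜),
      ∀ v, T v = create B hB p 𝒜 L v := by
    induction L with
    | nil => exact ⟨1, fun v => rfl⟩
    | cons q L ih =>
      obtain ⟨T, hT⟩ := ih
      exact ⟨heis B hB p 𝒜 (-(q.1 : ℤ) - 1) q.2 * T, fun v => by
        rw [Module.End.mul_apply, hT]; rfl⟩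
  suffices ∀ w L, f (create B hB p 𝒜 L w) = g (create B hB p 𝒜 L w) from
    LinearMap.ext fun w => this w []
  intro w
  induction w using create_induction with
  | zero => intro L; obtain ⟨T, hT⟩ := hc L; simp [← hT]
  | add v w hv hw =>
    intro L; specialize hv L; specialize hw L
    obtain ⟨T, hT⟩ := hc L
    simp only [← hT, map_add] at *
    rw [hv, hw]
  | smul r v hv =>
    intro L; specialize hv L
    obtain ⟨T, hT⟩ := hc L
    simp only [← hT, map_smul] at *
    rw [hv]
  | incl β b hb => exact h β b hb
  | heis n k v hv =>
    intro L
    have := hv (L ++ [(n, k)])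
    rwa [create, List.foldr_append] at this

/-- The normal ordering rules determine Y on h(-n-1)v from Y on v for chiral h, and chiral vectors
span H. -/
theorem IsVertexOperator.unique (hp : p ∈ projections B)
    {Y Y' : Induced B hB p 𝒜 →ₗ[ℂ] (ℝ → ℝ → Module.End ℂ (Induced B hB p 𝒜))}
    (hY : IsVertexOperator B hB p 𝒜 Y) (hY' : IsVertexOperator B hB p 𝒜 Y') : Y' = Y := by
  have key (v) : fieldSeries Y' v = fieldSeries Y v := by
    refine chiral_induction hp (C := fun v => fieldSeries Y' v = fieldSeries Y v) ?_ ?_ ?_ ?_ ?_ v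
    · intro α a ha
      funext x y
      refine create_ext fun β b hb L => ?_
      rw [hY.base α a ha β b hb, hY'.base α a ha β b hb]
    · intro n ε h hh v hv
      funext x y
      refine LinearMap.ext fun w => ?_
      cases ε
      · rw [hY.right h hh, hY'.right h hh, hv]
      · rw [hY.left h hh, hY'.left h hh, hv]
    · funext x y; simp [fieldSeries]
    · intro v w hv hw
      have e (Y : Induced B hB p 𝒜 →ₗ[ℂ] (ℝ → ℝ → Module.End ℂ (Induced B hB p 𝒜))) :
        fieldSeries Y (v + w) = fieldSeries Y v + fieldSeries Y w := by
        funext x y; simp [fieldSeries]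
      rw [e, e, hv, hw]
    · intro r v hv
      have e (Y : Induced B hB p 𝒜 →ₗ[ℂ] (ℝ → ℝ → Module.End ℂ (Induced B hB p 𝒜))) :
        fieldSeries Y (r • v) = r • fieldSeries Y v := by
        funext x y; simp [fieldSeries]
      rw [e, e, hv]
  refine LinearMap.ext fun v => ?_
  funext r s
  have := congrFun (congrFun (key v) (-r - 1)) (-s - 1)
  simpa [fieldSeries] using this

end VertexOperator

end
end AHVertex

open scoped TensorProduct
namespace AHVertex
noncomputable section

/-! ## The grading -/

section Grading

variable {H : Type*} [AddCommGroup H] [Module ℝ H] {A : Type*} [Ring A] [Algebra ℂ A]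
variable (B : LinearMap.BilinForm ℝ H) (hB : B.IsSymm) (p : Module.End ℝ H)
variable (𝒜 : H → Submodule ℂ A) [DecidableEq H] [GradedAlgebra 𝒜]

/-- The pair `(x, y)` as a complex number. -/
def cplx (x y : ℝ) : ℂ := x + y * Complex.I

theorem cplx_inj {x y x' y' : ℝ} (h : cplx x y = cplx x' y') : x = x' ∧ y = y' :=
  ⟨by simpa [cplx] using congrArg Complex.re h, by simpa [cplx] using congrArg Complex.im h⟩

/-- The weight of the elements of `A^α`. -/
def weight (α : H) : ℂ :=
  cplx (twistedForm B p (p α) (p α) / 2) (twistedForm B p ((1 - p) α) ((1 - p) α) / 2)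

/-- A derivation-like map is not directly a lift, so the pair (v, Dv) is lifted instead, with
h(-n-1) acting on F × F as on dual numbers. The first component turns out to be the identity. -/
theorem exists_gradingOp : ∃ D : Module.End ℂ (Induced B hB p 𝒜),
    (∀ α, ∀ a ∈ 𝒜 α, D (incl B hB p 𝒜 a) = weight B p α • incl B hB p 𝒜 a) ∧
    ∀ (n : ℕ) h v, D (heis B hB p 𝒜 (-(n : ℤ) - 1) h v) = heis B hB p 𝒜 (-(n : ℤ) - 1) h (D v) +
      ((n : ℂ) + 1) • (heis B hB p 𝒜 (-(n : ℤ) - 1) (p h) v +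
        Complex.I • heis B hB p 𝒜 (-(n : ℤ) - 1) ((1 - p) h) v) := by
  have hc (n m : ℕ) (h k : H) (v) :
      heis B hB p 𝒜 (-(n : ℤ) - 1) h (heis B hB p 𝒜 (-(m : ℤ) - 1) k v) =
        heis B hB p 𝒜 (-(m : ℤ) - 1) k (heis B hB p 𝒜 (-(n : ℤ) - 1) h v) :=
    LinearMap.congr_fun (cre_comm B hB p 𝒜 h k n m) v
  let G (n : ℕ) (h : H) : Module.End ℂ (Induced B hB p 𝒜) :=
    ((n : ℂ) + 1) • (heis B hB p 𝒜 (-(n : ℤ) - 1) (p h) +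
      Complex.I • heis B hB p 𝒜 (-(n : ℤ) - 1) ((1 - p) h))
  have hG (n : ℕ) (h k : H) : G n (h + k) = G n h + G n k := by
    simp only [G, map_add, heis_add, smul_add]; abel
  have hG' (n : ℕ) (r : ℝ) (h : H) : G n (r • h) = (r : ℂ) • G n h := by
    simp only [G, LinearMap.map_smul, heis_smul, smul_add]
    simp only [smul_comm (r : ℂ)]
  have hG'' (n m : ℕ) (h k : H) (v) : heis B hB p 𝒜 (-(n : ℤ) - 1) h (G m k v) =
      G m k (heis B hB p 𝒜 (-(n : ℤ) - 1) h v) := by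
    simp only [G, LinearMap.smul_apply, LinearMap.add_apply, map_smul, map_add, hc n m]
  obtain ⟨T, h1, h2⟩ := exists_creation_lift B hB p 𝒜
    (X := Induced B hB p 𝒜 × Induced B hB p 𝒜)
    (fun n => AddMonoidHom.mk' (fun h => LinearMap.prod
      (heis B hB p 𝒜 (-(n : ℤ) - 1) h ∘ₗ LinearMap.fst ℂ _ _)
      (heis B hB p 𝒜 (-(n : ℤ) - 1) h ∘ₗ LinearMap.snd ℂ _ _ + G n h ∘ₗ LinearMap.fst ℂ _ _))
      fun h k => LinearMap.ext fun v => Prod.ext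
        (LinearMap.congr_fun (heis_add B hB p 𝒜 _ h k) v.1) (by
        change heis B hB p 𝒜 _ (h + k) v.2 + G n (h + k) v.1 = heis B hB p 𝒜 _ h v.2 + G n h v.1 +
          (heis B hB p 𝒜 _ k v.2 + G n k v.1)
        rw [heis_add, hG, LinearMap.add_apply, LinearMap.add_apply]
        abel))
    (fun n r h => LinearMap.ext fun v => Prod.ext
        (LinearMap.congr_fun (heis_smul B hB p 𝒜 _ r h) v.1) (by
        change heis B hB p 𝒜 _ (r • h) v.2 + G n (r • h) v.1 =
          (r : ℂ) • (heis B hB p 𝒜 _ h v.2 + G n h v.1)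
        rw [heis_smul, hG', smul_add]
        rfl))
    (fun n m h k v => Prod.ext (hc n m h k v.1) (by
        change heis B hB p 𝒜 _ h (heis B hB p 𝒜 _ k v.2 + G m k v.1) +
            G n h (heis B hB p 𝒜 _ k v.1) =
          heis B hB p 𝒜 _ k (heis B hB p 𝒜 _ h v.2 + G n h v.1) +
            G m k (heis B hB p 𝒜 _ h v.1)
        rw [map_add, map_add, hc, hG'', hG'']
        abel))
    (LinearMap.prod (inclHom B hB p 𝒜) (gradedLift 𝒜 fun α =>
      weight B p α • (inclHom B hB p 𝒜 ∘ₗ (𝒜 α).subtype)))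
  have h3 (v) : (T v).1 = v := by
    induction v using create_induction with
    | zero => simp
    | add v w hv hw => simp [hv, hw]
    | smul r v hv => simp [hv]
    | incl α a ha => rw [h1]; rfl
    | heis n h v hv => rw [h2]; exact congrArg (heis B hB p 𝒜 (-(n : ℤ) - 1) h) hv
  refine ⟨LinearMap.snd ℂ _ _ ∘ₗ T, fun α a ha => ?_, fun n h v => ?_⟩
  · rw [LinearMap.comp_apply, h1]
    exact gradedLift_apply 𝒜 _ ha
  · rw [LinearMap.comp_apply, h2]
    simp [h3, G]

/-- The operator which is multiplication by `h + i h̄` on `F_{h,h̄}`. -/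
def gradingOp : Module.End ℂ (Induced B hB p 𝒜) := (exists_gradingOp B hB p 𝒜).choose

theorem gradingOp_incl {α : H} {a : A} (ha : a ∈ 𝒜 α) :
    gradingOp B hB p 𝒜 (incl B hB p 𝒜 a) = weight B p α • incl B hB p 𝒜 a :=
  (exists_gradingOp B hB p 𝒜).choose_spec.1 α a ha

/-- The complex number `1` or `i`, according to the chirality. -/
def unitC (ε : Bool) : ℂ := cplx (dir ε).1 (dir ε).2

variable {p}

theorem gradingOp_creation {ε : Bool} {h : H} (hh : IsChiral p ε h) (n : ℕ) (v) :
    gradingOp B hB p 𝒜 (heis B hB p 𝒜 (-(n : ℤ) - 1) h v) =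
      heis B hB p 𝒜 (-(n : ℤ) - 1) h (gradingOp B hB p 𝒜 v) +
        (((n : ℂ) + 1) * unitC ε) • heis B hB p 𝒜 (-(n : ℤ) - 1) h v := by
  have h1 := (exists_gradingOp B hB p 𝒜).choose_spec.2 n h v
  rw [← gradingOp] at h1
  rw [h1]
  congr 1
  cases ε
  · have e1 : p h = 0 := hh
    have e2 : (1 - p) h = h := by rw [LinearMap.sub_apply, e1, sub_zero]; rfl
    rw [e1, e2, heis_zero_right]
    simp [unitC, cplx, dir, mul_smul]
  · have e1 : p h = h := left_proj p hh
    have e2 : (1 - p) h = 0 := hh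
    rw [e1, e2, heis_zero_right]
    simp [unitC, cplx, dir]

theorem gradingOp_heis (hp : p ∈ projections B) {ε : Bool} {h : H} (hh : IsChiral p ε h) (n : ℤ)
    (v) : gradingOp B hB p 𝒜 (heis B hB p 𝒜 n h v) =
      heis B hB p 𝒜 n h (gradingOp B hB p 𝒜 v) - ((n : ℂ) * unitC ε) • heis B hB p 𝒜 n h v := by
  rcases lt_or_ge n 0 with hn | hn
  · obtain ⟨m, rfl⟩ : ∃ m : ℕ, n = -(m : ℤ) - 1 := ⟨(-n - 1).toNat, by omega⟩
    rw [gradingOp_creation B hB 𝒜 hh]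
    push_cast
    module
  · refine chiral_induction hp (C := fun v => gradingOp B hB p 𝒜 (heis B hB p 𝒜 n h v) =
      heis B hB p 𝒜 n h (gradingOp B hB p 𝒜 v) - ((n : ℂ) * unitC ε) • heis B hB p 𝒜 n h v)
      ?_ ?_ ?_ ?_ ?_ v
    · intro α a ha
      rcases hn.eq_or_lt with rfl | hn
      · rw [heis_zero_incl B hB p 𝒜 h α ha, map_smul, gradingOp_incl B hB p 𝒜 ha, map_smul,
          heis_zero_incl B hB p 𝒜 h α ha, smul_comm]
        simp
      · rw [gradingOp_incl B hB p 𝒜 ha, map_smul, heis_incl_pos B hB p 𝒜 (by omega)]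
        simp
    · intro m ε' k hk v hv
      rw [gradingOp_creation B hB 𝒜 hk, map_add, map_smul, heis_comm_apply B hB p 𝒜 n,
        heis_comm_apply B hB p 𝒜 n, map_add, gradingOp_creation B hB 𝒜 hk, hv, map_sub, map_smul,
        smul_add]
      by_cases h0 : n + (-(m : ℤ) - 1) = 0
      · have e : (n : ℂ) = m + 1 := by exact_mod_cast (by omega : n = m + 1)
        simp only [if_pos h0, map_smul, smul_add, smul_smul, e]
        by_cases hε : ε = ε'
        · subst hε
          module
        · rw [twistedForm_chiral B hh hk hε]
          simp only [Complex.ofReal_zero, mul_zero, zero_smul]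
          module
      · simp only [if_neg h0, zero_smul, add_zero, map_zero, smul_zero]
        module
    · simp
    · intro v w hv hw
      simp only [map_add, hv, hw, smul_add]; abel
    · intro r v hv
      simp only [map_smul, hv, smul_sub, smul_comm r]

theorem sector_chiral_induction (hp : p ∈ projections B) {γ : H} {C : Induced B hB p 𝒜 → Prop}
    (incl : ∀ a ∈ 𝒜 γ, C (incl B hB p 𝒜 a))
    (heis : ∀ (n : ℕ) (ε : Bool) h, IsChiral p ε h → ∀ v ∈ sector B hB p 𝒜 γ, C v →
      C (heis B hB p 𝒜 (-(n : ℤ) - 1) h v))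
    (zero : C 0) (add : ∀ v w, C v → C w → C (v + w)) (smul : ∀ (r : ℂ) v, C v → C (r • v)) (v)
    (hv : v ∈ sector B hB p 𝒜 γ) : C v := by
  refine sector_induction B hB p 𝒜 incl (fun n h v hv hC => ?_) zero add smul v hv
  have e : AHVertex.heis B hB p 𝒜 (-(n : ℤ) - 1) h =
      AHVertex.heis B hB p 𝒜 (-(n : ℤ) - 1) (p h) +
        AHVertex.heis B hB p 𝒜 (-(n : ℤ) - 1) ((1 - p) h) := by
    rw [← heis_add, LinearMap.sub_apply, Module.End.one_apply, add_sub_cancel]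
  rw [e]
  exact add _ _ (heis n true _ (proj_mem_left B hp h) v hv hC)
    (heis n false _ (proj_mem_right B hp h) v hv hC)

theorem gradingOp_mem_sector (hp : p ∈ projections B) {γ : H} {w : Induced B hB p 𝒜}
    (hw : w ∈ sector B hB p 𝒜 γ) : gradingOp B hB p 𝒜 w ∈ sector B hB p 𝒜 γ := by
  refine sector_chiral_induction B hB 𝒜 hp (C := fun w => gradingOp B hB p 𝒜 w ∈
    sector B hB p 𝒜 γ) ?_ ?_ ?_ ?_ ?_ w hw
  · intro a ha
    rw [gradingOp_incl B hB p 𝒜 ha]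
    exact Submodule.smul_mem _ _ (incl_mem_sector B hB p 𝒜 ha)
  · intro n ε h hh v hv hC
    rw [gradingOp_creation B hB 𝒜 hh]
    exact Submodule.add_mem _ (heis_mem_sector B hB p 𝒜 hC _ _)
      (Submodule.smul_mem _ _ (heis_mem_sector B hB p 𝒜 hv _ _))
  · simp
  · intro v w hv hw
    rw [map_add]; exact Submodule.add_mem _ hv hw
  · intro r v hv
    rw [map_smul]; exact Submodule.smul_mem _ r hv

/-- The weight is a quadratic function of the charge; its polarisation is the pair of exponents in
z^((pα,pβ)_p) z̄^((p̄α,p̄β)_p). -/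
theorem gradingOp_lmap (hp : p ∈ projections B) {α β : H} {a : A} (ha : a ∈ 𝒜 α)
    {w : Induced B hB p 𝒜} (hw : w ∈ sector B hB p 𝒜 β) :
    gradingOp B hB p 𝒜 (lmap B hB p 𝒜 a w) = lmap B hB p 𝒜 a (gradingOp B hB p 𝒜 w) +
      (weight B p α + cplx (twistedForm B p (p α) (p β))
        (twistedForm B p ((1 - p) α) ((1 - p) β))) • lmap B hB p 𝒜 a w := by
  have hw2 : weight B p (α + β) = weight B p β + (weight B p α +
      cplx (twistedForm B p (p α) (p β)) (twistedForm B p ((1 - p) α) ((1 - p) β))) := by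
    have e1 := (twistedForm_isSymm hB p).eq (p α) (p β)
    have e2 := (twistedForm_isSymm hB p).eq ((1 - p) α) ((1 - p) β)
    simp only [weight, cplx, map_add, LinearMap.add_apply, ← e1, ← e2]
    push_cast
    ring
  generalize weight B p α + cplx (twistedForm B p (p α) (p β))
    (twistedForm B p ((1 - p) α) ((1 - p) β)) = κ at hw2
  refine sector_chiral_induction B hB 𝒜 hp (C := fun w => gradingOp B hB p 𝒜 (lmap B hB p 𝒜 a w) =
    lmap B hB p 𝒜 a (gradingOp B hB p 𝒜 w) + κ • lmap B hB p 𝒜 a w) ?_ ?_ ?_ ?_ ?_ w hw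
  · intro b hb
    rw [lmap_incl, gradingOp_incl B hB p 𝒜 (SetLike.mul_mem_graded ha hb),
      gradingOp_incl B hB p 𝒜 hb, map_smul, lmap_incl, hw2, add_smul]
  · intro n ε h hh w _ hw
    rw [gradingOp_creation B hB 𝒜 hh, map_add, map_smul, lmap_heis B hB p 𝒜 a (by omega),
      lmap_heis B hB p 𝒜 a (by omega), gradingOp_creation B hB 𝒜 hh, hw, map_add, map_smul]
    module
  · simp
  · intro v w hv hw
    simp only [map_add, hv, hw, smul_add]; abel
  · intro r v hv
    simp only [map_smul, hv, smul_add, smul_comm r]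

theorem recSeq_homogeneous {F : Type*} [AddCommGroup F] [Module ℂ F] {d : ℕ → Module.End ℂ F}
    {D : Module.End ℂ F} {κ : ℂ} (h : ∀ m : ℕ, D * d m = d m * D + (((m : ℂ) + 1) * κ) • d m)
    (n : ℕ) : D * recSeq d n = recSeq d n * D + ((n : ℂ) * κ) • recSeq d n := by
  induction n using Nat.strong_induction_on with
  | _ n ih =>
    rcases n with _ | n
    · simp [recSeq_zero]
    · refine eq_of_succ_smul n ?_
      rw [smul_add, smul_comm _ (((n + 1 : ℕ) : ℂ) * κ), ← mul_smul_comm, ← smul_mul_assoc,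
        recSeq_succ, Finset.mul_sum, Finset.sum_mul, Finset.smul_sum, ← Finset.sum_add_distrib]
      refine Finset.sum_congr rfl fun m hm => ?_
      have hm' : m ≤ n := by simpa [Nat.lt_succ_iff] using hm
      rw [← mul_assoc, h, add_mul, mul_assoc, ih (n - m) (by omega), mul_add, smul_mul_assoc,
        mul_smul_comm, ← mul_assoc, add_assoc, ← add_smul, Nat.cast_sub hm']
      congr 2
      push_cast; ring

/-- The creation exponential contributes x + j and the annihilation exponential -j, so every summand
has the same degree x. -/
theorem gradingOp_vl {hp : p ∈ projections B} {ε : Bool} {h : H} (hh : IsChiral p ε h) (x : ℝ)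
    (w : Induced B hB p 𝒜) : gradingOp B hB p 𝒜 (vl B hB p 𝒜 h x w) =
      vl B hB p 𝒜 h x (gradingOp B hB p 𝒜 w) + ((x : ℂ) * unitC ε) • vl B hB p 𝒜 h x w := by
  have he (n : ℕ) (w) : gradingOp B hB p 𝒜 (eS B hB p 𝒜 h n w) =
      eS B hB p 𝒜 h n (gradingOp B hB p 𝒜 w) + ((n : ℂ) * unitC ε) • eS B hB p 𝒜 h n w :=
    LinearMap.congr_fun (recSeq_homogeneous (fun m => LinearMap.ext fun v => by
      simpa using gradingOp_creation B hB 𝒜 hh m v) n) w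
  have hf (n : ℕ) (w) : gradingOp B hB p 𝒜 (fS B hB p 𝒜 h n w) =
      fS B hB p 𝒜 h n (gradingOp B hB p 𝒜 w) + ((n : ℂ) * -unitC ε) • fS B hB p 𝒜 h n w :=
    LinearMap.congr_fun (recSeq_homogeneous (fun m => LinearMap.ext fun v => by
      have := gradingOp_heis B hB 𝒜 hp hh (m + 1) v
      simp only [Module.End.mul_apply, LinearMap.neg_apply, LinearMap.add_apply, map_neg, this,
        LinearMap.smul_apply]
      push_cast
      module) n) w
  refine ((vl_evSum B hB p 𝒜 h x w).mapₗ (gradingOp B hB p 𝒜)).unique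
    (((vl_evSum B hB p 𝒜 h x (gradingOp B hB p 𝒜 w)).add ((vl_evSum B hB p 𝒜 h x w).smul
    ((x : ℂ) * unitC ε))).congr (fun j => ?_) rfl)
  by_cases hx : ∃ n : ℕ, x + j = n
  · obtain ⟨n, hn⟩ := hx
    have hx : (x : ℂ) = n - j := by
      rw [eq_sub_iff_add_eq]; exact_mod_cast hn
    rw [hn, natExt_natCast, he, hf, map_add, map_smul, hx]
    module
  · push Not at hx
    rw [natExt_of_ne hx]; simp

/-- For elements of A, the exponents subtracted in the vertex operator cancel the polarisation term
of `gradingOp_lmap`. Normal ordering then preserves homogeneity, since the degree of each mode of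
the current balances the shift of exponent. -/
theorem IsVertexField.gradingOp (hp : p ∈ projections B)
    {Y : Induced B hB p 𝒜 →ₗ[ℂ] OpSeries (Induced B hB p 𝒜)} (hY : IsVertexField B hB p 𝒜 Y)
    (v : Induced B hB p 𝒜) (x y : ℝ) (w : Induced B hB p 𝒜) :
    gradingOp B hB p 𝒜 (Y v x y w) = Y (gradingOp B hB p 𝒜 v) x y w +
      Y v x y (gradingOp B hB p 𝒜 w) + cplx x y • Y v x y w := by
  refine chiral_induction hp (C := fun v => ∀ x y w, AHVertex.gradingOp B hB p 𝒜 (Y v x y w) =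
    Y (AHVertex.gradingOp B hB p 𝒜 v) x y w +
      Y v x y (AHVertex.gradingOp B hB p 𝒜 w) + cplx x y • Y v x y w) ?_ ?_ ?_ ?_ ?_ v x y w
  · intro α a ha x y w
    induction w using sector_span with
    | zero => simp
    | add v w hv hw => simp only [map_add, hv, hw, smul_add]; abel
    | sector β w hw =>
      have hw' := gradingOp_mem_sector B hB 𝒜 hp hw
      rw [gradingOp_incl B hB p 𝒜 ha, map_smul, Pi.smul_apply, Pi.smul_apply, LinearMap.smul_apply,
        hY.base α a ha β w hw, hY.base α a ha β _ hw',
        gradingOp_vl B hB 𝒜 (hp := hp) (ε := true) (proj_mem_left B hp α),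
        gradingOp_vl B hB 𝒜 (hp := hp) (ε := false) (proj_mem_right B hp α),
        gradingOp_lmap B hB 𝒜 hp ha hw]
      simp only [map_add, map_smul, cplx, unitC, dir]
      push_cast
      module
  · intro n ε h hh v hv x y w
    rw [gradingOp_creation B hB 𝒜 hh, map_add, map_smul, hY.chiral hh, hY.chiral hh]
    have hL := lmulS_evSum (cre B hB p 𝒜 h) ε n (hY.isField v) x y
    have hR := rmulS_evSum (ann_locFin B hB p 𝒜 h) ε n (Y v) x y
    have hL' := lmulS_evSum (cre B hB p 𝒜 h) ε n (hY.isField (AHVertex.gradingOp B hB p 𝒜 v)) x y w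
    have hR' := rmulS_evSum (ann_locFin B hB p 𝒜 h) ε n (Y (AHVertex.gradingOp B hB p 𝒜 v)) x y w
    have e1 := (((hL'.add (hL (AHVertex.gradingOp B hB p 𝒜 w))).add ((hL w).smul
      (cplx x y + ((n : ℂ) + 1) * unitC ε))).congr (fun m => by
        rw [map_smul, show cre B hB p 𝒜 h m = heis B hB p 𝒜 (-(m : ℤ) - 1) h from rfl,
          gradingOp_creation B hB 𝒜 hh, hv, map_add, map_add, map_smul]
        simp only [cplx, unitC]
        push_cast
        module) rfl).unique ((hL w).mapₗ (AHVertex.gradingOp B hB p 𝒜))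
    have e2 := (((hR'.add (hR (AHVertex.gradingOp B hB p 𝒜 w))).add ((hR w).smul
      (cplx x y + ((n : ℂ) + 1) * unitC ε))).congr (fun m => by
        rw [map_smul, hv, show ann B hB p 𝒜 h m = heis B hB p 𝒜 m h from rfl,
          gradingOp_heis B hB 𝒜 hp hh m w, map_sub, map_smul]
        simp only [cplx, unitC]
        push_cast
        module) rfl).unique ((hR w).mapₗ (AHVertex.gradingOp B hB p 𝒜))
    simp only [normS, Pi.add_apply, LinearMap.add_apply, Pi.smul_apply, LinearMap.smul_apply,
      map_add, ← e1, ← e2]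
    module
  · simp
  · intro v v' hv hv' x y w
    simp only [map_add, Pi.add_apply, LinearMap.add_apply, hv, hv', smul_add]; abel
  · intro r v hv x y w
    simp only [map_smul, Pi.smul_apply, LinearMap.smul_apply, hv, smul_add, smul_comm r]

theorem gradingOp_create {ε : Bool} (L : List (ℕ × H)) (hL : ∀ x ∈ L, IsChiral p ε x.2)
    (v : Induced B hB p 𝒜) : gradingOp B hB p 𝒜 (create B hB p 𝒜 L v) =
      create B hB p 𝒜 L (gradingOp B hB p 𝒜 v) +
        ((degree L : ℂ) * unitC ε) • create B hB p 𝒜 L v := by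
  induction L with
  | nil => simp [create, degree]
  | cons q L ih =>
    change gradingOp B hB p 𝒜 (heis B hB p 𝒜 _ _ (create B hB p 𝒜 L v)) = heis B hB p 𝒜 _ _
      (create B hB p 𝒜 L (gradingOp B hB p 𝒜 v)) + _ • heis B hB p 𝒜 _ _ (create B hB p 𝒜 L v)
    rw [gradingOp_creation B hB 𝒜 (hL q (by simp)), ih fun x hx => hL x (by simp [hx]), map_add,
      map_smul, show degree (q :: L) = q.1 + 1 + degree L by simp [degree]]
    push_cast
    module

theorem create_smul (L : List (ℕ × H)) (r : ℂ) (v : Induced B hB p 𝒜) :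
    create B hB p 𝒜 L (r • v) = r • create B hB p 𝒜 L v := by
  induction L with
  | nil => rfl
  | cons q L ih => exact (congrArg _ ih).trans (map_smul _ _ _)

theorem create_heis_comm (L : List (ℕ × H)) (n : ℕ) (h : H) (v : Induced B hB p 𝒜) :
    create B hB p 𝒜 L (heis B hB p 𝒜 (-(n : ℤ) - 1) h v) =
      heis B hB p 𝒜 (-(n : ℤ) - 1) h (create B hB p 𝒜 L v) := by
  induction L with
  | nil => rfl
  | cons q L ih =>
    exact (congrArg _ ih).trans (LinearMap.congr_fun (cre_comm B hB p 𝒜 q.2 h q.1 n) _)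

/-- The eigenspaces of the grading operator. -/
def wtSpace (q : ℝ × ℝ) : Submodule ℂ (Induced B hB p 𝒜) :=
  Module.End.eigenspace (gradingOp B hB p 𝒜) (cplx q.1 q.2)

theorem mem_wtSpace {q : ℝ × ℝ} {v : Induced B hB p 𝒜} :
    v ∈ wtSpace B hB 𝒜 q ↔ gradingOp B hB p 𝒜 v = cplx q.1 q.2 • v :=
  Module.End.mem_eigenspace_iff

theorem wtSpace_independent : iSupIndep (wtSpace B hB (p := p) 𝒜) :=
  (Module.End.eigenspaces_iSupIndep (gradingOp B hB p 𝒜)).comp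
    (f := fun q : ℝ × ℝ => cplx q.1 q.2) fun _ _ h => Prod.ext (cplx_inj h).1 (cplx_inj h).2

theorem grading_le_wtSpace (q : ℝ × ℝ) : grading B hB p 𝒜 q ≤ wtSpace B hB 𝒜 q := by
  refine Submodule.span_le.2 ?_
  rintro _ ⟨α, a, ha, L, R, hL, hR, h1, h2, rfl⟩
  rw [SetLike.mem_coe, mem_wtSpace, gradingOp_create B hB 𝒜 (ε := true) L hL,
    gradingOp_create B hB 𝒜 (ε := false) R hR, gradingOp_incl B hB p 𝒜 ha, create_smul,
    ← add_smul, create_smul, ← add_smul, h1, h2]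
  congr 1
  simp only [weight, cplx, unitC, dir]
  push_cast
  ring

theorem heis_mem_grading {ε : Bool} {h : H} (hh : IsChiral p ε h) (n : ℕ) {q : ℝ × ℝ}
    {v : Induced B hB p 𝒜} (hv : v ∈ grading B hB p 𝒜 q) :
    heis B hB p 𝒜 (-(n : ℤ) - 1) h v ∈
      grading B hB p 𝒜 (q.1 + (dir ε).1 * (n + 1), q.2 + (dir ε).2 * (n + 1)) := by
  induction hv using Submodule.span_induction with
  | zero => rw [map_zero]; exact Submodule.zero_mem _
  | add v w _ _ hv hw => rw [map_add]; exact Submodule.add_mem _ hv hw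
  | smul r v _ hv => rw [map_smul]; exact Submodule.smul_mem _ _ hv
  | mem v hv =>
    obtain ⟨α, a, ha, L, R, hL, hR, h1, h2, rfl⟩ := hv
    apply Submodule.subset_span
    cases ε
    · refine ⟨α, a, ha, L, (n, h) :: R, hL, ?_, ?_, ?_, ?_⟩
      · intro x hx
        rcases List.mem_cons.1 hx with rfl | hx
        · exact hh
        · exact hR x hx
      · simp [h1, dir]
      · simp only [h2, dir, degree, List.map_cons, List.sum_cons]
        push_cast; ring
      · exact (create_heis_comm B hB 𝒜 L n h _).symm
    · refine ⟨α, a, ha, (n, h) :: L, R, ?_, hR, ?_, ?_, rfl⟩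
      · intro x hx
        rcases List.mem_cons.1 hx with rfl | hx
        · exact hh
        · exact hL x hx
      · simp only [h1, dir, degree, List.map_cons, List.sum_cons]
        push_cast; ring
      · simp [h2, dir]

theorem incl_mem_grading {α : H} {a : A} (ha : a ∈ 𝒜 α) : incl B hB p 𝒜 a ∈ grading B hB p 𝒜
    (twistedForm B p (p α) (p α) / 2, twistedForm B p ((1 - p) α) ((1 - p) α) / 2) :=
  Submodule.subset_span ⟨α, a, ha, [], [], by simp, by simp, by simp [degree], by simp [degree],
    rfl⟩

theorem iSup_grading (hp : p ∈ projections B) : ⨆ q, grading B hB p 𝒜 q = ⊤ := by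
  refine Submodule.eq_top_iff'.2 fun v => ?_
  refine chiral_induction hp (C := fun v => v ∈ ⨆ q, grading B hB p 𝒜 q)
    (fun α a ha => Submodule.mem_iSup_of_mem _ (incl_mem_grading B hB 𝒜 ha)) ?_
    (Submodule.zero_mem _) (fun v w hv hw => Submodule.add_mem _ hv hw)
    (fun r v hv => Submodule.smul_mem _ r hv) v
  intro n ε h hh v hv
  induction hv using Submodule.iSup_induction' with
  | zero => rw [map_zero]; exact Submodule.zero_mem _
  | add v w _ _ hv hw => rw [map_add]; exact Submodule.add_mem _ hv hw
  | mem q v hv => exact Submodule.mem_iSup_of_mem _ (heis_mem_grading B hB 𝒜 hh n hv)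

/-- Independence holds because the spaces lie in eigenspaces of one operator with distinct
eigenvalues h + i h̄; two real gradings are encoded in one complex number. Spanning comes from
creation operators. -/
theorem grading_isInternal (hp : p ∈ projections B) [DecidableEq (ℝ × ℝ)] :
    DirectSum.IsInternal (grading B hB p 𝒜) :=
  DirectSum.isInternal_submodule_of_iSupIndep_of_iSup_eq_top
    ((wtSpace_independent B hB 𝒜).mono (grading_le_wtSpace B hB 𝒜)) (iSup_grading B hB 𝒜 hp)

/-- An eigenvector splits into its component of degree q and a remainder that is both of eigenvalue
q and a sum of other eigenvectors, hence zero. -/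
theorem grading_eq_wtSpace (hp : p ∈ projections B) (q : ℝ × ℝ) :
    grading B hB p 𝒜 q = wtSpace B hB 𝒜 q := by
  refine le_antisymm (grading_le_wtSpace B hB 𝒜 q) fun v hv => ?_
  classical
  have hv' : v ∈ ⨆ q, grading B hB p 𝒜 q := iSup_grading B hB 𝒜 hp ▸ Submodule.mem_top
  rw [iSup_split_single _ q] at hv'
  obtain ⟨x, hx, y, hy, rfl⟩ := Submodule.mem_sup.1 hv'
  have h1 : y ∈ wtSpace B hB 𝒜 q := by
    have := Submodule.sub_mem _ hv (grading_le_wtSpace B hB 𝒜 q hx)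
    rwa [add_sub_cancel_left] at this
  have h2 : y ∈ ⨆ q', ⨆ (_ : q' ≠ q), wtSpace B hB 𝒜 q' :=
    iSup₂_mono (fun q' _ => grading_le_wtSpace B hB 𝒜 q') hy
  rw [Submodule.disjoint_def.1 (wtSpace_independent B hB (p := p) 𝒜 q) y h1 h2, add_zero]
  exact hx

end Grading
end
end AHVertex

open scoped TensorProduct
namespace AHVertex
noncomputable section

/-! ## Supports of the vertex operators, vacuum and grading -/

section Support

theorem EvSum.mem {E : Type*} [AddCommGroup E] [Module ℂ E] {g : ℕ → E} {s : E} (h : EvSum g s)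
    {S : Submodule ℂ E} (hg : ∀ n, g n ∈ S) : s ∈ S := by
  obtain ⟨N, hN⟩ := h.exists
  exact hN ▸ Submodule.sum_mem _ fun n _ => hg n

theorem recSeq_mem {F : Type*} [AddCommGroup F] [Module ℂ F] {d : ℕ → Module.End ℂ F}
    {S : Submodule ℂ F} (h : ∀ m, ∀ v ∈ S, d m v ∈ S) (n : ℕ) : ∀ v ∈ S, recSeq d n v ∈ S := by
  induction n using Nat.strong_induction_on with
  | _ n ih =>
    intro v hv
    rcases n with _ | n
    · rw [recSeq_zero]; exact hv
    · rw [recSeq, LinearMap.smul_apply, LinearMap.sum_apply]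
      exact Submodule.smul_mem _ _ (Submodule.sum_mem _ fun m _ => h _ _ (ih _ (by omega) v hv))

theorem natExt_mem {F : Type*} [AddCommGroup F] [Module ℂ F] {g : ℕ → Module.End ℂ F}
    {S : Submodule ℂ F} {v : F} (h : ∀ n, g n v ∈ S) (x : ℝ) : natExt g x v ∈ S := by
  unfold natExt
  split_ifs
  · exact h _
  · exact S.zero_mem

variable {H : Type*} [AddCommGroup H] [Module ℝ H] {A : Type*} [Ring A] [Algebra ℂ A]
variable (B : LinearMap.BilinForm ℝ H) (hB : B.IsSymm) (p : Module.End ℝ H)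
variable (𝒜 : H → Submodule ℂ A) [DecidableEq H] [GradedAlgebra 𝒜]

theorem vl_mem_sector {γ : H} {w : Induced B hB p 𝒜} (hw : w ∈ sector B hB p 𝒜 γ) (h : H)
    (x : ℝ) : vl B hB p 𝒜 h x w ∈ sector B hB p 𝒜 γ := by
  have hf (j : ℕ) : fS B hB p 𝒜 h j w ∈ sector B hB p 𝒜 γ :=
    recSeq_mem (d := fun m : ℕ => -heis B hB p 𝒜 (m + 1) h) (fun m v hv => by
      rw [LinearMap.neg_apply]
      exact Submodule.neg_mem _ (heis_mem_sector B hB p 𝒜 hv _ _)) j _ hw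
  have he (n : ℕ) (v) (hv : v ∈ sector B hB p 𝒜 γ) : eS B hB p 𝒜 h n v ∈ sector B hB p 𝒜 γ :=
    recSeq_mem (d := fun m : ℕ => heis B hB p 𝒜 (-(m : ℤ) - 1) h)
      (fun m v hv => heis_mem_sector B hB p 𝒜 hv _ _) n _ hv
  exact (vl_evSum B hB p 𝒜 h x w).mem fun j => natExt_mem (fun n => he n _ (hf j)) _

theorem vl_support {h : H} {x : ℝ} {w : Induced B hB p 𝒜} (hx : vl B hB p 𝒜 h x w ≠ 0) :
    ∃ m : ℤ, x = m := by
  by_contra! h0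
  refine hx ((vl_evSum B hB p 𝒜 h x w).unique (EvSum.of_eq_zero fun j => ?_))
  rw [natExt_of_ne fun n hn => h0 (n - j) (by push_cast; linarith), LinearMap.zero_apply]

/-- A nonzero product needs (α, β) ∈ ℤ, and multiplication commutes with creation operators. -/
theorem lmap_integral (hA : IsAHPair B 𝒜) {α β : H} {a : A} (ha : a ∈ 𝒜 α)
    {w : Induced B hB p 𝒜} (hw : w ∈ sector B hB p 𝒜 β) (h0 : lmap B hB p 𝒜 a w ≠ 0) :
    ∃ n : ℤ, B α β = n := by
  by_contra hn
  refine h0 (sector_induction B hB p 𝒜 (C := fun w => lmap B hB p 𝒜 a w = 0) ?_ ?_ ?_ ?_ ?_ w hw)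
  · intro b hb
    rw [lmap_incl, show a * b = 0 from by_contra fun hab => hn (hA.integral α β a ha b hb hab)]
    exact map_zero (inclHom B hB p 𝒜)
  · intro n h v _ hv
    rw [lmap_heis B hB p 𝒜 a (by omega), hv, map_zero]
  · exact map_zero _
  · intro v w hv hw
    rw [map_add, hv, hw, add_zero]
  · intro r v hv
    rw [map_smul, hv, smul_zero]

/-- The possible exponents of a vertex operator from charge `β` to charge `α + β`. -/
def OnLattice (α β : H) (x y : ℝ) : Prop :=
  (∃ k : ℤ, B α β = k) ∧ (∃ m : ℤ, x = twistedForm B p (p α) (p β) + m) ∧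
    ∃ n : ℤ, y = twistedForm B p ((1 - p) α) ((1 - p) β) + n

theorem OnLattice.shift {B : LinearMap.BilinForm ℝ H} {p : Module.End ℝ H} {α β : H} {x y : ℝ}
    (h : OnLattice B p α β x y) (m n : ℤ) : OnLattice B p α β (x + m) (y + n) := by
  obtain ⟨h, ⟨i, rfl⟩, ⟨j, rfl⟩⟩ := h
  exact ⟨h, ⟨i + m, by push_cast; ring⟩, ⟨j + n, by push_cast; ring⟩⟩

theorem OnLattice.shift_dir {B : LinearMap.BilinForm ℝ H} {p : Module.End ℝ H} {α β : H}
    {x y : ℝ} (ε : Bool) (m : ℤ)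
    (h : OnLattice B p α β (x + (dir ε).1 * m) (y + (dir ε).2 * m)) : OnLattice B p α β x y := by
  cases ε
  · have := h.shift 0 (-m)
    simpa [dir] using this
  · have := h.shift (-m) 0
    simpa [dir] using this

open Classical in
/-- The space of possible values of the `(x, y)` coefficient of a vertex operator. -/
def latticeSpace (α β : H) (x y : ℝ) : Submodule ℂ (Induced B hB p 𝒜) :=
  if OnLattice B p α β x y then sector B hB p 𝒜 (α + β) else ⊥

theorem latticeSpace_shift {α β : H} {x y : ℝ} (ε : Bool) (m : ℤ) :
    latticeSpace B hB p 𝒜 α β (x + (dir ε).1 * m) (y + (dir ε).2 * m) =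
      latticeSpace B hB p 𝒜 α β x y := by
  have : OnLattice B p α β (x + (dir ε).1 * m) (y + (dir ε).2 * m) ↔ OnLattice B p α β x y := by
    refine ⟨OnLattice.shift_dir ε m, fun h => OnLattice.shift_dir ε (-m) ?_⟩
    have e1 : x + (dir ε).1 * m + (dir ε).1 * ((-m : ℤ) : ℝ) = x := by push_cast; ring
    have e2 : y + (dir ε).2 * m + (dir ε).2 * ((-m : ℤ) : ℝ) = y := by push_cast; ring
    rwa [e1, e2]
  unfold latticeSpace
  split_ifs with h1 h2 h2
  · rfl
  · exact absurd (this.1 h1) h2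
  · exact absurd (this.2 h2) h1
  · rfl

theorem heis_mem_latticeSpace {α β : H} {x y : ℝ} {w : Induced B hB p 𝒜}
    (hw : w ∈ latticeSpace B hB p 𝒜 α β x y) (n : ℤ) (h : H) :
    heis B hB p 𝒜 n h w ∈ latticeSpace B hB p 𝒜 α β x y := by
  unfold latticeSpace at *
  split_ifs at *
  · exact heis_mem_sector B hB p 𝒜 hw n h
  · rw [(Submodule.mem_bot ℂ).1 hw, map_zero]; exact Submodule.zero_mem _

variable {B hB p 𝒜}
variable {Y : Induced B hB p 𝒜 →ₗ[ℂ] OpSeries (Induced B hB p 𝒜)}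

/-- Exponential factors have integral exponents, and normal ordering shifts exponents by integers
without changing charges. Formulating the support statement as membership in a subspace makes it
pass through the sums. -/
theorem IsVertexField.mem_latticeSpace (hY : IsVertexField B hB p 𝒜 Y) (hp : p ∈ projections B)
    (hA : IsAHPair B 𝒜) {α β : H} {v w : Induced B hB p 𝒜} (hv : v ∈ sector B hB p 𝒜 α)
    (hw : w ∈ sector B hB p 𝒜 β) (x y : ℝ) : Y v x y w ∈ latticeSpace B hB p 𝒜 α β x y := by
  refine sector_chiral_induction B hB 𝒜 hp (C := fun v => ∀ w ∈ sector B hB p 𝒜 β, ∀ x y,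
    Y v x y w ∈ latticeSpace B hB p 𝒜 α β x y) ?_ ?_ ?_ ?_ ?_ v hv w hw x y
  · intro a ha w hw x y
    rw [hY.base α a ha β w hw]
    by_cases h0 : vl B hB p 𝒜 (p α) (x - twistedForm B p (p α) (p β))
        (vl B hB p 𝒜 ((1 - p) α) (y - twistedForm B p ((1 - p) α) ((1 - p) β))
          (lmap B hB p 𝒜 a w)) = 0
    · rw [h0]; exact Submodule.zero_mem _
    · obtain ⟨m, hm⟩ := vl_support B hB p 𝒜 h0
      have h1 : vl B hB p 𝒜 ((1 - p) α) (y - twistedForm B p ((1 - p) α) ((1 - p) β))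
          (lmap B hB p 𝒜 a w) ≠ 0 := fun h => h0 (by rw [h, map_zero])
      obtain ⟨n, hn⟩ := vl_support B hB p 𝒜 h1
      obtain ⟨k, hk⟩ := lmap_integral B hB p 𝒜 hA ha hw fun h => h1 (by rw [h, map_zero])
      rw [latticeSpace, if_pos ⟨⟨k, hk⟩, ⟨m, by linarith⟩, ⟨n, by linarith⟩⟩]
      exact vl_mem_sector B hB p 𝒜 (vl_mem_sector B hB p 𝒜 (lmap_mem_sector B hB p 𝒜 ha hw) _ _) _ _
  · intro n ε h hh v _ hv w hw x y
    rw [hY.chiral hh, normS]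
    refine Submodule.add_mem _
      ((lmulS_evSum (cre B hB p 𝒜 h) ε n (hY.isField v) x y w).mem fun m => ?_)
      ((rmulS_evSum (ann_locFin B hB p 𝒜 h) ε n (Y v) x y w).mem fun m => ?_)
    · refine Submodule.smul_mem _ _ (heis_mem_latticeSpace B hB p 𝒜 ?_ _ _)
      have e (x t : ℝ) : x - t * (m - n) = x + t * ((n - m : ℤ) : ℝ) := by push_cast; ring
      rw [e, e, ← latticeSpace_shift B hB p 𝒜 ε (n - m)]
      exact hv w hw _ _
    · refine Submodule.smul_mem _ _ ?_
      have e (x t : ℝ) : x + t * (m + 1 + n) = x + t * ((m + 1 + n : ℤ) : ℝ) := by push_cast; rfl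
      rw [e, e, ← latticeSpace_shift B hB p 𝒜 ε (m + 1 + n)]
      exact hv _ (heis_mem_sector B hB p 𝒜 hw m h) _ _
  · intro w _ x y
    rw [map_zero]; exact Submodule.zero_mem _
  · intro v v' hv hv' w hw x y
    rw [map_add]; exact Submodule.add_mem _ (hv w hw x y) (hv' w hw x y)
  · intro r v hv w hw x y
    rw [map_smul]; exact Submodule.smul_mem _ _ (hv w hw x y)

theorem IsVertexField.onLattice (hY : IsVertexField B hB p 𝒜 Y) (hp : p ∈ projections B)
    (hA : IsAHPair B 𝒜) {α β : H} {v w : Induced B hB p 𝒜} (hv : v ∈ sector B hB p 𝒜 α)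
    (hw : w ∈ sector B hB p 𝒜 β) {x y : ℝ} (h0 : Y v x y w ≠ 0) : OnLattice B p α β x y := by
  by_contra h
  have := hY.mem_latticeSpace hp hA hv hw x y
  rw [latticeSpace, if_neg h] at this
  exact h0 this

theorem IsVertexField.mem_sector (hY : IsVertexField B hB p 𝒜 Y) (hp : p ∈ projections B)
    (hA : IsAHPair B 𝒜) {α β : H} {v w : Induced B hB p 𝒜} (hv : v ∈ sector B hB p 𝒜 α)
    (hw : w ∈ sector B hB p 𝒜 β) (x y : ℝ) : Y v x y w ∈ sector B hB p 𝒜 (α + β) := by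
  have := hY.mem_latticeSpace hp hA hv hw x y
  rw [latticeSpace] at this
  split_ifs at this
  · exact this
  · rw [(Submodule.mem_bot ℂ).1 this]; exact Submodule.zero_mem _

/-- The form (-,-)_p reverses sign on H_r, and H_l, H_r are orthogonal for B. So the difference of
the two exponents is (α, β), which turns integrality of B into single-valuedness. -/
theorem twistedForm_sub (hB : B.IsSymm) (hp : p ∈ projections B) (α β : H) :
    twistedForm B p (p α) (p β) - twistedForm B p ((1 - p) α) ((1 - p) β) = B α β := by
  have e0 (h : H) : p (p h) = p h := left_proj p (proj_mem_left B hp h)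
  have e1 (h : H) : p ((1 - p) h) = 0 := proj_mem_right B hp h
  have e2 (h : H) : (1 - p) (p h) = 0 := proj_mem_left B hp h
  have e3 (h : H) : (1 - p) ((1 - p) h) = (1 - p) h := by
    rw [LinearMap.sub_apply, e1, sub_zero]; rfl
  have e4 (h : H) : h = p h + (1 - p) h := by
    rw [LinearMap.sub_apply, Module.End.one_apply, add_sub_cancel]
  have o1 := hp.2 _ (proj_mem_right B hp α) _ (proj_mem_left B hp β)
  have o2 := hp.2 _ (proj_mem_right B hp β) _ (proj_mem_left B hp α)
  have o3 := hB.eq ((1 - p) β) (p α)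
  rw [o2] at o3
  have e5 : B α β = B (p α) (p β) + B ((1 - p) α) ((1 - p) β) := by
    conv_lhs => rw [e4 α, e4 β]
    rw [map_add, map_add, LinearMap.add_apply, LinearMap.add_apply, o1, ← o3]
    ring
  rw [e5]
  have tw (h k : H) : twistedForm B p h k = B (p h) (p k) - B ((1 - p) h) ((1 - p) k) := rfl
  rw [tw, tw, e0, e0, e1, e1, e2, e2, e3, e3]
  simp only [map_zero, sub_zero, LinearMap.zero_apply, zero_sub, sub_neg_eq_add]

end Support

end
end AHVertex

open scoped TensorProduct
namespace AHVertex
noncomputable section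

/-! ### The axioms other than the one on correlation functions -/

section Axioms

variable {H : Type*} [AddCommGroup H] [Module ℝ H] {A : Type*} [Ring A] [Algebra ℂ A]
variable {B : LinearMap.BilinForm ℝ H} {hB : B.IsSymm} {p : Module.End ℝ H}
variable {𝒜 : H → Submodule ℂ A} [DecidableEq H] [GradedAlgebra 𝒜]
variable {Y : Induced B hB p 𝒜 →ₗ[ℂ] OpSeries (Induced B hB p 𝒜)}

theorem IsVertexField.integral (hY : IsVertexField B hB p 𝒜 Y) (hp : p ∈ projections B)
    (hA : IsAHPair B 𝒜) (v w : Induced B hB p 𝒜) {x y : ℝ} (hxy : ¬ ∃ n : ℤ, x - y = n) :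
    Y v x y w = 0 := by
  induction v using sector_span with
  | zero => simp
  | add v v' hv hv' => simp [hv, hv']
  | sector α v hv =>
    induction w using sector_span with
    | zero => simp
    | add w w' hw hw' => simp [hw, hw']
    | sector β w hw =>
      by_contra h0
      obtain ⟨⟨k, hk⟩, ⟨m, hm⟩, ⟨n, hn⟩⟩ := hY.onLattice hp hA hv hw h0
      refine hxy ⟨k + m - n, ?_⟩
      rw [← twistedForm_sub hB hp] at hk
      push_cast
      linarith

theorem onLattice_countable (α β : H) : {q : ℝ × ℝ | OnLattice B p α β q.1 q.2}.Countable := by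
  refine (Set.countable_range fun z : ℤ × ℤ => ((twistedForm B p (p α) (p β) + z.1,
    twistedForm B p ((1 - p) α) ((1 - p) β) + z.2) : ℝ × ℝ)).mono ?_
  rintro q ⟨-, ⟨m, hm⟩, ⟨n, hn⟩⟩
  exact ⟨(m, n), Prod.ext hm.symm hn.symm⟩

theorem IsVertexField.countable (hY : IsVertexField B hB p 𝒜 Y) (hp : p ∈ projections B)
    (hA : IsAHPair B 𝒜) (v w : Induced B hB p 𝒜) :
    {q : ℝ × ℝ | Y v q.1 q.2 w ≠ 0}.Countable := by
  induction v using sector_span with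
  | zero => simp
  | add v v' hv hv' =>
    refine (hv.union hv').mono fun q hq => ?_
    by_contra h
    simp only [Set.mem_union, Set.mem_setOf_eq, not_or, not_not] at h
    exact hq (by simp [h.1, h.2])
  | sector α v hv =>
    induction w using sector_span with
    | zero => simp
    | add w w' hw hw' =>
      refine (hw.union hw').mono fun q hq => ?_
      by_contra h
      simp only [Set.mem_union, Set.mem_setOf_eq, not_or, not_not] at h
      exact hq (by simp [h.1, h.2])
    | sector β w hw =>
      exact (onLattice_countable (B := B) (p := p) α β).mono fun q hq => hY.onLattice hp hA hv hw hq

theorem sector_eq_zero {β : H} (h : 𝒜 β = ⊥) {w : Induced B hB p 𝒜}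
    (hw : w ∈ sector B hB p 𝒜 β) : w = 0 := by
  refine sector_induction B hB p 𝒜 (C := fun w => w = 0) ?_ ?_ rfl ?_ ?_ w hw
  · intro a ha
    rw [h, Submodule.mem_bot] at ha
    rw [ha]; exact map_zero (inclHom B hB p 𝒜)
  · intro n h v _ hv
    rw [hv, map_zero]
  · intro v w hv hw
    rw [hv, hw, add_zero]
  · intro r v hv
    rw [hv, smul_zero]

/-- A nonzero operator must act on some sector with A^β ≠ 0, and for each such β the exponents lie
in one coset of ℤ². -/
theorem IsVertexField.countable_operators (hY : IsVertexField B hB p 𝒜 Y) (hp : p ∈ projections B)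
    (hA : IsAHPair B 𝒜) (hc : {α : H | 𝒜 α ≠ ⊥}.Countable) (v : Induced B hB p 𝒜) :
    {q : ℝ × ℝ | Y v q.1 q.2 ≠ 0}.Countable := by
  induction v using sector_span with
  | zero => simp
  | add v v' hv hv' =>
    refine (hv.union hv').mono fun q hq => ?_
    by_contra h
    simp only [Set.mem_union, Set.mem_setOf_eq, not_or, not_not] at h
    exact hq (by simp [h.1, h.2])
  | sector α v hv =>
    refine (hc.biUnion fun β _ => onLattice_countable (B := B) (p := p) α β).mono fun q hq => ?_
    by_contra h
    simp only [Set.mem_iUnion, not_exists] at h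
    refine hq (LinearMap.ext fun w => ?_)
    induction w using sector_span with
    | zero => simp
    | add w w' hw hw' => simp [hw, hw']
    | sector β w hw =>
      by_cases hβ : 𝒜 β = ⊥
      · rw [sector_eq_zero hβ hw, map_zero, map_zero]
      · by_contra h0
        exact h β hβ (hY.onLattice hp hA hv hw h0)

theorem IsVertexField.mem_grading (hY : IsVertexField B hB p 𝒜 Y) (hp : p ∈ projections B)
    {q q' : ℝ × ℝ} {v w : Induced B hB p 𝒜} (hv : v ∈ grading B hB p 𝒜 q)
    (hw : w ∈ grading B hB p 𝒜 q') (x y : ℝ) :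
    Y v x y w ∈ grading B hB p 𝒜 (q.1 + q'.1 + x, q.2 + q'.2 + y) := by
  rw [grading_eq_wtSpace B hB 𝒜 hp, mem_wtSpace] at *
  rw [hY.gradingOp B hB 𝒜 hp, hv, hw, map_smul, map_smul, Pi.smul_apply, Pi.smul_apply,
    LinearMap.smul_apply, ← add_smul, ← add_smul]
  congr 1
  simp only [cplx]
  push_cast
  ring

/-- The weight of A^α has h - h̄ = (α, α)/2, an integer by evenness whenever A^α ≠ 0; creation
operators add integers. -/
theorem grading_eq_bot (hp : p ∈ projections B) (hA : IsEvenAHPair B 𝒜) {q : ℝ × ℝ}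
    (h : ¬ ∃ n : ℤ, q.1 - q.2 = n) : grading B hB p 𝒜 q = ⊥ := by
  refine Submodule.span_eq_bot.2 ?_
  rintro _ ⟨α, a, ha, L, R, hL, hR, h1, h2, rfl⟩
  have ha0 : 𝒜 α = ⊥ := by
    by_contra h0
    obtain ⟨n, hn⟩ := hA.even α h0
    refine h ⟨n + degree L - degree R, ?_⟩
    rw [← twistedForm_sub hB hp] at hn
    rw [h1, h2]
    push_cast
    linarith
  exact sector_eq_zero ha0 (create_mem_sector B hB p 𝒜 _ (create_mem_sector B hB p 𝒜 _
    (incl_mem_sector B hB p 𝒜 ha)))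

theorem vl_eq_of_fS {h : H} {w : Induced B hB p 𝒜} (hw : ∀ j, fS B hB p 𝒜 h (j + 1) w = 0)
    (x : ℝ) : vl B hB p 𝒜 h x w = natExt (eS B hB p 𝒜 h) x w := by
  refine (vl_evSum B hB p 𝒜 h x w).unique ((EvSum.single 0 fun j hj => ?_).congr (fun _ => rfl) ?_)
  · obtain ⟨j, rfl⟩ := Nat.exists_eq_succ_of_ne_zero hj
    rw [hw, map_zero]
  · simp [fS, recSeq_zero]

theorem fS_eS_incl {h k : H} (hk : twistedForm B p k h = 0) (a : A) (i j : ℕ) :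
    fS B hB p 𝒜 h (j + 1) (eS B hB p 𝒜 k i (incl B hB p 𝒜 a)) = 0 := by
  have := LinearMap.congr_fun (eS_fS_comm B hB p 𝒜 hk i (j + 1)) (incl B hB p 𝒜 a)
  rw [Module.End.mul_apply, Module.End.mul_apply, fS_incl, map_zero] at this
  exact this.symm

theorem natExt_comp_mul {F : Type*} [AddCommGroup F] [Module ℂ F] {g : ℕ → Module.End ℂ F}
    {T : Module.End ℂ F} {w : F} (h : ∀ n, T (g n w) = 0) (x : ℝ) : T (natExt g x w) = 0 := by
  unfold natExt
  split_ifs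
  · exact h _
  · exact map_zero _

theorem vl_vl_incl (hp : p ∈ projections B) (α α' : H) (a : A) (x y : ℝ) :
    vl B hB p 𝒜 (p α) x (vl B hB p 𝒜 ((1 - p) α') y (incl B hB p 𝒜 a)) =
      natExt (eS B hB p 𝒜 (p α)) x (natExt (eS B hB p 𝒜 ((1 - p) α')) y (incl B hB p 𝒜 a)) := by
  rw [vl_eq_of_fS (fun j => fS_incl B hB p 𝒜 _ a j), vl_eq_of_fS fun j => natExt_comp_mul
    (fun n => fS_eS_incl (twistedForm_proj B hp α' α).2 a n j) y]

theorem IsVertexField.incl_incl (hY : IsVertexField B hB p 𝒜 Y) (hp : p ∈ projections B)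
    {α β : H} {a b : A} (ha : a ∈ 𝒜 α) (hb : b ∈ 𝒜 β) (x y : ℝ) :
    Y (incl B hB p 𝒜 a) x y (incl B hB p 𝒜 b) =
      natExt (eS B hB p 𝒜 (p α)) (x - twistedForm B p (p α) (p β))
        (natExt (eS B hB p 𝒜 ((1 - p) α)) (y - twistedForm B p ((1 - p) α) ((1 - p) β))
          (incl B hB p 𝒜 (a * b))) := by
  rw [hY.base α a ha β _ (incl_mem_sector B hB p 𝒜 hb), lmap_incl, vl_vl_incl hp]

theorem heis_vacuum (n : ℕ) (h : H) : heis B hB p 𝒜 n h (incl B hB p 𝒜 1) = 0 := by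
  rcases Nat.eq_zero_or_pos n with rfl | hn
  · have := heis_zero_incl B hB p 𝒜 h 0 (SetLike.one_mem_graded 𝒜)
    simpa using this
  · exact heis_incl_pos B hB p 𝒜 (by omega) h 1

theorem natExt_eS_zero (x : ℝ) (w : Induced B hB p 𝒜) :
    natExt (eS B hB p 𝒜 0) x w = if x = 0 then w else 0 := by
  split_ifs with h
  · subst h
    have := natExt_natCast (eS B hB p 𝒜 0) 0
    rw [Nat.cast_zero] at this
    rw [this, eS, recSeq_zero]; rfl
  · by_cases hx : ∃ n : ℕ, x = n
    · obtain ⟨n, rfl⟩ := hx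
      rcases n with _ | n
      · simp at h
      · rw [natExt_natCast, eS, recSeq_of_zero fun m => heis_zero_right B hB p 𝒜 _,
          LinearMap.zero_apply]
    · push Not at hx
      rw [natExt_of_ne hx, LinearMap.zero_apply]

theorem vl_zero (x : ℝ) (w : Induced B hB p 𝒜) :
    vl B hB p 𝒜 0 x w = if x = 0 then w else 0 := by
  rw [vl_eq_of_fS fun j => ?_, natExt_eS_zero]
  rw [fS, recSeq_of_zero fun m => by rw [heis_zero_right, neg_zero], LinearMap.zero_apply]

theorem lmap_one (w : Induced B hB p 𝒜) : lmap B hB p 𝒜 1 w = w := by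
  induction w using sector_span with
  | zero => simp
  | add v w hv hw => rw [map_add, hv, hw]
  | sector β w hw =>
    have h1 := secMul_sector B hB p 𝒜 hw 1
    rw [(AHVertex.mem_sector B hB p 𝒜).1 hw] at h1
    exact (Finsupp.single_injective β h1).symm

theorem IsVertexField.vacuum (hY : IsVertexField B hB p 𝒜 Y) (x y : ℝ) (w : Induced B hB p 𝒜) :
    Y (incl B hB p 𝒜 1) x y w = if x = 0 ∧ y = 0 then w else 0 := by
  induction w using sector_span with
  | zero => simp
  | add v w hv hw => rw [map_add, hv, hw]; split_ifs <;> simp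
  | sector β w hw =>
    rw [hY.base 0 1 (SetLike.one_mem_graded 𝒜) β w hw]
    simp only [map_zero, LinearMap.zero_apply, sub_zero, vl_zero, lmap_one]
    split_ifs <;> simp_all

/-- All annihilation operators, the zero modes included, kill the vacuum. Hence only creation parts
survive, and these carry nonnegative integral exponents. -/
theorem IsVertexField.apply_vacuum (hY : IsVertexField B hB p 𝒜 Y) (hp : p ∈ projections B)
    (v : Induced B hB p 𝒜) : (∀ x y, Y v x y (incl B hB p 𝒜 1) ≠ 0 → ∃ m n : ℕ, x = m ∧ y = n) ∧
      Y v 0 0 (incl B hB p 𝒜 1) = v := by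
  refine chiral_induction hp (C := fun v => (∀ x y, Y v x y (incl B hB p 𝒜 1) ≠ 0 →
    ∃ m n : ℕ, x = m ∧ y = n) ∧ Y v 0 0 (incl B hB p 𝒜 1) = v) ?_ ?_ ?_ ?_ ?_ v
  · intro α a ha
    have key (x y) := hY.incl_incl hp ha (SetLike.one_mem_graded 𝒜) x y
    simp only [map_zero, sub_zero, mul_one] at key
    refine ⟨fun x y h0 => ?_, ?_⟩
    · rw [key] at h0
      obtain ⟨m, hm⟩ := natExt_ne_zero (g := eS B hB p 𝒜 (p α)) (x := x) fun h => h0 (by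
        rw [h, LinearMap.zero_apply])
      obtain ⟨n, hn⟩ := natExt_ne_zero (g := eS B hB p 𝒜 ((1 - p) α)) (x := y) fun h => h0 (by
        rw [h, LinearMap.zero_apply, map_zero])
      exact ⟨m, n, hm, hn⟩
    · have e1 := natExt_natCast (eS B hB p 𝒜 (p α)) 0
      have e2 := natExt_natCast (eS B hB p 𝒜 ((1 - p) α)) 0
      rw [Nat.cast_zero] at e1 e2
      rw [key, e1, e2, eS, eS, recSeq_zero, recSeq_zero]; rfl
  · rintro n ε h hh v ⟨hv, hv'⟩
    have hR (x y : ℝ) : rmulS (ann B hB p 𝒜 h) ε n (Y v) x y (incl B hB p 𝒜 1) = 0 :=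
      (rmulS_evSum (ann_locFin B hB p 𝒜 h) ε n (Y v) x y _).unique (EvSum.of_eq_zero fun m => by
        rw [show ann B hB p 𝒜 h m (incl B hB p 𝒜 1) = 0 from heis_vacuum m h, map_zero, smul_zero])
    have hL (x y : ℝ) := lmulS_evSum (cre B hB p 𝒜 h) ε n (hY.isField v) x y (incl B hB p 𝒜 1)
    rw [hY.chiral hh]
    refine ⟨fun x y h0 => ?_, ?_⟩
    · rw [normS, Pi.add_apply, Pi.add_apply, LinearMap.add_apply, hR, add_zero] at h0
      have : ∃ m : ℕ, Ring.choose (m : ℂ) n • cre B hB p 𝒜 h m (Y v (x - (dir ε).1 * (m - n))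
          (y - (dir ε).2 * (m - n)) (incl B hB p 𝒜 1)) ≠ 0 := by
        by_contra! h1
        exact h0 ((hL x y).unique (EvSum.of_eq_zero h1))
      obtain ⟨m, hm⟩ := this
      have hmn : n ≤ m := by
        by_contra h1
        exact hm (by rw [choose_natCast_of_lt (by omega), zero_smul])
      obtain ⟨i, j, hi, hj⟩ := hv _ _ fun h1 => hm (by rw [h1, map_zero, smul_zero])
      cases ε
      · refine ⟨i, j + (m - n), by simpa [dir] using hi, ?_⟩
        push_cast [hmn]
        simp only [dir] at hj
        linarith
      · refine ⟨i + (m - n), j, ?_, by simpa [dir] using hj⟩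
        push_cast [hmn]
        simp only [dir] at hi
        linarith
    · rw [normS, Pi.add_apply, Pi.add_apply, LinearMap.add_apply, hR, add_zero]
      -- At exponent (0, 0) the terms with m < n vanish by the binomial coefficient, and those with
      -- m > n would need a negative exponent on the vacuum.
      refine (hL 0 0).unique ((EvSum.single n fun m hm => ?_).congr (fun _ => rfl) ?_)
      · rcases lt_or_gt_of_ne hm with h1 | h1
        · rw [choose_natCast_of_lt h1, zero_smul]
        · have h2 : (n : ℝ) < m := by exact_mod_cast h1
          rw [show Y v _ _ (incl B hB p 𝒜 1) = 0 from ?_, map_zero, smul_zero]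
          by_contra h3
          obtain ⟨i, j, hi, hj⟩ := hv _ _ h3
          have hi' : (0 : ℝ) ≤ i := i.cast_nonneg
          have hj' : (0 : ℝ) ≤ j := j.cast_nonneg
          cases ε <;> simp only [dir] at hi hj <;> linarith
      · simp only [sub_self, mul_zero, hv']
        rw [Ring.choose_natCast, Nat.choose_self, Nat.cast_one, one_smul]; rfl
  · exact ⟨fun x y h => absurd (by simp) h, by simp⟩
  · rintro v w ⟨hv, hv'⟩ ⟨hw, hw'⟩
    refine ⟨fun x y h => ?_, by rw [map_add, Pi.add_apply, Pi.add_apply, LinearMap.add_apply, hv',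
      hw']⟩
    by_cases h1 : Y v x y (incl B hB p 𝒜 1) = 0
    · exact hw x y fun h2 => h (by simp [h1, h2])
    · exact hv x y h1
  · rintro r v ⟨hv, hv'⟩
    exact ⟨fun x y h => hv x y fun h1 => h (by simp [h1]), by
      rw [map_smul, Pi.smul_apply, Pi.smul_apply, LinearMap.smul_apply, hv']⟩

end Axioms

end
end AHVertex

open scoped TensorProduct
namespace AHVertex
noncomputable section

/-! ## Monomial correlation functions -/

section Monomials

/-- The exponents of a function `z₁^α₁ z₂^α₂ (z₁-z₂)^α₁₂ z̄₁^β₁ z̄₂^β₂ (z̄₁-z̄₂)^β₁₂`. -/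
structure Expo where
  (α₁ α₂ α₁₂ β₁ β₂ β₁₂ : ℝ)
  int₁ : ∃ n : ℤ, α₁ - β₁ = n
  int₂ : ∃ n : ℤ, α₂ - β₂ = n
  int₁₂ : ∃ n : ℤ, α₁₂ - β₁₂ = n

open Classical in
/-- The expansion of the constant function `1`. -/
def unitSeries (r s : ℝ) : ℂ := if r = 0 ∧ s = 0 then 1 else 0

theorem isExpansionAtZero_one : IsExpansionAtZero (fun _ => 1) unitSeries := by
  have h (r s : ℝ) (h : unitSeries r s ≠ 0) : r = 0 ∧ s = 0 := by
    by_contra h0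
    exact h (if_neg h0)
  refine ⟨⟨fun r s h0 => ⟨0, by simp [h r s h0]⟩, ?_, 0, fun r s h0 => ⟨(h r s h0).1.ge,
    (h r s h0).2.ge⟩⟩, 1, one_pos, fun q _ _ => ?_⟩
  · exact (Set.countable_singleton ((0, 0) : ℝ × ℝ)).mono fun q hq =>
      Prod.ext (h _ _ hq).1 (h _ _ hq).2
  · have := hasSum_single (f := fun r : ℝ × ℝ => unitSeries r.1 r.2 * cpow2 q r.1 r.2) (0, 0)
      fun r hr => by
        rw [unitSeries, if_neg fun h0 => hr (Prod.ext h0.1 h0.2), zero_mul]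
    simpa [unitSeries, cpow2] using this

/-- The monomial function as an element of `GCor₂`. -/
def Expo.term (e : Expo) : GTerm where
  α₁ := e.α₁
  α₂ := e.α₂
  α₁₂ := e.α₁₂
  β₁ := e.β₁
  β₂ := e.β₂
  β₁₂ := e.β₁₂
  int₁ := e.int₁
  int₂ := e.int₂
  int₁₂ := e.int₁₂
  f := fun _ => 1
  mem_f :=
    { analytic := analyticOnNhd_const
      sing_zero := fun _ _ _ _ => ⟨unitSeries, isExpansionAtZero_one⟩
      sing_one := fun _ _ _ _ => ⟨unitSeries, isExpansionAtZero_one⟩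
      sing_inf := fun _ _ _ _ => ⟨unitSeries, isExpansionAtZero_one⟩ }
  j₀ := unitSeries
  jinf := unitSeries
  j₁ := unitSeries
  exp_zero := isExpansionAtZero_one
  exp_inf := isExpansionAtZero_one
  exp_one := isExpansionAtZero_one

theorem finsum_unitSeries (f g : ℕ → ℂ) (x y : ℝ) :
    ∑ᶠ k : ℕ × ℕ, f k.1 * g k.2 * unitSeries (x - k.1) (y - k.2) = natExt f x * natExt g y := by
  have h (k : ℕ × ℕ) : f k.1 * g k.2 * unitSeries (x - k.1) (y - k.2) ≠ 0 → x = k.1 ∧ y = k.2 := by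
    intro h
    by_contra h0
    rw [unitSeries, if_neg fun h1 => h0 ⟨sub_eq_zero.1 h1.1, sub_eq_zero.1 h1.2⟩, mul_zero] at h
    exact h rfl
  by_cases hx : ∃ k : ℕ × ℕ, x = k.1 ∧ y = k.2
  · obtain ⟨k, rfl, rfl⟩ := hx
    rw [finsum_eq_single _ k fun k' hk' => ?_]
    · simp [unitSeries]
    · by_contra h0
      obtain ⟨h1, h2⟩ := h k' h0
      exact hk' (Prod.ext (by exact_mod_cast h1.symm) (by exact_mod_cast h2.symm))
  · rw [finsum_eq_zero_of_forall_eq_zero fun k => by_contra fun h0 => hx ⟨k, h k h0⟩]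
    by_contra h0
    obtain ⟨i, hi⟩ := natExt_ne_zero (left_ne_zero_of_mul (Ne.symm h0))
    obtain ⟨j, hj⟩ := natExt_ne_zero (right_ne_zero_of_mul (Ne.symm h0))
    exact hx ⟨(i, j), hi, hj⟩

/-- The coefficients of `(1 + q)^t`. -/
def binS (t : ℝ) (x : ℝ) : ℂ := natExt (fun k => Ring.choose (t : ℂ) k) x

/-- The coefficients of `(1 - q)^t`. -/
def altS (t : ℝ) (x : ℝ) : ℂ := natExt (fun k => (-1) ^ k * Ring.choose (t : ℂ) k) x

open Classical in
/-- The expansions of a monomial function in the three regions. -/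
def Expo.mono (e : Expo) : Series4 × Series4 × Series4 :=
  (fun x₁ y₁ x₂ y₂ => if x₁ + x₂ = e.α₁ + e.α₂ + e.α₁₂ ∧ y₁ + y₂ = e.β₁ + e.β₂ + e.β₁₂ then
      altS e.α₁₂ (x₂ - e.α₂) * altS e.β₁₂ (y₂ - e.β₂) else 0,
    fun x₀ y₀ x₂ y₂ => if x₀ + x₂ = e.α₁ + e.α₂ + e.α₁₂ ∧ y₀ + y₂ = e.β₁ + e.β₂ + e.β₁₂ then
      binS e.α₁ (x₀ - e.α₁₂) * binS e.β₁ (y₀ - e.β₁₂) else 0,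
    fun x₁ y₁ x₂ y₂ => if x₁ + x₂ = e.α₁ + e.α₂ + e.α₁₂ ∧ y₁ + y₂ = e.β₁ + e.β₂ + e.β₁₂ then
      signPow (e.α₁₂ - e.β₁₂) * (altS e.α₁₂ (x₁ - e.α₁) * altS e.β₁₂ (y₁ - e.β₁)) else 0)

theorem Expo.mono_eq (e : Expo) : e.mono = (e.term.exp₁₂, e.term.exp₂₀, e.term.exp₂₁) := by
  have h (t t' x y : ℝ) : altS t x * altS t' y = ∑ᶠ k : ℕ × ℕ, (Ring.choose (t : ℂ) k.1) *
      (Ring.choose (t' : ℂ) k.2) * (-1) ^ (k.1 + k.2) * unitSeries (x - k.1) (y - k.2) := by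
    rw [altS, altS, ← finsum_unitSeries]
    refine finsum_congr fun k => ?_
    rw [pow_add]; ring
  refine Prod.ext ?_ (Prod.ext ?_ ?_)
  · funext x₁ y₁ x₂ y₂
    simp only [mono, h]
    rfl
  · funext x₀ y₀ x₂ y₂
    simp only [mono, binS, ← finsum_unitSeries, GTerm.exp₂₀]
    refine if_congr Iff.rfl (finsum_congr fun k => ?_) rfl
    simp only [term]
    congr 1
    -- The sign of the chart q = -z₀/z₂ is invisible for a constant f, whose only coefficient sits
    -- at exponent (0, 0).
    simp only [unitSeries]
    split_ifs with h0
    · rw [h0.1, h0.2]; simp [signPow]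
    · rw [mul_zero]
  · funext x₁ y₁ x₂ y₂
    simp only [mono, h]
    rfl

/-- The span of the expansions of monomial functions. -/
def Good : Submodule ℂ (Series4 × Series4 × Series4) := Submodule.span ℂ (Set.range Expo.mono)

/-- The three expansions are kept together in a triple so that one function μ serves for all
regions. -/
theorem exists_gcor_of_good {T : Series4 × Series4 × Series4} (hT : T ∈ Good) :
    ∃ μ ∈ GCor2, (μ, T.1) ∈ expansion₁₂ ∧ (μ, T.2.1) ∈ expansion₂₀ ∧ (μ, T.2.2) ∈ expansion₂₁ := by
  induction hT using Submodule.span_induction with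
  | zero => exact ⟨0, Submodule.zero_mem _, Submodule.zero_mem _, Submodule.zero_mem _,
      Submodule.zero_mem _⟩
  | add T T' _ _ h h' =>
    obtain ⟨μ, h0, h1, h2, h3⟩ := h
    obtain ⟨μ', h0', h1', h2', h3'⟩ := h'
    exact ⟨μ + μ', Submodule.add_mem _ h0 h0', Submodule.add_mem _ h1 h1',
      Submodule.add_mem _ h2 h2', Submodule.add_mem _ h3 h3'⟩
  | smul r T _ h =>
    obtain ⟨μ, h0, h1, h2, h3⟩ := h
    exact ⟨r • μ, Submodule.smul_mem _ r h0, Submodule.smul_mem _ r h1, Submodule.smul_mem _ r h2,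
      Submodule.smul_mem _ r h3⟩
  | mem T hT =>
    obtain ⟨e, rfl⟩ := hT
    rw [e.mono_eq]
    exact ⟨e.term.toFun, Submodule.subset_span ⟨_, rfl⟩, Submodule.subset_span ⟨_, rfl⟩,
      Submodule.subset_span ⟨_, rfl⟩, Submodule.subset_span ⟨_, rfl⟩⟩

/-- Exchange of the holomorphic and antiholomorphic variables. -/
def swap4 (S : Series4) : Series4 := fun x₁ y₁ x₂ y₂ => S y₁ x₁ y₂ x₂

theorem signPow_neg {x : ℝ} (h : ∃ n : ℤ, x = n) : signPow (-x) = signPow x := by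
  obtain ⟨n, rfl⟩ := h
  rw [signPow, signPow, ← Int.cast_neg, Int.floor_intCast, Int.floor_intCast, zpow_neg,
    ← inv_zpow, inv_neg, inv_one]

/-- The set of monomials is symmetric in z and z̄; the sign depends only on the parity of the
integer α₁₂ - β₁₂. This transfers every statement about holomorphic currents to antiholomorphic
ones. -/
theorem good_swap {T : Series4 × Series4 × Series4} (hT : T ∈ Good) :
    (swap4 T.1, swap4 T.2.1, swap4 T.2.2) ∈ Good := by
  induction hT using Submodule.span_induction with
  | zero => exact Submodule.zero_mem _
  | add T T' _ _ h h' => exact Submodule.add_mem _ h h'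
  | smul r T _ h => exact Submodule.smul_mem _ r h
  | mem T hT =>
    obtain ⟨e, rfl⟩ := hT
    have hn {x y : ℝ} : (∃ n : ℤ, x - y = n) → ∃ n : ℤ, y - x = n := fun ⟨n, hn⟩ =>
      ⟨-n, by push_cast; linarith⟩
    refine Submodule.subset_span ⟨⟨e.β₁, e.β₂, e.β₁₂, e.α₁, e.α₂, e.α₁₂, hn e.int₁, hn e.int₂,
      hn e.int₁₂⟩, ?_⟩
    have hs := signPow_neg e.int₁₂
    rw [neg_sub] at hs
    refine Prod.ext ?_ (Prod.ext ?_ ?_)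
    · funext x₁ y₁ x₂ y₂
      exact if_congr and_comm (mul_comm _ _) rfl
    · funext x₁ y₁ x₂ y₂
      exact if_congr and_comm (mul_comm _ _) rfl
    · funext x₁ y₁ x₂ y₂
      exact if_congr and_comm (by dsimp only; rw [hs, mul_comm (altS _ _)]) rfl

/-! ### Multiplication by integral powers -/

theorem binS_add (t : ℝ) (r : ℤ) (x : ℝ) :
    EvSum (fun i : ℕ => Ring.choose (r : ℂ) i * binS t (x - i)) (binS (t + r) x) := by
  by_cases hx : ∃ n : ℕ, x = n
  · obtain ⟨n, rfl⟩ := hx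
    refine (EvSum.of_zero (N := n + 1) fun i hi => ?_).congr (fun _ => rfl) ?_
    · have : (n : ℝ) < i := by exact_mod_cast hi
      rw [binS, natExt_of_neg (by linarith), mul_zero]
    · have h1 := Ring.add_choose_eq n (Commute.all (r : ℂ) (t : ℂ))
      rw [binS, natExt_natCast, show ((t + r : ℝ) : ℂ) = (r : ℂ) + t by push_cast; ring, h1,
        Finset.Nat.sum_antidiagonal_eq_sum_range_succ fun i j =>
          Ring.choose (r : ℂ) i * Ring.choose (t : ℂ) j]
      refine Finset.sum_congr rfl fun i hi => ?_
      rw [binS, natExt_sub, if_pos (by simpa [Nat.lt_succ_iff] using hi)]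
  · push Not at hx
    rw [binS, natExt_of_ne hx]
    refine EvSum.of_eq_zero fun i => ?_
    rw [binS, natExt_of_ne fun n hn => hx (n + i) (by push_cast; linarith), mul_zero]

theorem altS_eq (t x : ℝ) : altS t x = signPow x * binS t x := by
  by_cases hx : ∃ n : ℕ, x = n
  · obtain ⟨n, rfl⟩ := hx
    rw [altS, binS, natExt_natCast, natExt_natCast, signPow, Int.floor_natCast, zpow_natCast]
  · push Not at hx
    rw [altS, binS, natExt_of_ne hx, natExt_of_ne hx, mul_zero]

theorem signPow_add_int (x : ℝ) (n : ℤ) : signPow (x + n) = (-1) ^ n * signPow x := by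
  rw [signPow, signPow, Int.floor_add_intCast, zpow_add₀ (by norm_num), mul_comm]

theorem altS_add (t : ℝ) (r : ℤ) (x : ℝ) :
    EvSum (fun i : ℕ => (-1) ^ i * Ring.choose (r : ℂ) i * altS t (x - i)) (altS (t + r) x) := by
  refine ((binS_add t r x).smul (signPow x)).congr (fun i => ?_) (altS_eq _ _).symm
  have h := signPow_add_int (x - i) i
  rw [show x - i + ((i : ℤ) : ℝ) = x by push_cast; ring, zpow_natCast] at h
  rw [altS_eq, h, smul_eq_mul]
  have h2 : ((-1 : ℂ) ^ i) * (-1) ^ i = 1 := by rw [← mul_pow]; norm_num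
  ring

/-- `T'` is `z₁^r T`. -/
def IsZ1 (r : ℤ) (T T' : Series4 × Series4 × Series4) : Prop :=
  ∀ x₁ y₁ x₂ y₂ : ℝ, T'.1 x₁ y₁ x₂ y₂ = T.1 (x₁ - r) y₁ x₂ y₂ ∧
    EvSum (fun i : ℕ => Ring.choose (r : ℂ) i * T.2.1 (x₁ - i) y₁ (x₂ - (r - i)) y₂)
      (T'.2.1 x₁ y₁ x₂ y₂) ∧ T'.2.2 x₁ y₁ x₂ y₂ = T.2.2 (x₁ - r) y₁ x₂ y₂

/-- `T'` is `z₂^r T`. -/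
def IsZ2 (r : ℤ) (T T' : Series4 × Series4 × Series4) : Prop :=
  ∀ x₁ y₁ x₂ y₂ : ℝ, T'.1 x₁ y₁ x₂ y₂ = T.1 x₁ y₁ (x₂ - r) y₂ ∧
    T'.2.1 x₁ y₁ x₂ y₂ = T.2.1 x₁ y₁ (x₂ - r) y₂ ∧ T'.2.2 x₁ y₁ x₂ y₂ = T.2.2 x₁ y₁ (x₂ - r) y₂

/-- `T'` is `(z₁ - z₂)^r T`. -/
def IsZ12 (r : ℤ) (T T' : Series4 × Series4 × Series4) : Prop :=
  ∀ x₁ y₁ x₂ y₂ : ℝ, EvSum (fun i : ℕ => (-1) ^ i * Ring.choose (r : ℂ) i *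
      T.1 (x₁ - (r - i)) y₁ (x₂ - i) y₂) (T'.1 x₁ y₁ x₂ y₂) ∧
    T'.2.1 x₁ y₁ x₂ y₂ = T.2.1 (x₁ - r) y₁ x₂ y₂ ∧
    EvSum (fun i : ℕ => (-1) ^ r * ((-1) ^ i * Ring.choose (r : ℂ) i) *
      T.2.2 (x₁ - i) y₁ (x₂ - (r - i)) y₂) (T'.2.2 x₁ y₁ x₂ y₂)

/-- A monomial times z₁^r is a monomial, and r ∈ ℤ preserves the integrality condition. In the
region |z₂| > |z₁ - z₂| one has z₁ = z₂ + z₀, and compatibility of the binomial expansions is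
Vandermonde's identity. -/
theorem good_z1 (r : ℤ) {T : Series4 × Series4 × Series4} (hT : T ∈ Good) :
    ∃ T' ∈ Good, IsZ1 r T T' := by
  induction hT using Submodule.span_induction with
  | zero => exact ⟨0, Submodule.zero_mem _, fun _ _ _ _ => ⟨rfl, EvSum.of_eq_zero fun _ =>
      mul_zero _, rfl⟩⟩
  | add S S' _ _ h h' =>
    obtain ⟨U, hU, h⟩ := h
    obtain ⟨U', hU', h'⟩ := h'
    refine ⟨U + U', Submodule.add_mem _ hU hU', fun x₁ y₁ x₂ y₂ => ?_⟩
    obtain ⟨e1, e2, e3⟩ := h x₁ y₁ x₂ y₂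
    obtain ⟨e1', e2', e3'⟩ := h' x₁ y₁ x₂ y₂
    exact ⟨congrArg₂ (· + ·) e1 e1', (e2.add e2').congr (fun i => (mul_add _ _ _).symm) rfl,
      congrArg₂ (· + ·) e3 e3'⟩
  | smul c S _ h =>
    obtain ⟨U, hU, h⟩ := h
    refine ⟨c • U, Submodule.smul_mem _ c hU, fun x₁ y₁ x₂ y₂ => ?_⟩
    obtain ⟨e1, e2, e3⟩ := h x₁ y₁ x₂ y₂
    exact ⟨congrArg (c * ·) e1, (e2.smul c).congr (fun i => mul_left_comm _ _ _) rfl,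
      congrArg (c * ·) e3⟩
  | mem T hT =>
    obtain ⟨e, rfl⟩ := hT
    obtain ⟨n, hn⟩ := e.int₁
    refine ⟨_, Submodule.subset_span ⟨⟨e.α₁ + r, e.α₂, e.α₁₂, e.β₁, e.β₂, e.β₁₂,
      ⟨n + r, by push_cast; linarith⟩, e.int₂, e.int₁₂⟩, rfl⟩, fun x₁ y₁ x₂ y₂ => ⟨?_, ?_, ?_⟩⟩
    · refine if_congr (and_congr_left fun _ => ?_) rfl rfl
      constructor <;> intro h <;> linarith
    · simp only [Expo.mono]
      by_cases h : x₁ + x₂ = e.α₁ + r + e.α₂ + e.α₁₂ ∧ y₁ + y₂ = e.β₁ + e.β₂ + e.β₁₂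
      · rw [if_pos h]
        refine ((binS_add e.α₁ r (x₁ - e.α₁₂)).smul (binS e.β₁ (y₁ - e.β₁₂))).congr
          (fun i => ?_) (mul_comm _ _)
        rw [if_pos ⟨by linarith [h.1], h.2⟩, smul_eq_mul, sub_right_comm]
        ring
      · rw [if_neg h]
        refine EvSum.of_eq_zero fun i => ?_
        rw [if_neg fun h' => h ⟨by linarith [h'.1], h'.2⟩, mul_zero]
    · refine if_congr (and_congr_left fun _ => ?_) (by
        dsimp only; rw [sub_add_eq_sub_sub_swap]) rfl
      constructor <;> intro h <;> linarith

theorem good_z2 (r : ℤ) {T : Series4 × Series4 × Series4} (hT : T ∈ Good) :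
    ∃ T' ∈ Good, IsZ2 r T T' := by
  induction hT using Submodule.span_induction with
  | zero => exact ⟨0, Submodule.zero_mem _, fun _ _ _ _ => ⟨rfl, rfl, rfl⟩⟩
  | add S S' _ _ h h' =>
    obtain ⟨U, hU, h⟩ := h
    obtain ⟨U', hU', h'⟩ := h'
    refine ⟨U + U', Submodule.add_mem _ hU hU', fun x₁ y₁ x₂ y₂ => ?_⟩
    obtain ⟨e1, e2, e3⟩ := h x₁ y₁ x₂ y₂
    obtain ⟨e1', e2', e3'⟩ := h' x₁ y₁ x₂ y₂
    exact ⟨congrArg₂ (· + ·) e1 e1', congrArg₂ (· + ·) e2 e2', congrArg₂ (· + ·) e3 e3'⟩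
  | smul c S _ h =>
    obtain ⟨U, hU, h⟩ := h
    refine ⟨c • U, Submodule.smul_mem _ c hU, fun x₁ y₁ x₂ y₂ => ?_⟩
    obtain ⟨e1, e2, e3⟩ := h x₁ y₁ x₂ y₂
    exact ⟨congrArg (c * ·) e1, congrArg (c * ·) e2, congrArg (c * ·) e3⟩
  | mem T hT =>
    obtain ⟨e, rfl⟩ := hT
    obtain ⟨n, hn⟩ := e.int₂
    refine ⟨_, Submodule.subset_span ⟨⟨e.α₁, e.α₂ + r, e.α₁₂, e.β₁, e.β₂, e.β₁₂, e.int₁,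
      ⟨n + r, by push_cast; linarith⟩, e.int₁₂⟩, rfl⟩, fun x₁ y₁ x₂ y₂ => ⟨?_, ?_, ?_⟩⟩
    · refine if_congr (and_congr_left fun _ => ?_) (by
        dsimp only; rw [sub_add_eq_sub_sub_swap]) rfl
      constructor <;> intro h <;> linarith
    · refine if_congr (and_congr_left fun _ => ?_) rfl rfl
      constructor <;> intro h <;> linarith
    · refine if_congr (and_congr_left fun _ => ?_) rfl rfl
      constructor <;> intro h <;> linarith

/-- Here it is the two outer regions that require a binomial expansion; in |z₂| > |z₁| the sign
(-1)^r appears because z₁ - z₂ is expanded as -(z₂ - z₁). -/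
theorem good_z12 (r : ℤ) {T : Series4 × Series4 × Series4} (hT : T ∈ Good) :
    ∃ T' ∈ Good, IsZ12 r T T' := by
  induction hT using Submodule.span_induction with
  | zero => exact ⟨0, Submodule.zero_mem _, fun _ _ _ _ => ⟨EvSum.of_eq_zero fun _ =>
      mul_zero _, rfl, EvSum.of_eq_zero fun _ => mul_zero _⟩⟩
  | add S S' _ _ h h' =>
    obtain ⟨U, hU, h⟩ := h
    obtain ⟨U', hU', h'⟩ := h'
    refine ⟨U + U', Submodule.add_mem _ hU hU', fun x₁ y₁ x₂ y₂ => ?_⟩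
    obtain ⟨e1, e2, e3⟩ := h x₁ y₁ x₂ y₂
    obtain ⟨e1', e2', e3'⟩ := h' x₁ y₁ x₂ y₂
    exact ⟨(e1.add e1').congr (fun i => (mul_add _ _ _).symm) rfl, congrArg₂ (· + ·) e2 e2',
      (e3.add e3').congr (fun i => (mul_add _ _ _).symm) rfl⟩
  | smul c S _ h =>
    obtain ⟨U, hU, h⟩ := h
    refine ⟨c • U, Submodule.smul_mem _ c hU, fun x₁ y₁ x₂ y₂ => ?_⟩
    obtain ⟨e1, e2, e3⟩ := h x₁ y₁ x₂ y₂
    exact ⟨(e1.smul c).congr (fun i => mul_left_comm _ _ _) rfl, congrArg (c * ·) e2,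
      (e3.smul c).congr (fun i => mul_left_comm _ _ _) rfl⟩
  | mem T hT =>
    obtain ⟨e, rfl⟩ := hT
    obtain ⟨n, hn⟩ := e.int₁₂
    refine ⟨_, Submodule.subset_span ⟨⟨e.α₁, e.α₂, e.α₁₂ + r, e.β₁, e.β₂, e.β₁₂, e.int₁, e.int₂,
      ⟨n + r, by push_cast; linarith⟩⟩, rfl⟩, fun x₁ y₁ x₂ y₂ => ⟨?_, ?_, ?_⟩⟩
    · simp only [Expo.mono]
      by_cases h : x₁ + x₂ = e.α₁ + e.α₂ + (e.α₁₂ + r) ∧ y₁ + y₂ = e.β₁ + e.β₂ + e.β₁₂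
      · rw [if_pos h]
        refine ((altS_add e.α₁₂ r (x₂ - e.α₂)).smul (altS e.β₁₂ (y₂ - e.β₂))).congr
          (fun i => ?_) (mul_comm _ _)
        rw [if_pos ⟨by linarith [h.1], h.2⟩, smul_eq_mul, sub_right_comm]
        ring
      · rw [if_neg h]
        refine EvSum.of_eq_zero fun i => ?_
        rw [if_neg fun h' => h ⟨by linarith [h'.1], h'.2⟩, mul_zero]
    · refine if_congr (and_congr_left fun _ => ?_) (by
        dsimp only; rw [sub_add_eq_sub_sub_swap]) rfl
      constructor <;> intro h <;> linarith
    · simp only [Expo.mono]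
      by_cases h : x₁ + x₂ = e.α₁ + e.α₂ + (e.α₁₂ + r) ∧ y₁ + y₂ = e.β₁ + e.β₂ + e.β₁₂
      · rw [if_pos h, show e.α₁₂ + r - e.β₁₂ = e.α₁₂ - e.β₁₂ + r by ring, signPow_add_int]
        refine ((altS_add e.α₁₂ r (x₁ - e.α₁)).smul ((-1) ^ r * signPow (e.α₁₂ - e.β₁₂) *
          altS e.β₁₂ (y₁ - e.β₁))).congr (fun i => ?_) (by rw [smul_eq_mul]; ring)
        rw [if_pos ⟨by linarith [h.1], h.2⟩, smul_eq_mul, sub_right_comm]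
        ring
      · rw [if_neg h]
        refine EvSum.of_eq_zero fun i => ?_
        rw [if_neg fun h' => h ⟨by linarith [h'.1], h'.2⟩, mul_zero]

end Monomials

end
end AHVertex

open scoped TensorProduct
namespace AHVertex
noncomputable section

/-! ## Recursion for correlation functions -/

section Recursion

variable {F : Type*} [AddCommGroup F] [Module ℂ F]

/-- The three series attached to a correlation function. -/
def corr (Y : F →ₗ[ℂ] OpSeries F) (u : F →ₗ[ℂ] ℂ) (a b w : F) : Series4 × Series4 × Series4 :=
  (fun x₁ y₁ x₂ y₂ => u (Y a x₁ y₁ (Y b x₂ y₂ w)),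
    fun x₀ y₀ x₂ y₂ => u (Y (Y a x₀ y₀ b) x₂ y₂ w),
    fun x₁ y₁ x₂ y₂ => u (Y b x₂ y₂ (Y a x₁ y₁ w)))

/-- The map `v ↦ Y(v, z) w` on coefficients. -/
def coeffAt (Y : F →ₗ[ℂ] OpSeries F) (x y : ℝ) (w : F) : F →ₗ[ℂ] F where
  toFun v := Y v x y w
  map_add' v v' := by rw [map_add]; rfl
  map_smul' r v := by rw [map_smul]; rfl

/-- The operators `c_n` are the modes of a holomorphic current. -/
structure IsCurrent (c : ℤ → Module.End ℂ F) (Y : F →ₗ[ℂ] OpSeries F) : Prop where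
  locFin : LocFin fun n : ℕ => c n
  isField : ∀ v, IsField (Y v)
  comm : ∀ v, HasCommutator true c Y v
  norm : ∀ (n : ℕ) v, Y (c (-(n : ℤ) - 1) v) =
    normS (fun m => c (-(m : ℤ) - 1)) (fun m => c m) true n (Y v)

/-- `a` is a primary vector of charge `k`. -/
def IsPrimary (c : ℤ → Module.End ℂ F) (Y : F →ₗ[ℂ] OpSeries F) (a : F) (k : ℂ) : Prop :=
  ∀ (m : ℤ) (x y : ℝ) (w : F), c m (Y a x y w) = Y a x y (c m w) + k • Y a (x - m) y w

theorem EvSum.eq_sum {E : Type*} [AddCommGroup E] {g g' : ℕ → E} {s : E} (h : EvSum g s) {N : ℕ}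
    (hz : ∀ n ≥ N, g n = 0) (hg : ∀ n, g n = g' n) : s = ∑ i ∈ Finset.range N, g' i :=
  h.unique ((EvSum.of_zero hz).congr (fun _ => rfl) (Finset.sum_congr rfl fun i _ => hg i))

variable {c : ℤ → Module.End ℂ F} {Y : F →ₗ[ℂ] OpSeries F}

theorem IsCurrent.comm_evSum (h : IsCurrent c Y) (v : F) (m : ℤ) (x y : ℝ) (w : F) :
    EvSum (fun j : ℕ => Ring.choose (m : ℂ) j • Y (c j v) (x - (m - j)) y w)
      (c m (Y v x y w) - Y v x y (c m w)) := by
  simpa only [dir, one_mul, zero_mul, sub_zero] using h.comm v m x y w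

theorem IsCurrent.comm_sum (h : IsCurrent c Y) {v : F} {J : ℕ} (hJ : ∀ j : ℕ, J ≤ j → c j v = 0)
    (m : ℤ) (x y : ℝ) (w : F) : c m (Y v x y w) = Y v x y (c m w) +
      ∑ j ∈ Finset.range J, Ring.choose (m : ℂ) j • Y (c j v) (x - (m - j)) y w := by
  rw [← sub_eq_iff_eq_add']
  refine (h.comm_evSum v m x y w).eq_sum (fun j hj => ?_) fun _ => rfl
  rw [hJ j hj, map_zero, Pi.zero_apply, Pi.zero_apply, LinearMap.zero_apply, smul_zero]

theorem IsCurrent.norm_evSum (h : IsCurrent c Y) (n : ℕ) (v : F) (x y : ℝ) (w : F) : ∃ L R : F,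
    Y (c (-(n : ℤ) - 1) v) x y w = L + R ∧
    EvSum (fun m : ℕ => Ring.choose (m : ℂ) n • c (-(m : ℤ) - 1) (Y v (x - (m - n)) y w)) L ∧
    EvSum (fun m : ℕ => Ring.choose (-(m : ℂ) - 1) n • Y v (x + (m + 1 + n)) y (c m w)) R := by
  refine ⟨_, _, by rw [h.norm, normS]; rfl, ?_, ?_⟩
  · simpa only [dir, one_mul, zero_mul, sub_zero] using
      lmulS_evSum (fun m => c (-(m : ℤ) - 1)) true n (h.isField v) x y w
  · simpa only [dir, one_mul, zero_mul, add_zero] using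
      rmulS_evSum h.locFin true n (Y v) x y w

theorem corr_eq_zero_iff {u : F →ₗ[ℂ] ℂ} {a b w : F} : corr Y u a b w = 0 ↔ ∀ x₁ y₁ x₂ y₂ : ℝ,
    u (Y a x₁ y₁ (Y b x₂ y₂ w)) = 0 ∧ u (Y (Y a x₁ y₁ b) x₂ y₂ w) = 0 ∧
      u (Y b x₂ y₂ (Y a x₁ y₁ w)) = 0 := by
  simp only [corr, Prod.ext_iff, funext_iff, Prod.fst_zero, Prod.snd_zero, Pi.zero_apply]
  exact ⟨fun h x y x' y' => ⟨h.1 x y x' y', h.2.1 x y x' y', h.2.2 x y x' y'⟩, fun h =>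
    ⟨fun x y x' y' => (h x y x' y').1, fun x y x' y' => (h x y x' y').2.1,
      fun x y x' y' => (h x y x' y').2.2⟩⟩

theorem choose_neg_alt (n j : ℕ) :
    (-1) ^ j * Ring.choose (-(n : ℂ) - 1) j = Ring.choose ((n : ℂ) + j) j := by
  rw [choose_neg_sub_one, ← mul_assoc, ← mul_pow]
  norm_num

theorem choose_add_symm (n j : ℕ) :
    Ring.choose ((n : ℂ) + j) n = Ring.choose ((n : ℂ) + j) j := by
  rw [← Nat.cast_add, Ring.choose_natCast, Ring.choose_natCast, Nat.choose_symm_add]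

theorem choose_add_mul_choose (r : ℂ) (n i : ℕ) :
    Ring.choose ((i + n : ℕ) : ℂ) n * Ring.choose r (i + n) =
      Ring.choose r n * Ring.choose (r - n) i := by
  rw [mul_comm, choose_mul_choose r (i + n) n (by omega), Nat.add_sub_cancel]

theorem choose_trinomial (n j i : ℕ) :
    Ring.choose ((n : ℂ) + j) n * Ring.choose (((n + j : ℕ) : ℂ) + i) i =
      Ring.choose ((i + n : ℕ) : ℂ) n * Ring.choose (((i + n : ℕ) : ℂ) + j) j := by
  rw [choose_add_symm, ← Nat.cast_add, ← Nat.cast_add, ← Nat.cast_add, Ring.choose_natCast,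
    Ring.choose_natCast, Ring.choose_natCast, Ring.choose_natCast, ← Nat.cast_mul, ← Nat.cast_mul,
    Nat.cast_inj]
  have h1 := Nat.add_choose_mul_factorial_mul_factorial n j
  have h2 := Nat.add_choose_mul_factorial_mul_factorial (n + j) i
  have h3 := Nat.add_choose_mul_factorial_mul_factorial i n
  have h4 := Nat.add_choose_mul_factorial_mul_factorial (i + n) j
  refine Nat.eq_of_mul_eq_mul_right (Nat.mul_pos (Nat.mul_pos n.factorial_pos j.factorial_pos)
    i.factorial_pos) ?_
  rw [show i + n + j = n + j + i by omega] at h4 ⊢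
  rw [← h2, ← h1, ← h3] at h4
  linarith

/-- The Ward identity for |z₁| > |z₂|. The creation modes of the current act on u and give t₁. The
annihilation modes pass through Y(b, z₂): reaching w they give t₃, and the contractions with b sum
to the expansion of (z₁ - z₂)^(-n-j-1), giving t₂. -/
theorem IsCurrent.create_left₁₂ (h : IsCurrent c Y) (n : ℕ) {u : F →ₗ[ℂ] ℂ} {a b w : F}
    {N J M : ℕ} {x₁ y₁ x₂ y₂ : ℝ}
    (hN : ∀ m : ℕ, N ≤ m → ∀ x, u (c (-(m : ℤ) - 1) (Y a x y₁ (Y b x₂ y₂ w))) = 0)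
    (hJ : ∀ j : ℕ, J ≤ j → c j b = 0) (hM : ∀ m : ℕ, M ≤ m → c m w = 0) {t₁ t₂ t₃ : ℕ → ℂ}
    (h₁ : ∀ m : ℕ, t₁ m = u (c (-(m : ℤ) - 1) (Y a (x₁ - ((m - n : ℤ) : ℝ)) y₁ (Y b x₂ y₂ w))))
    (h₂ : ∀ j : ℕ, EvSum (fun i : ℕ => (-1) ^ i * Ring.choose ((-(n + j) - 1 : ℤ) : ℂ) i *
      u (Y a (x₁ - ((-(n + j) - 1 : ℤ) - i)) y₁ (Y (c j b) (x₂ - i) y₂ w))) (t₂ j))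
    (h₃ : ∀ m : ℕ, t₃ m = u (Y a (x₁ - ((-m - 1 - n : ℤ) : ℝ)) y₁ (Y b x₂ y₂ (c m w)))) :
    u (Y (c (-(n : ℤ) - 1) a) x₁ y₁ (Y b x₂ y₂ w)) =
      ∑ m ∈ Finset.range N, Ring.choose (m : ℂ) n * t₁ m +
      (∑ j ∈ Finset.range J, (-1) ^ n * Ring.choose ((n : ℂ) + j) n * t₂ j +
      ∑ m ∈ Finset.range M, Ring.choose (-(m : ℂ) - 1) n * t₃ m) := by
  obtain ⟨L, R, e, hL, hR⟩ := h.norm_evSum n a x₁ y₁ (Y b x₂ y₂ w)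
  rw [e, map_add]
  congr 1
  · refine (hL.mapₗ u).eq_sum (fun m hm => ?_) fun m => ?_
    · rw [map_smul, hN m hm, smul_zero]
    · rw [h₁, map_smul, smul_eq_mul]
      push_cast
      rfl
  · refine (hR.mapₗ u).unique ?_
    have e1 := EvSum.of_zero (N := M) (g := fun m : ℕ => Ring.choose (-(m : ℂ) - 1) n *
      u (Y a (x₁ + (m + 1 + n)) y₁ (Y b x₂ y₂ (c m w)))) fun m hm => by
        rw [hM m hm]; simp
    -- A contraction with c_j b needs m ≥ j, whence the reindexing m = i + j.
    have e2 := EvSum.sum (t := Finset.range J) fun j _ =>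
      (evSum_shift_iff (g := fun m : ℕ => Ring.choose (-(m : ℂ) - 1) n * (Ring.choose (m : ℂ) j *
        u (Y a (x₁ + (m + 1 + n)) y₁ (Y (c j b) (x₂ - (m - j)) y₂ w)))) j fun i hi => by
          rw [choose_natCast_of_lt hi]; ring).1
      ((((h₂ j).smul ((-1) ^ n * Ring.choose ((n : ℂ) + j) n)).congr
        (fun i => by
          have := choose_neg_mul_choose (i + j) n j
          rw [if_pos (by omega), Nat.add_sub_cancel] at this
          rw [← mul_assoc (Ring.choose _ _), this]
          push_cast
          rw [smul_eq_mul, ← mul_assoc, add_sub_cancel_right]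
          congr 6
          ring_nf) rfl))
    refine (e2.add e1).congr (fun m => ?_) ?_
    · rw [h.comm_sum hJ, map_smul, map_add, map_add, map_sum, map_sum, smul_eq_mul, mul_add, add_comm,
        Finset.mul_sum]
      simp only [map_smul, smul_eq_mul, Int.cast_natCast]
    · congr 1
      refine Finset.sum_congr rfl fun m _ => ?_
      rw [h₃]
      push_cast
      congr 5
      ring_nf

/-- The same identity for |z₂| > |z₀|. The annihilation modes act on b at once and give t₂ exactly.
The creation modes applied to Y(a, z₀)b are normally ordered a second time at z₂, and resumming in
z₀/z₂ gives the powers of z₁ = z₂ + z₀ in t₁ and t₃. -/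
theorem IsCurrent.create_left₂₀ (h : IsCurrent c Y) (n : ℕ) {u : F →ₗ[ℂ] ℂ} {a b w : F}
    {N J M : ℕ} {x₁ y₁ x₂ y₂ : ℝ}
    (hN : ∀ m : ℕ, N ≤ m → ∀ x x', u (c (-(m : ℤ) - 1) (Y (Y a x y₁ b) x' y₂ w)) = 0)
    (hJ : ∀ j : ℕ, J ≤ j → c j b = 0) (hM : ∀ m : ℕ, M ≤ m → c m w = 0) {t₁ t₂ t₃ : ℕ → ℂ}
    (h₁ : ∀ m : ℕ, EvSum (fun i : ℕ => Ring.choose ((m - n : ℤ) : ℂ) i *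
      u (c (-(m : ℤ) - 1) (Y (Y a (x₁ - i) y₁ b) (x₂ - ((m - n : ℤ) - i)) y₂ w))) (t₁ m))
    (h₂ : ∀ j : ℕ, t₂ j = u (Y (Y a (x₁ - ((-(n + j) - 1 : ℤ) : ℝ)) y₁ (c j b)) x₂ y₂ w))
    (h₃ : ∀ m : ℕ, EvSum (fun i : ℕ => Ring.choose ((-m - 1 - n : ℤ) : ℂ) i *
      u (Y (Y a (x₁ - i) y₁ b) (x₂ - ((-m - 1 - n : ℤ) - i)) y₂ (c m w))) (t₃ m)) :
    u (Y (Y (c (-(n : ℤ) - 1) a) x₁ y₁ b) x₂ y₂ w) =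
      ∑ m ∈ Finset.range N, Ring.choose (m : ℂ) n * t₁ m +
      (∑ j ∈ Finset.range J, (-1) ^ n * Ring.choose ((n : ℂ) + j) n * t₂ j +
      ∑ m ∈ Finset.range M, Ring.choose (-(m : ℂ) - 1) n * t₃ m) := by
  obtain ⟨L, R, e, hL, hR⟩ := h.norm_evSum n a x₁ y₁ b
  have e' : u (Y (Y (c (-(n : ℤ) - 1) a) x₁ y₁ b) x₂ y₂ w) =
      u (Y R x₂ y₂ w) + u (Y L x₂ y₂ w) := by
    rw [e, add_comm, ← map_add]
    exact congrArg u ((coeffAt Y x₂ y₂ w).map_add _ _)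
  rw [e', add_left_comm]
  have ev {g : ℕ → F} {s : F} (hg : EvSum g s) :
      EvSum (fun m => u (Y (g m) x₂ y₂ w)) (u (Y s x₂ y₂ w)) :=
    hg.mapₗ (u ∘ₗ coeffAt Y x₂ y₂ w)
  congr 1
  · refine (ev hR).eq_sum (fun m hm => ?_) fun m => ?_
    · rw [hJ m hm]; simp
    · rw [h₂, map_smul, choose_neg_sub_one, add_comm (m : ℂ), choose_add_symm]
      simp only [Pi.smul_apply, LinearMap.smul_apply, map_smul, smul_eq_mul]
      push_cast
      congr 8
      ring_nf
  -- From (k choose n)(r choose k) = (r choose n)(r - n choose k - n), the sum over k is the n-th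
  -- divided derivative of (z₂ + z₀)^r. It is used with r = m and with r = -m - 1.
  · have hT (r : ℂ) (z : ℤ) (hz : (z : ℂ) = r) {f : ℝ → ℝ → ℂ} {s : ℂ}
        (hs : EvSum (fun i : ℕ => Ring.choose ((z - n : ℤ) : ℂ) i *
          f (x₁ - i) (x₂ - ((z - n : ℤ) - i))) s) :
        EvSum (fun k : ℕ => Ring.choose (k : ℂ) n * (Ring.choose r k *
          f (x₁ - (k - n)) (x₂ - (z - k)))) (Ring.choose r n * s) := by
      refine (evSum_shift_iff n fun i hi => by rw [choose_natCast_of_lt hi, zero_mul]).1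
        ((hs.smul (Ring.choose r n)).congr (fun i => ?_) rfl)
      subst hz
      rw [← mul_assoc (Ring.choose ((i + n : ℕ) : ℂ) n), choose_add_mul_choose]
      push_cast
      rw [smul_eq_mul, mul_assoc]
      congr 3 <;> ring_nf
    have e1 := EvSum.sum (t := Finset.range N) fun m _ => hT m m (by simp)
      (f := fun x x' => u (c (-(m : ℤ) - 1) (Y (Y a x y₁ b) x' y₂ w))) (h₁ m)
    have e2 := EvSum.sum (t := Finset.range M) fun m _ => hT (-(m : ℂ) - 1) (-m - 1) (by simp)
      (f := fun x x' => u (Y (Y a x y₁ b) x' y₂ (c m w))) (h₃ m)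
    refine (ev hL).unique ((e1.add e2).congr (fun k => ?_) rfl)
    obtain ⟨L', R', e', hL', hR'⟩ := h.norm_evSum k (Y a (x₁ - (k - n)) y₁ b) x₂ y₂ w
    have e3 : u (Y (Ring.choose (k : ℂ) n • c (-(k : ℤ) - 1) (Y a (x₁ - (k - n)) y₁ b))
        x₂ y₂ w) = Ring.choose (k : ℂ) n * (u L' + u R') := by
      refine (congrArg u ((coeffAt Y x₂ y₂ w).map_smul (Ring.choose (k : ℂ) n)
        (c (-(k : ℤ) - 1) (Y a (x₁ - (k - n)) y₁ b)))).trans ?_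
      rw [map_smul, smul_eq_mul, ← map_add, ← e']
      rfl
    rw [e3, mul_add, ← Finset.mul_sum, ← Finset.mul_sum]
    congr 2
    · refine ((hL'.mapₗ u).eq_sum (fun m hm => ?_) fun m => ?_).symm
      · rw [map_smul, hN m hm, smul_zero]
      · simp
    · refine ((hR'.mapₗ u).eq_sum (fun m hm => ?_) fun m => ?_).symm
      · rw [hM m hm]; simp
      · rw [map_smul, smul_eq_mul]
        push_cast
        congr 5
        ring_nf

/-- For |z₂| > |z₁| the roles are reversed: the annihilation modes already meet w, and it is the
creation modes moving left through Y(b, z₂) that contract with b. The result is the same function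
expanded in z₁/z₂. -/
theorem IsCurrent.create_left₂₁ (h : IsCurrent c Y) (n : ℕ) {u : F →ₗ[ℂ] ℂ} {a b w : F}
    {N J M : ℕ} {x₁ y₁ x₂ y₂ : ℝ}
    (hN : ∀ m : ℕ, N ≤ m → ∀ x, u (c (-(m : ℤ) - 1) (Y b x₂ y₂ (Y a x y₁ w))) = 0)
    (hJ : ∀ j : ℕ, J ≤ j → c j b = 0) (hM : ∀ m : ℕ, M ≤ m → c m w = 0) {t₁ t₂ t₃ : ℕ → ℂ}
    (h₁ : ∀ m : ℕ, t₁ m = u (c (-(m : ℤ) - 1) (Y b x₂ y₂ (Y a (x₁ - ((m - n : ℤ) : ℝ)) y₁ w))))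
    (h₂ : ∀ j : ℕ, EvSum (fun i : ℕ => (-1) ^ (-((n : ℤ) + j) - 1) * ((-1) ^ i *
      Ring.choose ((-(n + j) - 1 : ℤ) : ℂ) i) *
      u (Y (c j b) (x₂ - ((-(n + j) - 1 : ℤ) - i)) y₂ (Y a (x₁ - i) y₁ w))) (t₂ j))
    (h₃ : ∀ m : ℕ, t₃ m = u (Y b x₂ y₂ (Y a (x₁ - ((-m - 1 - n : ℤ) : ℝ)) y₁ (c m w)))) :
    u (Y b x₂ y₂ (Y (c (-(n : ℤ) - 1) a) x₁ y₁ w)) =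
      ∑ m ∈ Finset.range N, Ring.choose (m : ℂ) n * t₁ m +
      (∑ j ∈ Finset.range J, (-1) ^ n * Ring.choose ((n : ℂ) + j) n * t₂ j +
      ∑ m ∈ Finset.range M, Ring.choose (-(m : ℂ) - 1) n * t₃ m) := by
  obtain ⟨L, R, e, hL, hR⟩ := h.norm_evSum n a x₁ y₁ w
  rw [e, map_add, map_add, ← add_assoc]
  congr 1
  · refine (hL.mapₗ (u ∘ₗ Y b x₂ y₂)).unique ?_
    have e1 := EvSum.of_zero (N := N) (g := fun m : ℕ => Ring.choose (m : ℂ) n *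
      u (c (-(m : ℤ) - 1) (Y b x₂ y₂ (Y a (x₁ - (m - n)) y₁ w)))) fun m hm => by
        rw [hN m hm, mul_zero]
    have e2 := EvSum.sum (t := Finset.range J) fun j _ =>
      (evSum_shift_iff (g := fun m : ℕ => -(Ring.choose (m : ℂ) n *
        (Ring.choose (-(m : ℂ) - 1) j *
        u (Y (c j b) (x₂ - (-m - 1 - j)) y₂ (Y a (x₁ - (m - n)) y₁ w))))) n fun i hi => by
          rw [choose_natCast_of_lt hi]; ring).1
      ((((h₂ j).smul ((-1) ^ n * Ring.choose ((n : ℂ) + j) n)).congr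
        (fun i => by
          have h2 := choose_neg_alt (n + j) i
          have h3 := choose_neg_sub_one (i + n) j
          have h7 : (-1 : ℂ) ^ (-((n : ℤ) + j) - 1) = -((-1) ^ n * (-1) ^ j) := by
            rw [show -((n : ℤ) + j) - 1 = -((n + j + 1 : ℕ) : ℤ) by push_cast; ring, zpow_neg,
              ← inv_zpow, inv_neg, inv_one, zpow_natCast]
            ring
          have h8 : (-1 : ℂ) ^ n * (-1) ^ n = 1 := by rw [← mul_pow]; norm_num
          have h9 : x₂ - (((-(n + j) - 1 : ℤ) : ℝ) - i) = x₂ - (-((i + n : ℕ) : ℝ) - 1 - j) := by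
            push_cast; ring
          have h10 : x₁ - ((i + n : ℕ) - n : ℝ) = x₁ - i := by push_cast; ring
          have h11 : ((-(n + j) - 1 : ℤ) : ℂ) = -((n + j : ℕ) : ℂ) - 1 := by push_cast; ring
          rw [h9, h10, h11, h2, h3, h7, smul_eq_mul]
          linear_combination (-(-1) ^ j * u (Y (c j b) (x₂ - (-((i + n : ℕ) : ℝ) - 1 - j)) y₂
            (Y a (x₁ - i) y₁ w))) * (choose_trinomial n j i + Ring.choose ((n : ℂ) + j) n *
            Ring.choose (((n + j : ℕ) : ℂ) + i) i * h8)) rfl))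
    refine (e1.add e2).congr (fun m => ?_) ?_
    · have := h.comm_sum hJ (-(m : ℤ) - 1) x₂ y₂ (Y a (x₁ - (m - n)) y₁ w)
      rw [this, Finset.sum_neg_distrib, LinearMap.comp_apply, map_smul, map_smul, map_add,
        map_sum, mul_add, ← sub_eq_add_neg, ← Finset.mul_sum, add_sub_assoc, smul_eq_mul, add_eq_left,
        sub_eq_zero]
      simp
    · congr 1
      refine Finset.sum_congr rfl fun m _ => ?_
      rw [h₁]
      push_cast
      rfl
  · refine (hR.mapₗ (u ∘ₗ Y b x₂ y₂)).eq_sum (fun m hm => ?_) fun m => ?_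
    · rw [hM m hm]; simp
    · rw [h₃, map_smul, smul_eq_mul, LinearMap.comp_apply]
      push_cast
      congr 5
      ring_nf

/-- The three computations have identical coefficients, so they combine into an equality of triples
with the terms supplied by `good_z1` and `good_z12`. The hypothesis on N makes the sum over creation
modes finite. -/
theorem IsCurrent.good_create_left (h : IsCurrent c Y) (n : ℕ) {u : F →ₗ[ℂ] ℂ} {a b w : F}
    (h1 : ∀ m : ℕ, corr Y (u ∘ₗ c (-(m : ℤ) - 1)) a b w ∈ Good)
    (hN : ∃ N : ℕ, ∀ m ≥ N, corr Y (u ∘ₗ c (-(m : ℤ) - 1)) a b w = 0)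
    (h2 : ∀ j : ℕ, corr Y u a (c j b) w ∈ Good) (h3 : ∀ m : ℕ, corr Y u a b (c m w) ∈ Good) :
    corr Y u (c (-(n : ℤ) - 1) a) b w ∈ Good := by
  obtain ⟨N, hN⟩ := hN
  obtain ⟨J, hJ⟩ := h.locFin b
  obtain ⟨M, hM⟩ := h.locFin w
  have hN' (m : ℕ) (hm : N ≤ m) := (corr_eq_zero_iff).1 (hN m hm)
  choose T₁ hT₁ hZ₁ using fun m : ℕ => good_z1 ((m : ℤ) - n) (h1 m)
  choose T₂ hT₂ hZ₂ using fun j : ℕ => good_z12 (-((n : ℤ) + j) - 1) (h2 j)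
  choose T₃ hT₃ hZ₃ using fun m : ℕ => good_z1 (-(m : ℤ) - 1 - n) (h3 m)
  have key : corr Y u (c (-(n : ℤ) - 1) a) b w =
      ∑ m ∈ Finset.range N, Ring.choose (m : ℂ) n • T₁ m +
      (∑ j ∈ Finset.range J, ((-1) ^ n * Ring.choose ((n : ℂ) + j) n) • T₂ j +
      ∑ m ∈ Finset.range M, Ring.choose (-(m : ℂ) - 1) n • T₃ m) := by
    refine Prod.ext ?_ (Prod.ext ?_ ?_) <;> funext x₁ y₁ x₂ y₂
    · simp only [Prod.fst_add, Prod.fst_sum, Pi.add_apply, Finset.sum_apply, Prod.smul_fst,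
        Pi.smul_apply, smul_eq_mul]
      exact h.create_left₁₂ n (fun m hm x => (hN' m hm _ _ _ _).1) hJ hM
        (fun m => (hZ₁ m x₁ y₁ x₂ y₂).1) (fun j => (hZ₂ j x₁ y₁ x₂ y₂).1)
        (fun m => (hZ₃ m x₁ y₁ x₂ y₂).1)
    · simp only [Prod.fst_add, Prod.snd_add, Prod.fst_sum, Prod.snd_sum, Pi.add_apply,
        Finset.sum_apply, Prod.smul_fst, Prod.smul_snd, Pi.smul_apply, smul_eq_mul]
      exact h.create_left₂₀ n (fun m hm x x' => (hN' m hm _ _ _ _).2.1) hJ hM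
        (fun m => (hZ₁ m x₁ y₁ x₂ y₂).2.1) (fun j => (hZ₂ j x₁ y₁ x₂ y₂).2.1)
        (fun m => (hZ₃ m x₁ y₁ x₂ y₂).2.1)
    · simp only [Prod.snd_add, Prod.snd_sum, Pi.add_apply, Finset.sum_apply, Prod.smul_snd,
        Pi.smul_apply, smul_eq_mul]
      exact h.create_left₂₁ n (fun m hm x => (hN' m hm _ _ _ _).2.2) hJ hM
        (fun m => (hZ₁ m x₁ y₁ x₂ y₂).2.2) (fun j => (hZ₂ j x₁ y₁ x₂ y₂).2.2)
        (fun m => (hZ₃ m x₁ y₁ x₂ y₂).2.2)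
  rw [key]
  exact Submodule.add_mem _ (Submodule.sum_mem _ fun m _ => Submodule.smul_mem _ _ (hT₁ m))
    (Submodule.add_mem _ (Submodule.sum_mem _ fun m _ => Submodule.smul_mem _ _ (hT₂ m))
      (Submodule.sum_mem _ fun m _ => Submodule.smul_mem _ _ (hT₃ m)))

end Recursion

end
end AHVertex

open scoped TensorProduct
namespace AHVertex
noncomputable section

/-! ### Ward identities for the second and third vectors -/

section Recursion

variable {F : Type*} [AddCommGroup F] [Module ℂ F]
variable {c : ℤ → Module.End ℂ F} {Y : F →ₗ[ℂ] OpSeries F}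

theorem choose_add_eq_alt (n i : ℕ) : Ring.choose ((i + n : ℕ) : ℂ) n =
    (-1) ^ i * Ring.choose ((-n - 1 : ℤ) : ℂ) i := by
  have := choose_neg_alt n i
  push_cast
  rw [this, add_comm, choose_add_symm]

/-- Since a is primary, moving the creation modes left through Y(a, z₁) costs -k z₁^(-m-1). Summed
against z₂^(m-n), this is a single contraction with factor (z₁ - z₂)^(-n-1). -/
theorem IsCurrent.create_middle₁₂ (h : IsCurrent c Y) (n : ℕ) {u : F →ₗ[ℂ] ℂ} {a b w : F} {k : ℂ}
    (ha : IsPrimary c Y a k) {N M : ℕ} {x₁ y₁ x₂ y₂ : ℝ}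
    (hN : ∀ m : ℕ, N ≤ m → ∀ x, u (c (-(m : ℤ) - 1) (Y a x₁ y₁ (Y b x y₂ w))) = 0)
    (hM : ∀ m : ℕ, M ≤ m → c m w = 0) {t₁ t₃ : ℕ → ℂ} {t₂ : ℂ}
    (h₁ : ∀ m : ℕ, t₁ m = u (c (-(m : ℤ) - 1) (Y a x₁ y₁ (Y b (x₂ - ((m - n : ℤ) : ℝ)) y₂ w))))
    (h₂ : EvSum (fun i : ℕ => (-1) ^ i * Ring.choose ((-n - 1 : ℤ) : ℂ) i *
      u (Y a (x₁ - ((-n - 1 : ℤ) - i)) y₁ (Y b (x₂ - i) y₂ w))) t₂)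
    (h₃ : ∀ m : ℕ, t₃ m = u (Y a x₁ y₁ (Y b (x₂ - ((-m - 1 - n : ℤ) : ℝ)) y₂ (c m w)))) :
    u (Y a x₁ y₁ (Y (c (-(n : ℤ) - 1) b) x₂ y₂ w)) =
      ∑ m ∈ Finset.range N, Ring.choose (m : ℂ) n * t₁ m + -k * t₂ +
      ∑ m ∈ Finset.range M, Ring.choose (-(m : ℂ) - 1) n * t₃ m := by
  obtain ⟨L, R, e, hL, hR⟩ := h.norm_evSum n b x₂ y₂ w
  rw [e, map_add, map_add]
  congr 1
  · refine (hL.mapₗ (u ∘ₗ Y a x₁ y₁)).unique ?_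
    have e1 := EvSum.of_zero (N := N) (g := fun m : ℕ => Ring.choose (m : ℂ) n *
      u (c (-(m : ℤ) - 1) (Y a x₁ y₁ (Y b (x₂ - (m - n)) y₂ w)))) fun m hm => by
        rw [hN m hm, mul_zero]
    have e2 := (evSum_shift_iff (g := fun m : ℕ => -k * (Ring.choose (m : ℂ) n *
        u (Y a (x₁ - (-m - 1)) y₁ (Y b (x₂ - (m - n)) y₂ w)))) n fun i hi => by
          rw [choose_natCast_of_lt hi]; ring).1
      ((h₂.smul (-k)).congr (fun i => by
        rw [choose_add_eq_alt, smul_eq_mul]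
        push_cast
        congr 6 <;> ring_nf) rfl)
    refine (e1.add e2).congr (fun m => ?_) ?_
    · rw [LinearMap.comp_apply, map_smul, map_smul, ha, map_add, map_smul]
      push_cast
      simp only [smul_eq_mul]
      ring
    · simp only [smul_eq_mul]
      congr 1
      refine Finset.sum_congr rfl fun m _ => ?_
      rw [h₁]
      push_cast
      rfl
  · refine (hR.mapₗ (u ∘ₗ Y a x₁ y₁)).eq_sum (fun m hm => ?_) fun m => ?_
    · rw [hM m hm]; simp
    · rw [h₃, map_smul, smul_eq_mul, LinearMap.comp_apply]
      push_cast
      congr 5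
      ring_nf

/-- Primarity lets c(-n-1) be pulled out of Y(a, z₀) before any expansion, at the cost of -k
z₀^(-n-1); what remains is one normally ordered product at z₂. -/
theorem IsCurrent.create_middle₂₀ (h : IsCurrent c Y) (n : ℕ) {u : F →ₗ[ℂ] ℂ} {a b w : F} {k : ℂ}
    (ha : IsPrimary c Y a k) {N M : ℕ} {x₁ y₁ x₂ y₂ : ℝ}
    (hN : ∀ m : ℕ, N ≤ m → ∀ x, u (c (-(m : ℤ) - 1) (Y (Y a x₁ y₁ b) x y₂ w)) = 0)
    (hM : ∀ m : ℕ, M ≤ m → c m w = 0) {t₁ t₃ : ℕ → ℂ} {t₂ : ℂ}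
    (h₁ : ∀ m : ℕ, t₁ m = u (c (-(m : ℤ) - 1) (Y (Y a x₁ y₁ b) (x₂ - ((m - n : ℤ) : ℝ)) y₂ w)))
    (h₂ : t₂ = u (Y (Y a (x₁ - ((-n - 1 : ℤ) : ℝ)) y₁ b) x₂ y₂ w))
    (h₃ : ∀ m : ℕ, t₃ m = u (Y (Y a x₁ y₁ b) (x₂ - ((-m - 1 - n : ℤ) : ℝ)) y₂ (c m w))) :
    u (Y (Y a x₁ y₁ (c (-(n : ℤ) - 1) b)) x₂ y₂ w) =
      ∑ m ∈ Finset.range N, Ring.choose (m : ℂ) n * t₁ m + -k * t₂ +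
      ∑ m ∈ Finset.range M, Ring.choose (-(m : ℂ) - 1) n * t₃ m := by
  have e0 : Y a x₁ y₁ (c (-(n : ℤ) - 1) b) = c (-(n : ℤ) - 1) (Y a x₁ y₁ b) +
      -k • Y a (x₁ - ((-n - 1 : ℤ) : ℝ)) y₁ b := by
    rw [ha, neg_smul, add_neg_cancel_right]
  obtain ⟨L, R, e, hL, hR⟩ := h.norm_evSum n (Y a x₁ y₁ b) x₂ y₂ w
  have e1 : u (Y (Y a x₁ y₁ (c (-(n : ℤ) - 1) b)) x₂ y₂ w) = u L + u R + -k * t₂ := by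
    rw [e0, h₂, ← map_add, ← e]
    refine (congrArg u ((coeffAt Y x₂ y₂ w).map_add _ _)).trans ?_
    rw [map_smul, map_add, map_smul]
    rfl
  rw [e1, add_right_comm]
  congr 2
  · refine (hL.mapₗ u).eq_sum (fun m hm => ?_) fun m => ?_
    · rw [map_smul, hN m hm, smul_zero]
    · rw [h₁, map_smul, smul_eq_mul]
      push_cast
      rfl
  · refine (hR.mapₗ u).eq_sum (fun m hm => ?_) fun m => ?_
    · rw [hM m hm]; simp
    · rw [h₃, map_smul, smul_eq_mul]
      push_cast
      congr 5
      ring_nf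

/-- Here the annihilation modes contract with a. Their sum is (-1)^n (z₂ - z₁)^(-n-1), which agrees
in sign with -(z₁ - z₂)^(-n-1). -/
theorem IsCurrent.create_middle₂₁ (h : IsCurrent c Y) (n : ℕ) {u : F →ₗ[ℂ] ℂ} {a b w : F} {k : ℂ}
    (ha : IsPrimary c Y a k) {N M : ℕ} {x₁ y₁ x₂ y₂ : ℝ}
    (hN : ∀ m : ℕ, N ≤ m → ∀ x, u (c (-(m : ℤ) - 1) (Y b x y₂ (Y a x₁ y₁ w))) = 0)
    (hM : ∀ m : ℕ, M ≤ m → c m w = 0) {t₁ t₃ : ℕ → ℂ} {t₂ : ℂ}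
    (h₁ : ∀ m : ℕ, t₁ m = u (c (-(m : ℤ) - 1) (Y b (x₂ - ((m - n : ℤ) : ℝ)) y₂ (Y a x₁ y₁ w))))
    (h₂ : EvSum (fun i : ℕ => (-1) ^ (-(n : ℤ) - 1) * ((-1) ^ i *
      Ring.choose ((-n - 1 : ℤ) : ℂ) i) *
      u (Y b (x₂ - ((-n - 1 : ℤ) - i)) y₂ (Y a (x₁ - i) y₁ w))) t₂)
    (h₃ : ∀ m : ℕ, t₃ m = u (Y b (x₂ - ((-m - 1 - n : ℤ) : ℝ)) y₂ (Y a x₁ y₁ (c m w)))) :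
    u (Y (c (-(n : ℤ) - 1) b) x₂ y₂ (Y a x₁ y₁ w)) =
      ∑ m ∈ Finset.range N, Ring.choose (m : ℂ) n * t₁ m + -k * t₂ +
      ∑ m ∈ Finset.range M, Ring.choose (-(m : ℂ) - 1) n * t₃ m := by
  obtain ⟨L, R, e, hL, hR⟩ := h.norm_evSum n b x₂ y₂ (Y a x₁ y₁ w)
  rw [e, map_add, add_assoc]
  congr 1
  · refine (hL.mapₗ u).eq_sum (fun m hm => ?_) fun m => ?_
    · rw [map_smul, hN m hm, smul_zero]
    · rw [h₁, map_smul, smul_eq_mul]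
      push_cast
      rfl
  · refine (hR.mapₗ u).unique ?_
    have e1 := EvSum.of_zero (N := M) (g := fun m : ℕ => Ring.choose (-(m : ℂ) - 1) n *
      u (Y b (x₂ + (m + 1 + n)) y₂ (Y a x₁ y₁ (c m w)))) fun m hm => by
        rw [hM m hm]; simp
    have h7 : (-1 : ℂ) ^ (-(n : ℤ) - 1) = -(-1) ^ n := by
      rw [show -(n : ℤ) - 1 = -((n + 1 : ℕ) : ℤ) by push_cast; ring, zpow_neg,
        ← inv_zpow, inv_neg, inv_one, zpow_natCast]
      ring
    refine ((h₂.smul (-k)).add e1).congr (fun m => ?_) ?_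
    · have h2 := choose_neg_alt n m
      have h3 := choose_add_symm n m
      have h9 : x₂ - (((-n - 1 : ℤ) : ℝ) - m) = x₂ + (m + 1 + n) := by push_cast; ring
      have h10 : ((-n - 1 : ℤ) : ℂ) = -(n : ℂ) - 1 := by push_cast; ring
      rw [h9, h10, h2, h7, choose_neg_sub_one, add_comm (m : ℂ) n, h3, ha, map_smul, map_add, map_add,
        map_smul, map_smul, Int.cast_natCast]
      simp only [smul_eq_mul]
      ring
    · simp only [smul_eq_mul]
      congr 1
      refine Finset.sum_congr rfl fun m _ => ?_
      rw [h₃]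
      push_cast
      congr 5
      ring_nf

theorem IsCurrent.good_create_middle (h : IsCurrent c Y) (n : ℕ) {u : F →ₗ[ℂ] ℂ} {a b w : F} {k : ℂ}
    (ha : IsPrimary c Y a k) (h1 : ∀ m : ℕ, corr Y (u ∘ₗ c (-(m : ℤ) - 1)) a b w ∈ Good)
    (hN : ∃ N : ℕ, ∀ m ≥ N, corr Y (u ∘ₗ c (-(m : ℤ) - 1)) a b w = 0)
    (h2 : corr Y u a b w ∈ Good) (h3 : ∀ m : ℕ, corr Y u a b (c m w) ∈ Good) :
    corr Y u a (c (-(n : ℤ) - 1) b) w ∈ Good := by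
  obtain ⟨N, hN⟩ := hN
  obtain ⟨M, hM⟩ := h.locFin w
  have hN' (m : ℕ) (hm : N ≤ m) := (corr_eq_zero_iff).1 (hN m hm)
  choose T₁ hT₁ hZ₁ using fun m : ℕ => good_z2 ((m : ℤ) - n) (h1 m)
  obtain ⟨T₂, hT₂, hZ₂⟩ := good_z12 (-(n : ℤ) - 1) h2
  choose T₃ hT₃ hZ₃ using fun m : ℕ => good_z2 (-(m : ℤ) - 1 - n) (h3 m)
  have key : corr Y u a (c (-(n : ℤ) - 1) b) w =
      ∑ m ∈ Finset.range N, Ring.choose (m : ℂ) n • T₁ m + (-k) • T₂ +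
      ∑ m ∈ Finset.range M, Ring.choose (-(m : ℂ) - 1) n • T₃ m := by
    refine Prod.ext ?_ (Prod.ext ?_ ?_) <;> funext x₁ y₁ x₂ y₂
    · simp only [Prod.fst_add, Prod.fst_sum, Pi.add_apply, Finset.sum_apply, Prod.smul_fst,
        Pi.smul_apply, smul_eq_mul]
      exact h.create_middle₁₂ n ha (fun m hm x => (hN' m hm _ _ _ _).1) hM
        (fun m => (hZ₁ m x₁ y₁ x₂ y₂).1) (hZ₂ x₁ y₁ x₂ y₂).1
        (fun m => (hZ₃ m x₁ y₁ x₂ y₂).1)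
    · simp only [Prod.fst_add, Prod.snd_add, Prod.fst_sum, Prod.snd_sum, Pi.add_apply,
        Finset.sum_apply, Prod.smul_fst, Prod.smul_snd, Pi.smul_apply, smul_eq_mul]
      exact h.create_middle₂₀ n ha (fun m hm x => (hN' m hm _ _ _ _).2.1) hM
        (fun m => (hZ₁ m x₁ y₁ x₂ y₂).2.1) (hZ₂ x₁ y₁ x₂ y₂).2.1
        (fun m => (hZ₃ m x₁ y₁ x₂ y₂).2.1)
    · simp only [Prod.snd_add, Prod.snd_sum, Pi.add_apply, Finset.sum_apply, Prod.smul_snd,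
        Pi.smul_apply, smul_eq_mul]
      exact h.create_middle₂₁ n ha (fun m hm x => (hN' m hm _ _ _ _).2.2) hM
        (fun m => (hZ₁ m x₁ y₁ x₂ y₂).2.2) (hZ₂ x₁ y₁ x₂ y₂).2.2
        (fun m => (hZ₃ m x₁ y₁ x₂ y₂).2.2)
  rw [key]
  exact Submodule.add_mem _ (Submodule.add_mem _ (Submodule.sum_mem _ fun m _ =>
    Submodule.smul_mem _ _ (hT₁ m)) (Submodule.smul_mem _ _ hT₂))
    (Submodule.sum_mem _ fun m _ => Submodule.smul_mem _ _ (hT₃ m))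

/-- With both a and b primary, c(-n-1) is pulled all the way to u and contributes only the charges
times z₁^(-n-1) and z₂^(-n-1). -/
theorem IsCurrent.good_create_right (h : IsCurrent c Y) (n : ℕ) {u : F →ₗ[ℂ] ℂ} {a b w : F}
    {k l : ℂ} (ha : IsPrimary c Y a k) (hb : IsPrimary c Y b l)
    (hb' : ∀ j : ℕ, c j b = if j = 0 then l • b else 0)
    (h1 : corr Y (u ∘ₗ c (-(n : ℤ) - 1)) a b w ∈ Good) (h2 : corr Y u a b w ∈ Good) :
    corr Y u a b (c (-(n : ℤ) - 1) w) ∈ Good := by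
  obtain ⟨T₁, hT₁, hZ₁⟩ := good_z1 (-(n : ℤ) - 1) h2
  obtain ⟨T₂, hT₂, hZ₂⟩ := good_z2 (-(n : ℤ) - 1) h2
  have hc {a : F} {k : ℂ} (ha : IsPrimary c Y a k) (x y : ℝ) (w : F) :
      Y a x y (c (-(n : ℤ) - 1) w) = c (-(n : ℤ) - 1) (Y a x y w) +
      -k • Y a (x - ((-n - 1 : ℤ) : ℝ)) y w := by
    rw [ha, neg_smul, add_neg_cancel_right]
  have key : corr Y u a b (c (-(n : ℤ) - 1) w) =
      corr Y (u ∘ₗ c (-(n : ℤ) - 1)) a b w + (-k) • T₁ + (-l) • T₂ := by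
    refine Prod.ext ?_ (Prod.ext ?_ ?_) <;> funext x₁ y₁ x₂ y₂
    · simp only [Prod.fst_add, Pi.add_apply, Prod.smul_fst, Pi.smul_apply, smul_eq_mul]
      rw [(hZ₁ x₁ y₁ x₂ y₂).1, (hZ₂ x₁ y₁ x₂ y₂).1]
      simp only [corr]
      rw [hc hb, map_add, hc ha, map_add, map_add, map_smul, map_smul, map_smul]
      rfl
    · simp only [Prod.fst_add, Prod.snd_add, Pi.add_apply, Prod.smul_fst, Prod.smul_snd,
        Pi.smul_apply, smul_eq_mul]
      -- Commuting with the composite field at z₂: c_j acting on Y(a, z₀)b gives l b for j = 0 and k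
      -- z₀^j for every j. The latter sum to (z₂ + z₀)^(-n-1) = z₁^(-n-1).
      have e1 := (h.comm_evSum (Y a x₁ y₁ b) (-(n : ℤ) - 1) x₂ y₂ w).mapₗ u
      have e2 := EvSum.single (g := fun j : ℕ => if j = 0 then
        l * u (Y (Y a x₁ y₁ b) (x₂ - ((-n - 1 : ℤ) : ℝ)) y₂ w) else 0) 0 fun j hj => if_neg hj
      have e3 := e1.unique ((e2.add ((hZ₁ x₁ y₁ x₂ y₂).2.1.smul k)).congr (fun j => by
        have e4 := ha j x₁ y₁ b
        rw [hb'] at e4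
        have e5 : Y (c j (Y a x₁ y₁ b)) (x₂ - ((-n - 1 : ℤ) - j)) y₂ w =
            coeffAt Y (x₂ - ((-n - 1 : ℤ) - j)) y₂ w (c j (Y a x₁ y₁ b)) := rfl
        rw [e5, e4]
        rcases Nat.eq_zero_or_pos j with rfl | hj
        · rw [if_pos rfl, if_pos rfl, map_smul, map_add, map_smul, map_smul, map_smul, map_add, map_smul, map_smul, Ring.choose_zero_right]
          simp only [smul_eq_mul, one_mul, Nat.cast_zero, Int.cast_zero, sub_zero]
          rfl
        · rw [if_neg hj.ne', if_neg hj.ne', map_zero, zero_add, zero_add, map_smul, map_smul, map_smul]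
          simp only [smul_eq_mul]
          rw [mul_left_comm]
          rfl) rfl)
      rw [(hZ₂ x₁ y₁ x₂ y₂).2.1]
      rw [map_sub, if_pos rfl] at e3
      simp only [corr, LinearMap.comp_apply]
      rw [smul_eq_mul] at e3
      linear_combination -e3
    · simp only [Prod.snd_add, Pi.add_apply, Prod.smul_snd, Pi.smul_apply, smul_eq_mul]
      rw [(hZ₁ x₁ y₁ x₂ y₂).2.2, (hZ₂ x₁ y₁ x₂ y₂).2.2]
      simp only [corr]
      rw [hc ha, map_add, hc hb, map_add, map_add, map_smul, map_smul, map_smul, add_right_comm]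
      rfl
  rw [key]
  exact Submodule.add_mem _ (Submodule.add_mem _ h1 (Submodule.smul_mem _ _ hT₁))
    (Submodule.smul_mem _ _ hT₂)

end Recursion

end
end AHVertex

open scoped TensorProduct
namespace AHVertex
noncomputable section

/-! ### Trilinearity of the correlation functions and exchange of z and z̄ -/

section Linearity

variable {F : Type*} [AddCommGroup F] [Module ℂ F] (Y : F →ₗ[ℂ] OpSeries F) (u : F →ₗ[ℂ] ℂ)

/-- The correlation functions as a trilinear map. -/
def corrHom : F →ₗ[ℂ] F →ₗ[ℂ] F →ₗ[ℂ] Series4 × Series4 × Series4 :=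
  LinearMap.mk₂ ℂ (fun a b =>
    { toFun := fun w => corr Y u a b w
      map_add' := fun w w' => by
        refine Prod.ext ?_ (Prod.ext ?_ ?_) <;> funext x y x' y' <;> simp [corr]
      map_smul' := fun r w => by
        refine Prod.ext ?_ (Prod.ext ?_ ?_) <;> funext x y x' y' <;> simp [corr] })
    (fun a a' b => LinearMap.ext fun w => by
      refine Prod.ext ?_ (Prod.ext ?_ ?_) <;> funext x y x' y' <;> simp [corr])
    (fun r a b => LinearMap.ext fun w => by
      refine Prod.ext ?_ (Prod.ext ?_ ?_) <;> funext x y x' y' <;> simp [corr])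
    (fun a b b' => LinearMap.ext fun w => by
      refine Prod.ext ?_ (Prod.ext ?_ ?_) <;> funext x y x' y' <;> simp [corr])
    (fun r a b => LinearMap.ext fun w => by
      refine Prod.ext ?_ (Prod.ext ?_ ?_) <;> funext x y x' y' <;> simp [corr])

theorem corrHom_apply (a b w : F) : corrHom Y u a b w = corr Y u a b w := rfl

/-- Exchange of the holomorphic and antiholomorphic variables. -/
def swapY : F →ₗ[ℂ] OpSeries F where
  toFun v x y := Y v y x
  map_add' v w := by rw [map_add]; rfl
  map_smul' r v := by rw [map_smul]; rfl

variable {Y u}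

theorem corr_swapY_mem_good {a b w : F} : corr (swapY Y) u a b w ∈ Good ↔ corr Y u a b w ∈ Good :=
  ⟨fun h => good_swap h, fun h => good_swap h⟩

theorem corr_swapY_eq_zero {a b w : F} (h : corr Y u a b w = 0) : corr (swapY Y) u a b w = 0 :=
  corr_eq_zero_iff.2 fun _ _ _ _ => corr_eq_zero_iff.1 h _ _ _ _

end Linearity

/-! ### Reduction of the correlation functions to elements of A -/

section VertexField

variable {H : Type*} [AddCommGroup H] [Module ℝ H] {A : Type*} [Ring A] [Algebra ℂ A]
variable {B : LinearMap.BilinForm ℝ H} {hB : B.IsSymm} {p : Module.End ℝ H}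
variable {𝒜 : H → Submodule ℂ A} [DecidableEq H] [GradedAlgebra 𝒜]
variable {Y : Induced B hB p 𝒜 →ₗ[ℂ] OpSeries (Induced B hB p 𝒜)}

theorem IsVertexField.isCurrent_left (hY : IsVertexField B hB p 𝒜 Y) (hp : p ∈ projections B)
    {h : H} (hh : IsChiral p true h) : IsCurrent (fun m => heis B hB p 𝒜 m h) Y where
  locFin := heis_locFin B hB p 𝒜 h
  isField := hY.isField
  comm := hY.hasCommutator hp hh
  norm := hY.chiral hh

theorem IsVertexField.isCurrent_right (hY : IsVertexField B hB p 𝒜 Y) (hp : p ∈ projections B)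
    {h : H} (hh : IsChiral p false h) : IsCurrent (fun m => heis B hB p 𝒜 m h) (swapY Y) where
  locFin := heis_locFin B hB p 𝒜 h
  isField := fun v w => (hY.isField v w).imp fun _ hN x y h => hN y x h.symm
  comm := fun v m x y w => hY.hasCommutator hp hh v m y x w
  norm := fun n v => by
    have := hY.chiral hh n v
    funext x y
    exact congrFun (congrFun this y) x

theorem IsVertexField.isPrimary_left (hY : IsVertexField B hB p 𝒜 Y) (hp : p ∈ projections B)
    {h : H} (hh : IsChiral p true h) {α : H} {a : A} (ha : a ∈ 𝒜 α) :
    IsPrimary (fun m => heis B hB p 𝒜 m h) Y (incl B hB p 𝒜 a) (twistedForm B p h α) :=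
  fun m x y w => by
    simpa only [dir, one_mul, zero_mul, sub_zero] using hY.incl_comm hp hh ha m x y w

theorem IsVertexField.isPrimary_right (hY : IsVertexField B hB p 𝒜 Y) (hp : p ∈ projections B)
    {h : H} (hh : IsChiral p false h) {α : H} {a : A} (ha : a ∈ 𝒜 α) :
    IsPrimary (fun m => heis B hB p 𝒜 m h) (swapY Y) (incl B hB p 𝒜 a) (twistedForm B p h α) :=
  fun m x y w => by
    have := hY.incl_comm hp hh ha m y x w
    simp only [dir, one_mul, zero_mul, sub_zero] at this
    exact this

variable (B hB p 𝒜) in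
/-- A linear form which vanishes on the elements of large weight of a sector. -/
def IsFiniteOn (γ : H) (u : Induced B hB p 𝒜 →ₗ[ℂ] ℂ) : Prop :=
  ∃ N : ℝ, ∀ q : ℝ × ℝ, (N ≤ q.1 ∨ N ≤ q.2) → ∀ w ∈ sector B hB p 𝒜 γ, w ∈ wtSpace B hB 𝒜 q →
    u w = 0

theorem heis_mem_wtSpace (hp : p ∈ projections B) {ε : Bool} {h : H} (hh : IsChiral p ε h) (n : ℕ)
    {q : ℝ × ℝ} {w : Induced B hB p 𝒜} (hw : w ∈ wtSpace B hB 𝒜 q) :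
    heis B hB p 𝒜 (-(n : ℤ) - 1) h w ∈
      wtSpace B hB 𝒜 (q.1 + (dir ε).1 * (n + 1), q.2 + (dir ε).2 * (n + 1)) := by
  rw [← grading_eq_wtSpace B hB 𝒜 hp] at hw ⊢
  exact heis_mem_grading B hB 𝒜 hh n hw

/-- Creation operators do not lower weights, so the same bound N works. -/
theorem IsFiniteOn.comp_heis (hp : p ∈ projections B) {γ : H} {u : Induced B hB p 𝒜 →ₗ[ℂ] ℂ}
    (hu : IsFiniteOn B hB p 𝒜 γ u) {ε : Bool} {h : H} (hh : IsChiral p ε h) (m : ℕ) :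
    IsFiniteOn B hB p 𝒜 γ (u ∘ₗ heis B hB p 𝒜 (-(m : ℤ) - 1) h) := by
  obtain ⟨N, hN⟩ := hu
  have hm : (0 : ℝ) ≤ m := m.cast_nonneg
  refine ⟨N, fun q hq w hw hw' => hN _ ?_ _ (heis_mem_sector B hB p 𝒜 hw _ _)
    (heis_mem_wtSpace hp hh m hw')⟩
  cases ε <;> exact hq.imp (fun hq => by simp only [dir]; linarith)
    fun hq => by simp only [dir]; linarith

/-- The point is the lower bound: within a sector, weights start at that of A^γ and creation
operators only raise them. -/
theorem sector_wt_induction (hp : p ∈ projections B) {γ : H} {C : Induced B hB p 𝒜 → Prop}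
    (zero : C 0) (add : ∀ v w, C v → C w → C (v + w))
    (mem : ∀ q : ℝ × ℝ, twistedForm B p (p γ) (p γ) / 2 ≤ q.1 →
      twistedForm B p ((1 - p) γ) ((1 - p) γ) / 2 ≤ q.2 → ∀ w ∈ sector B hB p 𝒜 γ,
      w ∈ wtSpace B hB 𝒜 q → C w) (w) (hw : w ∈ sector B hB p 𝒜 γ) : C w := by
  -- Building the lower bound into S lets the induction over creation operators propagate it.
  let S : ℝ × ℝ → Submodule ℂ (Induced B hB p 𝒜) := fun q =>
    if twistedForm B p (p γ) (p γ) / 2 ≤ q.1 ∧ twistedForm B p ((1 - p) γ) ((1 - p) γ) / 2 ≤ q.2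
    then sector B hB p 𝒜 γ ⊓ wtSpace B hB 𝒜 q else ⊥
  have h1 : w ∈ ⨆ q, S q := by
    refine sector_chiral_induction B hB 𝒜 hp (C := fun w => w ∈ ⨆ q, S q) ?_ ?_
      (Submodule.zero_mem _) (fun v w hv hw => Submodule.add_mem _ hv hw)
      (fun r v hv => Submodule.smul_mem _ r hv) w hw
    · intro a ha
      refine Submodule.mem_iSup_of_mem (twistedForm B p (p γ) (p γ) / 2,
        twistedForm B p ((1 - p) γ) ((1 - p) γ) / 2) ?_
      rw [show S _ = _ from if_pos ⟨le_rfl, le_rfl⟩]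
      refine ⟨incl_mem_sector B hB p 𝒜 ha, ?_⟩
      rw [← grading_eq_wtSpace B hB 𝒜 hp]
      exact incl_mem_grading B hB 𝒜 ha
    · intro n ε h hh v hv' hv
      clear hv'
      have hn : (0 : ℝ) ≤ n := n.cast_nonneg
      induction hv using Submodule.iSup_induction' with
      | zero => rw [map_zero]; exact Submodule.zero_mem _
      | add v w _ _ hv hw => rw [map_add]; exact Submodule.add_mem _ hv hw
      | mem q v hv =>
        by_cases hq : twistedForm B p (p γ) (p γ) / 2 ≤ q.1 ∧
          twistedForm B p ((1 - p) γ) ((1 - p) γ) / 2 ≤ q.2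
        · rw [show S _ = _ from if_pos hq] at hv
          refine Submodule.mem_iSup_of_mem
            (q.1 + (dir ε).1 * (n + 1), q.2 + (dir ε).2 * (n + 1)) ?_
          rw [show S _ = _ from if_pos (by
            cases ε <;> simp only [dir] <;> constructor <;> linarith [hq.1, hq.2])]
          exact ⟨heis_mem_sector B hB p 𝒜 hv.1 _ _, heis_mem_wtSpace hp hh n hv.2⟩
        · rw [show S _ = _ from if_neg hq, Submodule.mem_bot] at hv
          rw [hv, map_zero]; exact Submodule.zero_mem _
  clear hw
  induction h1 using Submodule.iSup_induction' with
  | zero => exact zero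
  | add v w _ _ hv hw => exact add v w hv hw
  | mem q v hv =>
    by_cases hq : twistedForm B p (p γ) (p γ) / 2 ≤ q.1 ∧
      twistedForm B p ((1 - p) γ) ((1 - p) γ) / 2 ≤ q.2
    · rw [show S _ = _ from if_pos hq] at hv
      exact mem q hq.1 hq.2 v hv.1 hv.2
    · rw [show S _ = _ from if_neg hq, Submodule.mem_bot] at hv
      rw [hv]; exact zero

/-- Weights on the sector are bounded below, and h(-m-1) raises one of them by m + 1, eventually
beyond everything u detects. This supplies the finiteness in the Ward identities. -/
theorem IsFiniteOn.eventually_zero (hp : p ∈ projections B) {γ : H}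
    {u : Induced B hB p 𝒜 →ₗ[ℂ] ℂ} (hu : IsFiniteOn B hB p 𝒜 γ u) {ε : Bool} {h : H}
    (hh : IsChiral p ε h) : ∃ N : ℕ, ∀ m ≥ N, ∀ w ∈ sector B hB p 𝒜 γ,
      u (heis B hB p 𝒜 (-(m : ℤ) - 1) h w) = 0 := by
  obtain ⟨N, hN⟩ := hu
  obtain ⟨M, hM⟩ := exists_nat_gt (max (N - twistedForm B p (p γ) (p γ) / 2)
    (N - twistedForm B p ((1 - p) γ) ((1 - p) γ) / 2))
  rw [max_lt_iff] at hM
  refine ⟨M, fun m hm w hw => ?_⟩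
  have hm' : (M : ℝ) ≤ m := by exact_mod_cast hm
  refine sector_wt_induction hp (C := fun w => u (heis B hB p 𝒜 (-(m : ℤ) - 1) h w) = 0) ?_ ?_ ?_
    w hw
  · rw [map_zero, map_zero]
  · intro v w hv hw
    rw [map_add, map_add, hv, hw, add_zero]
  · intro q h1 h2 w hw hw'
    refine hN _ ?_ _ (heis_mem_sector B hB p 𝒜 hw _ _) (heis_mem_wtSpace hp hh m hw')
    cases ε
    · right; simp only [dir]; linarith [hM.2]
    · left; simp only [dir]; linarith [hM.1]

theorem IsRestrictedDual.isFiniteOn (hp : p ∈ projections B) {u : Induced B hB p 𝒜 →ₗ[ℂ] ℂ}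
    (hu : IsRestrictedDual (grading B hB p 𝒜) u) (γ : H) : IsFiniteOn B hB p 𝒜 γ u := by
  obtain ⟨N, hN⟩ := (hu.image Prod.fst).bddAbove
  obtain ⟨M, hM⟩ := (hu.image Prod.snd).bddAbove
  refine ⟨max N M + 1, fun q hq w _ hw => ?_⟩
  by_contra h0
  rw [← grading_eq_wtSpace B hB 𝒜 hp] at hw
  have h1 := hN (Set.mem_image_of_mem Prod.fst (show q ∈ _ from ⟨w, hw, h0⟩))
  have h2 := hM (Set.mem_image_of_mem Prod.snd (show q ∈ _ from ⟨w, hw, h0⟩))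
  have h3 := le_max_left N M
  have h4 := le_max_right N M
  rcases hq with hq | hq <;> linarith

/-- All three composites have total charge α + β + γ. -/
theorem IsVertexField.corr_eq_zero (hY : IsVertexField B hB p 𝒜 Y) (hp : p ∈ projections B)
    (hA : IsAHPair B 𝒜) {α β γ : H} {a b w : Induced B hB p 𝒜} (ha : a ∈ sector B hB p 𝒜 α)
    (hb : b ∈ sector B hB p 𝒜 β) (hw : w ∈ sector B hB p 𝒜 γ) {u : Induced B hB p 𝒜 →ₗ[ℂ] ℂ}
    (hu : ∀ v ∈ sector B hB p 𝒜 (α + β + γ), u v = 0) : corr Y u a b w = 0 := by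
  refine corr_eq_zero_iff.2 fun x₁ y₁ x₂ y₂ => ⟨hu _ ?_, hu _ ?_, hu _ ?_⟩
  · rw [add_assoc]
    exact hY.mem_sector hp hA ha (hY.mem_sector hp hA hb hw _ _) _ _
  · exact hY.mem_sector hp hA (hY.mem_sector hp hA ha hb _ _) hw _ _
  · rw [add_comm α, add_assoc]
    exact hY.mem_sector hp hA hb (hY.mem_sector hp hA ha hw _ _) _ _

/-- The order of the three inductions is forced: stripping a needs nothing of b and w, stripping b
needs a primary, stripping w needs a and b primary. The functional u stays arbitrary throughout,
since the Ward identities compose it with creation operators. -/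
theorem IsVertexField.good_of_incl (hY : IsVertexField B hB p 𝒜 Y) (hp : p ∈ projections B)
    (hA : IsAHPair B 𝒜) {α β γ : H} (hbase : ∀ a ∈ 𝒜 α, ∀ b ∈ 𝒜 β, ∀ d ∈ 𝒜 γ, ∀ u,
      IsFiniteOn B hB p 𝒜 (α + β + γ) u →
        corr Y u (incl B hB p 𝒜 a) (incl B hB p 𝒜 b) (incl B hB p 𝒜 d) ∈ Good)
    {a b w : Induced B hB p 𝒜} (ha : a ∈ sector B hB p 𝒜 α) (hb : b ∈ sector B hB p 𝒜 β)
    (hw : w ∈ sector B hB p 𝒜 γ) {u : Induced B hB p 𝒜 →ₗ[ℂ] ℂ}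
    (hu : IsFiniteOn B hB p 𝒜 (α + β + γ) u) : corr Y u a b w ∈ Good := by
  refine sector_chiral_induction B hB 𝒜 hp (C := fun a => ∀ b ∈ sector B hB p 𝒜 β,
    ∀ w ∈ sector B hB p 𝒜 γ, ∀ u, IsFiniteOn B hB p 𝒜 (α + β + γ) u → corr Y u a b w ∈ Good)
    ?_ ?_ ?_ ?_ ?_ a ha b hb w hw u hu
  · intro a ha b hb
    have ha' := incl_mem_sector B hB p 𝒜 ha
    refine sector_chiral_induction B hB 𝒜 hp (C := fun b =>
      ∀ w ∈ sector B hB p 𝒜 γ, ∀ u, IsFiniteOn B hB p 𝒜 (α + β + γ) u →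
        corr Y u (incl B hB p 𝒜 a) b w ∈ Good) ?_ ?_ ?_ ?_ ?_ b hb
    · intro b hb w hw
      refine sector_chiral_induction B hB 𝒜 hp (C := fun w => ∀ u,
        IsFiniteOn B hB p 𝒜 (α + β + γ) u →
          corr Y u (incl B hB p 𝒜 a) (incl B hB p 𝒜 b) w ∈ Good) ?_ ?_ ?_ ?_ ?_ w hw
      · intro d hd
        exact hbase a ha b hb d hd
      · intro n ε h hh w hw hC u hu
        have hb' (j : ℕ) : heis B hB p 𝒜 j h (incl B hB p 𝒜 b) =
            if j = 0 then (twistedForm B p h β : ℂ) • incl B hB p 𝒜 b else 0 := by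
          split_ifs with hj
          · subst hj
            exact heis_zero_incl B hB p 𝒜 h β hb
          · exact heis_incl_pos B hB p 𝒜 (by omega) h b
        cases ε
        · exact corr_swapY_mem_good.1 ((hY.isCurrent_right hp hh).good_create_right n
            (hY.isPrimary_right hp hh ha) (hY.isPrimary_right hp hh hb) hb'
            (corr_swapY_mem_good.2 (hC _ (hu.comp_heis hp hh n)))
            (corr_swapY_mem_good.2 (hC u hu)))
        · exact (hY.isCurrent_left hp hh).good_create_right n
            (hY.isPrimary_left hp hh ha) (hY.isPrimary_left hp hh hb) hb'
            (hC _ (hu.comp_heis hp hh n)) (hC u hu)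
      · intro u _
        rw [← corrHom_apply, map_zero]
        exact Good.zero_mem
      · intro v w hv hw u hu
        rw [← corrHom_apply, map_add]
        exact Good.add_mem (hv u hu) (hw u hu)
      · intro r v hv u hu
        rw [← corrHom_apply, map_smul]
        exact Good.smul_mem r (hv u hu)
    · intro n ε h hh b hb hC w hw u hu
      obtain ⟨N, hN⟩ := hu.eventually_zero hp hh
      have hz (m : ℕ) (hm : m ≥ N) := hY.corr_eq_zero hp hA ha' hb hw
        (u := u ∘ₗ heis B hB p 𝒜 (-(m : ℤ) - 1) h) (hN m hm)
      cases ε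
      · exact corr_swapY_mem_good.1 ((hY.isCurrent_right hp hh).good_create_middle n
          (hY.isPrimary_right hp hh ha)
          (fun m => corr_swapY_mem_good.2 (hC w hw _ (hu.comp_heis hp hh m)))
          ⟨N, fun m hm => corr_swapY_eq_zero (hz m hm)⟩ (corr_swapY_mem_good.2 (hC w hw u hu))
          (fun m => corr_swapY_mem_good.2 (hC _ (heis_mem_sector B hB p 𝒜 hw m h) u hu)))
      · exact (hY.isCurrent_left hp hh).good_create_middle n (hY.isPrimary_left hp hh ha)
          (fun m => hC w hw _ (hu.comp_heis hp hh m)) ⟨N, hz⟩ (hC w hw u hu)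
          (fun m => hC _ (heis_mem_sector B hB p 𝒜 hw m h) u hu)
    · intro w _ u _
      rw [← corrHom_apply, map_zero, LinearMap.zero_apply]
      exact Good.zero_mem
    · intro v b hv hb w hw u hu
      rw [← corrHom_apply, map_add, LinearMap.add_apply]
      exact Good.add_mem (hv w hw u hu) (hb w hw u hu)
    · intro r v hv w hw u hu
      rw [← corrHom_apply, map_smul, LinearMap.smul_apply]
      exact Good.smul_mem r (hv w hw u hu)
  · intro n ε h hh a ha hC b hb w hw u hu
    obtain ⟨N, hN⟩ := hu.eventually_zero hp hh
    have hz (m : ℕ) (hm : m ≥ N) := hY.corr_eq_zero hp hA ha hb hw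
      (u := u ∘ₗ heis B hB p 𝒜 (-(m : ℤ) - 1) h) (hN m hm)
    cases ε
    · exact corr_swapY_mem_good.1 ((hY.isCurrent_right hp hh).good_create_left n
        (fun m => corr_swapY_mem_good.2 (hC b hb w hw _ (hu.comp_heis hp hh m)))
        ⟨N, fun m hm => corr_swapY_eq_zero (hz m hm)⟩
        (fun j => corr_swapY_mem_good.2 (hC _ (heis_mem_sector B hB p 𝒜 hb j h) w hw u hu))
        (fun m => corr_swapY_mem_good.2 (hC b hb _ (heis_mem_sector B hB p 𝒜 hw m h) u hu)))
    · exact (hY.isCurrent_left hp hh).good_create_left n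
        (fun m => hC b hb w hw _ (hu.comp_heis hp hh m)) ⟨N, hz⟩
        (fun j => hC _ (heis_mem_sector B hB p 𝒜 hb j h) w hw u hu)
        (fun m => hC b hb _ (heis_mem_sector B hB p 𝒜 hw m h) u hu)
  · intro b _ w _ u _
    rw [← corrHom_apply, map_zero, LinearMap.zero_apply, LinearMap.zero_apply]
    exact Good.zero_mem
  · intro v a hv ha b hb w hw u hu
    rw [← corrHom_apply, map_add, LinearMap.add_apply, LinearMap.add_apply]
    exact Good.add_mem (hv b hb w hw u hu) (ha b hb w hw u hu)
  · intro r v hv b hb w hw u hu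
    rw [← corrHom_apply, map_smul, LinearMap.smul_apply, LinearMap.smul_apply]
    exact Good.smul_mem r (hv b hb w hw u hu)

end VertexField

end
end AHVertex

open scoped TensorProduct
namespace AHVertex
noncomputable section

/-! ## Exponentials of creation operators -/

section Exponentials

theorem mk_recSeq_euler {F : Type*} [AddCommGroup F] [Module ℂ F] (d : ℕ → Module.End ℂ F) :
    mvEuler () (PowerSeries.mk (recSeq d)) =
      PowerSeries.X * (PowerSeries.mk d * PowerSeries.mk (recSeq d)) := by
  refine PowerSeries.ext fun n => ?_
  change MvPowerSeries.coeff (Finsupp.single () n) (mvEuler () _) = _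
  rw [coeff_mvEuler, Finsupp.single_eq_same]
  rcases n with _ | n
  · simp
  · rw [PowerSeries.coeff_succ_X_mul, PowerSeries.coeff_mul]
    simp only [PowerSeries.coeff_mk]
    rw [Finset.Nat.sum_antidiagonal_eq_sum_range_succ fun i j => d i * recSeq d j, ← recSeq_succ]
    change (n + 1) • PowerSeries.coeff (n + 1) (PowerSeries.mk (recSeq d)) = _
    rw [PowerSeries.coeff_mk, ← Nat.cast_smul_eq_nsmul ℂ]
    push_cast
    rfl

/-- The law exp(X + Y) = exp X exp Y for commuting exponents: the product satisfies the Euler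
equation of the sum, whose solution is unique. -/
theorem recSeq_add {F : Type*} [AddCommGroup F] [Module ℂ F] {d d' : ℕ → Module.End ℂ F}
    (h : ∀ m n, d m * d' n = d' n * d m) (n : ℕ) : recSeq (fun m => d m + d' m) n =
      ∑ i ∈ Finset.range (n + 1), recSeq d i * recSeq d' (n - i) := by
  have hc : Commute (PowerSeries.mk (recSeq d)) (PowerSeries.mk d') :=
    mvPowerSeries_commute fun a b => (recSeq_comm_of_comm (fun m => (h m _).symm) _).symm
  have key : mvEuler () (PowerSeries.mk (recSeq d) * PowerSeries.mk (recSeq d')) =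
      PowerSeries.X * (PowerSeries.mk (fun m => d m + d' m) *
        (PowerSeries.mk (recSeq d) * PowerSeries.mk (recSeq d'))) := by
    have e : PowerSeries.mk (fun m => d m + d' m) = PowerSeries.mk d + PowerSeries.mk d' :=
      PowerSeries.ext fun n => by simp
    have e1 := mvEuler_mul () (PowerSeries.mk (recSeq d)) (PowerSeries.mk (recSeq d'))
    rw [mk_recSeq_euler, mk_recSeq_euler] at e1
    refine e1.trans ?_
    rw [e, add_mul, mul_add, ← mul_assoc (PowerSeries.mk (recSeq d)) PowerSeries.X,
      (PowerSeries.commute_X _).eq, mul_assoc PowerSeries.X (PowerSeries.mk (recSeq d)),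
      ← mul_assoc (PowerSeries.mk (recSeq d)) (PowerSeries.mk d'), hc.eq]
    simp only [mul_assoc]
  have h1 (n : ℕ) : ((n : ℂ) + 1) • PowerSeries.coeff (n + 1)
      (PowerSeries.mk (recSeq d) * PowerSeries.mk (recSeq d')) =
      ∑ m ∈ Finset.range (n + 1), (d m + d' m) * PowerSeries.coeff (n - m)
        (PowerSeries.mk (recSeq d) * PowerSeries.mk (recSeq d')) := by
    have e2 := congrArg (PowerSeries.coeff (n + 1)) key
    rw [PowerSeries.coeff_succ_X_mul, PowerSeries.coeff_mul,
      Finset.Nat.sum_antidiagonal_eq_sum_range_succ_mk] at e2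
    simp only [PowerSeries.coeff_mk] at e2
    rw [← e2]
    change _ = MvPowerSeries.coeff (Finsupp.single () (n + 1)) (mvEuler () _)
    rw [coeff_mvEuler, Finsupp.single_eq_same, ← Nat.cast_smul_eq_nsmul ℂ]
    push_cast
    rfl
  have h2 := eq_recSeq_mul (d := fun m => d m + d' m) (e := fun n => PowerSeries.coeff n
    (PowerSeries.mk (recSeq d) * PowerSeries.mk (recSeq d'))) h1 n
  simp only [PowerSeries.coeff_mul, Finset.Nat.sum_antidiagonal_eq_sum_range_succ_mk,
    PowerSeries.coeff_mk, zero_add, Finset.sum_range_one, Nat.sub_zero, recSeq_zero, mul_one] at h2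
  exact h2.symm

variable {H : Type*} [AddCommGroup H] [Module ℝ H] {A : Type*} [Ring A] [Algebra ℂ A]
variable {B : LinearMap.BilinForm ℝ H} {hB : B.IsSymm} {p : Module.End ℝ H}
variable {𝒜 : H → Submodule ℂ A} [DecidableEq H] [GradedAlgebra 𝒜]

theorem natExt_eS_add (h k : H) (x : ℝ) (w : Induced B hB p 𝒜) :
    EvSum (fun m : ℕ => eS B hB p 𝒜 h m (natExt (eS B hB p 𝒜 k) (x - m) w))
      (natExt (eS B hB p 𝒜 (h + k)) x w) := by
  by_cases hx : ∃ n : ℕ, x = n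
  · obtain ⟨n, rfl⟩ := hx
    refine (EvSum.of_zero (N := n + 1) fun m hm => ?_).congr (fun _ => rfl) ?_
    · have : (n : ℝ) < m := by exact_mod_cast hm
      rw [natExt_of_neg (by linarith), LinearMap.zero_apply, map_zero]
    · have e : (fun m : ℕ => heis B hB p 𝒜 (-(m : ℤ) - 1) (h + k)) =
        fun m : ℕ => heis B hB p 𝒜 (-(m : ℤ) - 1) h + heis B hB p 𝒜 (-(m : ℤ) - 1) k :=
        funext fun m => heis_add B hB p 𝒜 _ h k
      have e2 := recSeq_add (d := fun m : ℕ => heis B hB p 𝒜 (-(m : ℤ) - 1) h)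
        (d' := fun m : ℕ => heis B hB p 𝒜 (-(m : ℤ) - 1) k)
        (fun m n => heis_mul_comm B hB p 𝒜 fun h0 => by omega) n
      rw [natExt_natCast]
      change _ = recSeq (fun m : ℕ => heis B hB p 𝒜 (-(m : ℤ) - 1) (h + k)) n w
      rw [e, e2, LinearMap.sum_apply]
      refine Finset.sum_congr rfl fun m hm => ?_
      rw [natExt_sub, if_pos (by simpa [Nat.lt_succ_iff] using hm)]
      rfl
  · push Not at hx
    rw [natExt_of_ne hx, LinearMap.zero_apply]
    refine EvSum.of_eq_zero fun m => ?_
    rw [natExt_of_ne fun n hn => hx (n + m) (by push_cast; linarith), LinearMap.zero_apply, map_zero]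

/-- Moving exp(-∑ h(n) z^(-n)/n) past exp(∑ k(-n) w^n/n) produces the factor (1 - w/z)^((h,k)_p);
here are its coefficients, on a vector killed by the positive modes of h. -/
theorem fS_natExt_eS (h k : H) {w : Induced B hB p 𝒜}
    (hw : ∀ n : ℕ, heis B hB p 𝒜 (n + 1) h w = 0) (j : ℕ) (x : ℝ) :
    fS B hB p 𝒜 h j (natExt (eS B hB p 𝒜 k) x w) =
      ((-1) ^ j * Ring.choose (twistedForm B p h k : ℂ) j) •
        natExt (eS B hB p 𝒜 k) (x - j) w := by
  induction j using Nat.strong_induction_on with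
  | _ j ih =>
    rcases j with _ | j
    · simp [fS, recSeq_zero]
    · refine eq_of_succ_smul j ?_
      have h1 := LinearMap.congr_fun (recSeq_succ (fun m : ℕ => -heis B hB p 𝒜 (m + 1) h) j)
        (natExt (eS B hB p 𝒜 k) x w)
      rw [LinearMap.smul_apply, ← fS, LinearMap.sum_apply] at h1
      rw [h1]
      have h2 : ∀ m ∈ Finset.range (j + 1), (-heis B hB p 𝒜 (m + 1) h * fS B hB p 𝒜 h (j - m))
          (natExt (eS B hB p 𝒜 k) x w) =
          ((-1) ^ (j - m) * Ring.choose (twistedForm B p h k : ℂ) (j - m)) •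
            -(twistedForm B p h k : ℂ) • natExt (eS B hB p 𝒜 k) (x - (j + 1 : ℕ)) w := by
        intro m hm
        have hm' : m ≤ j := by simpa [Nat.lt_succ_iff] using hm
        rw [Module.End.mul_apply, ih _ (by omega), LinearMap.neg_apply, map_smul,
          heis_eS_apply B hB p 𝒜 (by omega), hw, map_zero, zero_add, neg_smul, smul_neg,
          show x - ((j - m : ℕ) : ℝ) - ((m + 1 : ℤ) : ℝ) = x - (j + 1 : ℕ) by
            push_cast [hm']; ring]
      have h3 : ∑ m ∈ Finset.range (j + 1), (-1) ^ (j - m) *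
          Ring.choose (twistedForm B p h k : ℂ) (j - m) =
          (-1) ^ j * Ring.choose ((twistedForm B p h k : ℂ) - 1) j := by
        rw [← alternating_sum_choose]
        exact Finset.sum_range_reflect (fun m => (-1) ^ m *
          Ring.choose (twistedForm B p h k : ℂ) m) (j + 1)
      rw [Finset.sum_congr rfl h2, ← Finset.sum_smul, h3, smul_smul, smul_smul]
      congr 1
      linear_combination (-1) ^ j * succ_mul_choose (twistedForm B p h k : ℂ) j

/-- The sum is reindexed by the order m = x + j of the creation exponential. The sign of x decides
on which side the range of indices must be padded by zeros. -/
theorem vl_natExt_eS (h k : H) {w : Induced B hB p 𝒜}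
    (hw : ∀ n : ℕ, heis B hB p 𝒜 (n + 1) h w = 0) (x x' : ℝ) :
    EvSum (fun m : ℕ => altS (twistedForm B p h k) (m - x) •
      eS B hB p 𝒜 h m (natExt (eS B hB p 𝒜 k) (x + x' - m) w))
      (vl B hB p 𝒜 h x (natExt (eS B hB p 𝒜 k) x' w)) := by
  have h1 := vl_evSum B hB p 𝒜 h x (natExt (eS B hB p 𝒜 k) x' w)
  simp only [fS_natExt_eS h k hw, map_smul] at h1
  by_cases hx : ∃ z : ℤ, x = z
  · obtain ⟨z, rfl⟩ := hx
    rcases le_or_gt 0 z with hz | hz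
    · obtain ⟨n, rfl⟩ := Int.eq_ofNat_of_zero_le hz
      refine (evSum_shift_iff n fun i hi => ?_).1 (h1.congr (fun i => ?_) rfl)
      · have : (i : ℝ) < n := by exact_mod_cast hi
        rw [altS, natExt_of_neg (by push_cast; linarith), zero_smul]
      · have e1 : (((i + n : ℕ) : ℝ) - ((n : ℤ) : ℝ)) = i := by push_cast; ring
        have e2 : (((n : ℤ) : ℝ) + i) = ((i + n : ℕ) : ℝ) := by push_cast; ring
        rw [e1, e2, natExt_natCast, altS, natExt_natCast]
        congr 4
        push_cast; ring
    · obtain ⟨n, rfl⟩ : ∃ n : ℕ, z = -n := ⟨(-z).toNat, by omega⟩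
      refine ((evSum_shift_iff n fun i hi => ?_).2 h1).congr (fun i => ?_) rfl
      · have : (i : ℝ) < n := by exact_mod_cast hi
        rw [natExt_of_neg (x := ((-(n : ℤ) : ℤ) : ℝ) + i) (by push_cast; linarith),
          LinearMap.zero_apply, smul_zero]
      · have e1 : ((i : ℝ) - ((-(n : ℤ) : ℤ) : ℝ)) = ((i + n : ℕ) : ℝ) := by push_cast; ring
        have e2 : (((-(n : ℤ) : ℤ) : ℝ) + ((i + n : ℕ) : ℝ)) = i := by push_cast; ring
        rw [e1, e2, natExt_natCast, altS, natExt_natCast]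
        congr 4
        push_cast; ring
  · push Not at hx
    rw [h1.unique (EvSum.of_eq_zero fun j => ?_)]
    · refine EvSum.of_eq_zero fun m => ?_
      rw [altS, natExt_of_ne fun n hn => hx (m - n) (by push_cast; linarith), zero_smul]
    · rw [natExt_of_ne fun n hn => hx (n - j) (by push_cast; linarith), LinearMap.zero_apply,
        smul_zero]

end Exponentials

/-! ### Exponentials under vertex operators -/

section Current

variable {F : Type*} [AddCommGroup F] [Module ℂ F]
variable {c : ℤ → Module.End ℂ F} {Y : F →ₗ[ℂ] OpSeries F}

theorem alternating_sum_choose_reflect (t : ℂ) (i : ℕ) :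
    ∑ l ∈ Finset.range (i + 1), (-1) ^ l * Ring.choose t (i - l) = Ring.choose (t - 1) i := by
  have h1 := alternating_sum_choose t i
  have h2 : (-1 : ℂ) ^ i * (-1) ^ i = 1 := by rw [← mul_pow]; norm_num
  have h3 : Ring.choose (t - 1) i = (-1) ^ i * ((-1) ^ i * Ring.choose (t - 1) i) := by
    rw [← mul_assoc, h2, one_mul]
  rw [h3, ← h1, Finset.mul_sum, ← Finset.sum_range_reflect]
  refine Finset.sum_congr rfl fun l hl => ?_
  have hl' : l ≤ i := by simpa [Nat.lt_succ_iff] using hl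
  obtain ⟨k, rfl⟩ := Nat.exists_eq_add_of_le hl'
  rw [show l + k + 1 - 1 - l = k by omega, show l + k - k = l by omega, ← mul_assoc]
  congr 1
  have h4 : (-1 : ℂ) ^ l * (-1) ^ l = 1 := by rw [← mul_pow]; norm_num
  rw [pow_add]
  linear_combination (-(-1) ^ k) * h4

/-- If Y(v, z)w = z^s E(z) G(z) with E the creation exponential of the current, then replacing v by
the exponential of creation operators in z₀ applied to v gives (z₀ + z)^s E(z₀ + z) G(z). The
formula is its coefficient of z₀^i; on w the current acts only through its zero mode s. -/
theorem IsCurrent.recSeq_create (h : IsCurrent c Y) {v w : F} {s : ℝ}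
    (hw : ∀ j : ℕ, c j w = if j = 0 then (s : ℂ) • w else 0) {G : ℝ → F} {y : ℝ}
    (hG : ∃ N : ℝ, ∀ x < N, G x = 0)
    (hv : ∀ x, EvSum (fun m : ℕ => recSeq (fun m : ℕ => c (-(m : ℤ) - 1)) m (G (x - s - m)))
      (Y v x y w)) (i : ℕ) (x : ℝ) :
    EvSum (fun m : ℕ => Ring.choose ((s : ℂ) + m) i •
      recSeq (fun m : ℕ => c (-(m : ℤ) - 1)) m (G (x - s - m + i)))
      (Y (recSeq (fun m : ℕ => c (-(m : ℤ) - 1)) i v) x y w) := by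
  set e := recSeq (fun m : ℕ => c (-(m : ℤ) - 1)) with he
  induction i using Nat.strong_induction_on generalizing x with
  | _ i ih =>
    rcases i with _ | i
    · simpa [he, recSeq_zero] using hv x
    · obtain ⟨N, hN⟩ := hG
      -- R is the total order of creation: m + 1 from the new current and R - 1 - m from the
      -- exponential. The annihilation part reduces to m = 0 and contributes (-1)^l s.
      have key (l : ℕ) (hl : l ∈ Finset.range (i + 1)) :
          EvSum (fun R : ℕ => ∑ m ∈ Finset.range R, (Ring.choose (m : ℂ) l *
            Ring.choose ((s : ℂ) + (R - 1 - m : ℕ)) (i - l)) • c (-(m : ℤ) - 1)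
              (e (R - 1 - m) (G (x - s - R + (i + 1 : ℕ)))) +
            ((-1) ^ l * Ring.choose ((s : ℂ) + R) (i - l) * s) • e R (G (x - s - R + (i + 1 : ℕ))))
          (Y (c (-(l : ℤ) - 1) (e (i - l) v)) x y w) := by
        have hl' : l ≤ i := by simpa [Nat.lt_succ_iff] using hl
        obtain ⟨L, R, e1, hL, hR⟩ := h.norm_evSum l (e (i - l) v) x y w
        rw [e1]
        refine EvSum.add ?_ ?_
        · obtain ⟨M, hM⟩ := exists_nat_gt (x - s + (i + 1 : ℕ) - N)
          refine EvSum.comm (a := fun m R : ℕ => if m + 1 ≤ R then (Ring.choose (m : ℂ) l *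
            Ring.choose ((s : ℂ) + (R - 1 - m : ℕ)) (i - l)) • c (-(m : ℤ) - 1)
              (e (R - 1 - m) (G (x - s - R + (i + 1 : ℕ)))) else 0) ⟨M, fun m R hmR => ?_⟩
            (fun m => ?_) (fun R => ?_) hL
          · split_ifs with h0
            · have : (M : ℝ) ≤ R := by
                have : M ≤ R := by omega
                exact_mod_cast this
              rw [hN _ (by linarith), map_zero, map_zero, smul_zero]
            · rfl
          · refine (evSum_shift_iff (m + 1) fun R hR => if_neg (by omega)).1
              (((ih (i - l) (by omega) (x - (m - l))).mapₗ
                (Ring.choose (m : ℂ) l • c (-(m : ℤ) - 1))).congr (fun R => ?_) rfl)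
            rw [if_pos (by omega), show R + (m + 1) - 1 - m = R by omega, map_smul, LinearMap.smul_apply, smul_smul,
              mul_comm (Ring.choose (m : ℂ) l)]
            push_cast [hl']
            congr 4
            ring
          · refine (EvSum.of_zero (N := R) fun m hm => if_neg (by omega)).congr (fun _ => rfl)
              (Finset.sum_congr rfl fun m hm => if_pos ?_)
            simpa using hm
        · have e2 : R = (Ring.choose (-1 : ℂ) l * s) • Y (e (i - l) v) (x + (1 + l)) y w := by
            refine hR.unique ((EvSum.single 0 fun m hm => ?_).congr (fun _ => rfl) ?_)
            · rw [hw, if_neg hm, map_zero, smul_zero]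
            · rw [hw, if_pos rfl, map_smul, smul_smul]
              simp
          rw [e2]
          refine ((ih (i - l) (by omega) (x + (1 + l))).smul _).congr (fun R => ?_) rfl
          have e3 := choose_neg_sub_one 0 l
          rw [Nat.cast_zero, neg_zero, zero_sub, zero_add, Ring.choose_natCast, Nat.choose_self,
            Nat.cast_one, mul_one] at e3
          rw [smul_smul, e3]
          congr 1
          · ring
          · push_cast [hl']
            congr 2
            ring
      have e0 : ((i : ℂ) + 1) • Y (e (i + 1) v) x y w =
          ∑ l ∈ Finset.range (i + 1), Y (c (-(l : ℤ) - 1) (e (i - l) v)) x y w := by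
        have e1 := LinearMap.congr_fun (recSeq_succ (fun m : ℕ => c (-(m : ℤ) - 1)) i) v
        have e2 := congrArg (coeffAt Y x y w) e1
        rw [LinearMap.smul_apply, map_smul, LinearMap.sum_apply, map_sum] at e2
        exact e2
      have h1 := (EvSum.sum key).smul ((i : ℂ) + 1)⁻¹
      have hi : ((i : ℂ) + 1) ≠ 0 := Nat.cast_add_one_ne_zero i
      refine h1.congr (fun R => ?_) (by rw [← e0, smul_smul, inv_mul_cancel₀ hi, one_smul])
      -- Summing over l, Vandermonde and the recursion give R (s + R - 1 choose i) for the creation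
      -- part, and the alternating sum gives s (s + R - 1 choose i) for the zero mode. Their total
      -- is (i + 1)(s + R choose i + 1).
      rw [inv_smul_eq_iff₀ hi, Finset.sum_add_distrib, Finset.sum_comm, ← Finset.sum_smul,
        ← Finset.sum_mul, alternating_sum_choose_reflect, smul_smul, succ_mul_choose]
      have e4 : ∀ m ∈ Finset.range R, ∑ l ∈ Finset.range (i + 1), (Ring.choose (m : ℂ) l *
            Ring.choose ((s : ℂ) + (R - 1 - m : ℕ)) (i - l)) • c (-(m : ℤ) - 1)
              (e (R - 1 - m) (G (x - s - R + (i + 1 : ℕ)))) =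
          Ring.choose ((s : ℂ) + R - 1) i • c (-(m : ℤ) - 1)
              (e (R - 1 - m) (G (x - s - R + (i + 1 : ℕ)))) := by
        intro m hm
        have hm' : m + 1 ≤ R := by simpa using hm
        have h2 := Ring.add_choose_eq i (Commute.all (m : ℂ) ((s : ℂ) + (R - 1 - m : ℕ)))
        rw [Finset.Nat.sum_antidiagonal_eq_sum_range_succ_mk] at h2
        rw [← Finset.sum_smul, ← h2]
        congr 2
        obtain ⟨k, rfl⟩ := Nat.exists_eq_add_of_le hm'
        rw [show m + 1 + k - 1 - m = k by omega]
        push_cast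
        ring
      rw [Finset.sum_congr rfl e4, ← Finset.smul_sum]
      have e5 : ∑ m ∈ Finset.range R, c (-(m : ℤ) - 1)
          (e (R - 1 - m) (G (x - s - R + (i + 1 : ℕ)))) =
          (R : ℂ) • e R (G (x - s - R + (i + 1 : ℕ))) := by
        rcases R with _ | R
        · simp
        · have := LinearMap.congr_fun (recSeq_succ (fun m : ℕ => c (-(m : ℤ) - 1)) R)
            (G (x - s - (R + 1 : ℕ) + (i + 1 : ℕ)))
          rw [LinearMap.smul_apply, LinearMap.sum_apply] at this
          push_cast at this ⊢
          rw [this]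
          rfl
      rw [e5, smul_smul, ← add_smul]
      congr 1
      ring

end Current

end
end AHVertex

open scoped TensorProduct
namespace AHVertex
noncomputable section

/-! ## Correlation functions of elements of `A` -/

section PairSum

variable {H : Type*} [AddCommGroup H] [Module ℝ H] {A : Type*} [Ring A] [Algebra ℂ A]
variable {B : LinearMap.BilinForm ℝ H} {hB : B.IsSymm} {p : Module.End ℝ H}
variable {𝒜 : H → Submodule ℂ A} [DecidableEq H] [GradedAlgebra 𝒜]

variable (B hB p 𝒜) in
/-- A finite sum of products of coefficients of two exponentials. -/
def pairSum (h k : H) (P : ℕ → ℕ → ℂ) (K : ℕ) : Module.End ℂ (Induced B hB p 𝒜) :=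
  ∑ i ∈ Finset.range K ×ˢ Finset.range K, P i.1 i.2 • (eS B hB p 𝒜 h i.1 * eS B hB p 𝒜 k i.2)

theorem pairSum_swap (h k : H) (P : ℕ → ℕ → ℂ) (K : ℕ) :
    pairSum B hB p 𝒜 k h P K = pairSum B hB p 𝒜 h k (fun i j => P j i) K := by
  rw [pairSum, pairSum, Finset.sum_product, Finset.sum_product_right]
  refine Finset.sum_congr rfl fun i _ => Finset.sum_congr rfl fun j _ => ?_
  dsimp only
  rw [eS_eS_comm]

theorem pairSum_zero (h k : H) {P : ℕ → ℕ → ℂ} (hP : ∀ i j, P i j = 0) (K : ℕ) :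
    pairSum B hB p 𝒜 h k P K = 0 :=
  Finset.sum_eq_zero fun i _ => by rw [hP, zero_smul]

open Classical in
theorem eventually_pairSum {h k : H} {c : ℕ → ℂ} {x : ℝ} {w v : Induced B hB p 𝒜}
    (hv : EvSum (fun m : ℕ => c m • eS B hB p 𝒜 h m (natExt (eS B hB p 𝒜 k) (x - m) w)) v)
    {P : ℕ → ℕ → ℂ} (hP : ∀ i j : ℕ, P i j = if x = i + j then c i else 0) :
    ∀ᶠ K in Filter.atTop, v = pairSum B hB p 𝒜 h k P K w := by
  obtain ⟨M, hM⟩ := exists_nat_gt x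
  filter_upwards [hv, Filter.eventually_ge_atTop M] with K hK hMK
  rw [← hK, pairSum, LinearMap.sum_apply, Finset.sum_product]
  refine Finset.sum_congr rfl fun i hi => ?_
  have hMK' : (M : ℝ) ≤ K := by exact_mod_cast hMK
  have hi0 : (0 : ℝ) ≤ i := i.cast_nonneg
  simp only [hP]
  by_cases hx : ∃ j : ℕ, x - i = j
  · obtain ⟨j, hj⟩ := hx
    have hjK : j < K := by
      have : (j : ℝ) < K := by linarith
      exact_mod_cast this
    rw [hj, natExt_natCast, Finset.sum_eq_single j]
    · rw [if_pos (by linarith)]; rfl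
    · intro j' _ hj'
      rw [if_neg fun h => hj' (by
        have : (j' : ℝ) = j := by linarith
        exact_mod_cast this), zero_smul, LinearMap.zero_apply]
    · intro h
      exact absurd (Finset.mem_range.2 hjK) h
  · push Not at hx
    rw [natExt_of_ne hx, LinearMap.zero_apply, map_zero, smul_zero]
    refine (Finset.sum_eq_zero fun j _ => ?_).symm
    rw [if_neg fun h => hx j (by linarith), zero_smul, LinearMap.zero_apply]

/-- Commutation with every coefficient passes to the extension by zero, whose values are either
coefficients or 0. -/
theorem natExt_comm_apply {F : Type*} [AddCommGroup F] [Module ℂ F] {g : ℕ → Module.End ℂ F}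
    {D : Module.End ℂ F} (h : ∀ n, D * g n = g n * D) (x : ℝ) (w : F) :
    D (natExt g x w) = natExt g x (D w) := by
  unfold natExt
  split_ifs
  · exact LinearMap.congr_fun (h _) w
  · exact map_zero _

theorem lmap_natExt_eS (a : A) (h : H) (x : ℝ) (w : Induced B hB p 𝒜) :
    lmap B hB p 𝒜 a (natExt (eS B hB p 𝒜 h) x w) = natExt (eS B hB p 𝒜 h) x (lmap B hB p 𝒜 a w) :=
  natExt_comm_apply (fun n => recSeq_comm_of_comm (fun _ => LinearMap.ext fun _ =>
    lmap_heis B hB p 𝒜 a (by omega) h _) n) x w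

theorem vl_natExt_eS_comm {h k : H} (hk : twistedForm B p k h = 0) (x x' : ℝ)
    (w : Induced B hB p 𝒜) : vl B hB p 𝒜 h x (natExt (eS B hB p 𝒜 k) x' w) =
      natExt (eS B hB p 𝒜 k) x' (vl B hB p 𝒜 h x w) :=
  natExt_comm_apply (fun n => recSeq_comm_of_comm (fun _ => LinearMap.ext fun _ =>
    (heis_vl_comm B hB p 𝒜 hk _ x _).symm) n) x' w

theorem natExt_eS_mem_sector (h : H) {γ : H} {w : Induced B hB p 𝒜}
    (hw : w ∈ sector B hB p 𝒜 γ) (x : ℝ) : natExt (eS B hB p 𝒜 h) x w ∈ sector B hB p 𝒜 γ :=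
  natExt_mem (fun n => recSeq_mem (d := fun m : ℕ => heis B hB p 𝒜 (-(m : ℤ) - 1) h)
    (fun m v hv => heis_mem_sector B hB p 𝒜 hv _ _) n _ hw) x

open Classical in
/-- Coefficients of `z₁^(s₁+i) z₂^(s₂+j) (z₁-z₂)^t` for `|z₁| > |z₂|`. -/
def coeff₁₂ (s₁ s₂ t x₁ x₂ : ℝ) (i j : ℕ) : ℂ :=
  if x₁ + x₂ = s₁ + i + (s₂ + j) + t then altS t (x₂ - (s₂ + j)) else 0

open Classical in
/-- Coefficients of `z₁^(s₁+i) z₂^(s₂+j) (z₂-z₁)^t` for `|z₂| > |z₁|`. -/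
def coeff₂₁ (s₁ s₂ t x₁ x₂ : ℝ) (i j : ℕ) : ℂ :=
  if x₁ + x₂ = s₁ + i + (s₂ + j) + t then altS t (x₁ - (s₁ + i)) else 0

open Classical in
/-- Coefficients of `(z₂+z₀)^(s₁+i) z₂^(s₂+j) z₀^t` for `|z₂| > |z₀|`. -/
def coeff₂₀ (s₁ s₂ t x₀ x₂ : ℝ) (i j : ℕ) : ℂ :=
  if x₀ + x₂ = s₁ + i + (s₂ + j) + t then binS (s₁ + i) (x₀ - t) else 0

variable {Y : Induced B hB p 𝒜 →ₗ[ℂ] OpSeries (Induced B hB p 𝒜)}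

/-- The charge of bd shifts the exponents of Y(a, z₁) by (α, β + γ), which splits into the powers of
z₁ and of z₁ - z₂; the factor (1 - z₂/z₁)^((α,β)) comes from reordering the exponentials. Asking for
all large K allows several such identities to share one cutoff. -/
theorem IsVertexField.incl₁₂ (hY : IsVertexField B hB p 𝒜 Y) (hp : p ∈ projections B)
    {α β γ : H} {a b d : A} (ha : a ∈ 𝒜 α) (hb : b ∈ 𝒜 β) (hd : d ∈ 𝒜 γ) (x₁ y₁ x₂ y₂ : ℝ) :
    ∀ᶠ K in Filter.atTop, Y (incl B hB p 𝒜 a) x₁ y₁ (Y (incl B hB p 𝒜 b) x₂ y₂ (incl B hB p 𝒜 d)) =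
      pairSum B hB p 𝒜 (p α) (p β) (coeff₁₂ (twistedForm B p (p α) (p γ))
        (twistedForm B p (p β) (p γ)) (twistedForm B p (p α) (p β)) x₁ x₂) K
      (pairSum B hB p 𝒜 ((1 - p) α) ((1 - p) β) (coeff₁₂
        (twistedForm B p ((1 - p) α) ((1 - p) γ)) (twistedForm B p ((1 - p) β) ((1 - p) γ))
        (twistedForm B p ((1 - p) α) ((1 - p) β)) y₁ y₂) K (incl B hB p 𝒜 (a * b * d))) := by
  have hm := natExt_eS_mem_sector (p β) (natExt_eS_mem_sector ((1 - p) β)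
    (incl_mem_sector B hB p 𝒜 (SetLike.mul_mem_graded hb hd))
    (y₂ - twistedForm B p ((1 - p) β) ((1 - p) γ))) (x₂ - twistedForm B p (p β) (p γ))
  rw [hY.incl_incl hp hb hd, hY.base α a ha _ _ hm, lmap_natExt_eS, lmap_natExt_eS, lmap_incl,
    vl_natExt_eS_comm (twistedForm_proj B hp β α).1, ← mul_assoc]
  set g := incl B hB p 𝒜 (a * b * d)
  have hg (h : H) (n : ℕ) : heis B hB p 𝒜 (n + 1) h g = 0 :=
    heis_incl_pos B hB p 𝒜 (by omega) h _
  have e1 := vl_natExt_eS ((1 - p) α) ((1 - p) β) (hg _)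
    (y₁ - twistedForm B p ((1 - p) α) ((1 - p) (β + γ)))
    (y₂ - twistedForm B p ((1 - p) β) ((1 - p) γ))
  set g' := vl B hB p 𝒜 ((1 - p) α) (y₁ - twistedForm B p ((1 - p) α) ((1 - p) (β + γ)))
    (natExt (eS B hB p 𝒜 ((1 - p) β)) (y₂ - twistedForm B p ((1 - p) β) ((1 - p) γ)) g) with hg'
  -- The vector g' contains only exponentials orthogonal to pα, so the positive modes of pα still
  -- kill it.
  have e2 := vl_natExt_eS (p α) (p β) (w := g') (fun n => by
    rw [hg', heis_vl_comm B hB p 𝒜 (twistedForm_proj B hp α α).1,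
      heis_eS_comm_apply B hB p 𝒜 (Or.inr (twistedForm_proj B hp α β).1), hg, map_zero, map_zero])
    (x₁ - twistedForm B p (p α) (p (β + γ))) (x₂ - twistedForm B p (p β) (p γ))
  have hP (s₁ s₂ t x₁ x₂ : ℝ) (i j : ℕ) : coeff₁₂ s₁ s₂ t x₁ x₂ i j =
      if x₁ - (t + s₁) + (x₂ - s₂) = i + j then altS t (i - (x₁ - (t + s₁))) else 0 := by
    unfold coeff₁₂
    by_cases h : x₁ + x₂ = s₁ + i + (s₂ + j) + t
    · rw [if_pos h, if_pos (by linarith)]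
      congr 1
      linarith
    · rw [if_neg h, if_neg fun h' => h (by linarith)]
  filter_upwards [eventually_pairSum e1 (P := coeff₁₂ (twistedForm B p ((1 - p) α) ((1 - p) γ))
    (twistedForm B p ((1 - p) β) ((1 - p) γ)) (twistedForm B p ((1 - p) α) ((1 - p) β)) y₁ y₂)
    fun i j => by rw [hP, map_add, map_add],
    eventually_pairSum e2 (P := coeff₁₂ (twistedForm B p (p α) (p γ))
    (twistedForm B p (p β) (p γ)) (twistedForm B p (p α) (p β)) x₁ x₂)
    fun i j => by rw [hP, map_add, map_add]] with K h1 h2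
  rw [h2, h1]

theorem twistedForm_comm (hB : B.IsSymm) (h k : H) : twistedForm B p h k = twistedForm B p k h :=
  (twistedForm_isSymm hB p).eq k h |>.symm

/-- The previous computation with a and b exchanged; the product in A appears as b a d, and the sign
is dealt with only at the end. -/
theorem IsVertexField.incl₂₁ (hY : IsVertexField B hB p 𝒜 Y) (hp : p ∈ projections B)
    {α β γ : H} {a b d : A} (ha : a ∈ 𝒜 α) (hb : b ∈ 𝒜 β) (hd : d ∈ 𝒜 γ) (x₁ y₁ x₂ y₂ : ℝ) :
    ∀ᶠ K in Filter.atTop, Y (incl B hB p 𝒜 b) x₂ y₂ (Y (incl B hB p 𝒜 a) x₁ y₁ (incl B hB p 𝒜 d)) =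
      pairSum B hB p 𝒜 (p α) (p β) (coeff₂₁ (twistedForm B p (p α) (p γ))
        (twistedForm B p (p β) (p γ)) (twistedForm B p (p α) (p β)) x₁ x₂) K
      (pairSum B hB p 𝒜 ((1 - p) α) ((1 - p) β) (coeff₂₁
        (twistedForm B p ((1 - p) α) ((1 - p) γ)) (twistedForm B p ((1 - p) β) ((1 - p) γ))
        (twistedForm B p ((1 - p) α) ((1 - p) β)) y₁ y₂) K (incl B hB p 𝒜 (b * a * d))) := by
  have hP (s₁ s₂ t x₁ x₂ : ℝ) : (fun i j => coeff₁₂ s₂ s₁ t x₂ x₁ j i) =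
      coeff₂₁ s₁ s₂ t x₁ x₂ := by
    funext i j
    exact if_congr (by rw [add_comm x₂, add_comm (s₂ + (j : ℝ))]) rfl rfl
  filter_upwards [hY.incl₁₂ hp hb ha hd x₂ y₂ x₁ y₁] with K hK
  rw [hK, pairSum_swap (p α), pairSum_swap ((1 - p) α), hP, hP, twistedForm_comm hB (p β) (p α),
    twistedForm_comm hB ((1 - p) β) ((1 - p) α)]

theorem natExt_eS_comm (h k : H) (n : ℕ) (x : ℝ) (w : Induced B hB p 𝒜) :
    eS B hB p 𝒜 h n (natExt (eS B hB p 𝒜 k) x w) = natExt (eS B hB p 𝒜 k) x (eS B hB p 𝒜 h n w) :=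
  natExt_comm_apply (fun m => eS_eS_comm B hB p 𝒜 h k n m) x w

/-- The coefficients of Y(a, z₀)b are exponentials of creation operators applied to ab, so
`recSeq_create` applies once for each chirality; V is the result of the antiholomorphic one. -/
theorem IsVertexField.eS_incl (hY : IsVertexField B hB p 𝒜 Y) (hp : p ∈ projections B)
    {α β γ : H} {a b d : A} (ha : a ∈ 𝒜 α) (hb : b ∈ 𝒜 β) (hd : d ∈ 𝒜 γ) (x y : ℝ) (i j : ℕ) :
    ∃ V : Induced B hB p 𝒜,
      EvSum (fun m : ℕ => Ring.choose ((twistedForm B p ((1 - p) α) ((1 - p) γ) : ℂ) + m) j •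
        eS B hB p 𝒜 ((1 - p) α) m (natExt (eS B hB p 𝒜 ((1 - p) β))
          (y - twistedForm B p ((1 - p) α) ((1 - p) γ) -
            twistedForm B p ((1 - p) β) ((1 - p) γ) + j - m) (incl B hB p 𝒜 (a * b * d)))) V ∧
      EvSum (fun m : ℕ => Ring.choose ((twistedForm B p (p α) (p γ) : ℂ) + m) i •
        eS B hB p 𝒜 (p α) m (natExt (eS B hB p 𝒜 (p β)) (x - twistedForm B p (p α) (p γ) -
            twistedForm B p (p β) (p γ) + i - m) V))
        (Y (eS B hB p 𝒜 (p α) i (eS B hB p 𝒜 ((1 - p) α) j (incl B hB p 𝒜 (a * b)))) x y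
          (incl B hB p 𝒜 d)) := by
  set s := twistedForm B p (p α) (p γ)
  set s₂ := twistedForm B p (p β) (p γ)
  set s' := twistedForm B p ((1 - p) α) ((1 - p) γ)
  set s₂' := twistedForm B p ((1 - p) β) ((1 - p) γ)
  set g := incl B hB p 𝒜 (a * b * d)
  have hl : IsChiral p true (p α) := proj_mem_left B hp α
  have hr : IsChiral p false ((1 - p) α) := proj_mem_right B hp α
  have hz (h : H) (n : ℕ) : heis B hB p 𝒜 n h (incl B hB p 𝒜 d) =
      if n = 0 then (twistedForm B p h γ : ℂ) • incl B hB p 𝒜 d else 0 := by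
    split_ifs with h0
    · subst h0; exact heis_zero_incl B hB p 𝒜 h γ hd
    · exact heis_incl_pos B hB p 𝒜 (by omega) h d
  have hab (x y : ℝ) := hY.incl_incl hp (SetLike.mul_mem_graded ha hb) hd x y
  obtain ⟨M, hM⟩ := exists_nat_gt (y - s' - s₂' + j)
  obtain ⟨V, hV⟩ : ∃ V, EvSum (fun m : ℕ => Ring.choose ((s' : ℂ) + m) j •
        eS B hB p 𝒜 ((1 - p) α) m (natExt (eS B hB p 𝒜 ((1 - p) β)) (y - s' - s₂' + j - m) g)) V :=
    ⟨_, EvSum.of_zero (N := M) fun m hm => by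
      have : (M : ℝ) ≤ m := by exact_mod_cast hm
      rw [natExt_of_neg (by linarith), LinearMap.zero_apply, map_zero, smul_zero]⟩
  refine ⟨V, hV, ?_⟩
  -- First application, in z̄: the holomorphic exponential of p(α + β) is a spectator included in G.
  have hA (x : ℝ) : Y (eS B hB p 𝒜 ((1 - p) α) j (incl B hB p 𝒜 (a * b))) x y (incl B hB p 𝒜 d) =
      natExt (eS B hB p 𝒜 (p (α + β))) (x - twistedForm B p (p (α + β)) (p γ)) V := by
    have h1 := (hY.isCurrent_right hp hr).recSeq_create (v := incl B hB p 𝒜 (a * b))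
      (w := incl B hB p 𝒜 d) (s := s') (y := x)
      (G := fun y => natExt (eS B hB p 𝒜 (p (α + β))) (x - twistedForm B p (p (α + β)) (p γ))
        (natExt (eS B hB p 𝒜 ((1 - p) β)) (y - s₂') g)) (fun n => by
          rw [hz, hr.twistedForm_eq_right hp]) ⟨s₂', fun y hy => by
          rw [natExt_of_neg (x := y - s₂') (by linarith), LinearMap.zero_apply, map_zero]⟩
      (fun y => by
        refine ((natExt_eS_add ((1 - p) α) ((1 - p) β) (y - s' - s₂') g).mapₗ
          (natExt (eS B hB p 𝒜 (p (α + β))) (x - twistedForm B p (p (α + β)) (p γ)))).congr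
          (fun m => ?_) ?_
        · rw [← natExt_eS_comm, sub_right_comm _ s₂']
          rfl
        · refine Eq.trans ?_ (hab x y).symm
          rw [map_add (1 - p), map_add (twistedForm B p), LinearMap.add_apply, sub_sub]) j y
    refine h1.unique ((hV.mapₗ (natExt (eS B hB p 𝒜 (p (α + β)))
      (x - twistedForm B p (p (α + β)) (p γ)))).congr (fun m => ?_) rfl)
    rw [map_smul, ← natExt_eS_comm,
      show y - s' - s₂' + j - m = y - s' - m + j - s₂' by ring]
    rfl
  have h2 := (hY.isCurrent_left hp hl).recSeq_create
    (v := eS B hB p 𝒜 ((1 - p) α) j (incl B hB p 𝒜 (a * b)))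
    (w := incl B hB p 𝒜 d) (s := s) (y := y)
    (G := fun x => natExt (eS B hB p 𝒜 (p β)) (x - s₂) V) (fun n => by
      rw [hz, hl.twistedForm_eq hp]) ⟨s₂, fun y hy => by
      rw [natExt_of_neg (x := y - s₂) (by linarith), LinearMap.zero_apply]⟩
    (fun x => by
      refine (natExt_eS_add (p α) (p β) (x - s - s₂) V).congr (fun m => ?_) ?_
      · rw [sub_right_comm _ s₂]
        rfl
      · rw [hA, map_add p, map_add (twistedForm B p), LinearMap.add_apply, sub_sub]) i x
  refine h2.congr (fun m => ?_) rfl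
  rw [show x - s - s₂ + i - m = x - s - m + i - s₂ by ring]
  rfl

/-- The binomial coefficients of `eS_incl` are those of (z₂ + z₀)^(s₁+i), so the vectors are the
same as in the other regions and only the scalar expansions differ. -/
theorem IsVertexField.incl₂₀ (hY : IsVertexField B hB p 𝒜 Y) (hp : p ∈ projections B)
    {α β γ : H} {a b d : A} (ha : a ∈ 𝒜 α) (hb : b ∈ 𝒜 β) (hd : d ∈ 𝒜 γ) (x₀ y₀ x₂ y₂ : ℝ) :
    ∀ᶠ K in Filter.atTop, Y (Y (incl B hB p 𝒜 a) x₀ y₀ (incl B hB p 𝒜 b)) x₂ y₂ (incl B hB p 𝒜 d) =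
      pairSum B hB p 𝒜 (p α) (p β) (coeff₂₀ (twistedForm B p (p α) (p γ))
        (twistedForm B p (p β) (p γ)) (twistedForm B p (p α) (p β)) x₀ x₂) K
      (pairSum B hB p 𝒜 ((1 - p) α) ((1 - p) β) (coeff₂₀
        (twistedForm B p ((1 - p) α) ((1 - p) γ)) (twistedForm B p ((1 - p) β) ((1 - p) γ))
        (twistedForm B p ((1 - p) α) ((1 - p) β)) y₀ y₂) K (incl B hB p 𝒜 (a * b * d))) := by
  rw [hY.incl_incl hp ha hb]
  have h0 {s₁ s₂ t x₀ x₂ : ℝ} (h : ∀ n : ℕ, x₀ - t ≠ n) (i j : ℕ) :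
      coeff₂₀ s₁ s₂ t x₀ x₂ i j = 0 := by
    unfold coeff₂₀
    rw [binS, natExt_of_ne h, ite_self]
  by_cases hx : ∃ n : ℕ, x₀ - twistedForm B p (p α) (p β) = n
  · by_cases hy : ∃ n : ℕ, y₀ - twistedForm B p ((1 - p) α) ((1 - p) β) = n
    · obtain ⟨i, hi⟩ := hx
      obtain ⟨j, hj⟩ := hy
      obtain ⟨V, hV, hV'⟩ := hY.eS_incl hp ha hb hd x₂ y₂ i j
      have hP {s₁ s₂ t x₀ x₂ : ℝ} {n : ℕ} (h : x₀ - t = n) (i j : ℕ) :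
          coeff₂₀ s₁ s₂ t x₀ x₂ i j = if x₂ - s₁ - s₂ + n = i + j then
            Ring.choose ((s₁ : ℂ) + i) n else 0 := by
        unfold coeff₂₀
        rw [h, binS, natExt_natCast]
        push_cast
        refine if_congr ?_ rfl rfl
        constructor <;> intro h' <;> linarith
      rw [hi, hj, natExt_natCast, natExt_natCast]
      filter_upwards [eventually_pairSum hV (hP hj), eventually_pairSum hV' (hP hi)] with K h1 h2
      rw [h2, h1]
    · push Not at hy
      rw [natExt_of_ne hy]
      refine Filter.Eventually.of_forall fun K => ?_
      rw [pairSum_zero ((1 - p) α) _ (h0 hy)]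
      simp
  · push Not at hx
    rw [natExt_of_ne hx]
    refine Filter.Eventually.of_forall fun K => ?_
    rw [pairSum_zero (p α) _ (h0 hx)]
    simp

end PairSum

end
end AHVertex

open scoped TensorProduct
namespace AHVertex
noncomputable section

/-! ### Correlation functions of elements of A as finite sums of monomials -/

section CorrelationIncl

variable {H : Type*} [AddCommGroup H] [Module ℝ H] {A : Type*} [Ring A] [Algebra ℂ A]
variable {B : LinearMap.BilinForm ℝ H} {hB : B.IsSymm} {p : Module.End ℝ H}
variable {𝒜 : H → Submodule ℂ A} [DecidableEq H] [GradedAlgebra 𝒜]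

theorem eS_mem_sector (h : H) (n : ℕ) {γ : H} {w : Induced B hB p 𝒜}
    (hw : w ∈ sector B hB p 𝒜 γ) : eS B hB p 𝒜 h n w ∈ sector B hB p 𝒜 γ := by
  have := natExt_eS_mem_sector h hw n
  rwa [natExt_natCast] at this

theorem eS_mem_wtSpace {ε : Bool} {h : H} (hh : IsChiral p ε h) (n : ℕ) {q : ℝ × ℝ}
    {w : Induced B hB p 𝒜} (hw : w ∈ wtSpace B hB 𝒜 q) :
    eS B hB p 𝒜 h n w ∈ wtSpace B hB 𝒜 (q.1 + (dir ε).1 * n, q.2 + (dir ε).2 * n) := by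
  have h1 := LinearMap.congr_fun (recSeq_homogeneous (D := gradingOp B hB p 𝒜)
    (κ := unitC ε) (d := fun m : ℕ => heis B hB p 𝒜 (-(m : ℤ) - 1) h)
    (fun m => LinearMap.ext fun v => by simpa using gradingOp_creation B hB 𝒜 hh m v) n) w
  rw [mem_wtSpace] at hw ⊢
  refine h1.trans ?_
  rw [LinearMap.add_apply, Module.End.mul_apply, hw, map_smul, LinearMap.smul_apply, ← add_smul]
  refine congrArg (· • _) ?_
  simp only [cplx, unitC]
  push_cast
  ring

variable (B hB p 𝒜) in
/-- The coefficients of a product of four exponentials, applied to `c`. -/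
def eS₄ (α β : H) (c : A) (i j : ℕ × ℕ) : Induced B hB p 𝒜 :=
  eS B hB p 𝒜 (p α) i.1 (eS B hB p 𝒜 (p β) i.2 (eS B hB p 𝒜 ((1 - p) α) j.1
    (eS B hB p 𝒜 ((1 - p) β) j.2 (incl B hB p 𝒜 c))))

/-- Each index adds to one of the two weights, which start at the weight of A^γ, and u vanishes at
large weight. The bound does not depend on the exponents of the series. -/
theorem IsFiniteOn.exists_eS₄_eq_zero (hp : p ∈ projections B) {γ : H}
    {u : Induced B hB p 𝒜 →ₗ[ℂ] ℂ} (hu : IsFiniteOn B hB p 𝒜 γ u) (α β : H) {c : A}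
    (hc : c ∈ 𝒜 γ) : ∃ N : ℕ, ∀ i j : ℕ × ℕ, (N ≤ i.1 ∨ N ≤ i.2 ∨ N ≤ j.1 ∨ N ≤ j.2) →
      u (eS₄ B hB p 𝒜 α β c i j) = 0 := by
  obtain ⟨N, hN⟩ := hu
  obtain ⟨M, hM⟩ := exists_nat_gt (max (N - twistedForm B p (p γ) (p γ) / 2)
    (N - twistedForm B p ((1 - p) γ) ((1 - p) γ) / 2))
  rw [max_lt_iff] at hM
  refine ⟨M, fun i j hij => hN _ ?_ _ (eS_mem_sector _ _ (eS_mem_sector _ _ (eS_mem_sector _ _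
    (eS_mem_sector _ _ (incl_mem_sector B hB p 𝒜 hc)))))
    (eS_mem_wtSpace (ε := true) (proj_mem_left B hp α) _
    (eS_mem_wtSpace (ε := true) (proj_mem_left B hp β) _
    (eS_mem_wtSpace (ε := false) (proj_mem_right B hp α) _
    (eS_mem_wtSpace (ε := false) (proj_mem_right B hp β) _
    (grading_le_wtSpace B hB 𝒜 _ (incl_mem_grading B hB 𝒜 hc))))))⟩
  have h0 (n : ℕ) : (0 : ℝ) ≤ n := n.cast_nonneg
  have h1 {n : ℕ} (hn : M ≤ n) : (M : ℝ) ≤ n := by exact_mod_cast hn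
  simp only [dir]
  rcases hij with h | h | h | h
  · left; linarith [h1 h, h0 i.2, hM.1]
  · left; linarith [h1 h, h0 i.1, hM.1]
  · right; linarith [h1 h, h0 j.2, hM.2]
  · right; linarith [h1 h, h0 j.1, hM.2]

/-- The pairs of natural numbers below `N`. -/
def sq (N : ℕ) : Finset (ℕ × ℕ) := Finset.range N ×ˢ Finset.range N

/-- The cutoff K depends on the exponents (x, y); after applying u it can be replaced by the fixed
N, giving one finite sum of monomials for all coefficients. -/
theorem apply_pairSum_pairSum (u : Induced B hB p 𝒜 →ₗ[ℂ] ℂ) (α β : H) (c : A)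
    (P Q : ℕ → ℕ → ℂ) {N K : ℕ} (hK : N ≤ K)
    (hN : ∀ i j : ℕ × ℕ, (N ≤ i.1 ∨ N ≤ i.2 ∨ N ≤ j.1 ∨ N ≤ j.2) →
      u (eS₄ B hB p 𝒜 α β c i j) = 0) :
    u (pairSum B hB p 𝒜 (p α) (p β) P K (pairSum B hB p 𝒜 ((1 - p) α) ((1 - p) β) Q K
      (incl B hB p 𝒜 c))) = ∑ x ∈ sq N ×ˢ sq N,
        u (eS₄ B hB p 𝒜 α β c x.1 x.2) * (P x.1.1 x.1.2 * Q x.2.1 x.2.2) := by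
  have h1 : u (pairSum B hB p 𝒜 (p α) (p β) P K (pairSum B hB p 𝒜 ((1 - p) α) ((1 - p) β) Q K
      (incl B hB p 𝒜 c))) = ∑ x ∈ sq K ×ˢ sq K,
        u (eS₄ B hB p 𝒜 α β c x.1 x.2) * (P x.1.1 x.1.2 * Q x.2.1 x.2.2) := by
    rw [Finset.sum_product, pairSum, pairSum, LinearMap.sum_apply, map_sum]
    refine Finset.sum_congr rfl fun i _ => ?_
    rw [LinearMap.sum_apply, map_sum, map_sum]
    refine Finset.sum_congr rfl fun j _ => ?_
    simp only [LinearMap.smul_apply, Module.End.mul_apply, map_smul, smul_eq_mul, eS₄]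
    ring
  have hs : sq N ⊆ sq K := Finset.product_subset_product (Finset.range_subset_range.2 hK)
    (Finset.range_subset_range.2 hK)
  rw [h1]
  refine (Finset.sum_subset (Finset.product_subset_product hs hs) fun x _ hx => ?_).symm
  rw [hN, zero_mul]
  by_contra! h0
  exact hx (by simp [sq, h0])

/-- The exponents of the monomials in the correlation functions of elements of `A`. -/
def inclExpo (hB : B.IsSymm) (hp : p ∈ projections B) {α β γ : H}
    (h₁ : ∃ n : ℤ, B α γ = n) (h₂ : ∃ n : ℤ, B β γ = n) (h₁₂ : ∃ n : ℤ, B α β = n)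
    (i j : ℕ × ℕ) : Expo where
  α₁ := twistedForm B p (p α) (p γ) + i.1
  α₂ := twistedForm B p (p β) (p γ) + i.2
  α₁₂ := twistedForm B p (p α) (p β)
  β₁ := twistedForm B p ((1 - p) α) ((1 - p) γ) + j.1
  β₂ := twistedForm B p ((1 - p) β) ((1 - p) γ) + j.2
  β₁₂ := twistedForm B p ((1 - p) α) ((1 - p) β)
  int₁ := by
    obtain ⟨n, hn⟩ := h₁
    refine ⟨n + i.1 - j.1, ?_⟩
    rw [add_sub_add_comm, twistedForm_sub hB hp, hn]
    push_cast
    ring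
  int₂ := by
    obtain ⟨n, hn⟩ := h₂
    refine ⟨n + i.2 - j.2, ?_⟩
    rw [add_sub_add_comm, twistedForm_sub hB hp, hn]
    push_cast
    ring
  int₁₂ := by rwa [twistedForm_sub hB hp]

variable {Y : Induced B hB p 𝒜 →ₗ[ℂ] OpSeries (Induced B hB p 𝒜)}

/-- In each region the coefficient of a given product of four exponentials is the expansion of the
same monomial, with exponents the pairings of α, β, γ shifted by natural numbers. Integrality and
the sign come from the AH axioms. -/
theorem IsVertexField.good_incl (hY : IsVertexField B hB p 𝒜 Y) (hp : p ∈ projections B)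
    (hA : IsAHPair B 𝒜) {α β γ : H} {a b d : A} (ha : a ∈ 𝒜 α) (hb : b ∈ 𝒜 β) (hd : d ∈ 𝒜 γ)
    {u : Induced B hB p 𝒜 →ₗ[ℂ] ℂ} (hu : IsFiniteOn B hB p 𝒜 (α + β + γ) u) :
    corr Y u (incl B hB p 𝒜 a) (incl B hB p 𝒜 b) (incl B hB p 𝒜 d) ∈ Good := by
  have hab (h : a * b ≠ 0) : ∃ n : ℤ, B α β = n := hA.integral α β a ha b hb h
  have hba (h : b * a ≠ 0) : ∃ n : ℤ, B α β = n := by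
    rw [← hB.eq β α]
    exact hA.integral β α b hb a ha h
  have hcomm {n : ℤ} (hn : B α β = n) : b * a = (-1 : ℂ) ^ n • (a * b) :=
    hA.comm β α b hb a ha n ((hB.eq α β).symm.trans hn)
  -- If abd = 0 the pairings need not be integral and no monomial is available, but then bad = 0 too
  -- and all three series vanish.
  by_cases h0 : a * b * d = 0
  · have h0' : b * a * d = 0 := by
      by_cases h : b * a = 0
      · rw [h, zero_mul]
      · obtain ⟨n, hn⟩ := hba h
        rw [hcomm hn, smul_mul_assoc, h0, smul_zero]
    have hz : incl B hB p 𝒜 (0 : A) = 0 := map_zero (inclHom B hB p 𝒜)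
    rw [corr_eq_zero_iff.2]
    · exact Good.zero_mem
    · intro x₁ y₁ x₂ y₂
      obtain ⟨_, h1⟩ := (hY.incl₁₂ hp ha hb hd x₁ y₁ x₂ y₂).exists
      obtain ⟨_, h2⟩ := (hY.incl₂₀ hp ha hb hd x₁ y₁ x₂ y₂).exists
      obtain ⟨_, h3⟩ := (hY.incl₂₁ hp ha hb hd x₁ y₁ x₂ y₂).exists
      rw [h1, h2, h3, h0, h0', hz]
      simp only [map_zero, and_self]
  obtain ⟨n, hn⟩ := hab fun h => h0 (by rw [h, zero_mul])
  have h₂ : ∃ n : ℤ, B β γ = n := hA.integral β γ b hb d hd fun h => h0 (by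
    rw [mul_assoc, h, mul_zero])
  -- Since abd = ±bad ≠ 0, also ad ≠ 0.
  have h₁ : ∃ n : ℤ, B α γ = n := hA.integral α γ a ha d hd fun h => h0 (by
    rw [hA.comm α β a ha b hb n hn, smul_mul_assoc, mul_assoc, h, mul_zero, smul_zero])
  obtain ⟨N, hN⟩ := hu.exists_eS₄_eq_zero hp α β
    (SetLike.mul_mem_graded (SetLike.mul_mem_graded ha hb) hd)
  set E := inclExpo hB hp h₁ h₂ ⟨n, hn⟩
  suffices corr Y u (incl B hB p 𝒜 a) (incl B hB p 𝒜 b) (incl B hB p 𝒜 d) =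
      ∑ x ∈ sq N ×ˢ sq N, u (eS₄ B hB p 𝒜 α β (a * b * d) x.1 x.2) • (E x.1 x.2).mono by
    rw [this]
    exact Submodule.sum_mem _ fun x _ => Submodule.smul_mem _ _ (Submodule.subset_span ⟨_, rfl⟩)
  refine Prod.ext ?_ (Prod.ext ?_ ?_) <;> funext x₁ y₁ x₂ y₂
  · obtain ⟨K, hK, hNK⟩ := ((hY.incl₁₂ hp ha hb hd x₁ y₁ x₂ y₂).and
      (Filter.eventually_ge_atTop N)).exists
    refine (congrArg u hK).trans ?_
    rw [apply_pairSum_pairSum u α β _ _ _ hNK hN]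
    simp only [Prod.fst_sum, Finset.sum_apply, Prod.smul_fst, Pi.smul_apply, smul_eq_mul]
    refine Finset.sum_congr rfl fun x _ => congrArg _ ?_
    exact (ite_zero_mul_ite_zero _ _ _ _).trans (if_congr Iff.rfl rfl rfl)
  · obtain ⟨K, hK, hNK⟩ := ((hY.incl₂₀ hp ha hb hd x₁ y₁ x₂ y₂).and
      (Filter.eventually_ge_atTop N)).exists
    refine (congrArg u hK).trans ?_
    rw [apply_pairSum_pairSum u α β _ _ _ hNK hN]
    simp only [Prod.snd_sum, Prod.fst_sum, Finset.sum_apply, Prod.smul_snd, Prod.smul_fst,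
      Pi.smul_apply, smul_eq_mul]
    refine Finset.sum_congr rfl fun x _ => congrArg _ ?_
    exact (ite_zero_mul_ite_zero _ _ _ _).trans (if_congr Iff.rfl rfl rfl)
  · obtain ⟨K, hK, hNK⟩ := ((hY.incl₂₁ hp ha hb hd x₁ y₁ x₂ y₂).and
      (Filter.eventually_ge_atTop N)).exists
    -- The sign of (z₁ - z₂)^α₁₂ (z̄₁ - z̄₂)^β₁₂ expanded for |z₂| > |z₁| is (-1)^(α,β), and this
    -- equals the sign in ba = (-1)^(α,β) ab.
    have hs : signPow (twistedForm B p (p α) (p β) -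
        twistedForm B p ((1 - p) α) ((1 - p) β)) = (-1) ^ n := by
      rw [twistedForm_sub hB hp, hn, signPow, Int.floor_intCast]
    have hi : incl B hB p 𝒜 (b * a * d) = (-1 : ℂ) ^ n • incl B hB p 𝒜 (a * b * d) := by
      rw [hcomm hn, smul_mul_assoc]
      exact map_smul (inclHom B hB p 𝒜) _ _
    refine (congrArg u hK).trans ?_
    rw [hi, map_smul, map_smul, map_smul, apply_pairSum_pairSum u α β _ _ _ hNK hN,
      smul_eq_mul, Finset.mul_sum]
    simp only [Prod.snd_sum, Finset.sum_apply, Prod.smul_snd, Pi.smul_apply, smul_eq_mul]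
    refine Finset.sum_congr rfl fun x _ => (mul_left_comm _ _ _).trans (congrArg _ ?_)
    refine (congrArg _ (ite_zero_mul_ite_zero _ _ _ _)).trans ?_
    rw [mul_ite, mul_zero, ← hs]
    exact if_congr Iff.rfl rfl rfl

theorem IsVertexField.corr_mem_good (hY : IsVertexField B hB p 𝒜 Y) (hp : p ∈ projections B)
    (hA : IsAHPair B 𝒜) {u : Induced B hB p 𝒜 →ₗ[ℂ] ℂ}
    (hu : IsRestrictedDual (grading B hB p 𝒜) u) (a b w : Induced B hB p 𝒜) :
    corr Y u a b w ∈ Good := by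
  induction a using sector_span with
  | zero => rw [← corrHom_apply, map_zero]; exact Good.zero_mem
  | add a a' h h' => rw [← corrHom_apply, map_add]; exact Good.add_mem h h'
  | sector α a ha =>
  induction b using sector_span with
  | zero => rw [← corrHom_apply, map_zero]; exact Good.zero_mem
  | add b b' h h' => rw [← corrHom_apply, map_add]; exact Good.add_mem h h'
  | sector β b hb =>
  induction w using sector_span with
  | zero => rw [← corrHom_apply, map_zero]; exact Good.zero_mem
  | add w w' h h' => rw [← corrHom_apply, map_add]; exact Good.add_mem h h'
  | sector γ w hw =>
  exact hY.good_of_incl hp hA (fun a ha b hb d hd u hu => hY.good_incl hp hA ha hb hd hu) ha hb hw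
    (hu.isFiniteOn hp _)

end CorrelationIncl

end
end AHVertex

/-! ### The main theorem -/

theorem mainTheorem6 {H : Type*} [AddCommGroup H] [Module ℝ H] [FiniteDimensional ℝ H]
    [DecidableEq H] (B : LinearMap.BilinForm ℝ H) (hB : B.IsSymm) (hnd : B.Nondegenerate)
    {A : Type*} [Ring A] [Algebra ℂ A] (𝒜 : H → Submodule ℂ A) [GradedAlgebra 𝒜]
    (hA : AHVertex.IsEvenAHPair B 𝒜) (p : Module.End ℝ H) (hp : p ∈ AHVertex.projections B) :
    ∃ Y : AHVertex.Induced B hB p 𝒜 →ₗ[ℂ]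
        (ℝ → ℝ → Module.End ℂ (AHVertex.Induced B hB p 𝒜)),
      AHVertex.IsVertexOperator B hB p 𝒜 Y ∧
      (∀ Y', AHVertex.IsVertexOperator B hB p 𝒜 Y' → Y' = Y) ∧
      AHVertex.IsFullVertexAlgebra (AHVertex.grading B hB p 𝒜) Y
        (AHVertex.incl B hB p 𝒜 (1 : A)) ∧
      ({α : H | 𝒜 α ≠ ⊥}.Countable →
        ∀ v, {q : ℝ × ℝ | Y v q.1 q.2 ≠ 0}.Countable) := by
  obtain ⟨Y, hY⟩ := AHVertex.exists_isVertexField B hB 𝒜 hp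
  have hAH := hA.toIsAHPair
  -- The mode (r, s) is the coefficient at exponent (-r-1, -s-1); injectivity transports
  -- countability from exponents to modes.
  have hinj : Function.Injective fun q : ℝ × ℝ => ((-q.1 - 1, -q.2 - 1) : ℝ × ℝ) := fun q q' h => by
    simp only [Prod.mk.injEq, sub_left_inj, neg_inj] at h
    exact Prod.ext h.1 h.2
  have hvac (r s : ℝ) : -r - 1 = 0 ∧ -s - 1 = 0 ↔ r = -1 ∧ s = -1 := by
    constructor <;> rintro ⟨h1, h2⟩ <;> constructor <;> linarith
  refine ⟨AHVertex.modes Y, hY.isVertexOperator hp,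
    fun Y' hY' => (hY.isVertexOperator hp).unique hp hY', ?_, fun hc v =>
      (hY.countable_operators hp hAH hc v).preimage hinj⟩
  exact
    { decomp := by classical exact AHVertex.grading_isInternal B hB 𝒜 hp
      vac_mem := by
        have := AHVertex.incl_mem_grading B hB (p := p) 𝒜 (SetLike.one_mem_graded 𝒜)
        simpa only [map_zero, zero_div] using this
      mode_integral := fun a r s h => LinearMap.ext fun w => hY.integral hp hAH a w fun ⟨n, hn⟩ =>
        h ⟨-n, by
          have h1 : (r : ℝ) - s = ((-n : ℤ) : ℝ) := by push_cast; linarith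
          exact_mod_cast h1⟩
      mode_countable := fun a b => (hY.countable hp hAH a b).preimage hinj
      fv1 := fun a b => by
        obtain ⟨N, hN⟩ := hY.isField a b
        exact ⟨-N, fun r s h => hN _ _ (h.imp (fun h => by linarith) fun h => by linarith)⟩
      fv2 := fun h h' hh => AHVertex.grading_eq_bot hp hA hh
      fv3_holomorphic := fun a r s h => by
        obtain ⟨m, n, hm, hn⟩ := (hY.apply_vacuum hp a).1 _ _ h
        exact ⟨m, n, by linarith, by linarith⟩
      fv3_creation := fun a => by
        change Y a (- -1 - 1) (- -1 - 1) _ = a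
        rw [show (- -1 - 1 : ℝ) = 0 by norm_num]
        exact (hY.apply_vacuum hp a).2
      fv4_id := LinearMap.ext fun w => (hY.vacuum _ _ w).trans (if_pos ((hvac _ _).2 ⟨rfl, rfl⟩))
      fv4_zero := fun r s h => LinearMap.ext fun w => (hY.vacuum _ _ w).trans
        (if_neg fun h' => h ((hvac _ _).1 h'))
      fv5 := fun a b c u hu => by
        have hm (v : AHVertex.Induced B hB p 𝒜) (x y : ℝ) :
            AHVertex.modes Y v (-x - 1) (-y - 1) = Y v x y :=
          congrFun (congrFun (AHVertex.fieldSeries_modes Y v) x) y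
        simp only [hm]
        exact AHVertex.exists_gcor_of_good (hY.corr_mem_good hp hAH hu a b c)
      fv6 := fun r s h₁ h₁' h₂ h₂' a ha b hb => by
        have := hY.mem_grading hp ha hb (-r - 1) (-s - 1)
        simp only [← add_sub_assoc, ← sub_eq_add_neg] at this
        exact this }
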